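/- Notation. For $|p|,|q|<1$ put $(x;q)=\prod_{r\ge 0}(1-xq^r)$, $(x;p,q)=\prod_{r,s\ge 0}(1-xp^rq^s)$, $\theta(x;q)=(x;q)(q/x;q)$, $\Gamma(x)=\Gamma(x;p,q)=(pq/x;p,q)/(x;p,q)$; several arguments before the semicolon denote a product, and $\Gamma(az^{\pm k})=\Gamma(az^k)\Gamma(az^{-k})$. For $u\in(\mathbb C^*)^{16}$ with $\prod_i u_i=(pq)^6$ let $$E^5(u)=\Bigl(\prod_{0\le i<j\le 15}(u_iu_j;p,q)\Bigr)\frac{(p;p)(q;q)}2\int_{\mathcal C}\frac{\prod_{i=0}^{15}\Gamma(u_iz^{\pm1})}{\Gamma(z^{\pm2})}\frac{dz}{2\pi i z},$$ where $\mathcal C$ circles once around the origin in the positive direction and separates the points $u_ip^jq^k$ (inside) from the points $u_i^{-1}p^{-j}q^{-k}$ (outside), $j,k\ge0$. For $b\in\mathbb C^*$, $t\in(\mathbb C^*)^4$ and $p,q\ne0$ let $$E(b;t;p,q)=\frac{E^5\bigl(t_1,\tfrac{pq}{bt_1},\dots,t_4,\tfrac{pq}{bt_4},\pm\sqrt b,\pm\sqrt{bq},\pm\sqrt{bp},\pm\sqrt{bpq}\bigr)}{\prod_{r=1}^4\bigl(bt_r^2,\,p^2q^2/(bt_r^2);p,q\bigr)},$$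 extended by analytic continuation in $(b,t)$ to the parameters where no such contour exists or the denominator vanishes. Proposition. Let $0<|q|<1$ and let $\tau_1,\dots,\tau_4$ be real with $\tau_1<0$ and $-\tau_1\le\tau_r\le1+\tau_1$ for $r=2,3,4$. Consider the expression $$\prod_{r\ge2:\,\tau_r=-\tau_1}(t_rt_1;q)\prod_{r\ge2:\,\tau_r=1+\tau_1}\Bigl(\frac{qt_1}{bt_r};q\Bigr)\frac{(\frac qb,qb^2;q)}{(\frac q{b^2},qb;q)}(q;q)\int_{\mathcal C}\Bigl(\frac{(1-z^{-2})(\frac q{bz^2},\frac{bt_1}z;q)}{(\frac b{z^2},\frac{t_1}z;q)}\Bigr)^{1_{\{\tau_1=-1/2\}}}\frac{\theta(b^2t_1z;q)}{(t_1z,\frac q{bt_1z};q)}\prod_{r\ge2:\,\tau_r=-\tau_1}\frac{(\frac{bt_r}z;q)}{(\frac{t_r}z;q)}\prod_{r\ge2:\,\tau_r=1+\tau_1}\frac{(\frac q{t_rz};q)}{(\frac q{bt_rz};q)}\,\frac{dz}{2\pi iz},$$ where $\mathcal C$ is a deformation of the unit circle, traversed in the positive direction, which has the zeros of $(t_1z;q)$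 outside and has inside the zeros of $(q/(bt_1z);q)$, of $(t_r/z;q)$ for $r\ge2$ with $\tau_r=-\tau_1$, of $(q/(bt_rz);q)$ for $r\ge2$ with $\tau_r=1+\tau_1$, and, if $\tau_1=-1/2$, of $(b/z^2,t_1/z;q)$. Wherever such a contour exists and $(q/b^2,qb;q)\neq0$, this expression does not depend on the choice of $\mathcal C$, and it extends to a function $R(b,t)$ which is analytic on $\mathbb C^*\times(\mathbb C^*)^4$. For all $b\in\mathbb C^*$ and $t\in(\mathbb C^*)^4$, $$\lim_{p\to0}E(b;\,t_1p^{\tau_1},t_2p^{\tau_2},t_3p^{\tau_3},t_4p^{\tau_4};\,p,q)=R(b,t).$$ Here $p\to0$ through non-zero complex numbers and $p^{\tau}=e^{\tau w}$ with $p=e^w$, uniformly in the choice of the logarithm $w$ (the same one for all four powers). -/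

import Mathlib

open Filter Topology Set

namespace EllipticBeta

noncomputable section

/-! ## Infinite products, theta function and elliptic gamma function -/

/-- The infinite `q`-shifted factorial `(x;q) = ∏_{r ≥ 0} (1 - x q^r)`. -/
def qPoch (x q : ℂ) : ℂ := ∏' r : ℕ, (1 - x * q ^ r)

/-- The `p,q`-shifted factorial `(x;p,q) = ∏_{r,s ≥ 0} (1 - x p^r q^s)`. -/
def pqPoch (x p q : ℂ) : ℂ := ∏' rs : ℕ × ℕ, (1 - x * p ^ rs.1 * q ^ rs.2)

/-- The theta function `θ(x;q) = (x, q/x; q)`. -/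
def theta (x q : ℂ) : ℂ := qPoch x q * qPoch (q / x) q

/-- The elliptic gamma function `Γ(x;p,q) = (pq/x;p,q) / (x;p,q)`. -/
def ellGamma (x p q : ℂ) : ℂ := pqPoch (p * q / x) p q / pqPoch x p q

/-! ## Contours -/

/-- A piecewise continuously differentiable closed contour, given as a finite family of
`C¹` arcs parametrised by `[0,1]`, each of which ends where the arc `next i` begins.
(If `next` has several cycles, the contour has several closed components.) -/
structure Contour where
  n : ℕ
  arc : Fin n → ℝ → ℂ
  next : Equiv.Perm (Fin n)
  contDiff_arc : ∀ i, ContDiff ℝ 1 (arc i)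
  closed : ∀ i, arc i 1 = arc (next i) 0

namespace Contour

/-- The set of points on the contour. -/
def trace (C : Contour) : Set ℂ := ⋃ i, C.arc i '' Icc 0 1

/-- The contour integral `∫_C f(z) dz`. -/
def integral (C : Contour) (f : ℂ → ℂ) : ℂ :=
  ∑ i, ∫ s in (0 : ℝ)..1, f (C.arc i s) * deriv (C.arc i) s

/-- The winding number of the contour around a point `a` that is not on it. -/
def index (C : Contour) (a : ℂ) : ℂ :=
  (2 * Real.pi * Complex.I)⁻¹ * C.integral (fun z => (z - a)⁻¹)

/-- The contour circles once around the origin in the positive direction and separates the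
points of `inner` from those of `outer`: it goes once around the origin and around each point
of `inner`, and it does not go around any point of `outer`. -/
def Separates (C : Contour) (inner outer : Set ℂ) : Prop :=
  (∀ a ∈ insert 0 inner, a ∉ C.trace ∧ C.index a = 1) ∧
    ∀ a ∈ outer, a ∉ C.trace ∧ C.index a = 0

end Contour

/-! ## The renormalised elliptic beta integral and the function `E` -/

/-- `C` separates the points `t_r p^j q^k` from the points `t_r⁻¹ p^{-j} q^{-k}`. -/
def IsBetaContour {m : ℕ} (t : Fin (2 * m + 6) → ℂ) (p q : ℂ) (C : Contour) : Prop :=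
  C.Separates {z | ∃ r, ∃ j k : ℕ, z = t r * p ^ j * q ^ k}
    {z | ∃ r, ∃ j k : ℕ, z = (t r)⁻¹ * (p ^ j)⁻¹ * (q ^ k)⁻¹}

/-- The renormalised elliptic beta integral, computed along the contour `C`. -/
def betaAlong {m : ℕ} (t : Fin (2 * m + 6) → ℂ) (p q : ℂ) (C : Contour) : ℂ :=
  (∏ r, ∏ s ∈ Finset.Ioi r, pqPoch (t r * t s) p q) *
    (qPoch p p * qPoch q q / 2) *
    C.integral (fun z =>
      (∏ r, (ellGamma (t r * z) p q * ellGamma (t r / z) p q)) /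
        (ellGamma (z ^ 2) p q * ellGamma ((z ^ 2)⁻¹) p q) *
        (1 / (2 * Real.pi * Complex.I * z)))

open Classical in
/-- The renormalised elliptic beta integral `E^m(t)` at parameters for which a separating contour
exists (the value does not depend on the contour). -/
def beta {m : ℕ} (t : Fin (2 * m + 6) → ℂ) (p q : ℂ) : ℂ :=
  if h : ∃ C, IsBetaContour t p q C then betaAlong t p q h.choose else 0

/-- The sixteen parameters
`t_r, pq/(b t_r)` (`1 ≤ r ≤ 4`), `±√b, ±√(bq), ±√(bp), ±√(bpq)`.
Their set does not depend on the choice of the square roots. -/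
def params (b : ℂ) (t : Fin 4 → ℂ) (p q : ℂ) : Fin (2 * 5 + 6) → ℂ :=
  ![t 0, p * q / (b * t 0), t 1, p * q / (b * t 1),
    t 2, p * q / (b * t 2), t 3, p * q / (b * t 3),
    b ^ (1 / 2 : ℂ), -b ^ (1 / 2 : ℂ),
    (b * q) ^ (1 / 2 : ℂ), -(b * q) ^ (1 / 2 : ℂ),
    (b * p) ^ (1 / 2 : ℂ), -(b * p) ^ (1 / 2 : ℂ),
    (b * p * q) ^ (1 / 2 : ℂ), -(b * p * q) ^ (1 / 2 : ℂ)]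

/-- The denominator `∏_r (b t_r², p²q²/(b t_r²); p,q)`. -/
def denom (b : ℂ) (t : Fin 4 → ℂ) (p q : ℂ) : ℂ :=
  ∏ r, (pqPoch (b * t r ^ 2) p q * pqPoch (p ^ 2 * q ^ 2 / (b * t r ^ 2)) p q)

/-- The parameters `(b, t)` at which `E(b;t;p,q)` is given directly by an integral: a separating
contour exists and the denominator does not vanish. For `0 < |p|, |q| < 1` this is an open dense
subset of the parameter space. -/
def generic (p q : ℂ) : Set (ℂ × (Fin 4 → ℂ)) :=
  {x | x.1 ≠ 0 ∧ (∀ r, x.2 r ≠ 0) ∧ (∃ C, IsBetaContour (params x.1 x.2 p q) p q C) ∧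
    denom x.1 x.2 p q ≠ 0}

/-- The elliptic hypergeometric integral
`E(b;t;p,q) = E^5(t_r, pq/(b t_r), ±√b, ±√(bq), ±√(bp), ±√(bpq)) / ∏_r (b t_r², p²q²/(b t_r²);p,q)`,
extended from the generic parameters `(b,t)`, where the right-hand side is holomorphic, to all
parameters by analytic continuation. As the generic parameters are dense, the value of the
continuation at a point is the limit of the values at generic parameters. -/
def ellE (b : ℂ) (t : Fin 4 → ℂ) (p q : ℂ) : ℂ :=
  extendFrom (generic p q)
    (fun x : ℂ × (Fin 4 → ℂ) => beta (params x.1 x.2 p q) p q / denom x.1 x.2 p q) (b, t)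

/-! ## The limiting basic hypergeometric integral

The parameters `t_1, t_2, t_3, t_4` are indexed by `0, 1, 2, 3 : Fin 4`. -/

/-- The indices `r ≥ 2` with `τ_r = -τ_1`. -/
def lowerFace (τ : Fin 4 → ℝ) : Finset (Fin 4) := {r | r ≠ 0 ∧ τ r = -τ 0}

/-- The indices `r ≥ 2` with `τ_r = 1 + τ_1`. -/
def upperFace (τ : Fin 4 → ℝ) : Finset (Fin 4) := {r | r ≠ 0 ∧ τ r = 1 + τ 0}

/-- The factor in front of the limiting integral. -/
def limitPrefactor (τ : Fin 4 → ℝ) (b : ℂ) (t : Fin 4 → ℂ) (q : ℂ) : ℂ :=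
  (∏ r ∈ lowerFace τ, qPoch (t r * t 0) q) *
    (∏ r ∈ upperFace τ, qPoch (q * t 0 / (b * t r)) q) *
    (qPoch (q / b) q * qPoch (q * b ^ 2) q / (qPoch (q / b ^ 2) q * qPoch (q * b) q)) *
    qPoch q q

/-- The integrand of the limiting integral, as a function multiplying `dz`. -/
def limitIntegrand (τ : Fin 4 → ℝ) (b : ℂ) (t : Fin 4 → ℂ) (q z : ℂ) : ℂ :=
  (if τ 0 = -1 / 2 then
      (1 - (z ^ 2)⁻¹) * (qPoch (q / (b * z ^ 2)) q * qPoch (b * t 0 / z) q) /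
        (qPoch (b / z ^ 2) q * qPoch (t 0 / z) q)
    else 1) *
    (theta (b ^ 2 * t 0 * z) q / (qPoch (t 0 * z) q * qPoch (q / (b * t 0 * z)) q)) *
    (∏ r ∈ lowerFace τ, qPoch (b * t r / z) q / qPoch (t r / z) q) *
    (∏ r ∈ upperFace τ, qPoch (q / (t r * z)) q / qPoch (q / (b * t r * z)) q) *
    (1 / (2 * Real.pi * Complex.I * z))

/-- The contours allowed in the limiting integral: they separate the zeros of `(t_1 z;q)` (outside)
from those of `(q/(b t_1 z);q)`, of `(b/z², t_1/z;q)` if `τ_1 = -1/2`, of `(t_r/z;q)` if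
`τ_r = -τ_1`, and of `(q/(b t_r z);q)` if `τ_r = 1 + τ_1` (inside). -/
def IsLimitContour (τ : Fin 4 → ℝ) (b : ℂ) (t : Fin 4 → ℂ) (q : ℂ) (C : Contour) : Prop :=
  C.Separates
    {z | z ≠ 0 ∧
      (qPoch (q / (b * t 0 * z)) q = 0 ∨
        (τ 0 = -1 / 2 ∧ (qPoch (b / z ^ 2) q = 0 ∨ qPoch (t 0 / z) q = 0)) ∨
        (∃ r ∈ lowerFace τ, qPoch (t r / z) q = 0) ∨
        (∃ r ∈ upperFace τ, qPoch (q / (b * t r * z)) q = 0))}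
    {z | z ≠ 0 ∧ qPoch (t 0 * z) q = 0}

end

end EllipticBeta

namespace EllipticBeta

/-! ## Basic properties of the infinite products -/

section Products

/-! The integrand of E is invariant under z → 1/z, and under this symmetry nothing simple survives
as p → 0. The symmetry is therefore broken first. A quasi-periodic addition formula in the nome q
(`theta_addition`) writes θ(b²;q) times the integrand as θ(b;q) times k(z) + k(1/z), where the
kernel k singles out the parameter with index 0. Inverting the contour shows that both halves
contribute equally, so E is an explicit prefactor times the integral of k(z) dz/z
(`StronglyGeneric.betaQuotient_eq`). After the substitution z = p^{-τ_0} ζ every power of p that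
occurs in k and in the prefactor has a non-negative exponent. These powers are collected in an array
of scales, `powScale`. It converges to `limitScale`, whose entries are 0 or 1; the entries that
depend on τ equal 1 exactly on the faces τ_r = -τ_0, τ_r = 1 + τ_0 and τ_0 = -1/2
(`tendsto_powScale`).

A separating contour need not exist and would depend on the parameters. `brokenIntegral` replaces it
by a circle of fixed radius together with the residues at the poles 1/(t_0 q^n) which that circle
wrongly encloses. After cancellation against the prefactor these terms are continuous in the scales,
including p = 0, and holomorphic in (b,t), apart from two families of hypersurfaces: zeros of
(q/b²;q), and zeros of (t_0² k_{10};p,q), which matter only for τ_0 = -1/2.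

For small p ≠ 0 both families are removable. At a zero of (q/b²;q) the original integral is still
continuous for generic t, and density of such t suffices (`brokenIntegral_cauchy_fst`). On t_0² q^N
= 1 the poles with indices n and N - n are inverse to each other and their contributions are
opposite, so the singular parts of the residue terms cancel (`residueCore_antisymm`,
`brokenIntegral_cauchy_snd`).

Consequently Cauchy's formula over a torus around the given (b,t) represents E for all small p
(`ellE_eq_cauchyIntegral`). The torus avoids the bad hypersurfaces, so `cauchyIntegral` is
continuous in the scales up to p = 0 and analytic in (b,t). This gives the limit and its analyticity
at once (`exists_analytic_limit`). At `limitScale` the broken integral is the basic hypergeometric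
integral of the statement (`IsLimitContour.brokenIntegral_eq`). Working with w and the filter `comap
exp` makes the limit uniform in the choice of log p. -/

theorem continuousAt_tprod_one_add {ι X : Type*} [TopologicalSpace X] [LocallyCompactSpace X]
    {f : ι → X → ℂ} {U : Set X} (hU : IsOpen U) (hf : ∀ i, ContinuousOn (f i) U)
    (hb : ∀ x ∈ U, ∃ u : ι → ℝ, Summable u ∧ ∀ᶠ y in 𝓝 x, ∀ i, ‖f i y‖ ≤ u i) {x : X} (hx : x ∈ U) :
    ContinuousAt (fun y => ∏' i, (1 + f i y)) x := by
  obtain ⟨u, hu, hev⟩ := hb x hx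
  -- Local compactness gives a compact neighbourhood on which one summable majorant holds. There the
  -- partial products converge uniformly.
  obtain ⟨K, hK, hKs, hKc⟩ := local_compact_nhds (Filter.inter_mem hev (hU.mem_nhds hx))
  have h := hu.hasProdUniformlyOn_one_add (f := f) hKc
    (Eventually.of_forall fun i y hy => (hKs hy).1 i)
    (fun i => (hf i).mono fun y hy => (hKs hy).2)
  rw [hasProdUniformlyOn_iff_tendstoUniformlyOn] at h
  refine (h.continuousOn (Frequently.of_forall fun s => ?_)).continuousAt hK
  exact continuousOn_finsetProd _ fun i _ =>
    continuousOn_const.add ((hf i).mono fun y hy => (hKs hy).2)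

theorem summable_norm_mul_pow {q : ℂ} (hq : ‖q‖ < 1) (x : ℂ) :
    Summable fun r : ℕ => ‖-(x * q ^ r)‖ := by
  simpa [norm_mul] using (summable_geometric_of_lt_one (norm_nonneg _) hq).mul_left ‖x‖

theorem summable_pow_mul_pow {a b : ℝ} (ha : 0 ≤ a) (ha1 : a < 1) (hb : 0 ≤ b) (hb1 : b < 1) :
    Summable fun rs : ℕ × ℕ => a ^ rs.1 * b ^ rs.2 :=
  (summable_geometric_of_lt_one ha ha1).mul_of_nonneg (summable_geometric_of_lt_one hb hb1)
    (fun _ => by positivity) (fun _ => by positivity)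

theorem summable_norm_mul_pow_pow {p q : ℂ} (hp : ‖p‖ < 1) (hq : ‖q‖ < 1) (x : ℂ) :
    Summable fun rs : ℕ × ℕ => ‖-(x * p ^ rs.1 * q ^ rs.2)‖ := by
  simpa [norm_mul, mul_assoc] using
    (summable_pow_mul_pow (norm_nonneg _) hp (norm_nonneg _) hq).mul_left ‖x‖

theorem multipliable_qPoch {q : ℂ} (hq : ‖q‖ < 1) (x : ℂ) :
    Multipliable fun r : ℕ => 1 - x * q ^ r := by
  simpa only [sub_eq_add_neg] using multipliable_one_add_of_summable (summable_norm_mul_pow hq x)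

theorem multipliable_pqPoch {p q : ℂ} (hp : ‖p‖ < 1) (hq : ‖q‖ < 1) (x : ℂ) :
    Multipliable fun rs : ℕ × ℕ => 1 - x * p ^ rs.1 * q ^ rs.2 := by
  simpa only [sub_eq_add_neg] using
    multipliable_one_add_of_summable (summable_norm_mul_pow_pow hp hq x)

theorem qPoch_eq_zero_iff {q : ℂ} (hq : ‖q‖ < 1) {x : ℂ} :
    qPoch x q = 0 ↔ ∃ k : ℕ, x * q ^ k = 1 := by
  constructor
  · intro h
    by_contra! hne
    refine tprod_one_add_ne_zero_of_summable (f := fun r : ℕ => -(x * q ^ r)) (fun r => ?_)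
      (summable_norm_mul_pow hq x) (by simpa only [qPoch, sub_eq_add_neg] using h)
    rw [← sub_eq_add_neg]
    exact sub_ne_zero.2 (hne r).symm
  · rintro ⟨k, hk⟩
    exact tprod_of_exists_eq_zero ⟨k, by simp [hk]⟩

theorem pqPoch_eq_zero_iff {p q : ℂ} (hp : ‖p‖ < 1) (hq : ‖q‖ < 1) {x : ℂ} :
    pqPoch x p q = 0 ↔ ∃ j k : ℕ, x * p ^ j * q ^ k = 1 := by
  constructor
  · intro h
    by_contra! hne
    refine tprod_one_add_ne_zero_of_summable (f := fun r : ℕ × ℕ => -(x * p ^ r.1 * q ^ r.2))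
      (fun r => ?_)
      (summable_norm_mul_pow_pow hp hq x) (by simpa only [pqPoch, sub_eq_add_neg] using h)
    rw [← sub_eq_add_neg]
    exact sub_ne_zero.2 (hne r.1 r.2).symm
  · rintro ⟨j, k, hk⟩
    exact tprod_of_exists_eq_zero ⟨(j, k), by simp [hk]⟩

/-- The nome has to be a variable as well, because the scale `k 3 0`, which serves as p, tends to 0
in the limit. -/
theorem continuousAt_qPoch_uncurried {v : ℂ × ℂ} (hv : ‖v.2‖ < 1) :
    ContinuousAt (fun v : ℂ × ℂ => qPoch v.1 v.2) v := by
  have hU : IsOpen {v : ℂ × ℂ | ‖v.2‖ < 1} := isOpen_lt (by fun_prop) continuous_const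
  refine (continuousAt_tprod_one_add (f := fun (r : ℕ) (v : ℂ × ℂ) => -(v.1 * v.2 ^ r)) hU
    (fun i => by fun_prop) (fun x hx => ?_) hv).congr
    (Eventually.of_forall fun v => by simp only [qPoch, sub_eq_add_neg])
  obtain ⟨a, ha, ha1⟩ := exists_between (show ‖x.2‖ < 1 from hx)
  refine ⟨fun r => (‖x.1‖ + 1) * a ^ r,
    (summable_geometric_of_lt_one ((norm_nonneg _).trans ha.le) ha1).mul_left _, ?_⟩
  have h1 : ∀ᶠ y : ℂ × ℂ in 𝓝 x, ‖y.1‖ < ‖x.1‖ + 1 :=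
    (continuous_fst.norm.tendsto x).eventually (Iio_mem_nhds (lt_add_one _))
  have h2 : ∀ᶠ y : ℂ × ℂ in 𝓝 x, ‖y.2‖ < a :=
    (continuous_snd.norm.tendsto x).eventually (Iio_mem_nhds ha)
  filter_upwards [h1, h2] with y hy1 hy2 r
  rw [norm_neg, norm_mul, norm_pow]
  gcongr

theorem continuousAt_pqPoch_uncurried {v : ℂ × ℂ × ℂ} (hp : ‖v.2.1‖ < 1) (hq : ‖v.2.2‖ < 1) :
    ContinuousAt (fun v : ℂ × ℂ × ℂ => pqPoch v.1 v.2.1 v.2.2) v := by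
  have hU : IsOpen {v : ℂ × ℂ × ℂ | ‖v.2.1‖ < 1 ∧ ‖v.2.2‖ < 1} :=
    .and (isOpen_lt (by fun_prop) continuous_const) (isOpen_lt (by fun_prop) continuous_const)
  refine (continuousAt_tprod_one_add
    (f := fun (r : ℕ × ℕ) (v : ℂ × ℂ × ℂ) => -(v.1 * v.2.1 ^ r.1 * v.2.2 ^ r.2)) hU
    (fun i => by fun_prop) (fun x hx => ?_) ⟨hp, hq⟩).congr
    (Eventually.of_forall fun v => by simp only [pqPoch, sub_eq_add_neg])
  obtain ⟨a, ha, ha1⟩ := exists_between (show ‖x.2.1‖ < 1 from hx.1)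
  obtain ⟨c, hc, hc1⟩ := exists_between (show ‖x.2.2‖ < 1 from hx.2)
  have ha0 := (norm_nonneg _).trans ha.le
  have hc0 := (norm_nonneg _).trans hc.le
  refine ⟨fun r => (‖x.1‖ + 1) * (a ^ r.1 * c ^ r.2),
    (summable_pow_mul_pow ha0 ha1 hc0 hc1).mul_left _, ?_⟩
  have h1 : ∀ᶠ y : ℂ × ℂ × ℂ in 𝓝 x, ‖y.1‖ < ‖x.1‖ + 1 :=
    (continuous_fst.norm.tendsto x).eventually (Iio_mem_nhds (lt_add_one _))
  have h2 : ∀ᶠ y : ℂ × ℂ × ℂ in 𝓝 x, ‖y.2.1‖ < a :=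
    (continuous_snd.fst.norm.tendsto x).eventually (Iio_mem_nhds ha)
  have h3 : ∀ᶠ y : ℂ × ℂ × ℂ in 𝓝 x, ‖y.2.2‖ < c :=
    (continuous_snd.snd.norm.tendsto x).eventually (Iio_mem_nhds hc)
  filter_upwards [h1, h2, h3] with y hy1 hy2 hy3 r
  rw [norm_neg, norm_mul, norm_mul, norm_pow, norm_pow, mul_assoc]
  gcongr

-- In this form the continuity of the long products below is left to `fun_prop`, with bounds on the
-- nomes and non-vanishing of denominators as side goals.
@[fun_prop]
theorem _root_.ContinuousAt.qPoch {X : Type*} [TopologicalSpace X] {f g : X → ℂ} {x : X}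
    (hf : ContinuousAt f x) (hg : ContinuousAt g x) (h : ‖g x‖ < 1) :
    ContinuousAt (fun y => qPoch (f y) (g y)) x :=
  ContinuousAt.comp (f := fun y => (f y, g y)) (continuousAt_qPoch_uncurried h) (hf.prodMk hg)

@[fun_prop]
theorem _root_.ContinuousAt.pqPoch {X : Type*} [TopologicalSpace X] {f g k : X → ℂ} {x : X}
    (hf : ContinuousAt f x) (hg : ContinuousAt g x) (hk : ContinuousAt k x) (h : ‖g x‖ < 1)
    (h' : ‖k x‖ < 1) :
    ContinuousAt (fun y => pqPoch (f y) (g y) (k y)) x :=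
  ContinuousAt.comp (f := fun y => (f y, g y, k y)) (continuousAt_pqPoch_uncurried h h')
    (hf.prodMk (hg.prodMk hk))

/-- The product converges uniformly on every disc. Holomorphy is needed only in the argument, with
the nomes fixed. -/
theorem differentiable_tprod_one_sub {ι : Type*} {c : ι → ℂ} (hc : Summable fun i => ‖c i‖) :
    Differentiable ℂ fun x : ℂ => ∏' i, (1 - x * c i) := by
  have key : ∀ R : ℝ, DifferentiableOn ℂ (fun x : ℂ => ∏' i, (1 - x * c i))
      (Metric.ball 0 R) := by
    intro R
    have h := (hc.mul_left R).hasProdUniformlyOn_one_add (f := fun i x => -(x * c i))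
      (isCompact_closedBall (0 : ℂ) R) (Eventually.of_forall fun i y hy => by
        rw [norm_neg, norm_mul]
        gcongr
        simpa using hy) (fun i => by fun_prop)
    rw [hasProdUniformlyOn_iff_tendstoUniformlyOn] at h
    have h2 := (h.mono Metric.ball_subset_closedBall).tendstoLocallyUniformlyOn.differentiableOn
      (Eventually.of_forall fun s => ?_) Metric.isOpen_ball
    · simpa only [sub_eq_add_neg] using h2
    · exact DifferentiableOn.fun_finsetProd fun i _ => by fun_prop
  intro x
  exact (key (‖x‖ + 1)).differentiableAt (Metric.isOpen_ball.mem_nhds (by simp))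

theorem differentiable_qPoch {q : ℂ} (hq : ‖q‖ < 1) : Differentiable ℂ fun x => qPoch x q :=
  differentiable_tprod_one_sub (by simpa using summable_norm_mul_pow hq 1)

theorem differentiable_pqPoch {p q : ℂ} (hp : ‖p‖ < 1) (hq : ‖q‖ < 1) :
    Differentiable ℂ fun x => pqPoch x p q := by
  simpa only [pqPoch, mul_assoc] using
    differentiable_tprod_one_sub (c := fun rs : ℕ × ℕ => p ^ rs.1 * q ^ rs.2)
    (by simpa using summable_norm_mul_pow_pow hp hq 1)

@[fun_prop]
theorem _root_.DifferentiableAt.qPoch {E : Type*} [NormedAddCommGroup E] [NormedSpace ℂ E]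
    {f : E → ℂ} {x : E} {q : ℂ} (hf : DifferentiableAt ℂ f x) (hq : ‖q‖ < 1) :
    DifferentiableAt ℂ (fun y => qPoch (f y) q) x :=
  DifferentiableAt.comp x (differentiable_qPoch hq).differentiableAt hf

@[fun_prop]
theorem _root_.DifferentiableAt.pqPoch {E : Type*} [NormedAddCommGroup E] [NormedSpace ℂ E]
    {f : E → ℂ} {x : E} {p q : ℂ} (hf : DifferentiableAt ℂ f x) (hp : ‖p‖ < 1) (hq : ‖q‖ < 1) :
    DifferentiableAt ℂ (fun y => pqPoch (f y) p q) x :=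
  DifferentiableAt.comp x (differentiable_pqPoch hp hq).differentiableAt hf

@[simp] theorem qPoch_zero_left (q : ℂ) : qPoch 0 q = 1 := by simp [qPoch]

@[simp] theorem pqPoch_zero_left (p q : ℂ) : pqPoch 0 p q = 1 := by simp [pqPoch]

theorem qPoch_succ {q : ℂ} (hq : ‖q‖ < 1) (x : ℂ) :
    qPoch x q = (1 - x) * qPoch (x * q) q := by
  by_cases hx : x = 1
  · subst hx
    rw [sub_self, zero_mul, qPoch_eq_zero_iff hq]
    exact ⟨0, by simp⟩
  rw [qPoch, tprod_eq_zero_mul' (by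
    simpa only [pow_succ', ← mul_assoc] using multipliable_qPoch hq (x * q))]
  simp only [pow_zero, mul_one, pow_succ', ← mul_assoc, qPoch]

theorem qPoch_eq_prod_mul {q : ℂ} (hq : ‖q‖ < 1) (x : ℂ) (k : ℕ) :
    qPoch x q = (∏ j ∈ Finset.range k, (1 - x * q ^ j)) * qPoch (x * q ^ k) q := by
  induction k with
  | zero => simp
  | succ k ih =>
    rw [Finset.prod_range_succ, ih, qPoch_succ hq (x * q ^ k), pow_succ]
    ring_nf

-- Since 0 ^ 0 = 1, the first factor survives at nome zero. This is where the factor 1 - z^{-2} of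
-- the limiting integrand comes from.
@[simp] theorem qPoch_zero_right (x : ℂ) : qPoch x 0 = 1 - x := by
  rw [qPoch_succ (by simp)]; simp

theorem hasProd_pqPoch {p q : ℂ} (hp : ‖p‖ < 1) (hq : ‖q‖ < 1) (x : ℂ) :
    HasProd (fun j : ℕ => qPoch (x * p ^ j) q) (pqPoch x p q) :=
  (multipliable_pqPoch hp hq x).hasProd.prod_fiberwise
    fun j => (multipliable_qPoch hq (x * p ^ j)).hasProd

theorem pqPoch_eq_tprod {p q : ℂ} (hp : ‖p‖ < 1) (hq : ‖q‖ < 1) (x : ℂ) :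
    pqPoch x p q = ∏' j : ℕ, qPoch (x * p ^ j) q := (hasProd_pqPoch hp hq x).tprod_eq.symm

theorem pqPoch_comm (x p q : ℂ) : pqPoch x p q = pqPoch x q p := by
  rw [pqPoch, ← (Equiv.prodComm ℕ ℕ).tprod_eq, pqPoch]
  simp [mul_right_comm]

theorem pqPoch_succ_left {p q : ℂ} (hp : ‖p‖ < 1) (hq : ‖q‖ < 1) (x : ℂ) :
    pqPoch x p q = qPoch x q * pqPoch (x * p) p q := by
  rw [pqPoch_eq_tprod hp hq, tprod_eq_zero_mul' (by
    simpa only [pow_succ', ← mul_assoc] using (hasProd_pqPoch hp hq (x * p)).multipliable)]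
  simp only [pow_zero, mul_one, pow_succ', ← mul_assoc, pqPoch_eq_tprod hp hq (x * p)]

theorem pqPoch_succ_right {p q : ℂ} (hp : ‖p‖ < 1) (hq : ‖q‖ < 1) (x : ℂ) :
    pqPoch x p q = qPoch x p * pqPoch (x * q) p q := by
  rw [pqPoch_comm x p q, pqPoch_succ_left hq hp, pqPoch_comm _ q p]

theorem pqPoch_eq_prod_mul {p q : ℂ} (hp : ‖p‖ < 1) (hq : ‖q‖ < 1) (x : ℂ) (k : ℕ) :
    pqPoch x p q = (∏ j ∈ Finset.range k, qPoch (x * q ^ j) p) * pqPoch (x * q ^ k) p q := by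
  induction k with
  | zero => simp
  | succ k ih =>
    rw [Finset.prod_range_succ, ih, pqPoch_succ_right hp hq (x * q ^ k), pow_succ]
    ring_nf

-- At p = 0 only the row of exponent zero contributes, so every elliptic factor degenerates to a
-- basic one.
@[simp] theorem pqPoch_zero_mid {q : ℂ} (hq : ‖q‖ < 1) (x : ℂ) : pqPoch x 0 q = qPoch x q := by
  rw [pqPoch_succ_left (by simp) hq]; simp

theorem qPoch_mul_neg {q : ℂ} (hq : ‖q‖ < 1) (x : ℂ) :
    qPoch x q * qPoch (-x) q = qPoch (x ^ 2) (q ^ 2) := by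
  rw [qPoch, qPoch, ← (multipliable_qPoch hq x).tprod_mul (multipliable_qPoch hq (-x)), qPoch]
  congr 1; ext r; ring

theorem pqPoch_mul_neg {p q : ℂ} (hp : ‖p‖ < 1) (hq : ‖q‖ < 1) (x : ℂ) :
    pqPoch x p q * pqPoch (-x) p q = pqPoch (x ^ 2) (p ^ 2) (q ^ 2) := by
  rw [pqPoch, pqPoch, ← (multipliable_pqPoch hp hq x).tprod_mul (multipliable_pqPoch hp hq (-x)),
    pqPoch]
  congr 1; ext r; ring

theorem norm_sq_lt_one {q : ℂ} (hq : ‖q‖ < 1) : ‖q ^ 2‖ < 1 := by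
  rw [norm_pow]; exact pow_lt_one₀ (norm_nonneg _) hq two_ne_zero

theorem qPoch_even_odd {q : ℂ} (hq : ‖q‖ < 1) (x : ℂ) :
    qPoch x q = qPoch x (q ^ 2) * qPoch (x * q) (q ^ 2) := by
  have h2 := norm_sq_lt_one hq
  have e : ∀ (y : ℂ) (k : ℕ), 1 - y * (q ^ 2) ^ k = 1 - y * q ^ (2 * k) := fun y k => by
    rw [pow_mul]
  have o : ∀ (k : ℕ), 1 - (x * q) * (q ^ 2) ^ k = 1 - x * q ^ (2 * k + 1) := fun k => by
    rw [pow_succ q (2 * k), pow_mul]; ring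
  rw [qPoch, ← tprod_even_mul_odd, qPoch, qPoch]
  · congr 1
    · exact tprod_congr fun k => (e x k).symm
    · exact tprod_congr fun k => (o k).symm
  · exact (multipliable_qPoch h2 x).congr fun k => e x k
  · exact (multipliable_qPoch h2 (x * q)).congr fun k => o k

theorem pqPoch_even_odd_right {p q : ℂ} (hp : ‖p‖ < 1) (hq : ‖q‖ < 1) (x : ℂ) :
    pqPoch x p q = pqPoch x p (q ^ 2) * pqPoch (x * q) p (q ^ 2) := by
  have h2 := norm_sq_lt_one hq
  rw [pqPoch_eq_tprod hp hq, pqPoch_eq_tprod hp h2, pqPoch_eq_tprod hp h2,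
    ← (hasProd_pqPoch hp h2 _).multipliable.tprod_mul (hasProd_pqPoch hp h2 _).multipliable]
  refine tprod_congr fun j => ?_
  rw [qPoch_even_odd hq]; ring_nf

/-- Sorting both exponents by parity produces the four arguments x, xq, xp, xpq with squared nomes.
This recombines the square roots of b, bq, bp, bpq into a single factor in b. -/
theorem pqPoch_even_odd {p q : ℂ} (hp : ‖p‖ < 1) (hq : ‖q‖ < 1) (x : ℂ) :
    pqPoch x p q = pqPoch x (p ^ 2) (q ^ 2) * pqPoch (x * q) (p ^ 2) (q ^ 2) *
      (pqPoch (x * p) (p ^ 2) (q ^ 2) * pqPoch (x * p * q) (p ^ 2) (q ^ 2)) := by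
  have h2 := norm_sq_lt_one hq
  have hh : ∀ y, pqPoch y p (q ^ 2) = pqPoch y (p ^ 2) (q ^ 2) * pqPoch (y * p) (p ^ 2) (q ^ 2) :=
    fun y => by
      rw [pqPoch_comm, pqPoch_even_odd_right h2 hp, pqPoch_comm _ _ (p ^ 2),
        pqPoch_comm _ _ (p ^ 2)]
  rw [pqPoch_even_odd_right hp hq, hh, hh]
  ring_nf

/-! ## The theta function -/

theorem theta_inv {q : ℂ} (hq : ‖q‖ < 1) {x : ℂ} (hx : x ≠ 0) :
    theta x⁻¹ q = -x⁻¹ * theta x q := by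
  have h1 : q / x⁻¹ = x * q := by field_simp
  have h2 : q / x = x⁻¹ * q := by field_simp
  rw [theta, theta, qPoch_succ hq x⁻¹, qPoch_succ hq x, h1, h2]
  field_simp
  ring

theorem theta_mul {q : ℂ} (hq : ‖q‖ < 1) (hq0 : q ≠ 0) {x : ℂ} (hx : x ≠ 0) :
    theta (x * q) q = -x⁻¹ * theta x q := by
  have h1 : q / (x * q) = x⁻¹ := by field_simp
  have h2 : q / x = x⁻¹ * q := by field_simp
  rw [theta, theta, h1, qPoch_succ hq x⁻¹, qPoch_succ hq x, h2]
  field_simp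
  ring

theorem theta_eq_zero_iff {q : ℂ} (hq : ‖q‖ < 1) {x : ℂ} :
    theta x q = 0 ↔ (∃ k : ℕ, x * q ^ k = 1) ∨ ∃ k : ℕ, q / x * q ^ k = 1 := by
  rw [theta, mul_eq_zero, qPoch_eq_zero_iff hq, qPoch_eq_zero_iff hq]

theorem theta_zpow_ne_zero {q : ℂ} (hq : ‖q‖ < 1) (hq0 : q ≠ 0) {x : ℂ} (hx : x ≠ 0)
    (h : ∀ n : ℤ, x ≠ q ^ n) : theta x q ≠ 0 := by
  rw [Ne, theta_eq_zero_iff hq]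
  rintro (⟨k, hk⟩ | ⟨k, hk⟩)
  · refine h (-k) ?_
    rw [zpow_neg, zpow_natCast]
    exact eq_inv_of_mul_eq_one_left hk
  · refine h (k + 1) ?_
    rw [zpow_add₀ hq0, zpow_natCast, zpow_one]
    field_simp at hk
    rw [← hk]; ring

theorem theta_one {q : ℂ} (hq : ‖q‖ < 1) : theta 1 q = 0 :=
  (theta_eq_zero_iff hq).2 (Or.inl ⟨0, by simp⟩)

@[fun_prop]
theorem _root_.ContinuousAt.theta {X : Type*} [TopologicalSpace X] {f : X → ℂ} {x : X} {q : ℂ}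
    (hf : ContinuousAt f x) (hq : ‖q‖ < 1) (h0 : f x ≠ 0) :
    ContinuousAt (fun y => theta (f y) q) x :=
  (hf.qPoch continuousAt_const hq).mul
    ((continuousAt_const.div hf h0).qPoch continuousAt_const hq)

@[fun_prop]
theorem _root_.DifferentiableAt.div_of_ne_zero {E : Type*} [NormedAddCommGroup E]
    [NormedSpace ℂ E] {f g : E → ℂ} {x : E} (hf : DifferentiableAt ℂ f x)
    (hg : DifferentiableAt ℂ g x) (h0 : g x ≠ 0) : DifferentiableAt ℂ (fun y => f y / g y) x := by
  simp only [div_eq_mul_inv]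
  exact hf.fun_mul (hg.inv h0)

@[fun_prop]
theorem _root_.DifferentiableAt.theta {E : Type*} [NormedAddCommGroup E] [NormedSpace ℂ E]
    {f : E → ℂ} {x : E} {q : ℂ} (hf : DifferentiableAt ℂ f x) (hq : ‖q‖ < 1) (h0 : f x ≠ 0) :
    DifferentiableAt ℂ (fun y => theta (f y) q) x :=
  (hf.qPoch hq).mul (((differentiableAt_const q).div_of_ne_zero hf h0).qPoch hq)

end Products

end EllipticBeta

namespace EllipticBeta

/-! ## Contour integrals -/

theorem continuous_deriv_circleMap (c : ℂ) (R : ℝ) : Continuous (deriv (circleMap c R)) := by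
  have : deriv (circleMap c R) = fun θ => circleMap 0 R θ * Complex.I := by
    ext θ; exact deriv_circleMap c R θ
  rw [this]
  fun_prop

namespace Contour

open MeasureTheory

variable (C : Contour)

theorem arc_mem_trace (i : Fin C.n) {s : ℝ} (hs : s ∈ Icc (0 : ℝ) 1) : C.arc i s ∈ C.trace :=
  mem_iUnion.2 ⟨i, s, hs, rfl⟩

theorem continuous_arc (i : Fin C.n) : Continuous (C.arc i) := (C.contDiff_arc i).continuous

theorem continuous_deriv_arc (i : Fin C.n) : Continuous (deriv (C.arc i)) :=
  (C.contDiff_arc i).continuous_deriv le_rfl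

theorem hasDerivAt_arc (i : Fin C.n) (s : ℝ) : HasDerivAt (C.arc i) (deriv (C.arc i) s) s :=
  ((C.contDiff_arc i).differentiable one_ne_zero s).hasDerivAt

theorem isCompact_trace : IsCompact C.trace :=
  isCompact_iUnion fun i => isCompact_Icc.image (C.continuous_arc i)

theorem integral_congr {f g : ℂ → ℂ} (h : ∀ z ∈ C.trace, f z = g z) :
    C.integral f = C.integral g := by
  refine Finset.sum_congr rfl fun i _ => intervalIntegral.integral_congr fun s hs => ?_
  rw [uIcc_of_le zero_le_one] at hs
  simp only [h _ (C.arc_mem_trace i hs)]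

variable {C} in

theorem _root_.ContinuousOn.comp_arc {f : ℂ → ℂ} (hf : ContinuousOn f C.trace) (i : Fin C.n) :
    ContinuousOn (fun s => f (C.arc i s)) (Icc 0 1) :=
  hf.comp (C.continuous_arc i).continuousOn fun _ hs => C.arc_mem_trace i hs

variable {C} in

theorem intervalIntegrable_of_continuousOn {f : ℂ → ℂ} (hf : ContinuousOn f C.trace)
    (i : Fin C.n) :
    IntervalIntegrable (fun s => f (C.arc i s) * deriv (C.arc i) s) volume 0 1 := by
  apply ContinuousOn.intervalIntegrable
  rw [uIcc_of_le zero_le_one]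
  exact (hf.comp_arc i).mul (C.continuous_deriv_arc i).continuousOn

variable {C} in

theorem integral_add {f g : ℂ → ℂ} (hf : ContinuousOn f C.trace) (hg : ContinuousOn g C.trace) :
    C.integral (fun z => f z + g z) = C.integral f + C.integral g := by
  simp only [integral, ← Finset.sum_add_distrib]
  refine Finset.sum_congr rfl fun i _ => ?_
  rw [← intervalIntegral.integral_add (intervalIntegrable_of_continuousOn hf i)
    (intervalIntegrable_of_continuousOn hg i)]
  simp only [add_mul]

theorem integral_const_mul (c : ℂ) (f : ℂ → ℂ) :
    C.integral (fun z => c * f z) = c * C.integral f := by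
  simp only [integral, Finset.mul_sum, ← intervalIntegral.integral_const_mul, mul_assoc]

variable {C} in

theorem integral_sub {f g : ℂ → ℂ} (hf : ContinuousOn f C.trace) (hg : ContinuousOn g C.trace) :
    C.integral (fun z => f z - g z) = C.integral f - C.integral g := by
  have := integral_add hf (g := fun z => (-1) * g z) (continuousOn_const.mul hg)
  rw [integral_const_mul] at this
  simpa [sub_eq_add_neg] using this

variable {C} in

theorem integral_finset_sum {ι : Type*} (s : Finset ι) {f : ι → ℂ → ℂ}
    (hf : ∀ j ∈ s, ContinuousOn (f j) C.trace) :
    C.integral (fun z => ∑ j ∈ s, f j z) = ∑ j ∈ s, C.integral (f j) := by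
  classical
  induction s using Finset.induction_on with
  | empty => simp [integral]
  | insert a s ha ih =>
    simp only [Finset.sum_insert ha]
    rw [integral_add (hf a (Finset.mem_insert_self a s))
      (continuousOn_finsetSum s fun j hj => hf j (Finset.mem_insert_of_mem hj)),
      ih fun j hj => hf j (Finset.mem_insert_of_mem hj)]

/-- The fundamental theorem of calculus on each arc leaves endpoint values, and these cancel because
`next` permutes the arcs. -/
theorem integral_eq_zero_of_hasDerivAt {F g : ℂ → ℂ} (hF : ∀ z ∈ C.trace, HasDerivAt F (g z) z)
    (hg : ContinuousOn g C.trace) : C.integral g = 0 := by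
  have h : ∀ i, ∫ s in (0 : ℝ)..1, g (C.arc i s) * deriv (C.arc i) s =
      F (C.arc (C.next i) 0) - F (C.arc i 0) := by
    intro i
    rw [← C.closed i]
    refine intervalIntegral.integral_eq_sub_of_hasDerivAt (f := fun s => F (C.arc i s))
      (fun s hs => ?_)
      (intervalIntegrable_of_continuousOn hg i)
    rw [uIcc_of_le zero_le_one] at hs
    exact (hF _ (C.arc_mem_trace i hs)).comp s (C.hasDerivAt_arc i s)
  rw [integral, Finset.sum_congr rfl fun i _ => h i, Finset.sum_sub_distrib,
    Equiv.sum_comp C.next fun i => F (C.arc i 0), sub_self]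

theorem continuousOn_sub_inv {a : ℂ} (ha : a ∉ C.trace) :
    ContinuousOn (fun z => (z - a)⁻¹) C.trace :=
  (continuousOn_id.sub continuousOn_const).inv₀ fun z hz =>
    sub_ne_zero.2 fun h => ha (by rwa [← show z = a from h])

/-- The index does not change when the point moves by less than its distance from the contour. -/
theorem index_eq_of_dist_lt {a a₀ : ℂ} (h : ∀ z ∈ C.trace, ‖a - a₀‖ < ‖z - a₀‖) :
    a ∉ C.trace ∧ C.index a = C.index a₀ := by
  have ha : a ∉ C.trace := fun ha => (h a ha).false
  have ha₀ : a₀ ∉ C.trace := fun ha => (by simpa using h a₀ ha : ‖a - a₀‖ < 0).not_ge (norm_nonneg _)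
  refine ⟨ha, ?_⟩
  rw [index, index, ← sub_eq_zero, ← mul_sub, ← integral_sub (C.continuousOn_sub_inv ha)
    (C.continuousOn_sub_inv ha₀), mul_eq_zero]
  right
  -- The difference of the two integrands has the primitive log(1 - (a - a₀)/(z - a₀)). The
  -- principal branch is available because the subtracted quotient has modulus below one.
  refine C.integral_eq_zero_of_hasDerivAt
    (F := fun z => Complex.log (1 - (a - a₀) * (z - a₀)⁻¹)) (fun z hz => ?_)
    ((C.continuousOn_sub_inv ha).sub (C.continuousOn_sub_inv ha₀))
  have hz0 : z - a₀ ≠ 0 := sub_ne_zero.2 fun h' => ha₀ (h' ▸ hz)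
  have hza : z - a ≠ 0 := sub_ne_zero.2 fun h' => ha (h' ▸ hz)
  have hlt : ‖(a - a₀) * (z - a₀)⁻¹‖ < 1 := by
    rw [norm_mul, norm_inv, ← div_eq_mul_inv, div_lt_one (norm_pos_iff.2 hz0)]
    exact h z hz
  have hs : 1 - (a - a₀) * (z - a₀)⁻¹ ∈ Complex.slitPlane := by
    rw [sub_eq_add_neg]
    exact Complex.mem_slitPlane_of_norm_lt_one (by rwa [norm_neg])
  have hd := ((((hasDerivAt_id z).sub_const a₀).inv hz0).const_mul (a - a₀)).const_sub 1
  refine (hd.clog hs).congr_deriv ?_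
  have e : 1 - (a - a₀) * (z - a₀)⁻¹ = (z - a) / (z - a₀) := by field_simp; ring
  simp only [id, Pi.inv_apply, e]
  field_simp
  ring

theorem eventually_index_eq {a₀ : ℂ} (ha₀ : a₀ ∉ C.trace) :
    ∀ᶠ a in 𝓝 a₀, a ∉ C.trace ∧ C.index a = C.index a₀ := by
  obtain ⟨ε, hε, h⟩ := Metric.mem_nhds_iff.1
    (C.isCompact_trace.isClosed.isOpen_compl.mem_nhds ha₀)
  filter_upwards [Metric.ball_mem_nhds a₀ hε] with a ha
  refine C.index_eq_of_dist_lt fun z hz => ?_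
  rw [Metric.mem_ball, dist_eq_norm] at ha
  by_contra! hlt
  exact h (Metric.mem_ball.2 (by rw [dist_eq_norm]; exact hlt.trans_lt ha)) hz

theorem index_eq_zero_of_norm_lt {a : ℂ} (h : ∀ z ∈ C.trace, ‖z‖ < ‖a‖) :
    a ∉ C.trace ∧ C.index a = 0 := by
  have ha : a ∉ C.trace := fun ha => (h a ha).false
  refine ⟨ha, ?_⟩
  rw [index, mul_eq_zero]
  right
  -- Here log(1 - z/a) is a primitive, since |z| < |a| along the whole contour.
  refine C.integral_eq_zero_of_hasDerivAt (F := fun z => Complex.log (1 - z * a⁻¹))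
    (fun z hz => ?_) (C.continuousOn_sub_inv ha)
  have ha0 : a ≠ 0 := norm_pos_iff.1 ((norm_nonneg z).trans_lt (h z hz))
  have hza : z - a ≠ 0 := sub_ne_zero.2 fun h' => ha (h' ▸ hz)
  have hlt : ‖z * a⁻¹‖ < 1 := by
    rw [norm_mul, norm_inv, ← div_eq_mul_inv, div_lt_one (norm_pos_iff.2 ha0)]
    exact h z hz
  have hs : 1 - z * a⁻¹ ∈ Complex.slitPlane := by
    rw [sub_eq_add_neg]
    exact Complex.mem_slitPlane_of_norm_lt_one (by rwa [norm_neg])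
  have hd := ((hasDerivAt_id z).mul_const a⁻¹).const_sub 1
  refine (hd.clog hs).congr_deriv ?_
  have hza' : a - z ≠ 0 := by rwa [← neg_sub, neg_ne_zero]
  have e : 1 - z * a⁻¹ = (a - z) / a := by field_simp
  simp only [id]
  field_simp
  ring

theorem exists_norm_lt : ∃ R > 0, ∀ z ∈ C.trace, ‖z‖ < R := by
  obtain ⟨R, hR⟩ := C.isCompact_trace.isBounded.exists_norm_le
  exact ⟨max R 0 + 1, by positivity, fun z hz => by linarith [hR z hz, le_max_left R 0]⟩

theorem exists_lt_norm (h0 : (0 : ℂ) ∉ C.trace) : ∃ r > 0, ∀ z ∈ C.trace, r < ‖z‖ := by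
  obtain ⟨ε, hε, h⟩ := Metric.mem_nhds_iff.1
    (C.isCompact_trace.isClosed.isOpen_compl.mem_nhds h0)
  refine ⟨ε / 2, by positivity, fun z hz => ?_⟩
  by_contra! hlt
  exact h (Metric.mem_ball.2 (by rw [dist_zero_right]; linarith)) hz

/-- Exchanging a contour integral with a circle integral. -/
theorem integral_circleIntegral_comm {k : ℂ → ℂ → ℂ} {R : ℝ} (hR : 0 ≤ R)
    (hk : ContinuousOn (Function.uncurry k) (Metric.sphere 0 R ×ˢ C.trace)) :
    C.integral (fun z => ∮ w in C(0, R), k w z) = ∮ w in C(0, R), C.integral (k w) := by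
  have e : ∀ i : Fin C.n, ∫ s in (0 : ℝ)..1, (∮ w in C(0, R), k w (C.arc i s)) * deriv (C.arc i) s
      = ∫ θ in (0 : ℝ)..2 * Real.pi, ∫ s in (0 : ℝ)..1, deriv (circleMap 0 R) θ *
        (k (circleMap 0 R θ) (C.arc i s) * deriv (C.arc i) s) := by
    intro i
    simp only [circleIntegral, smul_eq_mul, ← intervalIntegral.integral_mul_const, mul_assoc]
    apply intervalIntegral_intervalIntegral_swap
    refine (ContinuousOn.integrableOn_compact (K := Icc 0 1 ×ˢ Icc 0 (2 * Real.pi))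
      (isCompact_Icc.prod isCompact_Icc) ?_).mono_set ?_
    · refine ContinuousOn.mul ?_ (ContinuousOn.mul ?_ ?_)
      · simp only [deriv_circleMap]; fun_prop
      · refine hk.comp (f := fun x : ℝ × ℝ => (circleMap 0 R x.2, C.arc i x.1)) ?_ ?_
        · exact ((continuous_circleMap 0 R).comp continuous_snd).continuousOn.prodMk
            ((C.continuous_arc i).comp continuous_fst).continuousOn
        · exact fun x hx => ⟨circleMap_mem_sphere _ hR _, C.arc_mem_trace i hx.1⟩
      · exact ((C.continuous_deriv_arc i).comp continuous_fst).continuousOn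
    · rw [uIoc_of_le zero_le_one, uIoc_of_le Real.two_pi_pos.le]
      exact prod_mono Ioc_subset_Icc_self Ioc_subset_Icc_self
  rw [integral, Finset.sum_congr rfl fun i _ => e i, ← intervalIntegral.integral_finsetSum]
  · simp only [circleIntegral, smul_eq_mul, integral, Finset.mul_sum,
      intervalIntegral.integral_const_mul]
  · intro i _
    refine ContinuousOn.intervalIntegrable ?_
    simp only [intervalIntegral.integral_const_mul]
    refine ContinuousOn.mul (continuous_deriv_circleMap _ _).continuousOn ?_
    -- Clamping the arc parameter to [0,1] makes the integrand continuous on the whole plane without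
    -- changing the integral.
    have hc : Continuous fun x : ℝ × ℝ => k (circleMap 0 R x.1) (C.arc i (projIcc 0 1 zero_le_one x.2))
        * deriv (C.arc i) x.2 := by
      refine Continuous.mul ?_ ((C.continuous_deriv_arc i).comp continuous_snd)
      refine hk.comp_continuous (f := fun x : ℝ × ℝ => (circleMap 0 R x.1,
        C.arc i (projIcc 0 1 zero_le_one x.2))) ?_ ?_
      · exact ((continuous_circleMap 0 R).comp continuous_fst).prodMk
          ((C.continuous_arc i).comp (continuous_subtype_val.comp
            (continuous_projIcc.comp continuous_snd)))
      · exact fun x => ⟨circleMap_mem_sphere _ hR _, C.arc_mem_trace i (projIcc 0 1 _ x.2).2⟩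
    refine (intervalIntegral.continuous_parametric_intervalIntegral_of_continuous' (μ := volume)
      (f := fun θ s => k (circleMap 0 R θ) (C.arc i (projIcc 0 1 zero_le_one s))
        * deriv (C.arc i) s) hc 0 1).continuousOn.congr fun θ _ => ?_
    refine intervalIntegral.integral_congr fun s hs => ?_
    rw [uIcc_of_le zero_le_one] at hs
    simp only [projIcc_of_mem _ hs]

end Contour

theorem circleIntegral_sub_inv_of_norm_lt {R : ℝ} {z : ℂ} (hR : 0 ≤ R) (hz : R < ‖z‖) :
    (∮ w in C(0, R), (w - z)⁻¹) = 0 := by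
  refine Complex.circleIntegral_eq_zero_of_differentiable_on_off_countable hR
    countable_empty (fun w hw => ?_) (fun w hw => ?_)
  all_goals
    have hne : w - z ≠ 0 := by
      rw [sub_ne_zero]
      rintro rfl
      first
        | exact hz.not_ge (by simpa using hw)
        | exact hz.not_gt (by simpa using hw.1)
  · exact ((continuousAt_id.sub continuousAt_const).inv₀ hne).continuousWithinAt
  · exact (differentiableAt_id.sub_const z).inv hne

/-- Cauchy's integral formula for an annulus centred at the origin. -/
theorem cauchy_annulus {g : ℂ → ℂ} {r R : ℝ} (hr : 0 < r)
    (hg : ∀ w, r ≤ ‖w‖ → ‖w‖ ≤ R → DifferentiableAt ℂ g w) {z : ℂ} (hrz : r < ‖z‖) (hzR : ‖z‖ < R) :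
    2 * Real.pi * Complex.I * g z =
      (∮ w in C(0, R), (w - z)⁻¹ * g w) - ∮ w in C(0, r), (w - z)⁻¹ * g w := by
  have hR : 0 < R := hr.trans (hrz.trans hzR)
  -- The divided difference of g at z is holomorphic off z and continuous at z, so its integrals
  -- over the two circles agree.
  have key := Complex.circleIntegral_eq_of_differentiable_on_annulus_off_countable hr
    (hrz.trans hzR).le (f := dslope g z) (c := 0) (countable_singleton z)
    (fun w hw => ?_) (fun w hw => ?_)
  · have hs : ∀ ρ : ℝ, 0 < ρ → (‖z‖ ≠ ρ) → r ≤ ρ → ρ ≤ R →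
        (∮ w in C(0, ρ), dslope g z w) =
        (∮ w in C(0, ρ), (w - z)⁻¹ * g w) - (∮ w in C(0, ρ), (w - z)⁻¹) * g z := by
      intro ρ hρ hne h1 h2
      have hz : ∀ w ∈ Metric.sphere (0 : ℂ) ρ, w - z ≠ 0 := fun w hw => by
        rw [sub_ne_zero]; rintro rfl; exact hne (by simpa using hw)
      have hci : ContinuousOn (fun w => (w - z)⁻¹) (Metric.sphere (0 : ℂ) ρ) :=
        (continuousOn_id.sub continuousOn_const).inv₀ hz
      have hcg : ContinuousOn g (Metric.sphere (0 : ℂ) ρ) := fun w hw => by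
        have : ‖w‖ = ρ := by simpa using hw
        exact (hg w (by linarith) (by linarith)).continuousAt.continuousWithinAt
      have e : (∮ w in C(0, ρ), (w - z)⁻¹) * g z = ∮ w in C(0, ρ), g z * (w - z)⁻¹ := by
        rw [circleIntegral.integral_const_mul, mul_comm]
      rw [e, ← circleIntegral.integral_sub (f := fun w => (w - z)⁻¹ * g w)
        (g := fun w => g z * (w - z)⁻¹) ((hci.mul hcg).circleIntegrable hρ.le)
        ((continuousOn_const.mul hci).circleIntegrable hρ.le)]
      refine circleIntegral.integral_congr hρ.le fun w hw => ?_
      rw [dslope_of_ne _ (sub_ne_zero.1 (hz w hw)), slope_def_field]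
      ring
    rw [hs R hR hzR.ne (hrz.trans hzR).le le_rfl, hs r hr hrz.ne' le_rfl (hrz.trans hzR).le,
      circleIntegral_sub_inv_of_norm_lt hr.le hrz,
      circleIntegral.integral_sub_inv_of_mem_ball (by simpa using hzR)] at key
    linear_combination -key
  · simp only [Set.mem_sdiff, Metric.mem_closedBall, dist_zero_right, Metric.mem_ball, not_lt] at hw
    refine ContinuousAt.continuousWithinAt ?_
    rcases eq_or_ne w z with rfl | hne
    · exact continuousAt_dslope_same.2 (hg w hw.2 hw.1)
    · exact (continuousAt_dslope_of_ne hne).2 (hg w hw.2 hw.1).continuousAt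
  · simp only [Set.mem_sdiff, Metric.mem_closedBall, dist_zero_right, Metric.mem_ball, not_le] at hw
    exact (differentiableAt_dslope_of_ne hw.2).2 (hg w hw.1.2.le hw.1.1.le)

namespace Contour

/-- The integral of a function that is holomorphic in an annulus around the origin. -/
theorem integral_eq_of_differentiableAt_annulus (C : Contour) {g : ℂ → ℂ} {r R : ℝ} (hr : 0 < r)
    (hC : ∀ z ∈ C.trace, r < ‖z‖ ∧ ‖z‖ < R)
    (hg : ∀ w, r ≤ ‖w‖ → ‖w‖ ≤ R → DifferentiableAt ℂ g w) :
    C.integral g = C.index 0 * ∮ w in C(0, r), g w := by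
  -- If the annulus is empty then the contour has no arcs and both sides vanish.
  rcases le_or_gt R r with hRr | hrR
  · have he : ∀ z ∉ C.trace, True := fun _ _ => trivial
    have hn : C.n = 0 := by
      by_contra hn
      have := hC _ (C.arc_mem_trace ⟨0, Nat.pos_of_ne_zero hn⟩ (s := 0) (by simp))
      linarith [this.1, this.2]
    have : IsEmpty (Fin C.n) := by rw [hn]; infer_instance
    simp [integral, index]
  have hR : 0 < R := hr.trans hrR
  have hpi : (2 * Real.pi * Complex.I : ℂ) ≠ 0 := Complex.two_pi_I_ne_zero
  have hk : ∀ ρ : ℝ, r ≤ ρ → ρ ≤ R → (∀ z ∈ C.trace, ‖z‖ ≠ ρ) → ContinuousOn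
      (Function.uncurry fun w z : ℂ => (w - z)⁻¹ * g w) (Metric.sphere 0 ρ ×ˢ C.trace) := by
    intro ρ h1 h2 h3 x hx
    have hx1 : ‖x.1‖ = ρ := by simpa using hx.1
    refine ContinuousAt.continuousWithinAt ?_
    refine ((continuousAt_fst.sub continuousAt_snd).inv₀ (sub_ne_zero.2 fun h => ?_)).mul
      (ContinuousAt.comp (f := Prod.fst) (g := g)
        (hg x.1 (by linarith) (by linarith)).continuousAt continuousAt_fst)
    exact h3 _ hx.2 (by rw [← h, hx1])
  have hkR := hk R hrR.le le_rfl fun z hz => (hC z hz).2.ne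
  have hkr := hk r le_rfl hrR.le fun z hz => (hC z hz).1.ne'
  -- Cauchy's formula is inserted under the contour integral. After exchanging the integrals, the
  -- inner one is an index: it is 0 for points of the outer circle and the index of the origin for
  -- points of the inner one.
  have e1 : C.integral (fun z => 2 * Real.pi * Complex.I * g z) =
      C.integral (fun z => ∮ w in C(0, R), (w - z)⁻¹ * g w) -
        C.integral (fun z => ∮ w in C(0, r), (w - z)⁻¹ * g w) := by
    have hc : ∀ ρ : ℝ, 0 < ρ → ContinuousOn
        (Function.uncurry fun w z : ℂ => (w - z)⁻¹ * g w) (Metric.sphere 0 ρ ×ˢ C.trace) →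
        ContinuousOn (fun z => ∮ w in C(0, ρ), (w - z)⁻¹ * g w) C.trace := by
      intro ρ hρ h
      rw [continuousOn_iff_continuous_domRestrict]
      simp only [circleIntegral, Set.domRestrict_def]
      refine intervalIntegral.continuous_parametric_intervalIntegral_of_continuous'
        (f := fun (z : C.trace) θ => deriv (circleMap 0 ρ) θ •
          ((circleMap 0 ρ θ - z)⁻¹ * g (circleMap 0 ρ θ))) ?_ 0 (2 * Real.pi)
      refine Continuous.smul (f := fun x : C.trace × ℝ => deriv (circleMap 0 ρ) x.2)
        ((continuous_deriv_circleMap _ _).comp continuous_snd) ?_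
      exact h.comp_continuous (f := fun x : C.trace × ℝ => (circleMap 0 ρ x.2, (x.1 : ℂ)))
        (((continuous_circleMap 0 ρ).comp continuous_snd).prodMk
          (continuous_subtype_val.comp continuous_fst))
        fun x => ⟨circleMap_mem_sphere _ hρ.le _, x.1.2⟩
    rw [← integral_sub (hc R hR hkR) (hc r hr hkr)]
    exact C.integral_congr fun z hz => cauchy_annulus hr hg (hC z hz).1 (hC z hz).2
  have e2 : ∀ (ρ : ℝ) (c : ℂ), 0 < ρ → (∀ z ∈ C.trace, ‖z‖ ≠ ρ) →
      (∀ w : ℂ, ‖w‖ = ρ → C.index w = c) →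
      (∮ w in C(0, ρ), C.integral fun z => (w - z)⁻¹ * g w) =
        -(2 * Real.pi * Complex.I) * c * ∮ w in C(0, ρ), g w := by
    intro ρ c hρ h3 hc
    rw [← circleIntegral.integral_const_mul]
    refine circleIntegral.integral_congr hρ.le fun w hw => ?_
    have hw' : ‖w‖ = ρ := by simpa using hw
    have h4 : C.integral (fun z => (w - z)⁻¹ * g w) = C.integral fun z => -g w * (z - w)⁻¹ :=
      C.integral_congr fun z _ => by rw [← neg_sub z w, inv_neg]; ring
    rw [h4, integral_const_mul, ← hc w hw', index]
    field_simp
  rw [integral_const_mul, C.integral_circleIntegral_comm hR.le hkR,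
    C.integral_circleIntegral_comm hr.le hkr,
    e2 R 0 hR (fun z hz => (hC z hz).2.ne) fun w hw => (C.index_eq_zero_of_norm_lt fun z hz => by
      rw [hw]; exact (hC z hz).2).2,
    e2 r (C.index 0) hr (fun z hz => (hC z hz).1.ne') fun w hw =>
      (C.index_eq_of_dist_lt fun z hz => by simpa [hw] using (hC z hz).1).2] at e1
  refine mul_left_cancel₀ hpi ?_
  linear_combination e1

end Contour

end EllipticBeta

namespace EllipticBeta

/-! ## Contours with the same indices -/

/-- Induction on the order of the pole. Subtracting the leading term H(a)/(z - a)^{n+1} replaces the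
numerator H by its divided difference at a, which is again analytic, and lowers the order by one. -/
theorem exists_principalPart {a : ℂ} (n : ℕ) : ∀ (g H : ℂ → ℂ), AnalyticAt ℂ H a →
    (∀ᶠ z in 𝓝[≠] a, (z - a) ^ n * g z = H z) →
    ∃ (N : ℕ) (c : ℕ → ℂ) (h : ℂ → ℂ), AnalyticAt ℂ h a ∧
      ∀ᶠ z in 𝓝[≠] a, g z = (∑ k ∈ Finset.range N, c k * ((z - a) ^ (k + 1))⁻¹) + h z := by
  induction n with
  | zero =>
    intro g H hH hg
    exact ⟨0, 0, H, hH, hg.mono fun z hz => by simpa using hz⟩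
  | succ n ih =>
    intro g H hH hg
    obtain ⟨N, c, h, hh, hN⟩ := ih (fun z => g z - H a * ((z - a) ^ (n + 1))⁻¹) (dslope H a) (by
      obtain ⟨p, hp⟩ := hH
      exact ⟨_, hp.has_fpower_series_dslope_fslope⟩) (by
      filter_upwards [hg, self_mem_nhdsWithin] with z hz hne
      have hne' : z - a ≠ 0 := sub_ne_zero.2 hne
      rw [dslope_of_ne _ hne, slope_def_field, ← hz]
      field_simp
      ring)
    refine ⟨max N (n + 1), fun k => (if k < N then c k else 0) + if k = n then H a else 0, h, hh,
      ?_⟩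
    filter_upwards [hN] with z hz
    have h1 : ∑ k ∈ Finset.range (max N (n + 1)), (if k < N then c k else 0) * ((z - a) ^ (k + 1))⁻¹
        = ∑ k ∈ Finset.range N, c k * ((z - a) ^ (k + 1))⁻¹ := by
      simp only [ite_mul, zero_mul]
      rw [← Finset.sum_filter]
      refine Finset.sum_congr (Finset.ext fun k => ?_) fun _ _ => rfl
      simp only [Finset.mem_filter, Finset.mem_range, lt_sup_iff]
      tauto
    have h2 : ∑ k ∈ Finset.range (max N (n + 1)), (if k = n then H a else 0) *
        ((z - a) ^ (k + 1))⁻¹ = H a * ((z - a) ^ (n + 1))⁻¹ := by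
      simp [ite_mul]
    simp only [add_mul, Finset.sum_add_distrib, h1, h2]
    linear_combination hz

namespace Contour

/-- The first power is the index up to a constant, and every higher power has a single-valued
primitive. -/
theorem integral_inv_pow_eq {C C' : Contour} {a : ℂ} (ha : a ∉ C.trace) (ha' : a ∉ C'.trace)
    (h : C.index a = C'.index a) (k : ℕ) :
    C.integral (fun z => ((z - a) ^ (k + 1))⁻¹) = C'.integral fun z => ((z - a) ^ (k + 1))⁻¹ := by
  rcases k with _ | k
  · have hpi : (2 * Real.pi * Complex.I : ℂ)⁻¹ ≠ 0 := inv_ne_zero Complex.two_pi_I_ne_zero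
    simpa using mul_left_cancel₀ hpi h
  · have : ∀ C : Contour, a ∉ C.trace → C.integral (fun z => ((z - a) ^ (k + 1 + 1))⁻¹) = 0 := by
      intro C ha
      have hne : ∀ z ∈ C.trace, z - a ≠ 0 := fun z hz => sub_ne_zero.2 fun h => ha (h ▸ hz)
      refine C.integral_eq_zero_of_hasDerivAt
        (F := fun z => -(k + 1 : ℂ)⁻¹ * ((z - a) ^ (k + 1))⁻¹) (fun z hz => ?_) ?_
      · have hd := ((((hasDerivAt_id z).sub_const a).pow (k + 1)).inv
          (pow_ne_zero _ (hne z hz))).const_mul (-(k + 1 : ℂ)⁻¹)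
        refine hd.congr_deriv ?_
        have := hne z hz
        have h1 : (k + 1 : ℂ) ≠ 0 := Nat.cast_add_one_ne_zero k
        simp only [id]
        push_cast
        field_simp
        simp
        ring
      · exact ContinuousOn.inv₀ (by fun_prop) fun z hz => pow_ne_zero _ (hne z hz)
    rw [this C ha, this C' ha']

/-- Induction on the number of poles: subtracting a principal part removes one pole, and the
principal parts integrate equally because the indices agree. With no poles left the integral depends
only on the index of the origin. -/
theorem integral_eq_of_index_eq_finset {C C' : Contour} {r R : ℝ} (hr : 0 < r)
    (hC : ∀ z ∈ C.trace, r < ‖z‖ ∧ ‖z‖ < R) (hC' : ∀ z ∈ C'.trace, r < ‖z‖ ∧ ‖z‖ < R)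
    (h0 : C.index 0 = C'.index 0) (S : Finset ℂ) : ∀ g : ℂ → ℂ,
    (∀ w, r ≤ ‖w‖ → ‖w‖ ≤ R → w ∉ S → DifferentiableAt ℂ g w) →
    (∀ a ∈ S, MeromorphicAt g a ∧ a ∉ C.trace ∧ a ∉ C'.trace ∧ C.index a = C'.index a) →
    C.integral g = C'.integral g := by
  classical
  induction S using Finset.induction_on with
  | empty =>
    intro g hg _
    rw [C.integral_eq_of_differentiableAt_annulus hr hC fun w h1 h2 => hg w h1 h2 (by simp),
      C'.integral_eq_of_differentiableAt_annulus hr hC' fun w h1 h2 => hg w h1 h2 (by simp), h0]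
  | insert a S haS ih =>
    intro g hg hS
    obtain ⟨⟨n, hn⟩, ha, ha', hind⟩ := hS a (Finset.mem_insert_self a S)
    obtain ⟨N, c, h, hh, hev⟩ := exists_principalPart n g _ hn
      (Eventually.of_forall fun z => rfl)
    set G : ℂ → ℂ := fun z => ∑ k ∈ Finset.range N, c k * ((z - a) ^ (k + 1))⁻¹ with hG
    -- The value at a must be corrected as well, so that the remainder is differentiable there and a
    -- can be dropped from the exceptional set.
    set g' : ℂ → ℂ := Function.update (fun z => g z - G z) a (h a) with hg'
    have hGd : ∀ w, w ≠ a → DifferentiableAt ℂ G w := by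
      intro w hw
      refine DifferentiableAt.fun_sum fun k _ => ?_
      have h1 : DifferentiableAt ℂ (fun z => (z - a) ^ (k + 1)) w := by fun_prop
      exact (h1.inv (pow_ne_zero _ (sub_ne_zero.2 hw))).const_mul (c k)
    have hGa : ∀ w, w ≠ a → AnalyticAt ℂ G w := fun w hw =>
      (show DifferentiableOn ℂ G {a}ᶜ from fun x hx =>
        (hGd x hx).differentiableWithinAt).analyticAt (isOpen_compl_singleton.mem_nhds hw)
    have hne : ∀ w, w ≠ a → g' =ᶠ[𝓝 w] fun z => g z - G z := by
      intro w hw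
      filter_upwards [isOpen_compl_singleton.mem_nhds hw] with z hz
      exact Function.update_of_ne hz _ _
    have hga : g' =ᶠ[𝓝 a] h := by
      filter_upwards [eventually_nhdsWithin_iff.1 hev] with z hz
      by_cases hza : z = a
      · rw [hza]; exact Function.update_self ..
      · rw [hg', Function.update_of_ne hza, hz hza]; ring
    have h1 := ih g' (fun w hw1 hw2 hwS => by
        by_cases hwa : w = a
        · subst hwa
          exact (hga.differentiableAt_iff).2 hh.differentiableAt
        · exact ((hne w hwa).differentiableAt_iff).2
            ((hg w hw1 hw2 (by simp [hwa, hwS])).sub (hGd w hwa)))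
      (fun w hw => by
        have hwa : w ≠ a := fun h => haS (h ▸ hw)
        obtain ⟨hm, hrest⟩ := hS w (Finset.mem_insert_of_mem hw)
        exact ⟨(hm.sub (hGa w hwa).meromorphicAt).congr
          ((hne w hwa).symm.filter_mono nhdsWithin_le_nhds), hrest⟩)
    have key : ∀ D : Contour, (∀ z ∈ D.trace, r < ‖z‖ ∧ ‖z‖ < R) → a ∉ D.trace →
        (∀ w ∈ S, w ∉ D.trace) → D.integral g = D.integral g' +
          ∑ k ∈ Finset.range N, c k * D.integral fun z => ((z - a) ^ (k + 1))⁻¹ := by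
      intro D hD haD hSD
      have hza : ∀ z ∈ D.trace, z ≠ a := fun z hz h => haD (h ▸ hz)
      have hinv : ∀ k : ℕ, ContinuousOn (fun z => c k * ((z - a) ^ (k + 1))⁻¹) D.trace := fun k =>
        continuousOn_const.mul (ContinuousOn.inv₀ (by fun_prop)
          fun z hz => pow_ne_zero _ (sub_ne_zero.2 (hza z hz)))
      have hgc : ContinuousOn g' D.trace := fun z hz => by
        refine ContinuousAt.continuousWithinAt ?_
        refine ((hne z (hza z hz)).differentiableAt_iff.2 ((hg z (hD z hz).1.le (hD z hz).2.le ?_).sub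
          (hGd z (hza z hz)))).continuousAt
        rw [Finset.mem_insert, not_or]
        exact ⟨hza z hz, fun h => hSD z h hz⟩
      simp only [← integral_const_mul]
      rw [← integral_finset_sum _ fun k _ => hinv k,
        ← integral_add hgc (continuousOn_finsetSum _ fun k _ => hinv k)]
      refine D.integral_congr fun z hz => ?_
      rw [hg', Function.update_of_ne (hza z hz)]
      simp only [hG]
      ring
    rw [key C hC ha fun w hw => (hS w (Finset.mem_insert_of_mem hw)).2.1,
      key C' hC' ha' fun w hw => (hS w (Finset.mem_insert_of_mem hw)).2.2.1, h1]
    simp only [integral_inv_pow_eq ha ha' hind]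

/-- The integral of a function whose poles are separated by a contour does not depend on the
contour. -/
theorem integral_eq_of_separates {C C' : Contour} {I O : Set ℂ} (hC : C.Separates I O)
    (hC' : C'.Separates I O)
    (hfin : ∀ r R : ℝ, 0 < r → {z ∈ I ∪ O | r ≤ ‖z‖ ∧ ‖z‖ ≤ R}.Finite) {g : ℂ → ℂ}
    (hg : ∀ z ≠ 0, z ∉ I → z ∉ O → DifferentiableAt ℂ g z) (hm : ∀ z ≠ 0, MeromorphicAt g z) :
    C.integral g = C'.integral g := by
  have h0 := hC.1 0 (mem_insert 0 I)
  have h0' := hC'.1 0 (mem_insert 0 I)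
  obtain ⟨r₁, hr₁, h1⟩ := C.exists_lt_norm h0.1
  obtain ⟨r₂, hr₂, h2⟩ := C'.exists_lt_norm h0'.1
  obtain ⟨R₁, -, h3⟩ := C.exists_norm_lt
  obtain ⟨R₂, -, h4⟩ := C'.exists_norm_lt
  have hr : 0 < min r₁ r₂ := lt_min hr₁ hr₂
  -- An annulus containing both contours meets only finitely many of the poles.
  refine integral_eq_of_index_eq_finset (r := min r₁ r₂) (R := max R₁ R₂) hr
    (fun z hz => ⟨(min_le_left _ _).trans_lt (h1 z hz), (h3 z hz).trans_le (le_max_left _ _)⟩)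
    (fun z hz => ⟨(min_le_right _ _).trans_lt (h2 z hz), (h4 z hz).trans_le (le_max_right _ _)⟩)
    (by rw [h0.2, h0'.2]) (hfin _ (max R₁ R₂) hr).toFinset g
    (fun w hw1 hw2 hw => ?_) fun a ha => ?_
  · have hw0 : w ≠ 0 := norm_pos_iff.1 (hr.trans_le hw1)
    simp only [Finite.mem_toFinset, mem_ofPred_eq, not_and, mem_union] at hw
    exact hg w hw0 (fun h => hw (Or.inl h) hw1 hw2) fun h => hw (Or.inr h) hw1 hw2
  · simp only [Finite.mem_toFinset, mem_ofPred_eq, mem_union] at ha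
    have ha0 : a ≠ 0 := norm_pos_iff.1 (hr.trans_le ha.2.1)
    refine ⟨hm a ha0, ?_⟩
    rcases ha.1 with h | h
    · have h1 := hC.1 a (mem_insert_of_mem 0 h)
      have h2 := hC'.1 a (mem_insert_of_mem 0 h)
      exact ⟨h1.1, h2.1, h1.2.trans h2.2.symm⟩
    · exact ⟨(hC.2 a h).1, (hC'.2 a h).1, (hC.2 a h).2.trans (hC'.2 a h).2.symm⟩

open MeasureTheory in
/-- Countably many values of the integrand do not matter. -/
theorem integral_congr_off_countable (C : Contour) {Z : Set ℂ} (hZ : Z.Countable) {f g : ℂ → ℂ}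
    (h : ∀ z ∈ C.trace, z ∉ Z → f z = g z) : C.integral f = C.integral g := by
  refine Finset.sum_congr rfl fun i _ => intervalIntegral.integral_congr_ae ?_
  -- A parameter at which an arc meets a given point with non-zero velocity is isolated among such
  -- parameters, so there are countably many of them. Where the velocity vanishes, the value of the
  -- integrand is irrelevant.
  have hc : (⋃ z ∈ Z, {s : ℝ | C.arc i s = z ∧ deriv (C.arc i) s ≠ 0}).Countable := by
    refine hZ.biUnion fun z _ => ?_
    refine (HereditarilyLindelofSpace.isLindelof _).countable_of_isDiscrete ?_
    rw [isDiscrete_iff_forall_mem_exists_isOpen]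
    rintro s ⟨hs, hd⟩
    have hev := (C.hasDerivAt_arc i s).eventually_ne (c := z) hd
    obtain ⟨U, hU, hUo, hsU⟩ := eventually_nhds_iff.1 (eventually_nhdsWithin_iff.1 hev)
    refine ⟨U, hUo, ?_⟩
    ext x
    simp only [mem_inter_iff, mem_ofPred_eq, mem_singleton_iff]
    constructor
    · rintro ⟨hxU, hx, -⟩
      by_contra hne
      exact hU x hxU hne hx
    · rintro rfl
      exact ⟨hsU, hs, hd⟩
  filter_upwards [hc.ae_notMem volume] with s hs hs01
  rw [uIoc_of_le zero_le_one] at hs01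
  by_cases hd : deriv (C.arc i) s = 0
  · rw [hd, mul_zero, mul_zero]
  · rw [h _ (C.arc_mem_trace i (Ioc_subset_Icc_self hs01)) fun hz => hs ?_]
    exact mem_biUnion hz ⟨rfl, hd⟩

/-! ## Scaling and inversion -/

/-- The contour `a C`. -/
def scale (C : Contour) (a : ℂ) : Contour where
  n := C.n
  arc i s := a * C.arc i s
  next := C.next
  contDiff_arc i := contDiff_const.mul (C.contDiff_arc i)
  closed i := by rw [C.closed i]

theorem mem_trace_scale {C : Contour} {a z : ℂ} (ha : a ≠ 0) :
    a * z ∈ (C.scale a).trace ↔ z ∈ C.trace := by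
  simp only [trace, scale, mem_iUnion, mem_image, mul_right_inj' ha]

theorem integral_scale (C : Contour) (a : ℂ) (f : ℂ → ℂ) :
    (C.scale a).integral f = C.integral fun z => f (a * z) * a := by
  refine Finset.sum_congr rfl fun i _ => intervalIntegral.integral_congr fun s _ => ?_
  simp only [scale]
  rw [((C.hasDerivAt_arc i s).const_mul a).deriv]
  ring

theorem index_scale (C : Contour) {a z : ℂ} (ha : a ≠ 0) :
    (C.scale a).index (a * z) = C.index z := by
  rw [index, index, integral_scale]
  congr 1
  refine C.integral_congr fun w _ => ?_
  rw [← mul_sub, mul_inv]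
  field_simp

theorem separates_scale {C : Contour} {a : ℂ} (ha : a ≠ 0) {I O : Set ℂ}
    (h : C.Separates {z | a * z ∈ I} {z | a * z ∈ O}) : (C.scale a).Separates I O := by
  have key : ∀ z, z = a * (a⁻¹ * z) := fun z => by field_simp
  refine ⟨fun z hz => ?_, fun z hz => ?_⟩
  · rw [key z, mem_trace_scale ha, index_scale C ha]
    refine h.1 _ ?_
    rcases hz with rfl | hz
    · simp
    · exact Or.inr (by rwa [mem_ofPred_eq, ← key])
  · rw [key z, mem_trace_scale ha, index_scale C ha]
    exact h.2 _ (by rwa [mem_ofPred_eq, ← key])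

/-- The image of a contour under inversion, with the orientation reversed. -/
noncomputable def inv (C : Contour) (h : ∀ i s, C.arc i s ≠ 0) : Contour where
  n := C.n
  arc i s := (C.arc i (1 - s))⁻¹
  next := C.next.symm
  contDiff_arc i := ((C.contDiff_arc i).comp (contDiff_const.sub contDiff_id)).inv fun s => h i _
  closed i := by
    simp only [sub_self, sub_zero]
    rw [C.closed (C.next.symm i), Equiv.apply_symm_apply]

theorem mem_trace_inv {C : Contour} (h : ∀ i s, C.arc i s ≠ 0) {z : ℂ} :
    z ∈ (C.inv h).trace ↔ z⁻¹ ∈ C.trace := by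
  simp only [trace, inv, mem_iUnion, mem_image]
  refine exists_congr fun i => ⟨?_, ?_⟩
  · rintro ⟨s, hs, rfl⟩
    exact ⟨1 - s, ⟨by linarith [hs.2], by linarith [hs.1]⟩, by simp⟩
  · rintro ⟨s, hs, hz⟩
    exact ⟨1 - s, ⟨by linarith [hs.2], by linarith [hs.1]⟩, by simp [hz]⟩

theorem integral_inv (C : Contour) (h : ∀ i s, C.arc i s ≠ 0) (f : ℂ → ℂ) :
    (C.inv h).integral f = C.integral fun z => f z⁻¹ * (z ^ 2)⁻¹ := by
  refine Finset.sum_congr rfl fun i _ => ?_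
  have e : ∀ s : ℝ, f ((C.inv h).arc i s) * deriv ((C.inv h).arc i) s =
      (fun s => f (C.arc i s)⁻¹ * (C.arc i s ^ 2)⁻¹ * deriv (C.arc i) s) (1 - s) := by
    intro s
    have hd : HasDerivAt (fun s : ℝ => (C.arc i (1 - s))⁻¹)
        (-(-deriv (C.arc i) (1 - s)) / C.arc i (1 - s) ^ 2) s := by
      have h1 := (C.hasDerivAt_arc i (1 - s)).scomp s ((hasDerivAt_id s).const_sub 1)
      have h2 : HasDerivAt (C.arc i ∘ fun x : ℝ => 1 - id x) (-deriv (C.arc i) (1 - s)) s := by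
        simpa using h1
      exact h2.inv (h i _)
    change f (C.arc i (1 - s))⁻¹ * deriv (fun s : ℝ => (C.arc i (1 - s))⁻¹) s = _
    rw [hd.deriv]
    simp only [neg_neg]
    rw [div_eq_inv_mul]
    ring
  rw [intervalIntegral.integral_congr fun s _ => e s,
    intervalIntegral.integral_comp_sub_left
      (fun s => f (C.arc i s)⁻¹ * (C.arc i s ^ 2)⁻¹ * deriv (C.arc i) s) 1]
  simp

/-- Under w = 1/z the form dw/(w - a), with orientation reversed, becomes dz/z - dz/(z - 1/a). -/
theorem index_inv {C : Contour} (h : ∀ i s, C.arc i s ≠ 0) {a : ℂ} (ha : a ≠ 0)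
    (hC : a⁻¹ ∉ C.trace) : (C.inv h).index a = C.index 0 - C.index a⁻¹ := by
  have h0 : (0 : ℂ) ∉ C.trace := by
    simp only [trace, mem_iUnion, mem_image, not_exists, not_and]
    exact fun i s _ => h i s
  rw [index, index, index, ← mul_sub, ← integral_sub (C.continuousOn_sub_inv h0)
    (C.continuousOn_sub_inv hC), integral_inv]
  congr 1
  refine C.integral_congr fun z hz => ?_
  have hz0 : z ≠ 0 := fun h' => h0 (h' ▸ hz)
  have hza : z - a⁻¹ ≠ 0 := sub_ne_zero.2 fun h' => hC (h' ▸ hz)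
  have hza' : z⁻¹ - a ≠ 0 := by
    intro h'
    apply hza
    rw [sub_eq_zero] at h' ⊢
    rw [← h', inv_inv]
  have h1 : z * a - 1 ≠ 0 := by
    intro h'
    apply hza
    field_simp
    rw [h', mul_zero]
  have h2 : 1 - z * a ≠ 0 := by rw [← neg_sub]; exact neg_ne_zero.2 h1
  have e1 : (z⁻¹ - a) = (1 - z * a) / z := by field_simp
  have e2 : z - a⁻¹ = (z * a - 1) / a := by field_simp
  rw [e1, e2]
  field_simp
  ring

theorem index_inv_zero {C : Contour} (h : ∀ i s, C.arc i s ≠ 0) :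
    (C.inv h).index 0 = C.index 0 := by
  rw [index, index, integral_inv]
  congr 1
  refine C.integral_congr fun z hz => ?_
  have hz0 : z ≠ 0 := by
    rintro rfl
    simp only [trace, mem_iUnion, mem_image] at hz
    obtain ⟨i, s, -, hs⟩ := hz
    exact h i s hs
  simp only [sub_zero, inv_inv]
  field_simp

/-- Inversion turns the index into one minus the index at non-zero points, while it also exchanges
the inner and outer points. The two effects compensate. -/
theorem separates_inv {C : Contour} (h : ∀ i s, C.arc i s ≠ 0) {I O : Set ℂ}
    (hI : ∀ z ∈ I, z ≠ 0 ∧ z⁻¹ ∈ O) (hO : ∀ z ∈ O, z ≠ 0 ∧ z⁻¹ ∈ I)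
    (hC : C.Separates I O) : (C.inv h).Separates I O := by
  have h0 := hC.1 0 (mem_insert 0 I)
  refine ⟨fun a ha => ?_, fun a ha => ?_⟩
  · rcases ha with rfl | ha
    · rw [mem_trace_inv, index_inv_zero, inv_zero]
      exact h0
    · obtain ⟨ha0, haO⟩ := hI a ha
      rw [mem_trace_inv, index_inv h ha0 (hC.2 _ haO).1, (hC.2 _ haO).2, h0.2, sub_zero]
      exact ⟨(hC.2 _ haO).1, rfl⟩
  · obtain ⟨ha0, haI⟩ := hO a ha
    have := hC.1 _ (mem_insert_of_mem 0 haI)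
    rw [mem_trace_inv, index_inv h ha0 this.1, this.2, h0.2, sub_self]
    exact ⟨this.1, rfl⟩

end Contour

end EllipticBeta

namespace EllipticBeta

/-! ## Contours made of circles -/

theorem circleIntegral_sub_inv_of_lt_norm {c z : ℂ} {R : ℝ} (hR : 0 ≤ R) (hz : R < ‖z - c‖) :
    (∮ w in C(c, R), (w - z)⁻¹) = 0 := by
  refine Complex.circleIntegral_eq_zero_of_differentiable_on_off_countable hR
    countable_empty (fun w hw => ?_) (fun w hw => ?_)
  all_goals
    have hne : w - z ≠ 0 := by
      rw [sub_ne_zero]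
      rintro rfl
      first
        | exact hz.not_ge (by simpa [dist_eq_norm] using hw)
        | exact hz.not_gt (by simpa [dist_eq_norm] using hw.1)
  · exact ((continuousAt_id.sub continuousAt_const).inv₀ hne).continuousWithinAt
  · exact (differentiableAt_id.sub_const z).inv hne

namespace Contour

/-- A family of circles, each traversed in the direction given by a sign. -/
noncomputable def circles {n : ℕ} (c : Fin n → ℂ) (r : Fin n → ℝ) (e : Fin n → ℤˣ) : Contour where
  n := n
  arc i s := circleMap (c i) (r i) (((e i : ℤ) : ℝ) * (2 * Real.pi) * s)
  next := Equiv.refl _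
  contDiff_arc i := (contDiff_circleMap (c i) (r i)).comp (contDiff_const.mul contDiff_id)
  closed i := by
    rcases Int.units_eq_one_or (e i) with h | h
    · simp [h, circleMap]
    · simp [h, circleMap, Complex.exp_neg]

theorem integral_circles {n : ℕ} (c : Fin n → ℂ) (r : Fin n → ℝ) (e : Fin n → ℤˣ) (f : ℂ → ℂ) :
    (circles c r e).integral f = ∑ i, ((e i : ℤ) : ℂ) * ∮ z in C(c i, r i), f z := by
  refine Finset.sum_congr rfl fun i _ => ?_
  set k : ℝ := ((e i : ℤ) : ℝ) * (2 * Real.pi) with hk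
  set F : ℝ → ℂ := fun θ => deriv (circleMap (c i) (r i)) θ • f (circleMap (c i) (r i) θ) with hF
  have e1 : ∀ s : ℝ, f ((circles c r e).arc i s) * deriv ((circles c r e).arc i) s =
      (k : ℂ) * F (k * s) := by
    intro s
    change f (circleMap (c i) (r i) (k * s)) * deriv (fun s => circleMap (c i) (r i) (k * s)) s = _
    have hd := (differentiable_circleMap (c i) (r i) (k * s)).hasDerivAt.scomp s
      ((hasDerivAt_id s).const_mul k)
    simp only [mul_one] at hd
    have hd' : deriv (fun s => circleMap (c i) (r i) (k * s)) s = _ := hd.deriv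
    rw [hd']
    simp only [hF, smul_eq_mul, Complex.real_smul]
    ring
  have hper : Function.Periodic F (2 * Real.pi) := by
    intro θ
    simp only [hF, deriv_circleMap, periodic_circleMap (c i) (r i) θ, periodic_circleMap 0 (r i) θ]
  have hk0 : k ≠ 0 := by
    have : (e i : ℤ) ≠ 0 := (e i).ne_zero
    exact mul_ne_zero (Int.cast_ne_zero.2 this) Real.two_pi_pos.ne'
  rw [intervalIntegral.integral_congr fun s _ => e1 s, intervalIntegral.integral_const_mul,
    intervalIntegral.integral_comp_mul_left F hk0, mul_zero, mul_one, Complex.real_smul,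
    ← mul_assoc, Complex.ofReal_inv, mul_inv_cancel₀ (by exact_mod_cast hk0), one_mul]
  rcases Int.units_eq_one_or (e i) with h | h
  · simp [hk, h, circleIntegral, hF]
  · have h2 := hper.intervalIntegral_add_eq (-(2 * Real.pi)) 0
    rw [neg_add_cancel, zero_add] at h2
    have h3 : k = -(2 * Real.pi) := by simp [hk, h]
    rw [h3, intervalIntegral.integral_symm, h2]
    simp [h, circleIntegral, hF]

theorem mem_trace_circles {n : ℕ} {c : Fin n → ℂ} {r : Fin n → ℝ} {e : Fin n → ℤˣ}
    (hr : ∀ i, 0 ≤ r i) {z : ℂ} (hz : z ∈ (circles c r e).trace) : ∃ i, ‖z - c i‖ = r i := by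
  obtain ⟨i, s, -, rfl⟩ := mem_iUnion.1 hz
  exact ⟨i, mem_sphere_iff_norm.1 (circleMap_mem_sphere (c i) (hr i) _)⟩

theorem index_circles {n : ℕ} {c : Fin n → ℂ} {r : Fin n → ℝ} {e : Fin n → ℤˣ}
    (hr : ∀ i, 0 ≤ r i) {z : ℂ} (hz : ∀ i, ‖z - c i‖ ≠ r i) :
    z ∉ (circles c r e).trace ∧
      (circles c r e).index z = ∑ i, if ‖z - c i‖ < r i then ((e i : ℤ) : ℂ) else 0 := by
  refine ⟨fun h => (mem_trace_circles hr h).elim fun i hi => hz i hi, ?_⟩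
  rw [index, integral_circles, Finset.mul_sum]
  refine Finset.sum_congr rfl fun i _ => ?_
  have hpi : (2 * Real.pi * Complex.I : ℂ) ≠ 0 := Complex.two_pi_I_ne_zero
  split_ifs with h
  · rw [circleIntegral.integral_sub_inv_of_mem_ball (by simpa [dist_eq_norm] using h)]
    field_simp
  · rw [circleIntegral_sub_inv_of_lt_norm (hr i) (lt_of_le_of_ne (not_lt.1 h) (hz i).symm)]
    simp

/-- A large circle, and small circles around some points traversed in the negative direction. -/
noncomputable def punctured (ρ ε : ℝ) {n : ℕ} (a : Fin n → ℂ) : Contour :=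
  circles (Fin.cons 0 a : Fin (n + 1) → ℂ) (Fin.cons ρ fun _ => ε) (Fin.cons 1 fun _ => -1)

/-- The radii are so small that the small circles are separated from each other, from the large
circle and from the points of `I`. -/
def GoodRadii (ρ ε : ℝ) {n : ℕ} (a : Fin n → ℂ) (I : Set ℂ) : Prop :=
  ∀ i, ‖a i‖ + ε < ρ ∧ ε < ‖a i‖ ∧ (∀ j, j ≠ i → ε < ‖a j - a i‖) ∧ ∀ z ∈ I, ε < ‖z - a i‖

/-- `I` may accumulate at the origin. Only finitely many of its points have modulus at least half
that of a centre, and the remaining ones are far from that centre. -/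
theorem eventually_goodRadii {ρ : ℝ} {n : ℕ} {a : Fin n → ℂ} (ha : Function.Injective a)
    (haρ : ∀ i, ‖a i‖ < ρ) (ha0 : ∀ i, a i ≠ 0) {I : Set ℂ} (haI : ∀ i, a i ∉ I)
    (hI : ∀ r : ℝ, 0 < r → {z ∈ I | r ≤ ‖z‖}.Finite) :
    ∀ᶠ ε in 𝓝[>] (0 : ℝ), GoodRadii ρ ε a I := by
  have lt : ∀ δ : ℝ, 0 < δ → ∀ᶠ ε in 𝓝[>] (0 : ℝ), ε < δ := fun δ hδ =>
    (eventually_lt_nhds hδ).filter_mono nhdsWithin_le_nhds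
  refine eventually_all.2 fun i => ?_
  have hai : 0 < ‖a i‖ := norm_pos_iff.2 (ha0 i)
  refine ((lt (ρ - ‖a i‖) (by linarith [haρ i])).mono fun ε h => by linarith).and
    ((lt _ hai).and (Eventually.and ?_ ?_))
  · refine eventually_all.2 fun j => ?_
    by_cases hj : j = i
    · exact Eventually.of_forall fun _ h => absurd hj h
    · exact (lt ‖a j - a i‖ (norm_pos_iff.2 (sub_ne_zero.2 fun h => hj (ha h)))).mono fun _ h _ => h
  · have h1 : ∀ᶠ ε in 𝓝[>] (0 : ℝ), ∀ z ∈ {z ∈ I | ‖a i‖ / 2 ≤ ‖z‖}, ε < ‖z - a i‖ :=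
      (eventually_all_finite (hI _ (by positivity))).2 fun z hz =>
        lt _ (norm_pos_iff.2 (sub_ne_zero.2 fun h => haI i (h ▸ hz.1)))
    filter_upwards [h1, lt (‖a i‖ / 2) (by positivity)] with ε h h' z hz
    by_cases hlt : ‖a i‖ / 2 ≤ ‖z‖
    · exact h z ⟨hz, hlt⟩
    · have := norm_sub_norm_le (a i) z
      rw [norm_sub_rev]
      linarith

/-- An outer point enclosed by the large circle is the centre of a negative small circle, so its
index is 1 - 1 = 0. -/
theorem separates_punctured {ρ ε : ℝ} (hρ : 0 < ρ) (hε : 0 < ε) {n : ℕ} {a : Fin n → ℂ}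
    {I O : Set ℂ} (hr : GoodRadii ρ ε a I) (hI : ∀ z ∈ I, ‖z‖ < ρ)
    (hO : ∀ z ∈ O, ρ < ‖z‖ ∨ ∃ i, z = a i) : (punctured ρ ε a).Separates I O := by
  have h0 : ∀ i : Fin (n + 1), 0 ≤ (Fin.cons ρ fun _ => ε : Fin (n + 1) → ℝ) i := by
    intro i
    refine Fin.cases hρ.le (fun _ => ?_) i
    simpa using hε.le
  constructor
  · intro z hz
    have hz1 : ‖z‖ < ρ := by
      rcases hz with rfl | hz
      · simpa using hρ
      · exact hI z hz
    have hz2 : ∀ i, ε < ‖z - a i‖ := by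
      intro i
      rcases hz with rfl | hz
      · simpa using (hr i).2.1
      · exact (hr i).2.2.2 z hz
    have h1 := index_circles (c := (Fin.cons 0 a : Fin (n + 1) → ℂ)) (e := Fin.cons 1 fun _ => -1)
      h0 (z := z) (by
        intro i
        refine Fin.cases ?_ (fun j => ?_) i
        · simpa using hz1.ne
        · simpa using (hz2 j).ne')
    refine ⟨h1.1, h1.2.trans ?_⟩
    rw [Fin.sum_univ_succ]
    simp [hz1, fun i => (hz2 i).not_gt]
  · intro z hz
    rcases hO z hz with hz | ⟨k, rfl⟩
    · have hz2 : ∀ i, ε < ‖z - a i‖ := by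
        intro i
        have := norm_sub_norm_le z (a i)
        linarith [(hr i).1]
      have h1 := index_circles (c := (Fin.cons 0 a : Fin (n + 1) → ℂ)) (e := Fin.cons 1 fun _ => -1)
        h0 (z := z) (by
          intro i
          refine Fin.cases ?_ (fun j => ?_) i
          · simpa using hz.ne'
          · simpa using (hz2 j).ne')
      refine ⟨h1.1, h1.2.trans ?_⟩
      rw [Fin.sum_univ_succ]
      simp [hz.not_gt, fun i => (hz2 i).not_gt]
    · have hz1 : ‖a k‖ < ρ := by linarith [(hr k).1]
      have h1 := index_circles (c := (Fin.cons 0 a : Fin (n + 1) → ℂ)) (e := Fin.cons 1 fun _ => -1)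
        h0 (z := a k) (by
          intro i
          refine Fin.cases ?_ (fun j => ?_) i
          · simpa using hz1.ne
          · by_cases hj : j = k
            · subst hj; simpa using hε.ne
            · simpa using ((hr j).2.2.1 k (Ne.symm hj)).ne')
      refine ⟨h1.1, h1.2.trans ?_⟩
      rw [Fin.sum_univ_succ, Finset.sum_eq_single k]
      · simp [hz1, hε]
      · intro j _ hj
        simp [((hr j).2.2.1 k (Ne.symm hj)).not_gt]
      · simp

theorem integral_punctured (ρ ε : ℝ) {n : ℕ} (a : Fin n → ℂ) (f : ℂ → ℂ) :
    (punctured ρ ε a).integral f = (∮ z in C(0, ρ), f z) - ∑ i, ∮ z in C(a i, ε), f z := by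
  rw [punctured, integral_circles, Fin.sum_univ_succ]
  simp [sub_eq_add_neg]

theorem arc_punctured_ne_zero {ρ ε : ℝ} (hρ : 0 < ρ) (hε : 0 < ε) {n : ℕ} {a : Fin n → ℂ}
    {I : Set ℂ} (hr : GoodRadii ρ ε a I) (i : Fin (punctured ρ ε a).n) (s : ℝ) :
    (punctured ρ ε a).arc i s ≠ 0 := by
  change Fin (n + 1) at i
  change circleMap _ _ _ ≠ 0
  refine Fin.cases ?_ (fun j => ?_) i
  · simp [hρ.ne']
  · intro h
    have := circleMap_mem_sphere (a j) hε.le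
      ((((-1 : ℤˣ) : ℤ) : ℝ) * (2 * Real.pi) * s)
    simp only [Fin.cons_succ] at h
    rw [h] at this
    simp only [mem_sphere_iff_norm, zero_sub, norm_neg] at this
    exact (hr j).2.1.ne' this

/-- Separating contours exist. -/
theorem exists_separates {I O : Set ℂ} (hdisj : Disjoint I O) {B : ℝ} (hIB : ∀ z ∈ I, ‖z‖ ≤ B)
    (hI : ∀ r : ℝ, 0 < r → {z ∈ I | r ≤ ‖z‖}.Finite) (hO : ∀ R : ℝ, {z ∈ O | ‖z‖ ≤ R}.Finite)
    (hO0 : (0 : ℂ) ∉ O) : ∃ C : Contour, C.Separates I O ∧ ∀ i s, C.arc i s ≠ 0 := by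
  set B' := max B 0
  -- The radius exceeds all inner points and avoids the moduli of the finitely many outer points in
  -- the relevant disc.
  obtain ⟨ρ, hρ, hρO⟩ := (Ioo_infinite (lt_add_one B')).exists_notMem_finite
    ((hO (B' + 1)).image norm)
  have hρ0 : 0 < ρ := (le_max_right B 0).trans_lt hρ.1
  obtain ⟨n, a, ha⟩ := Finite.fin_param ((hO ρ).subset (show {z ∈ O | ‖z‖ ≤ ρ} ⊆ _ from subset_rfl))
  have haO : ∀ i, a i ∈ O ∧ ‖a i‖ < ρ := by
    intro i
    have h : a i ∈ {z ∈ O | ‖z‖ ≤ ρ} := ha.2 ▸ mem_range_self i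
    refine ⟨h.1, lt_of_le_of_ne h.2 fun h' => hρO ⟨a i, ⟨h.1, ?_⟩, h'⟩⟩
    rw [h']; exact hρ.2.le
  obtain ⟨ε, hr, hε⟩ := ((eventually_goodRadii ha.1 (fun i => (haO i).2)
    (fun i h => hO0 (h ▸ (haO i).1)) (fun i h => disjoint_left.1 hdisj h (haO i).1) hI).and
    self_mem_nhdsWithin).exists
  refine ⟨punctured ρ ε a, separates_punctured hρ0 hε hr
    (fun z hz => (hIB z hz).trans_lt ((le_max_left B 0).trans_lt hρ.1)) (fun z hz => ?_),
    arc_punctured_ne_zero hρ0 hε hr⟩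
  rcases lt_or_ge ρ ‖z‖ with h | h
  · exact Or.inl h
  · right
    have : z ∈ range a := ha.2 ▸ (show z ∈ {z ∈ O | ‖z‖ ≤ ρ} from ⟨hz, h⟩)
    obtain ⟨i, hi⟩ := this
    exact ⟨i, hi.symm⟩

end Contour

end EllipticBeta

namespace EllipticBeta

/-! ## The addition formula for theta functions -/

/-- This is Liouville's theorem for g ∘ exp: that function is entire, and it is bounded because
multiplication by powers of q moves every point into the compact annulus |q| ≤ |w| ≤ 1. -/
theorem eq_of_mul_periodic {q : ℂ} (hq : ‖q‖ < 1) (hq0 : q ≠ 0) {g : ℂ → ℂ}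
    (hg : ∀ u ≠ 0, DifferentiableAt ℂ g u) (hper : ∀ u ≠ 0, g (u * q) = g u) {u v : ℂ} (hu : u ≠ 0)
    (hv : v ≠ 0) : g u = g v := by
  have hz : ∀ n : ℤ, ∀ u ≠ 0, g (u * q ^ n) = g u := by
    intro n
    induction n using Int.induction_on with
    | zero => simp
    | succ n ih =>
      intro u hu
      rw [zpow_add_one₀ hq0, ← mul_assoc, hper _ (mul_ne_zero hu (zpow_ne_zero _ hq0)), ih u hu]
    | pred n ih =>
      intro u hu
      rw [← ih u hu, ← hper (u * q ^ (-(n : ℤ) - 1)) (mul_ne_zero hu (zpow_ne_zero _ hq0)),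
        mul_assoc, ← zpow_add_one₀ hq0, sub_add_cancel]
  have hnq : 0 < ‖q‖ := norm_pos_iff.2 hq0
  have hK : IsCompact {w : ℂ | ‖q‖ ≤ ‖w‖ ∧ ‖w‖ ≤ 1} := by
    refine Metric.isCompact_of_isClosed_isBounded ?_ ?_
    · exact (isClosed_le continuous_const continuous_norm).and
        (isClosed_le continuous_norm continuous_const)
    · exact (Metric.isBounded_closedBall (x := (0 : ℂ)) (r := 1)).subset
        fun w hw => by simpa using hw.2
  have hb : Bornology.IsBounded (range (g ∘ Complex.exp)) := by
    refine (hK.image_of_continuousOn (f := g) fun w hw => (hg w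
      (norm_pos_iff.1 (hnq.trans_le hw.1))).continuousAt.continuousWithinAt).isBounded.subset ?_
    rintro _ ⟨x, rfl⟩
    obtain ⟨n, hn1, hn2⟩ := exists_mem_Ioc_zpow (norm_pos_iff.2 (Complex.exp_ne_zero x))
      ((one_lt_inv₀ hnq).2 hq)
    refine ⟨Complex.exp x * q ^ (n + 1), ⟨?_, ?_⟩, hz _ _ (Complex.exp_ne_zero x)⟩
    · rw [norm_mul, norm_zpow]
      rw [inv_zpow'] at hn1
      calc ‖q‖ = ‖q‖ ^ (-n) * ‖q‖ ^ (n + 1) := by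
            rw [← zpow_add₀ hnq.ne']; simp
        _ ≤ _ := by gcongr
    · rw [norm_mul, norm_zpow]
      rw [inv_zpow'] at hn2
      calc _ ≤ ‖q‖ ^ (-(n + 1)) * ‖q‖ ^ (n + 1) := by gcongr
        _ = 1 := by rw [← zpow_add₀ hnq.ne']; simp
  have hd : Differentiable ℂ (g ∘ Complex.exp) := fun x =>
    (hg _ (Complex.exp_ne_zero x)).comp x Complex.differentiableAt_exp
  have := hd.apply_eq_apply_of_bounded hb (Complex.log u) (Complex.log v)
  simpa [Complex.exp_log hu, Complex.exp_log hv] using this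

theorem theta_eq_zero_iff_zpow {q : ℂ} (hq : ‖q‖ < 1) (hq0 : q ≠ 0) {x : ℂ} (hx : x ≠ 0) :
    theta x q = 0 ↔ ∃ n : ℤ, x = q ^ n := by
  constructor
  · intro h
    by_contra! hn
    exact theta_zpow_ne_zero hq hq0 hx hn h
  · rintro ⟨n, rfl⟩
    induction n using Int.induction_on with
    | zero => simpa using theta_one hq
    | succ n ih =>
      have hx : q ^ (n : ℤ) ≠ 0 := zpow_ne_zero _ hq0
      rw [zpow_add_one₀ hq0, theta_mul hq hq0 hx, ih hx, mul_zero]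
    | pred n ih =>
      have hx : q ^ (-(n : ℤ) - 1) ≠ 0 := zpow_ne_zero _ hq0
      have h := theta_mul hq hq0 hx
      rw [← zpow_add_one₀ hq0, sub_add_cancel, ih (zpow_ne_zero _ hq0)] at h
      simpa [hx] using h.symm

theorem differentiableAt_theta {q : ℂ} (hq : ‖q‖ < 1) {x : ℂ} (hx : x ≠ 0) :
    DifferentiableAt ℂ (fun x => theta x q) x := differentiableAt_id.theta hq hx

/-- Quasi-periodicity carries the derivative from one zero to the next, up to a non-zero factor. At
1 it equals -(q;q)². Hence all zeros are simple. -/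
theorem deriv_theta_ne_zero {q : ℂ} (hq : ‖q‖ < 1) (hq0 : q ≠ 0) (n : ℤ) :
    deriv (fun x => theta x q) (q ^ n) ≠ 0 := by
  have step : ∀ n : ℤ, deriv (fun x => theta x q) (q ^ (n + 1)) ≠ 0 ↔
      deriv (fun x => theta x q) (q ^ n) ≠ 0 := by
    intro n
    have hx : q ^ n ≠ 0 := zpow_ne_zero _ hq0
    have h1 : HasDerivAt (fun x => theta (x * q) q)
        (deriv (fun x => theta x q) (q ^ (n + 1)) * q) (q ^ n) := by
      have h := (differentiableAt_theta hq (x := q ^ (n + 1)) (zpow_ne_zero _ hq0)).hasDerivAt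
      rw [zpow_add_one₀ hq0] at h ⊢
      have h2 := (hasDerivAt_id (q ^ n)).mul_const q
      simp only [one_mul] at h2
      exact h.comp (q ^ n) h2
    have h2 : HasDerivAt (fun x => theta (x * q) q)
        (-(q ^ n)⁻¹ * deriv (fun x => theta x q) (q ^ n)) (q ^ n) := by
      have h := ((hasDerivAt_inv hx).neg).mul (differentiableAt_theta hq hx).hasDerivAt
      have h0 : theta (q ^ n) q = 0 := (theta_eq_zero_iff_zpow hq hq0 hx).2 ⟨n, rfl⟩
      simp only [h0, mul_zero, zero_add] at h
      refine h.congr_of_eventuallyEq ?_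
      filter_upwards [isOpen_ne.mem_nhds hx] with x hx'
      exact theta_mul hq hq0 hx'
    have h3 := h1.unique h2
    constructor
    · intro h h'
      rw [h', mul_zero] at h3
      exact mul_ne_zero h hq0 h3
    · intro h h'
      rw [h', zero_mul] at h3
      exact mul_ne_zero (neg_ne_zero.2 (inv_ne_zero hx)) h h3.symm
  induction n using Int.induction_on with
  | zero =>
    have h : HasDerivAt (fun x => theta x q) (-(qPoch q q * qPoch q q)) 1 := by
      have h1 : DifferentiableAt ℂ (fun x => qPoch (x * q) q * qPoch (q / x) q) 1 :=
        ((differentiableAt_id.mul_const q).qPoch hq).mul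
          (((differentiableAt_const q).div differentiableAt_id one_ne_zero).qPoch hq)
      have h2 := ((hasDerivAt_id (1 : ℂ)).const_sub 1).mul h1.hasDerivAt
      simp only [id, sub_self, zero_mul, add_zero, one_mul, div_one] at h2
      refine (h2.congr_of_eventuallyEq (Eventually.of_forall fun x => ?_)).congr_deriv (by ring)
      rw [theta, qPoch_succ hq x]
      simp only [Pi.mul_apply]
      ring
    rw [zpow_zero, h.deriv, neg_ne_zero]
    have : qPoch q q ≠ 0 := by
      rw [Ne, qPoch_eq_zero_iff hq]
      rintro ⟨k, hk⟩
      rw [← pow_succ'] at hk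
      have := congrArg norm hk
      rw [norm_pow, norm_one] at this
      exact (pow_lt_one₀ (norm_nonneg _) hq k.succ_ne_zero).ne this
    exact mul_ne_zero this this
  | succ n ih => exact (step n).2 ih
  | pred n ih =>
    rw [← step, sub_add_cancel]
    exact ih

/-- A function that vanishes at the zeros of a theta function is divisible by it. -/
theorem exists_eq_theta_mul {q : ℂ} (hq : ‖q‖ < 1) (hq0 : q ≠ 0) {φ : ℂ → ℂ}
    (hφ : ∀ u ≠ 0, DifferentiableAt ℂ φ u) {c : ℂ} (hc : c ≠ 0)
    (h0 : ∀ u ≠ 0, theta (c * u) q = 0 → φ u = 0) :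
    ∃ g : ℂ → ℂ, (∀ u ≠ 0, DifferentiableAt ℂ g u) ∧ ∀ u ≠ 0, φ u = theta (c * u) q * g u := by
  classical
  set D : ℂ → ℂ := fun u => theta (c * u) q with hD
  have hDd : ∀ u ≠ 0, DifferentiableAt ℂ D u := fun u hu =>
    (differentiableAt_id.const_mul c).theta hq (mul_ne_zero hc hu)
  -- At a simple zero of the denominator the quotient extends by the quotient of derivatives, and
  -- nearby it is the quotient of two divided differences.
  refine ⟨fun u => if D u = 0 then deriv φ u / deriv D u else φ u / D u, fun u hu => ?_,
    fun u hu => ?_⟩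
  · by_cases hDu : D u = 0
    · obtain ⟨n, hn⟩ := (theta_eq_zero_iff_zpow hq hq0 (mul_ne_zero hc hu)).1 hDu
      have hdD : deriv D u ≠ 0 := by
        have h1 := (differentiableAt_theta hq (x := c * u) (mul_ne_zero hc hu)).hasDerivAt
        have h2 : HasDerivAt D _ u := h1.comp u ((hasDerivAt_id u).const_mul c)
        rw [h2.deriv, hn]
        exact mul_ne_zero (deriv_theta_ne_zero hq hq0 n) (by simpa using hc)
      have hs : {u : ℂ | u ≠ 0} ∈ 𝓝 u := isOpen_ne.mem_nhds hu
      have d1 : DifferentiableAt ℂ (dslope φ u) u :=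
        ((Complex.differentiableOn_dslope hs).2 fun w hw =>
          (hφ w hw).differentiableWithinAt).differentiableAt hs
      have d2 : DifferentiableAt ℂ (dslope D u) u :=
        ((Complex.differentiableOn_dslope hs).2 fun w hw =>
          (hDd w hw).differentiableWithinAt).differentiableAt hs
      have hne : dslope D u u ≠ 0 := by rwa [dslope_same]
      refine (d1.div d2 hne).congr_of_eventuallyEq ?_
      filter_upwards [d2.continuousAt.eventually_ne hne] with w hw
      simp only [Pi.div_apply]
      by_cases hwu : w = u
      · subst hwu
        rw [if_pos hDu, dslope_same, dslope_same]
      · have e1 : D w = (w - u) * dslope D u w := by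
          have := sub_smul_dslope D u w
          rw [hDu, sub_zero, smul_eq_mul] at this
          exact this.symm
        have e2 : φ w = (w - u) * dslope φ u w := by
          have := sub_smul_dslope φ u w
          rw [h0 u hu hDu, sub_zero, smul_eq_mul] at this
          exact this.symm
        have hwu' : w - u ≠ 0 := sub_ne_zero.2 hwu
        rw [if_neg (by rw [e1]; exact mul_ne_zero hwu' hw), e1, e2, mul_div_mul_left _ _ hwu']
    · refine ((hφ u hu).div (hDd u hu) hDu).congr_of_eventuallyEq ?_
      filter_upwards [(hDd u hu).continuousAt.eventually_ne hDu] with w hw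
      rw [if_neg hw]; rfl
  · simp only
    split_ifs with h
    · rw [h0 u hu h]
      simp only [hD] at h
      rw [h, zero_mul]
    · rw [mul_div_cancel₀]
      exact h

/-- As functions of u both sides have the same multiplier under u → uq. The left side vanishes at u
= 1/(bz) and u = z/b, hence at all zeros of θ(buz)θ(bu/z). The quotient is holomorphic and
q-periodic, therefore constant, and its value is found at u = z. -/
theorem theta_addition {q : ℂ} (hq : ‖q‖ < 1) (hq0 : q ≠ 0) {b u z : ℂ} (hb0 : b ≠ 0) (hu0 : u ≠ 0)
    (hz0 : z ≠ 0) (hb : theta b q ≠ 0) (hz : theta (z ^ 2) q ≠ 0) (hbz : theta (b * z ^ 2) q ≠ 0) :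
    theta b q * (theta (b ^ 2 * u * z) q * theta (u / z) q * theta (b / z ^ 2) q -
      (z ^ 2)⁻¹ * (theta (b ^ 2 * u / z) q * theta (u * z) q * theta (b * z ^ 2) q)) =
    theta (b ^ 2) q * theta (b * u * z) q * theta (b * u / z) q * theta (z ^ 2)⁻¹ q := by
  set φ : ℂ → ℂ := fun u => theta b q * (theta (b ^ 2 * u * z) q * theta (u / z) q *
    theta (b / z ^ 2) q - (z ^ 2)⁻¹ * (theta (b ^ 2 * u / z) q * theta (u * z) q *
    theta (b * z ^ 2) q)) with hφ
  have hφd : ∀ u ≠ 0, DifferentiableAt ℂ φ u := by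
    intro u hu
    have e1 := DifferentiableAt.theta (f := fun u => b ^ 2 * u * z) (x := u) (by fun_prop) hq
      (by positivity)
    have e2 := DifferentiableAt.theta (f := fun u => u / z) (x := u) (by fun_prop) hq
      (by positivity)
    have e3 := DifferentiableAt.theta (f := fun u => b ^ 2 * u / z) (x := u) (by fun_prop) hq
      (by positivity)
    have e4 := DifferentiableAt.theta (f := fun u => u * z) (x := u) (by fun_prop) hq
      (by positivity)
    fun_prop
  have hper : ∀ u ≠ 0, φ (u * q) = (b ^ 2 * u ^ 2)⁻¹ * φ u := by
    intro u hu
    simp only [hφ]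
    rw [show b ^ 2 * (u * q) * z = b ^ 2 * u * z * q by ring, theta_mul hq hq0 (by positivity),
      show u * q / z = u / z * q by ring, theta_mul hq hq0 (by positivity),
      show b ^ 2 * (u * q) / z = b ^ 2 * u / z * q by ring, theta_mul hq hq0 (by positivity),
      show u * q * z = u * z * q by ring, theta_mul hq hq0 (by positivity)]
    field_simp
  have hzero : ∀ v ≠ 0, φ v = 0 → ∀ n : ℤ, φ (v * q ^ n) = 0 := by
    intro v hv h n
    induction n using Int.induction_on with
    | zero => simpa using h
    | succ n ih =>
      rw [zpow_add_one₀ hq0, ← mul_assoc, hper _ (mul_ne_zero hv (zpow_ne_zero _ hq0)), ih, mul_zero]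
    | pred n ih =>
      have hv' : v * q ^ (-(n : ℤ) - 1) ≠ 0 := mul_ne_zero hv (zpow_ne_zero _ hq0)
      have := hper _ hv'
      rw [mul_assoc, ← zpow_add_one₀ hq0, sub_add_cancel, ih] at this
      have h2 : (b ^ 2 * (v * q ^ (-(n : ℤ) - 1)) ^ 2)⁻¹ ≠ 0 := by positivity
      exact (mul_eq_zero.1 this.symm).resolve_left h2
  have i1 : theta b⁻¹ q = -b⁻¹ * theta b q := theta_inv hq hb0
  have i2 : theta (b * z ^ 2)⁻¹ q = -(b * z ^ 2)⁻¹ * theta (b * z ^ 2) q :=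
    theta_inv hq (by positivity)
  have i3 : theta (z ^ 2 / b) q = -(z ^ 2 / b) * theta (b / z ^ 2) q := by
    have := theta_inv hq (x := b / z ^ 2) (by positivity)
    rwa [inv_div] at this
  have i4 : theta (z ^ 2)⁻¹ q = -(z ^ 2)⁻¹ * theta (z ^ 2) q := theta_inv hq (by positivity)
  have z1 : φ (b * z)⁻¹ = 0 := by
    simp only [hφ]
    rw [show b ^ 2 * (b * z)⁻¹ * z = b by field_simp,
      show (b * z)⁻¹ / z = (b * z ^ 2)⁻¹ by field_simp,
      show b ^ 2 * (b * z)⁻¹ / z = b / z ^ 2 by field_simp,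
      show (b * z)⁻¹ * z = b⁻¹ by field_simp, i1, i2]
    field_simp
    ring
  have z2 : φ (z / b) = 0 := by
    simp only [hφ]
    rw [show b ^ 2 * (z / b) * z = b * z ^ 2 by field_simp,
      show z / b / z = b⁻¹ by field_simp,
      show b ^ 2 * (z / b) / z = b by field_simp,
      show z / b * z = z ^ 2 / b by field_simp, i1, i3]
    field_simp
    ring
  obtain ⟨g₁, hg₁, hφ₁⟩ := exists_eq_theta_mul hq hq0 hφd (c := b * z) (by positivity) (by
    intro u hu h
    obtain ⟨n, hn⟩ := (theta_eq_zero_iff_zpow hq hq0 (by positivity)).1 h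
    have : u = (b * z)⁻¹ * q ^ n := by rw [← hn]; field_simp
    rw [this]
    exact hzero _ (by positivity) z1 n)
  -- The second division requires that the zeros of the two theta functions be disjoint. A common
  -- zero would make z² a power of q, which `hz` excludes.
  obtain ⟨g, hg, hφ₂⟩ := exists_eq_theta_mul hq hq0 hg₁ (c := b / z) (by positivity) (by
    intro u hu h
    obtain ⟨n, hn⟩ := (theta_eq_zero_iff_zpow hq hq0 (by positivity)).1 h
    have e : u = z / b * q ^ n := by rw [← hn]; field_simp
    have h1 : φ u = 0 := by rw [e]; exact hzero _ (by positivity) z2 n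
    rw [hφ₁ u hu] at h1
    refine (mul_eq_zero.1 h1).resolve_left fun h2 => hz ?_
    obtain ⟨m, hm⟩ := (theta_eq_zero_iff_zpow hq hq0 (by positivity)).1 h2
    refine (theta_eq_zero_iff_zpow hq hq0 (by positivity)).2 ⟨m - n, ?_⟩
    rw [zpow_sub₀ hq0, ← hm, ← hn]
    field_simp)
  have hall : ∀ u ≠ 0, φ u = theta (b * z * u) q * theta (b / z * u) q * g u := by
    intro u hu
    rw [hφ₁ u hu, hφ₂ u hu]; ring
  have hgper : ∀ u ≠ 0, g (u * q) = g u := by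
    -- Periodicity of the quotient follows at once away from the zeros. These are countable, so
    -- continuity gives it everywhere.
    have hcount : ({u : ℂ | u ≠ 0 ∧ theta (b * z * u) q = 0} ∪
        {u : ℂ | u ≠ 0 ∧ theta (b / z * u) q = 0}).Countable := by
      refine Countable.union ?_ ?_
      · refine (countable_range fun n : ℤ => (b * z)⁻¹ * q ^ n).mono ?_
        rintro u ⟨hu, h⟩
        obtain ⟨n, hn⟩ := (theta_eq_zero_iff_zpow hq hq0 (by positivity)).1 h
        exact ⟨n, by simp only [← hn]; field_simp⟩
      · refine (countable_range fun n : ℤ => z / b * q ^ n).mono ?_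
        rintro u ⟨hu, h⟩
        obtain ⟨n, hn⟩ := (theta_eq_zero_iff_zpow hq hq0 (by positivity)).1 h
        exact ⟨n, by simp only [← hn]; field_simp⟩
    intro u hu
    have hc1 : ContinuousAt (fun u => g (u * q) - g u) u := by
      have : ContinuousAt (fun u => g (u * q)) u :=
        ContinuousAt.comp (f := fun u => u * q) (hg _ (mul_ne_zero hu hq0)).continuousAt
          (by fun_prop)
      exact this.sub (hg u hu).continuousAt
    have hfreq : ∃ᶠ w in 𝓝 u, g (w * q) - g w = 0 := by
      have hd := (hcount.dense_compl (𝕜 := ℂ)) u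
      refine (mem_closure_iff_frequently.1 hd).mp ?_
      filter_upwards [isOpen_ne.mem_nhds hu] with w hw0 hw
      simp only [mem_compl_iff, mem_union, mem_ofPred_eq, not_or, not_and] at hw
      have h1 := hw.1 hw0
      have h2 := hw.2 hw0
      have e := hper w hw0
      rw [hall _ (mul_ne_zero hw0 hq0), hall w hw0, ← mul_assoc, ← mul_assoc,
        theta_mul hq hq0 (by positivity), theta_mul hq hq0 (by positivity)] at e
      have h3 : (b ^ 2 * w ^ 2)⁻¹ * theta (b * z * w) q * theta (b / z * w) q ≠ 0 := by positivity
      rw [sub_eq_zero]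
      refine mul_left_cancel₀ h3 ?_
      refine Eq.trans ?_ (e.trans ?_)
      · field_simp
      · ring
    by_contra hne
    have := hc1.eventually_ne (sub_ne_zero.2 hne)
    exact hfreq (this.mono fun w hw => hw)
  -- At u = z the first term disappears because θ(1;q) = 0.
  have hval : φ z = theta (b ^ 2) q * theta (b * z ^ 2) q * theta b q * theta (z ^ 2)⁻¹ q := by
    simp only [hφ]
    rw [show z / z = 1 by field_simp, theta_one hq, show b ^ 2 * z / z = b ^ 2 by field_simp,
      show z * z = z ^ 2 by ring, i4]
    ring
  have hgz : g z = theta (b ^ 2) q * theta (z ^ 2)⁻¹ q := by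
    rw [hall z hz0, show b * z * z = b * z ^ 2 by ring, show b / z * z = b by field_simp] at hval
    refine mul_left_cancel₀ (mul_ne_zero hbz hb) ?_
    rw [hval]; ring
  have := hall u hu0
  rw [eq_of_mul_periodic hq hq0 hg hgper hu0 hz0, hgz] at this
  change φ u = _
  rw [this, show b * z * u = b * u * z by ring, show b / z * u = b * u / z by ring]
  ring

end EllipticBeta

namespace EllipticBeta

/-! ## The integrand before and after breaking its symmetry -/

section Integrand

noncomputable section

/-- The integrand of the beta integral at `params b t p q`, with `1 / Γ(z^{±2})` expressed by theta
functions and the factors of the eight roots combined. -/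
def symIntegrand (b : ℂ) (t : Fin 4 → ℂ) (p q z : ℂ) : ℂ :=
  theta (z ^ 2) p * theta (z ^ 2)⁻¹ q *
    (∏ r, (pqPoch (p * q / (t r * z)) p q * pqPoch (p * q * z / t r) p q *
        pqPoch (b * t r * z) p q * pqPoch (b * t r / z) p q /
      (pqPoch (t r * z) p q * pqPoch (t r / z) p q * pqPoch (p * q * z / (b * t r)) p q *
        pqPoch (p * q / (b * t r * z)) p q))) *
    (pqPoch (p * q / (b * z ^ 2)) p q * pqPoch (p * q * z ^ 2 / b) p q /
      (pqPoch (b * z ^ 2) p q * pqPoch (b / z ^ 2) p q))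

variable (k : Fin 4 → Fin 4 → ℂ) (b : ℂ) (t : Fin 4 → ℂ) (q ζ : ℂ)

/-- The numerator of the integrand of the symmetry-broken integral, without the factor
`(b t_0 k_{10} / ζ; p, q)`. The scales `k` are the powers of `p = k 3 0` that multiply
the parameters. -/
def numCore : ℂ :=
  theta (b ^ 2 * t 0 * ζ) q * pqPoch (k 3 0 * b * t 0 * ζ) (k 3 0) q *
    pqPoch (k 3 0 * q / (t 0 * ζ)) (k 3 0) q * pqPoch (k 2 0 * q * ζ / t 0) (k 3 0) q *
    pqPoch (k 2 0 * q * ζ ^ 2 / b) (k 3 0) q * pqPoch (q * k 1 0 / (b * ζ ^ 2)) (k 3 0) q *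
    qPoch (k 1 0 / ζ ^ 2) (k 3 0) * qPoch (k 2 0 * ζ ^ 2) (k 3 0) *
    ∏ r : Fin 3, (pqPoch (q * k 3 r.succ / (t r.succ * ζ)) (k 3 0) q *
      pqPoch (q * k 2 r.succ * ζ / t r.succ) (k 3 0) q *
      pqPoch (b * t r.succ * k 1 r.succ / ζ) (k 3 0) q *
      pqPoch (b * t r.succ * k 0 r.succ * ζ) (k 3 0) q)

/-- The factors of the denominator with zeros near the origin, without `(t_0 k_{10} / ζ; p, q)`. -/
def denInCore : ℂ :=
  pqPoch (q / (b * t 0 * ζ)) (k 3 0) q * pqPoch (b * k 1 0 / ζ ^ 2) (k 3 0) q *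
    ∏ r : Fin 3, (pqPoch (t r.succ * k 1 r.succ / ζ) (k 3 0) q *
      pqPoch (q * k 3 r.succ / (b * t r.succ * ζ)) (k 3 0) q)

/-- The factors of the denominator with zeros near infinity, without `(t_0 ζ; p, q)`. -/
def denOutCore : ℂ :=
  pqPoch (k 2 0 * q * ζ / (b * t 0)) (k 3 0) q * pqPoch (b * k 2 0 * ζ ^ 2) (k 3 0) q *
    ∏ r : Fin 3, (pqPoch (t r.succ * k 0 r.succ * ζ) (k 3 0) q *
      pqPoch (q * k 2 r.succ * ζ / (b * t r.succ)) (k 3 0) q)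

def num : ℂ := numCore k b t q ζ * pqPoch (b * t 0 * k 1 0 / ζ) (k 3 0) q

def denIn : ℂ := denInCore k b t q ζ * pqPoch (t 0 * k 1 0 / ζ) (k 3 0) q

def denOut : ℂ := denOutCore k b t q ζ * pqPoch (k 3 0 * t 0 * ζ) (k 3 0) q

/-- The integrand of the symmetry-broken integral. -/
def kernel : ℂ := num k b t q ζ / (denIn k b t q ζ * (qPoch (t 0 * ζ) q * denOut k b t q ζ))

/-- The contribution of the parameters `t_r, t_s` (`1 ≤ r < s`) to the prefactor. -/
def crossFactor (r s : Fin 4) : ℂ :=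
  pqPoch (t r * t s * (k 0 r * k 1 s)) (k 3 0) q *
    pqPoch (q * t r * (k 0 r * k 3 s) / (b * t s)) (k 3 0) q *
    pqPoch (q * t s * (k 0 s * k 3 r) / (b * t r)) (k 3 0) q *
    pqPoch (q ^ 2 * (k 2 r * k 3 s) / (b ^ 2 * t r * t s)) (k 3 0) q

/-- The contribution of the roots `±√b, …` to the prefactor, without the factors of order
`p ^ 0`. -/
def rootFactor (b p q : ℂ) : ℂ :=
  pqPoch (-b * p) p q ^ 2 * pqPoch (-b * p * q) p q ^ 2 *
    pqPoch (b ^ 2 * p ^ 2 * q) (p ^ 2) (q ^ 2) ^ 4 * pqPoch (b ^ 2 * p) (p ^ 2) (q ^ 2) ^ 2 *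
    pqPoch (b ^ 2 * p * q) (p ^ 2) (q ^ 2) ^ 4 * pqPoch (b ^ 2 * p * q ^ 2) (p ^ 2) (q ^ 2) ^ 2

/-- The prefactor, without the factors that cancel against the denominator in residues. -/
def prefCore : ℂ :=
  (∏ s : Fin 3, (pqPoch (q * t s.succ * (k 3 0 * k 0 s.succ) / (b * t 0)) (k 3 0) q *
      pqPoch (q ^ 2 * (k 3 0 * k 2 s.succ) / (b ^ 2 * t 0 * t s.succ)) (k 3 0) q)) *
    (crossFactor k b t q 1 2 * crossFactor k b t q 1 3 * crossFactor k b t q 2 3) *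
    pqPoch (k 3 0 * q / b) (k 3 0) q ^ 3 * (qPoch (k 3 0) (k 3 0) * qPoch q q) *
    rootFactor b (k 3 0) q *
    (qPoch (-q * b) q * qPoch (q * b ^ 2) (q ^ 2) / qPoch (q / b ^ 2) q)

/-- The prefactor of the symmetry-broken integral. -/
def pref : ℂ :=
  prefCore k b t q * pqPoch (q / b) (k 3 0) q *
    ∏ s : Fin 3, (pqPoch (t 0 * t s.succ * k 1 s.succ) (k 3 0) q *
      pqPoch (q * t 0 * k 3 s.succ / (b * t s.succ)) (k 3 0) q)

/-- The scales when the parameters already contain the powers of `p`. -/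
def unitScale (p : ℂ) : Fin 4 → Fin 4 → ℂ :=
  ![fun _ => 1, ![p, 1, 1, 1], ![1, p, p, p], fun _ => p]

/-- The scales for the parameters `t_r p^{τ_r}`, `p = exp w`, after the substitution
`z = p^{-τ_0} ζ`. -/
def powScale (τ : Fin 4 → ℝ) (w : ℂ) : Fin 4 → Fin 4 → ℂ :=
  ![fun r => Complex.exp ((τ r - τ 0) * w),
    fun r => if r = 0 then Complex.exp ((1 + 2 * τ 0) * w) else Complex.exp ((τ r + τ 0) * w),
    fun r => if r = 0 then Complex.exp (-(2 * τ 0) * w)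
      else Complex.exp ((1 - τ r - τ 0) * w),
    fun r => Complex.exp ((1 - τ r + τ 0) * w)]

end

/-- Applied with m = n = 8, this splits the pairs of parameters into pairs within the first eight,
mixed pairs, and pairs of roots. -/
theorem prod_Ioi_add {m n : ℕ} (F : Fin (m + n) → Fin (m + n) → ℂ) :
    ∏ r, ∏ s ∈ Finset.Ioi r, F r s =
      (∏ r, ∏ s ∈ Finset.Ioi r, F (Fin.castAdd n r) (Fin.castAdd n s)) *
      (∏ r, ∏ s, F (Fin.castAdd n r) (Fin.natAdd m s)) *
      (∏ r, ∏ s ∈ Finset.Ioi r, F (Fin.natAdd m r) (Fin.natAdd m s)) := by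
  have e := fun r => Finset.prod_ite_mem Finset.univ (Finset.Ioi r) (F r)
  have e1 := fun r => Finset.prod_ite_mem Finset.univ (Finset.Ioi r)
    (fun s => F (Fin.castAdd n r) (Fin.castAdd n s))
  have e2 := fun r => Finset.prod_ite_mem Finset.univ (Finset.Ioi r)
    (fun s => F (Fin.natAdd m r) (Fin.natAdd m s))
  simp only [Finset.univ_inter, Finset.mem_Ioi] at e e1 e2
  simp only [← e, ← e1, ← e2]
  have l1 : ∀ i j, ¬ (Fin.natAdd m i : Fin (m + n)) < Fin.castAdd n j := fun i j h => by
    simp [Fin.lt_def] at h; omega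
  have l2 : ∀ i j, (Fin.castAdd n i : Fin (m + n)) < Fin.natAdd m j := fun i j => by
    simp [Fin.lt_def]; omega
  have l3 : ∀ i j, (Fin.castAdd n i : Fin (m + n)) < Fin.castAdd n j ↔ i < j := fun _ _ => Iff.rfl
  simp [Fin.prod_univ_add, Finset.prod_mul_distrib, l1, l2, l3, mul_assoc]

/-- The product of a function over the eight roots. -/
theorem prod_roots {b p q : ℂ} (G H : ℂ → ℂ) (hG : ∀ x, G x * G (-x) = H (x ^ 2)) :
    G (b ^ (1 / 2 : ℂ)) * G (-b ^ (1 / 2 : ℂ)) * (G ((b * q) ^ (1 / 2 : ℂ)) *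
      G (-(b * q) ^ (1 / 2 : ℂ))) * (G ((b * p) ^ (1 / 2 : ℂ)) * G (-(b * p) ^ (1 / 2 : ℂ))) *
      (G ((b * p * q) ^ (1 / 2 : ℂ)) * G (-(b * p * q) ^ (1 / 2 : ℂ))) =
    H b * H (b * q) * H (b * p) * H (b * p * q) := by
  have hs : ∀ x : ℂ, (x ^ (1 / 2 : ℂ)) ^ 2 = x := fun x => by
    simp
  simp only [hG, hs]

theorem prod_left_pairs {b : ℂ} {t : Fin 4 → ℂ} {p q : ℂ} (hb : b ≠ 0) (ht : ∀ r, t r ≠ 0) :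
    (∏ r : Fin 8, ∏ s ∈ Finset.Ioi r,
      pqPoch (params b t p q (Fin.castAdd 8 r) * params b t p q (Fin.castAdd 8 s)) p q) =
    (∏ s : Fin 3, (pqPoch (q * t s.succ * p / (b * t 0)) p q *
      pqPoch (q ^ 2 * (p * p) / (b ^ 2 * t 0 * t s.succ)) p q)) *
    (crossFactor (unitScale p) b t q 1 2 * crossFactor (unitScale p) b t q 1 3 *
      crossFactor (unitScale p) b t q 2 3) *
    pqPoch (p * q / b) p q ^ 4 * ∏ s : Fin 3, (pqPoch (t 0 * t s.succ) p q *
      pqPoch (q * t 0 * p / (b * t s.succ)) p q) := by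
  -- The two parameters belonging to the same index multiply to pq/b. This happens four times and
  -- explains the fourth power.
  have d : ∀ r, t r * (p * q / (b * t r)) = p * q / b := fun r => by
    have := ht r
    field_simp
  simp only [params, Fin.prod_univ_succ, Fin.prod_Ioi_zero, Fin.prod_Ioi_succ, crossFactor,
    unitScale]
  simp
  rw [d 0, d 1, d 2, d 3]
  ring_nf

/-- A pair of opposite roots gives a factor with squared nomes, and the four such factors are the
four parity classes of (b y²;p,q). -/
theorem prod_mul_roots {p q : ℂ} (hp : ‖p‖ < 1) (hq : ‖q‖ < 1) (b : ℂ) (t : Fin 4 → ℂ) (y : ℂ) :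
    ∏ s : Fin 8, pqPoch (y * params b t p q (Fin.natAdd 8 s)) p q = pqPoch (b * y ^ 2) p q := by
  have := prod_roots (b := b) (p := p) (q := q) (fun x => pqPoch (y * x) p q)
    (fun x => pqPoch (y ^ 2 * x) (p ^ 2) (q ^ 2)) fun x => by
      rw [mul_neg, pqPoch_mul_neg hp hq, mul_pow]
  rw [pqPoch_even_odd hp hq (b * y ^ 2)]
  simp only [params, Fin.prod_univ_succ]
  simp at this ⊢
  rw [show b * y ^ 2 * q = y ^ 2 * (b * q) by ring, show b * y ^ 2 * p = y ^ 2 * (b * p) by ring,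
    show y ^ 2 * (b * p) * q = y ^ 2 * (b * p * q) by ring, mul_comm b (y ^ 2)]
  linear_combination this

/-- The mixed pairs reproduce exactly the denominator in the definition of E, which therefore only
removes them from the renormalising product. -/
theorem prod_left_mul_roots {b : ℂ} {t : Fin 4 → ℂ} {p q : ℂ} (hp : ‖p‖ < 1) (hq : ‖q‖ < 1)
    (hb : b ≠ 0) (ht : ∀ r, t r ≠ 0) :
    (∏ r : Fin 8, ∏ s : Fin 8,
      pqPoch (params b t p q (Fin.castAdd 8 r) * params b t p q (Fin.natAdd 8 s)) p q) =
      denom b t p q := by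
  have d2 : ∀ r, b * (p * q / (b * t r)) ^ 2 = p ^ 2 * q ^ 2 / (b * t r ^ 2) := fun r => by
    have := ht r
    field_simp
  simp_rw [prod_mul_roots hp hq]
  simp only [params, Fin.prod_univ_succ, denom]
  simp [d2]
  ring

/-- Opposite roots of x contribute -x. Roots of two different numbers x, y produce √x√y and -√x√y
twice each, hence the square of (xy;p²,q²). The exponent of b²pq is doubled once more, since it
arises from b, bpq and from bq, bp. -/
theorem prod_root_pairs {p q : ℂ} (hp : ‖p‖ < 1) (hq : ‖q‖ < 1) (b : ℂ) (t : Fin 4 → ℂ) :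
    (∏ r : Fin 8, ∏ s ∈ Finset.Ioi r,
      pqPoch (params b t p q (Fin.natAdd 8 r) * params b t p q (Fin.natAdd 8 s)) p q) =
      pqPoch (-b) p q * pqPoch (-b * q) p q * pqPoch (-b * p) p q * pqPoch (-b * p * q) p q *
      (pqPoch (b ^ 2 * q) (p ^ 2) (q ^ 2) * pqPoch (b ^ 2 * p) (p ^ 2) (q ^ 2) *
       pqPoch (b ^ 2 * p * q) (p ^ 2) (q ^ 2) ^ 2 * pqPoch (b ^ 2 * p * q ^ 2) (p ^ 2) (q ^ 2) *
       pqPoch (b ^ 2 * p ^ 2 * q) (p ^ 2) (q ^ 2)) ^ 2 := by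
  have hs : ∀ x : ℂ, (x ^ (1 / 2 : ℂ)) ^ 2 = x := fun x => by simp
  have hs' : ∀ x : ℂ, x ^ (1 / 2 : ℂ) * x ^ (1 / 2 : ℂ) = x := fun x => by rw [← sq, hs]
  have hc : ∀ x y : ℂ, pqPoch (x ^ (1 / 2 : ℂ) * y ^ (1 / 2 : ℂ)) p q *
      pqPoch (-(x ^ (1 / 2 : ℂ) * y ^ (1 / 2 : ℂ))) p q = pqPoch (x * y) (p ^ 2) (q ^ 2) :=
    fun x y => by rw [pqPoch_mul_neg hp hq, mul_pow, hs, hs]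
  rw [show b ^ 2 * q = b * (b * q) by ring, show b ^ 2 * p = b * (b * p) by ring, sq (pqPoch (b * (b * p) * q) _ _)]
  nth_rw 1 [show b * (b * p) * q = b * (b * p * q) by ring]
  rw [show b * (b * p) * q = (b * q) * (b * p) by ring,
    show b * (b * p) * q ^ 2 = (b * q) * (b * p * q) by ring,
    show b ^ 2 * p ^ 2 * q = (b * p) * (b * p * q) by ring]
  simp only [← hc]
  simp only [params, Fin.prod_univ_succ, Fin.prod_Ioi_zero, Fin.prod_Ioi_succ]
  simp [-one_div, hs']
  ring

/-- Everything follows from (b²;q) = (b²;q²)(b²q;q²) and (b²;q²) = (b;q)(-b;q). The identity absorbs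
the ratio θ(b;q)/θ(b²;q) created by the symmetrization into the root factors, at the price of the
denominator (q/b²;q). -/
theorem theta_mul_root_factors {p q : ℂ} (hp : ‖p‖ < 1) (hq : ‖q‖ < 1) (b : ℂ) :
    theta b q * (pqPoch (-b) p q * pqPoch (-b * q) p q *
      pqPoch (b ^ 2 * q) (p ^ 2) (q ^ 2) ^ 2) * qPoch (q / b ^ 2) q =
    theta (b ^ 2) q * qPoch (q / b) q * qPoch (-q * b) q * qPoch (q * b ^ 2) (q ^ 2) *
      (pqPoch (-b * p) p q * pqPoch (-b * p * q) p q *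
        pqPoch (b ^ 2 * p ^ 2 * q) (p ^ 2) (q ^ 2) ^ 2) := by
  rw [pqPoch_succ_left hp hq (-b), pqPoch_succ_left hp hq (-b * q),
    pqPoch_succ_left (norm_sq_lt_one hp) (norm_sq_lt_one hq) (b ^ 2 * q), theta, theta,
    qPoch_even_odd hq (b ^ 2), ← qPoch_mul_neg hq b, show -b * q * p = -b * p * q by ring,
    show b ^ 2 * q * p ^ 2 = b ^ 2 * p ^ 2 * q by ring, show -q * b = -b * q by ring,
    mul_comm q (b ^ 2)]
  ring

theorem pairs_mul_theta {b : ℂ} {t : Fin 4 → ℂ} {p q : ℂ} (hp : ‖p‖ < 1) (hq : ‖q‖ < 1)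
    (hb : b ≠ 0) (ht : ∀ r, t r ≠ 0) (h2 : qPoch (q / b ^ 2) q ≠ 0) :
    (∏ r, ∏ s ∈ Finset.Ioi r, pqPoch (params b t p q r * params b t p q s) p q) *
      (qPoch p p * qPoch q q) * theta b q =
    denom b t p q * pref (unitScale p) b t q * theta (b ^ 2) q := by
  have r2 : pqPoch (q / b) p q = qPoch (q / b) q * pqPoch (p * q / b) p q := by
    rw [pqPoch_succ_left hp hq]
    ring_nf
  have r1 := theta_mul_root_factors hp hq b
  rw [prod_Ioi_add (m := 8) (n := 8) (fun r s => pqPoch (params b t p q r * params b t p q s) p q),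
    prod_left_pairs hb ht, prod_left_mul_roots hp hq hb ht, prod_root_pairs hp hq, pref, prefCore,
    rootFactor, show unitScale p 3 0 = p from rfl, r2]
  simp only [show ∀ s : Fin 3, unitScale p 0 s.succ = 1 from fun s => rfl,
    show ∀ s : Fin 3, unitScale p 1 s.succ = 1 from fun s => by fin_cases s <;> rfl,
    show ∀ s : Fin 3, unitScale p 2 s.succ = p from fun s => by fin_cases s <;> rfl,
    show ∀ s : Fin 3, unitScale p 3 s.succ = p from fun s => rfl, mul_one]
  have h := congrArg (· * ((∏ s : Fin 3, (pqPoch (q * t s.succ * p / (b * t 0)) p q *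
      pqPoch (q ^ 2 * (p * p) / (b ^ 2 * t 0 * t s.succ)) p q)) *
    (∏ s : Fin 3, (pqPoch (t 0 * t s.succ) p q * pqPoch (q * t 0 * p / (b * t s.succ)) p q)) *
    (crossFactor (unitScale p) b t q 1 2 * crossFactor (unitScale p) b t q 1 3 *
      crossFactor (unitScale p) b t q 2 3) * denom b t p q * (qPoch p p * qPoch q q) *
    pqPoch (p * q / b) p q ^ 4 * (pqPoch (-b * p) p q * pqPoch (-b * p * q) p q *
      (pqPoch (b ^ 2 * p) (p ^ 2) (q ^ 2) *
       pqPoch (b ^ 2 * p * q) (p ^ 2) (q ^ 2) ^ 2 * pqPoch (b ^ 2 * p * q ^ 2) (p ^ 2) (q ^ 2) *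
       pqPoch (b ^ 2 * p ^ 2 * q) (p ^ 2) (q ^ 2)) ^ 2))) r1
  apply mul_right_cancel₀ h2
  have e (A B C D E F : ℂ) : A * (B * (C / qPoch (q / b ^ 2) q) * D * E) * F *
    qPoch (q / b ^ 2) q = A * B * C * D * E * F := by field_simp
  rw [e]
  exact Eq.trans (by ring) (h.trans (by ring))

/-- This is the reflection identity for 1/(Γ(x)Γ(1/x)), stated without division. -/
theorem pqPoch_mul_pqPoch_inv {p q : ℂ} (hp : ‖p‖ < 1) (hq : ‖q‖ < 1) (x : ℂ) :
    pqPoch x p q * pqPoch x⁻¹ p q =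
      theta x p * theta x⁻¹ q * (pqPoch (p * q / x) p q * pqPoch (p * q * x) p q) := by
  rw [pqPoch_succ_right hp hq x, pqPoch_succ_left hp hq (x * q), pqPoch_succ_left hp hq x⁻¹,
    pqPoch_succ_right hp hq (x⁻¹ * p), theta, theta, div_inv_eq_mul, div_eq_mul_inv,
    div_eq_mul_inv, show x * q * p = p * q * x by ring, show x⁻¹ * p * q = p * q * x⁻¹ by ring,
    mul_comm x q, mul_comm x⁻¹ p]
  ring

theorem prod_ellGamma_roots {p q z : ℂ} (hp : ‖p‖ < 1) (hq : ‖q‖ < 1) (hp0 : p ≠ 0) (hq0 : q ≠ 0)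
    (hz : z ≠ 0) {b : ℂ} (hb : b ≠ 0) (t : Fin 4 → ℂ) :
    ∏ s : Fin 8, (ellGamma (params b t p q (Fin.natAdd 8 s) * z) p q *
      ellGamma (params b t p q (Fin.natAdd 8 s) / z) p q) =
    pqPoch (p * q / (b * z ^ 2)) p q * pqPoch (p * q * z ^ 2 / b) p q /
      (pqPoch (b * z ^ 2) p q * pqPoch (b / z ^ 2) p q) := by
  have := prod_roots (b := b) (p := p) (q := q) (fun x => ellGamma (x * z) p q * ellGamma (x / z) p q)
    (fun y => pqPoch ((p * q) ^ 2 / (y * z ^ 2)) (p ^ 2) (q ^ 2) *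
        pqPoch ((p * q) ^ 2 / (y / z ^ 2)) (p ^ 2) (q ^ 2) /
        (pqPoch (y * z ^ 2) (p ^ 2) (q ^ 2) * pqPoch (y / z ^ 2) (p ^ 2) (q ^ 2))) fun x => by
      simp only [ellGamma]
      rw [neg_mul, neg_div, div_neg, div_neg, ← mul_pow, ← div_pow, ← div_pow, ← div_pow]
      simp only [← pqPoch_mul_neg hp hq]
      field_simp
  refine Eq.trans (Eq.trans ?_ this) ?_
  · simp only [params, Fin.prod_univ_succ]
    simp
    ring
  rw [pqPoch_even_odd hp hq (p * q / (b * z ^ 2)), pqPoch_even_odd hp hq (p * q * z ^ 2 / b),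
    pqPoch_even_odd hp hq (b * z ^ 2), pqPoch_even_odd hp hq (b / z ^ 2)]
  have e1 : ∀ c, b * c * z ^ 2 = b * z ^ 2 * c := fun c => by ring
  have e2 : ∀ c, b * c / z ^ 2 = b / z ^ 2 * c := fun c => by ring
  rw [show (p * q) ^ 2 / (b * z ^ 2) = p * q / (b * z ^ 2) * p * q by ring,
    show (p * q) ^ 2 / (b * q * z ^ 2) = p * q / (b * z ^ 2) * p by field_simp,
    show (p * q) ^ 2 / (b * p * z ^ 2) = p * q / (b * z ^ 2) * q by field_simp,
    show (p * q) ^ 2 / (b * p * q * z ^ 2) = p * q / (b * z ^ 2) by field_simp,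
    show (p * q) ^ 2 / (b / z ^ 2) = p * q * z ^ 2 / b * p * q by field_simp,
    show (p * q) ^ 2 / (b * q / z ^ 2) = p * q * z ^ 2 / b * p by field_simp,
    show (p * q) ^ 2 / (b * p / z ^ 2) = p * q * z ^ 2 / b * q by field_simp,
    show (p * q) ^ 2 / (b * p * q / z ^ 2) = p * q * z ^ 2 / b by field_simp,
    show b * q * z ^ 2 = b * z ^ 2 * q by ring, show b * p * z ^ 2 = b * z ^ 2 * p by ring,
    show b * p * q * z ^ 2 = b * z ^ 2 * p * q by ring,
    show b * q / z ^ 2 = b / z ^ 2 * q by ring, show b * p / z ^ 2 = b / z ^ 2 * p by ring,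
    show b * p * q / z ^ 2 = b / z ^ 2 * p * q by ring]
  ring

theorem prod_ellGamma_left {p q z : ℂ} (hp0 : p ≠ 0) (hq0 : q ≠ 0)
    (hz : z ≠ 0) {b : ℂ} (hb : b ≠ 0) {t : Fin 4 → ℂ} (ht : ∀ r, t r ≠ 0) :
    ∏ s : Fin 8, (ellGamma (params b t p q (Fin.castAdd 8 s) * z) p q *
      ellGamma (params b t p q (Fin.castAdd 8 s) / z) p q) =
    ∏ r, (pqPoch (p * q / (t r * z)) p q * pqPoch (p * q * z / t r) p q *
        pqPoch (b * t r * z) p q * pqPoch (b * t r / z) p q /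
      (pqPoch (t r * z) p q * pqPoch (t r / z) p q * pqPoch (p * q * z / (b * t r)) p q *
        pqPoch (p * q / (b * t r * z)) p q)) := by
  have h : ∀ x, x ≠ 0 → ellGamma (x * z) p q * ellGamma (x / z) p q *
      (ellGamma (p * q / (b * x) * z) p q * ellGamma (p * q / (b * x) / z) p q) =
      (pqPoch (p * q / (x * z)) p q * pqPoch (p * q * z / x) p q *
        pqPoch (b * x * z) p q * pqPoch (b * x / z) p q /
      (pqPoch (x * z) p q * pqPoch (x / z) p q * pqPoch (p * q * z / (b * x)) p q *
        pqPoch (p * q / (b * x * z)) p q)) := fun x hx => by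
    simp only [ellGamma]
    rw [show p * q / (x / z) = p * q * z / x by field_simp,
      show p * q / (p * q / (b * x) * z) = b * x / z by field_simp,
      show p * q / (p * q / (b * x) / z) = b * x * z by field_simp,
      show p * q / (b * x) * z = p * q * z / (b * x) by ring,
      show p * q / (b * x) / z = p * q / (b * x * z) by field_simp]
    ring
  simp_rw [← h _ (ht _)]
  simp only [params, Fin.prod_univ_succ]
  simp
  ring

/-- The two non-vanishing hypotheses exclude the points where Γ(z²)Γ(z^{-2}) would be a zero divisor
in the quotient. They concern countably many z and do not affect integrals. -/
theorem prod_ellGamma_eq_symIntegrand {p q z : ℂ} (hp : ‖p‖ < 1) (hq : ‖q‖ < 1) (hp0 : p ≠ 0)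
    (hq0 : q ≠ 0) (hz : z ≠ 0) {b : ℂ} (hb : b ≠ 0) {t : Fin 4 → ℂ} (ht : ∀ r, t r ≠ 0)
    (h1 : pqPoch (p * q / z ^ 2) p q ≠ 0) (h2 : pqPoch (p * q * z ^ 2) p q ≠ 0) :
    (∏ r, (ellGamma (params b t p q r * z) p q * ellGamma (params b t p q r / z) p q)) /
        (ellGamma (z ^ 2) p q * ellGamma ((z ^ 2)⁻¹) p q) = symIntegrand b t p q z := by
  have e := Fin.prod_univ_add (a := 8) (b := 8) fun r =>
    ellGamma (params b t p q r * z) p q * ellGamma (params b t p q r / z) p q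
  have e2 : (ellGamma (z ^ 2) p q * ellGamma ((z ^ 2)⁻¹) p q)⁻¹ = theta (z ^ 2) p * theta (z ^ 2)⁻¹ q := by
    have := pqPoch_mul_pqPoch_inv hp hq (z ^ 2)
    rw [ellGamma, ellGamma, div_inv_eq_mul, ← mul_div_mul_comm, inv_div, this,
      mul_div_cancel_right₀ _ (mul_ne_zero h1 h2)]
  rw [prod_ellGamma_roots hp hq hp0 hq0 hz hb, prod_ellGamma_left hp0 hq0 hz hb ht] at e
  rw [div_eq_mul_inv, e2, symIntegrand, e]
  ring
end Integrand

end EllipticBeta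

namespace EllipticBeta

/-! ### Symmetrization of the kernel -/

section Symmetrization

/-- The two theta functions acquire the factors -z^{-2} and -z², which cancel. All other factors are
permuted. -/
theorem symIntegrand_inv {p q z : ℂ} (hp : ‖p‖ < 1) (hq : ‖q‖ < 1) (hz : z ≠ 0) (b : ℂ)
    (t : Fin 4 → ℂ) : symIntegrand b t p q z⁻¹ = symIntegrand b t p q z := by
  have hz2 : z ^ 2 ≠ 0 := pow_ne_zero 2 hz
  simp only [symIntegrand, inv_pow, inv_inv, div_inv_eq_mul]
  congr 1
  · congr 1
    · rw [theta_inv hp hz2, show theta (z ^ 2) q = -z ^ 2 * theta (z ^ 2)⁻¹ q by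
        rw [theta_inv hq hz2]; field_simp]
      field_simp
    · refine Finset.prod_congr rfl fun r _ => ?_
      simp only [← div_eq_mul_inv, div_div_eq_mul_div]
      rw [show p * q / z / t r = p * q / (t r * z) by ring,
        show p * q / z / (b * t r) = p * q / (b * t r * z) by ring]
      ring
  · rw [show p * q / (b * (z ^ 2)⁻¹) = p * q * z ^ 2 / b by field_simp,
      show p * q * (z ^ 2)⁻¹ / b = p * q / (b * z ^ 2) by field_simp, ← div_eq_mul_inv]
    ring

/-- The contribution of one parameter `u` to `symIntegrand`. -/
noncomputable def symFactor (b u p q z : ℂ) : ℂ :=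
  pqPoch (p * q / (u * z)) p q * pqPoch (p * q * z / u) p q *
      pqPoch (b * u * z) p q * pqPoch (b * u / z) p q /
    (pqPoch (u * z) p q * pqPoch (u / z) p q * pqPoch (p * q * z / (b * u)) p q *
      pqPoch (p * q / (b * u * z)) p q)

theorem kernel_unitScale (b : ℂ) (t : Fin 4 → ℂ) (p q z : ℂ) :
    kernel (unitScale p) b t q z =
      theta (b ^ 2 * t 0 * z) q * pqPoch (p * b * t 0 * z) p q * pqPoch (p * q / (t 0 * z)) p q *
        pqPoch (q * z / t 0) p q * pqPoch (b * t 0 * p / z) p q * pqPoch (q * z ^ 2 / b) p q *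
        pqPoch (p * q / (b * z ^ 2)) p q * (qPoch (p / z ^ 2) p * qPoch (z ^ 2) p) /
      (pqPoch (q / (b * t 0 * z)) p q * pqPoch (b * p / z ^ 2) p q * pqPoch (t 0 * p / z) p q *
        (qPoch (t 0 * z) q * pqPoch (p * t 0 * z) p q) * pqPoch (q * z / (b * t 0)) p q *
        pqPoch (b * z ^ 2) p q) * ∏ r : Fin 3, symFactor b (t r.succ) p q z := by
  simp only [kernel, num, numCore, denIn, denInCore, denOut, denOutCore, symFactor,
    show unitScale p 3 0 = p from rfl, show unitScale p 2 0 = 1 from rfl,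
    show unitScale p 1 0 = p from rfl, show ∀ s : Fin 3, unitScale p 0 s.succ = 1 from fun s => rfl,
    show ∀ s : Fin 3, unitScale p 1 s.succ = 1 from fun s => by fin_cases s <;> rfl,
    show ∀ s : Fin 3, unitScale p 2 s.succ = p from fun s => by fin_cases s <;> rfl,
    show ∀ s : Fin 3, unitScale p 3 s.succ = p from fun s => rfl, mul_one, one_mul,
    Finset.prod_mul_distrib, Finset.prod_div_distrib, mul_comm q p]
  simp only [div_eq_mul_inv, mul_inv]
  ac_rfl

/-- The kernel differs from the symmetric integrand only in factors attached to b and t_0 in which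
the exponent of p is zero. In pairs they form theta functions of nome q. -/
theorem kernel_mul_theta {p q z : ℂ} (hp : ‖p‖ < 1) (hq : ‖q‖ < 1) {b : ℂ}
    {t : Fin 4 → ℂ} (h1 : theta (b * t 0 * z) q ≠ 0)
    (h2 : theta (b * t 0 / z) q ≠ 0) (h3 : theta (t 0 / z) q ≠ 0) (h4 : theta (b / z ^ 2) q ≠ 0) :
    kernel (unitScale p) b t q z *
        (theta (b * t 0 * z) q * theta (b * t 0 / z) q * theta (z ^ 2)⁻¹ q) =
      symIntegrand b t p q z *
        (theta (b ^ 2 * t 0 * z) q * theta (t 0 / z) q * theta (b / z ^ 2) q) := by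
  have s := pqPoch_succ_left hp hq
  rw [kernel_unitScale, symIntegrand]
  simp only [← symFactor.eq_def]
  rw [Fin.prod_univ_succ (n := 3), symFactor]
  generalize ∏ r : Fin 3, symFactor b (t r.succ) p q z = P
  generalize theta (b ^ 2 * t 0 * z) q = A8
  generalize theta (z ^ 2)⁻¹ q = A9
  simp only [theta, mul_ne_zero_iff, div_div_eq_mul_div] at h1 h2 h3 h4 ⊢
  rw [s (b * t 0 * z), s (q / (b * t 0 * z)), s (b * t 0 / z), s (q * z / (b * t 0)), s (q * z / t 0),
    s (t 0 / z), s (q * z ^ 2 / b), s (b / z ^ 2), s (t 0 * z),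
    show b * t 0 * z * p = p * b * t 0 * z by ring, show b * t 0 / z * p = b * t 0 * p / z by ring,
    show t 0 / z * p = t 0 * p / z by ring, show b / z ^ 2 * p = b * p / z ^ 2 by ring,
    show q * z / (b * t 0) * p = p * q * z / (b * t 0) by ring,
    show q / (b * t 0 * z) * p = p * q / (b * t 0 * z) by ring,
    show q * z / t 0 * p = p * q * z / t 0 by ring,
    show q * z ^ 2 / b * p = p * q * z ^ 2 / b by ring,
    show t 0 * z * p = p * t 0 * z by ring]
  obtain ⟨-, a2⟩ := h1
  obtain ⟨-, a4⟩ := h2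
  obtain ⟨a5, -⟩ := h3
  obtain ⟨a7, -⟩ := h4
  generalize qPoch (q / (b * t 0 * z)) q = A2 at *
  generalize qPoch (q * z / (b * t 0)) q = A4 at *
  generalize qPoch (t 0 / z) q = A5 at *
  generalize qPoch (b / z ^ 2) q = A7 at *
  -- These four factors occur both in numerators and in denominators. They are the only
  -- cancellations that need the non-vanishing of the theta functions.
  have c : A2 * A2⁻¹ * (A4 * A4⁻¹) = A5 * A5⁻¹ * (A7 * A7⁻¹) := by
    rw [mul_inv_cancel₀ a2, mul_inv_cancel₀ a4, mul_inv_cancel₀ a5, mul_inv_cancel₀ a7]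
  linear_combination (A8 * pqPoch (p * b * t 0 * z) p q * pqPoch (p * q / (t 0 * z)) p q *
    qPoch (q * z / t 0) q * pqPoch (p * q * z / t 0) p q * pqPoch (b * t 0 * p / z) p q *
    qPoch (q * z ^ 2 / b) q * pqPoch (p * q * z ^ 2 / b) p q * pqPoch (p * q / (b * z ^ 2)) p q *
    qPoch (p / z ^ 2) p * qPoch (z ^ 2) p * P * qPoch (b * t 0 * z) q * qPoch (b * t 0 / z) q * A9 /
    (pqPoch (p * q / (b * t 0 * z)) p q * pqPoch (b * p / z ^ 2) p q * pqPoch (t 0 * p / z) p q *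
      qPoch (t 0 * z) q * pqPoch (p * t 0 * z) p q * pqPoch (p * q * z / (b * t 0)) p q *
      pqPoch (b * z ^ 2) p q)) * c

/-- Dividing the kernel at z and at 1/z by the symmetric integrand gives the two terms on the left
of `theta_addition` with u = t_0. -/
theorem theta_mul_symIntegrand {p q z : ℂ} (hp : ‖p‖ < 1) (hq : ‖q‖ < 1) (hq0 : q ≠ 0)
    (hz : z ≠ 0) {b : ℂ} (hb : b ≠ 0) {t : Fin 4 → ℂ} (ht : t 0 ≠ 0) (hb1 : theta b q ≠ 0)
    (h1 : theta (b * t 0 * z) q ≠ 0) (h2 : theta (b * t 0 / z) q ≠ 0)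
    (h3 : theta (t 0 / z) q ≠ 0) (h4 : theta (t 0 * z) q ≠ 0)
    (h5 : theta (b / z ^ 2) q ≠ 0) (h6 : theta (b * z ^ 2) q ≠ 0)
    (h7 : theta (z ^ 2) q ≠ 0) :
    theta (b ^ 2) q * symIntegrand b t p q z =
      theta b q * (kernel (unitScale p) b t q z + kernel (unitScale p) b t q z⁻¹) := by
  have hz2 : z ^ 2 ≠ 0 := pow_ne_zero 2 hz
  have hi : theta (z ^ 2)⁻¹ q ≠ 0 := by
    rw [theta_inv hq hz2]
    exact mul_ne_zero (by simpa using hz) h7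
  have k1 := kernel_mul_theta hp hq h1 h2 h3 h5
  have k2 := kernel_mul_theta hp hq (z := z⁻¹) (b := b) (t := t)
    (by simpa only [← div_eq_mul_inv]) (by simpa only [div_inv_eq_mul])
    (by simpa only [div_inv_eq_mul]) (by simpa only [inv_pow, div_inv_eq_mul])
  have add := theta_addition hq hq0 hb ht hz hb1 h7 h6
  simp only [inv_pow, div_inv_eq_mul, inv_inv, ← div_eq_mul_inv, symIntegrand_inv hp hq hz] at k2
  rw [show theta (z ^ 2) q = -z ^ 2 * theta (z ^ 2)⁻¹ q by
    rw [theta_inv hq hz2]; field_simp] at k2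
  apply mul_right_cancel₀ (mul_ne_zero (mul_ne_zero h1 h2) hi)
  have k2' : kernel (unitScale p) b t q z⁻¹ *
      (theta (b * t 0 * z) q * theta (b * t 0 / z) q * theta (z ^ 2)⁻¹ q) =
      -(z ^ 2)⁻¹ * (symIntegrand b t p q z *
        (theta (b ^ 2 * t 0 / z) q * theta (t 0 * z) q * theta (b * z ^ 2) q)) := by
    rw [← k2]; field_simp
  linear_combination -symIntegrand b t p q z * add - theta b q * k1 - theta b q * k2'

/-- The squares of the points at which the identities for the integrand may fail. -/
def exceptionalSquares (b u p q : ℂ) : Set ℂ :=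
  {0} ∪ (⋃ c ∈ ({(b * u) ^ 2, ((b * u) ^ 2)⁻¹, u ^ 2, (u ^ 2)⁻¹, b, b⁻¹, 1} : Set ℂ), ⋃ n : ℤ,
    {c * q ^ n}) ∪ ⋃ j : ℕ, ⋃ k : ℕ, {p ^ j * q ^ k, (p ^ j * q ^ k)⁻¹}

theorem countable_exceptionalSquares (b u p q : ℂ) : (exceptionalSquares b u p q).Countable := by
  refine ((Set.countable_singleton 0).union ?_).union ?_
  · exact (Set.Finite.countable (by simp)).biUnion fun c _ => Set.countable_iUnion fun n =>
      Set.countable_singleton _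
  · exact Set.countable_iUnion fun j => Set.countable_iUnion fun k => (Set.toFinite _).countable

theorem countable_setOf_sq_mem {W : Set ℂ} (hW : W.Countable) : {z : ℂ | z ^ 2 ∈ W}.Countable := by
  refine (hW.biUnion (t := fun x _ => {z : ℂ | z ^ 2 = x}) fun x _ => ?_).mono fun z hz => ?_
  · have : {z : ℂ | z ^ 2 = x} ⊆ {x ^ (1 / 2 : ℂ), -x ^ (1 / 2 : ℂ)} := fun z hz => by
      rw [Set.mem_ofPred_eq, ← show (x ^ (1 / 2 : ℂ)) ^ 2 = x by simp] at hz
      simpa using sq_eq_sq_iff_eq_or_eq_neg.1 hz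
    exact ((Set.toFinite _).subset this).countable
  · simp only [Set.mem_iUnion]
    exact ⟨_, hz, rfl⟩

theorem theta_mul_symIntegrand_of_sq_notMem {p q z : ℂ} (hp : ‖p‖ < 1) (hq : ‖q‖ < 1)
    (hq0 : q ≠ 0) {b : ℂ} (hb : b ≠ 0) {t : Fin 4 → ℂ} (ht : t 0 ≠ 0)
    (hb1 : theta b q ≠ 0) (hW : z ^ 2 ∉ exceptionalSquares b (t 0) p q) :
    z ≠ 0 ∧ pqPoch (p * q / z ^ 2) p q ≠ 0 ∧ pqPoch (p * q * z ^ 2) p q ≠ 0 ∧ 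
    theta (b ^ 2) q * symIntegrand b t p q z =
      theta b q * (kernel (unitScale p) b t q z + kernel (unitScale p) b t q z⁻¹) := by
  simp only [exceptionalSquares, Set.mem_union, Set.mem_iUnion, Set.mem_singleton_iff,
    Set.mem_insert_iff, not_or, not_exists, exists_prop, not_and] at hW
  obtain ⟨⟨h0, hc⟩, hj⟩ := hW
  have hz : z ≠ 0 := fun h => h0 (by simp [h])
  have hc' : ∀ c ∈ ({(b * t 0) ^ 2, ((b * t 0) ^ 2)⁻¹, t 0 ^ 2, (t 0 ^ 2)⁻¹, b, b⁻¹, 1} : Set ℂ),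
      ∀ n : ℤ, z ^ 2 ≠ c * q ^ n := fun c h => hc c (by simpa using h)
  -- Each theta argument x satisfies z² = c x^{±1} or z² = c x^{±2} for one of the listed c. If x
  -- were a power of q, then z² would be exceptional.
  have lin : ∀ c x : ℂ, c ∈ ({(b * t 0) ^ 2, ((b * t 0) ^ 2)⁻¹, t 0 ^ 2, (t 0 ^ 2)⁻¹, b, b⁻¹, 1} : Set ℂ) →
      x ≠ 0 → (z ^ 2 = c * x ∨ z ^ 2 = c * x⁻¹ ∨ z ^ 2 = c * x ^ 2 ∨ z ^ 2 = c * (x ^ 2)⁻¹) →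
      theta x q ≠ 0 := fun c x h hx hh => by
    refine theta_zpow_ne_zero hq hq0 hx ?_
    rintro n rfl
    rcases hh with hh | hh | hh | hh
    · exact hc' c h _ hh
    · exact hc' c h (-n) (by rw [hh, zpow_neg])
    · exact hc' c h (n * 2) (by rw [hh, zpow_mul]; rfl)
    · exact hc' c h (-(n * 2)) (by rw [hh, zpow_neg, zpow_mul]; rfl)
  have hz2 : z ^ 2 ≠ 0 := pow_ne_zero 2 hz
  refine ⟨hz, ?_, ?_, theta_mul_symIntegrand hp hq hq0 hz hb ht hb1 ?_ ?_ ?_ ?_ ?_ ?_ ?_⟩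
  · rw [Ne, pqPoch_eq_zero_iff hp hq]
    rintro ⟨j, k, h⟩
    refine (hj (j + 1) (k + 1)).1 ?_
    field_simp at h
    rw [← h]; ring
  · rw [Ne, pqPoch_eq_zero_iff hp hq]
    rintro ⟨j, k, h⟩
    refine (hj (j + 1) (k + 1)).2 ?_
    exact eq_inv_of_mul_eq_one_left (by rw [← h]; ring)
  · exact lin ((b * t 0) ^ 2)⁻¹ _ (by simp) (by positivity) (.inr (.inr (.inl (by field_simp))))
  · exact lin ((b * t 0) ^ 2) _ (by simp) (by positivity) (.inr (.inr (.inr (by field_simp))))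
  · exact lin (t 0 ^ 2) _ (by simp) (by positivity) (.inr (.inr (.inr (by field_simp))))
  · exact lin (t 0 ^ 2)⁻¹ _ (by simp) (by positivity) (.inr (.inr (.inl (by field_simp))))
  · exact lin b _ (by simp) (by positivity) (.inr (.inl (by field_simp)))
  · exact lin b⁻¹ _ (by simp) (by positivity) (.inl (by field_simp))
  · exact lin 1 _ (by simp) (by positivity) (.inl (by ring))

end Symmetrization

end EllipticBeta

namespace EllipticBeta

/-! ## Regularity of the factors -/

section Regularity

/-- The polynomial part `(x; p, q) / (x q ^ n; p, q)`. -/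
noncomputable def shiftProd (x p q : ℂ) (n : ℕ) : ℂ := ∏ j ∈ Finset.range n, qPoch (x * q ^ j) p

theorem shiftProd_mul {p q : ℂ} (hp : ‖p‖ < 1) (hq : ‖q‖ < 1) (x : ℂ) (n : ℕ) :
    shiftProd x p q n * pqPoch (x * q ^ n) p q = pqPoch x p q :=
  (pqPoch_eq_prod_mul hp hq x n).symm

@[fun_prop]
theorem _root_.ContinuousAt.shiftProd {X : Type*} [TopologicalSpace X] {f g : X → ℂ} {x : X}
    (hf : ContinuousAt f x) (hg : ContinuousAt g x) (q : ℂ) (n : ℕ) (h : ‖g x‖ < 1) :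
    ContinuousAt (fun y => shiftProd (f y) (g y) q n) x :=
  tendsto_finsetProd _ fun j _ =>
    ((hf.mul continuousAt_const : ContinuousAt (fun y => f y * q ^ j) x).qPoch hg h)

@[fun_prop]
theorem _root_.DifferentiableAt.shiftProd {E : Type*} [NormedAddCommGroup E] [NormedSpace ℂ E]
    {f : E → ℂ} {x : E} {p : ℂ} (hf : DifferentiableAt ℂ f x) (q : ℂ) (n : ℕ) (hp : ‖p‖ < 1) :
    DifferentiableAt ℂ (fun y => shiftProd (f y) p q n) x :=
  DifferentiableAt.comp (g := fun z => EllipticBeta.shiftProd z p q n) x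
    (DifferentiableAt.fun_finsetProd fun j _ => (differentiableAt_id.mul_const (q ^ j)).qPoch hp) hf

section

variable {q : ℂ} {x : (Fin 4 → Fin 4 → ℂ) × ℂ × (Fin 4 → ℂ) × ℂ}

/-- Continuity is proved jointly with the scales, because these vary as p → 0. Holomorphy is needed
only for fixed scales. -/
theorem continuousAt_numCore (hq : ‖q‖ < 1) (hk : ‖x.1 3 0‖ < 1) (hb : x.2.1 ≠ 0)
    (ht : ∀ r, x.2.2.1 r ≠ 0) (hζ : x.2.2.2 ≠ 0) :
    ContinuousAt (fun x : (Fin 4 → Fin 4 → ℂ) × ℂ × (Fin 4 → ℂ) × ℂ =>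
      numCore x.1 x.2.1 x.2.2.1 q x.2.2.2) x := by
  have h0 := ht 0
  have h1 := ht 1
  have h2 := ht 2
  have h3 := ht 3
  unfold numCore
  simp only [Fin.prod_univ_three, Fin.succ_zero_eq_one, Fin.succ_one_eq_two,
    show Fin.succ (2 : Fin 3) = 3 from rfl]
  fun_prop (disch := first | assumption | positivity)

theorem continuousAt_num (hq : ‖q‖ < 1) (hk : ‖x.1 3 0‖ < 1) (hb : x.2.1 ≠ 0)
    (ht : ∀ r, x.2.2.1 r ≠ 0) (hζ : x.2.2.2 ≠ 0) :
    ContinuousAt (fun x : (Fin 4 → Fin 4 → ℂ) × ℂ × (Fin 4 → ℂ) × ℂ =>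
      num x.1 x.2.1 x.2.2.1 q x.2.2.2) x := by
  have := continuousAt_numCore hq hk hb ht hζ
  unfold num
  fun_prop (disch := first | assumption | positivity)

theorem continuousAt_denIn (hq : ‖q‖ < 1) (hk : ‖x.1 3 0‖ < 1) (hb : x.2.1 ≠ 0)
    (ht : ∀ r, x.2.2.1 r ≠ 0) (hζ : x.2.2.2 ≠ 0) :
    ContinuousAt (fun x : (Fin 4 → Fin 4 → ℂ) × ℂ × (Fin 4 → ℂ) × ℂ =>
      denIn x.1 x.2.1 x.2.2.1 q x.2.2.2) x := by
  have h0 := ht 0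
  have h1 := ht 1
  have h2 := ht 2
  have h3 := ht 3
  unfold denIn denInCore
  simp only [Fin.prod_univ_three, Fin.succ_zero_eq_one, Fin.succ_one_eq_two,
    show Fin.succ (2 : Fin 3) = 3 from rfl]
  fun_prop (disch := first | assumption | positivity)

theorem continuousAt_denOut (hq : ‖q‖ < 1) (hk : ‖x.1 3 0‖ < 1) (hb : x.2.1 ≠ 0)
    (ht : ∀ r, x.2.2.1 r ≠ 0) :
    ContinuousAt (fun x : (Fin 4 → Fin 4 → ℂ) × ℂ × (Fin 4 → ℂ) × ℂ =>
      denOut x.1 x.2.1 x.2.2.1 q x.2.2.2) x := by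
  have h0 := ht 0
  have h1 := ht 1
  have h2 := ht 2
  have h3 := ht 3
  unfold denOut denOutCore
  simp only [Fin.prod_univ_three, Fin.succ_zero_eq_one, Fin.succ_one_eq_two,
    show Fin.succ (2 : Fin 3) = 3 from rfl]
  fun_prop (disch := first | assumption | positivity)

theorem continuousAt_kernel (hq : ‖q‖ < 1) (hk : ‖x.1 3 0‖ < 1) (hb : x.2.1 ≠ 0)
    (ht : ∀ r, x.2.2.1 r ≠ 0) (hζ : x.2.2.2 ≠ 0)
    (h1 : denIn x.1 x.2.1 x.2.2.1 q x.2.2.2 ≠ 0) (h2 : qPoch (x.2.2.1 0 * x.2.2.2) q ≠ 0)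
    (h3 : denOut x.1 x.2.1 x.2.2.1 q x.2.2.2 ≠ 0) :
    ContinuousAt (fun x : (Fin 4 → Fin 4 → ℂ) × ℂ × (Fin 4 → ℂ) × ℂ =>
      kernel x.1 x.2.1 x.2.2.1 q x.2.2.2) x := by
  have c1 := continuousAt_num hq hk hb ht hζ
  have c2 := continuousAt_denIn hq hk hb ht hζ
  have c3 := continuousAt_denOut hq hk hb ht
  unfold kernel
  fun_prop (disch := first | assumption | positivity)

theorem continuousAt_prefCore {x : (Fin 4 → Fin 4 → ℂ) × ℂ × (Fin 4 → ℂ)} (hq : ‖q‖ < 1)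
    (hk : ‖x.1 3 0‖ < 1) (hb : x.2.1 ≠ 0) (ht : ∀ r, x.2.2 r ≠ 0)
    (h : qPoch (q / x.2.1 ^ 2) q ≠ 0) :
    ContinuousAt (fun x : (Fin 4 → Fin 4 → ℂ) × ℂ × (Fin 4 → ℂ) =>
      prefCore x.1 x.2.1 x.2.2 q) x := by
  have h0 := ht 0
  have h1 := ht 1
  have h2 := ht 2
  have h3 := ht 3
  have hq2 := norm_sq_lt_one hq
  have hk2 := norm_sq_lt_one hk
  unfold prefCore crossFactor rootFactor
  simp only [Fin.prod_univ_three, Fin.succ_zero_eq_one, Fin.succ_one_eq_two,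
    show Fin.succ (2 : Fin 3) = 3 from rfl]
  fun_prop (disch := first | assumption | positivity)

theorem continuousAt_pref {x : (Fin 4 → Fin 4 → ℂ) × ℂ × (Fin 4 → ℂ)} (hq : ‖q‖ < 1)
    (hk : ‖x.1 3 0‖ < 1) (hb : x.2.1 ≠ 0) (ht : ∀ r, x.2.2 r ≠ 0)
    (h : qPoch (q / x.2.1 ^ 2) q ≠ 0) :
    ContinuousAt (fun x : (Fin 4 → Fin 4 → ℂ) × ℂ × (Fin 4 → ℂ) =>
      pref x.1 x.2.1 x.2.2 q) x := by
  have h0 := ht 0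
  have h1 := ht 1
  have h2 := ht 2
  have h3 := ht 3
  have := continuousAt_prefCore hq hk hb ht h
  unfold pref
  simp only [Fin.prod_univ_three, Fin.succ_zero_eq_one, Fin.succ_one_eq_two,
    show Fin.succ (2 : Fin 3) = 3 from rfl]
  fun_prop (disch := first | assumption | positivity)

end

section

variable {q : ℂ} {k : Fin 4 → Fin 4 → ℂ} {x : ℂ × (Fin 4 → ℂ) × ℂ}

theorem differentiableAt_numCore (hq : ‖q‖ < 1) (hk : ‖k 3 0‖ < 1) (hb : x.1 ≠ 0)
    (ht : ∀ r, x.2.1 r ≠ 0) (hζ : x.2.2 ≠ 0) :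
    DifferentiableAt ℂ (fun x : ℂ × (Fin 4 → ℂ) × ℂ => numCore k x.1 x.2.1 q x.2.2) x := by
  have h0 := ht 0
  have h1 := ht 1
  have h2 := ht 2
  have h3 := ht 3
  unfold numCore
  simp only [Fin.prod_univ_three, Fin.succ_zero_eq_one, Fin.succ_one_eq_two,
    show Fin.succ (2 : Fin 3) = 3 from rfl]
  fun_prop (disch := first | assumption | positivity)

theorem differentiableAt_num (hq : ‖q‖ < 1) (hk : ‖k 3 0‖ < 1) (hb : x.1 ≠ 0)
    (ht : ∀ r, x.2.1 r ≠ 0) (hζ : x.2.2 ≠ 0) :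
    DifferentiableAt ℂ (fun x : ℂ × (Fin 4 → ℂ) × ℂ => num k x.1 x.2.1 q x.2.2) x := by
  have := differentiableAt_numCore hq hk hb ht hζ
  unfold num
  fun_prop (disch := first | assumption | positivity)

theorem differentiableAt_denIn (hq : ‖q‖ < 1) (hk : ‖k 3 0‖ < 1) (hb : x.1 ≠ 0)
    (ht : ∀ r, x.2.1 r ≠ 0) (hζ : x.2.2 ≠ 0) :
    DifferentiableAt ℂ (fun x : ℂ × (Fin 4 → ℂ) × ℂ => denIn k x.1 x.2.1 q x.2.2) x := by
  have h0 := ht 0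
  have h1 := ht 1
  have h2 := ht 2
  have h3 := ht 3
  unfold denIn denInCore
  simp only [Fin.prod_univ_three, Fin.succ_zero_eq_one, Fin.succ_one_eq_two,
    show Fin.succ (2 : Fin 3) = 3 from rfl]
  fun_prop (disch := first | assumption | positivity)

theorem differentiableAt_denOut (hq : ‖q‖ < 1) (hk : ‖k 3 0‖ < 1) (hb : x.1 ≠ 0)
    (ht : ∀ r, x.2.1 r ≠ 0) :
    DifferentiableAt ℂ (fun x : ℂ × (Fin 4 → ℂ) × ℂ => denOut k x.1 x.2.1 q x.2.2) x := by
  have h0 := ht 0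
  have h1 := ht 1
  have h2 := ht 2
  have h3 := ht 3
  unfold denOut denOutCore
  simp only [Fin.prod_univ_three, Fin.succ_zero_eq_one, Fin.succ_one_eq_two,
    show Fin.succ (2 : Fin 3) = 3 from rfl]
  fun_prop (disch := first | assumption | positivity)

theorem differentiableAt_kernel (hq : ‖q‖ < 1) (hk : ‖k 3 0‖ < 1) (hb : x.1 ≠ 0)
    (ht : ∀ r, x.2.1 r ≠ 0) (hζ : x.2.2 ≠ 0) (h1 : denIn k x.1 x.2.1 q x.2.2 ≠ 0)
    (h2 : qPoch (x.2.1 0 * x.2.2) q ≠ 0) (h3 : denOut k x.1 x.2.1 q x.2.2 ≠ 0) :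
    DifferentiableAt ℂ (fun x : ℂ × (Fin 4 → ℂ) × ℂ => kernel k x.1 x.2.1 q x.2.2) x := by
  have c1 := differentiableAt_num hq hk hb ht hζ
  have c2 := differentiableAt_denIn hq hk hb ht hζ
  have c3 := differentiableAt_denOut hq hk hb ht
  unfold kernel
  fun_prop (disch := first | assumption | positivity)

theorem differentiableAt_prefCore {x : ℂ × (Fin 4 → ℂ)} (hq : ‖q‖ < 1)
    (hk : ‖k 3 0‖ < 1) (hb : x.1 ≠ 0) (ht : ∀ r, x.2 r ≠ 0) (h : qPoch (q / x.1 ^ 2) q ≠ 0) :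
    DifferentiableAt ℂ (fun x : ℂ × (Fin 4 → ℂ) => prefCore k x.1 x.2 q) x := by
  have h0 := ht 0
  have h1 := ht 1
  have h2 := ht 2
  have h3 := ht 3
  have hq2 := norm_sq_lt_one hq
  have hk2 := norm_sq_lt_one hk
  unfold prefCore crossFactor rootFactor
  simp only [Fin.prod_univ_three, Fin.succ_zero_eq_one, Fin.succ_one_eq_two,
    show Fin.succ (2 : Fin 3) = 3 from rfl]
  fun_prop (disch := first | assumption | positivity)

theorem differentiableAt_pref {x : ℂ × (Fin 4 → ℂ)} (hq : ‖q‖ < 1)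
    (hk : ‖k 3 0‖ < 1) (hb : x.1 ≠ 0) (ht : ∀ r, x.2 r ≠ 0) (h : qPoch (q / x.1 ^ 2) q ≠ 0) :
    DifferentiableAt ℂ (fun x : ℂ × (Fin 4 → ℂ) => pref k x.1 x.2 q) x := by
  have h0 := ht 0
  have h1 := ht 1
  have h2 := ht 2
  have h3 := ht 3
  have := differentiableAt_prefCore hq hk hb ht h
  unfold pref
  simp only [Fin.prod_univ_three, Fin.succ_zero_eq_one, Fin.succ_one_eq_two,
    show Fin.succ (2 : Fin 3) = 3 from rfl]
  fun_prop (disch := first | assumption | positivity)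

theorem differentiableAt_num_right {z b : ℂ} {t : Fin 4 → ℂ} (hq : ‖q‖ < 1) (hk : ‖k 3 0‖ < 1)
    (hb : b ≠ 0) (ht : ∀ r, t r ≠ 0) (hz : z ≠ 0) : DifferentiableAt ℂ (num k b t q) z :=
  DifferentiableAt.comp (g := fun x : ℂ × (Fin 4 → ℂ) × ℂ => num k x.1 x.2.1 q x.2.2)
    (f := fun z => (b, t, z)) z (differentiableAt_num hq hk hb ht hz) (by fun_prop)

theorem differentiableAt_denIn_right {z b : ℂ} {t : Fin 4 → ℂ} (hq : ‖q‖ < 1) (hk : ‖k 3 0‖ < 1)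
    (hb : b ≠ 0) (ht : ∀ r, t r ≠ 0) (hz : z ≠ 0) : DifferentiableAt ℂ (denIn k b t q) z :=
  DifferentiableAt.comp (g := fun x : ℂ × (Fin 4 → ℂ) × ℂ => denIn k x.1 x.2.1 q x.2.2)
    (f := fun z => (b, t, z)) z (differentiableAt_denIn hq hk hb ht hz) (by fun_prop)

theorem differentiableAt_denOut_right {z b : ℂ} {t : Fin 4 → ℂ} (hq : ‖q‖ < 1) (hk : ‖k 3 0‖ < 1)
    (hb : b ≠ 0) (ht : ∀ r, t r ≠ 0) : DifferentiableAt ℂ (denOut k b t q) z :=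
  DifferentiableAt.comp (g := fun x : ℂ × (Fin 4 → ℂ) × ℂ => denOut k x.1 x.2.1 q x.2.2)
    (f := fun z => (b, t, z)) z (differentiableAt_denOut hq hk hb ht) (by fun_prop)

end

end Regularity

/-! ## Residues of the symmetry-broken integrand -/

section Residues

/-- Infinitely many zeros in a compact annulus would accumulate away from the origin, contradicting
the identity theorem on the connected punctured plane. -/
theorem finite_zeros {f : ℂ → ℂ} (hf : ∀ z ≠ 0, DifferentiableAt ℂ f z) {z₀ : ℂ} (hz₀ : z₀ ≠ 0)
    (hf₀ : f z₀ ≠ 0) (r R : ℝ) (hr : 0 < r) : {z | f z = 0 ∧ r ≤ ‖z‖ ∧ ‖z‖ ≤ R}.Finite := by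
  by_contra hinf
  have ho : IsOpen ({0}ᶜ : Set ℂ) := isOpen_compl_singleton
  have hK : IsCompact {z : ℂ | r ≤ ‖z‖ ∧ ‖z‖ ≤ R} := by
    refine (isCompact_closedBall (0 : ℂ) R).of_isClosed_subset
      ((isClosed_le continuous_const continuous_norm).inter
        (isClosed_le continuous_norm continuous_const)) fun z hz => by simpa using hz.2
  obtain ⟨x, hx, hacc⟩ := Set.Infinite.exists_accPt_of_subset_isCompact hinf hK fun z hz => hz.2
  have hx0 : x ≠ 0 := norm_pos_iff.1 (hr.trans_le hx.1)
  have han : AnalyticOnNhd ℂ f {0}ᶜ :=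
    DifferentiableOn.analyticOnNhd (fun z hz => (hf z hz).differentiableWithinAt) ho
  have hconn : IsPreconnected ({0}ᶜ : Set ℂ) :=
    (isConnected_compl_singleton_of_one_lt_rank (by simp) 0).isPreconnected
  have hfr : ∃ᶠ z in 𝓝[≠] x, f z = 0 := by
    rw [accPt_iff_frequently_nhdsNE] at hacc
    exact hacc.mono fun z hz => hz.1
  exact hf₀ (han.eqOn_zero_of_preconnected_of_frequently_eq_zero hconn hx0 hfr hz₀)

/-- The value of `(t_0 ζ; q) / (1 - t_0 ζ q ^ n)` at `ζ = 1 / (t_0 q ^ n)`. -/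
noncomputable def poleFactor (q : ℂ) (n : ℕ) : ℂ :=
  (∏ j ∈ Finset.range n, (1 - q ^ j / q ^ n)) * qPoch q q

theorem poleFactor_ne_zero {q : ℂ} (hq : ‖q‖ < 1) (hq0 : q ≠ 0) (n : ℕ) : poleFactor q n ≠ 0 := by
  refine mul_ne_zero (Finset.prod_ne_zero_iff.2 fun j hj h => ?_) fun h => ?_
  · have h' : q ^ j = q ^ n := by
      field_simp at h
      exact (sub_eq_zero.1 (by simpa using h)).symm
    have := congrArg norm h'
    rw [norm_pow, norm_pow] at this
    exact (pow_lt_pow_right_of_lt_one₀ (norm_pos_iff.2 hq0) hq (Finset.mem_range.1 hj)).ne' this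
  · obtain ⟨j, hj⟩ := (qPoch_eq_zero_iff hq).1 h
    have := congrArg norm hj
    rw [← pow_succ', norm_pow, norm_one] at this
    exact (pow_lt_one₀ (norm_nonneg q) hq j.succ_ne_zero).ne this

variable {k : Fin 4 → Fin 4 → ℂ} {b : ℂ} {t : Fin 4 → ℂ} {q : ℂ}

theorem qPoch_mul_eq_zero_iff (hq : ‖q‖ < 1) (hq0 : q ≠ 0) {u z : ℂ} (hu : u ≠ 0) :
    qPoch (u * z) q = 0 ↔ ∃ n : ℕ, z = (u * q ^ n)⁻¹ := by
  rw [qPoch_eq_zero_iff hq]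
  refine exists_congr fun n => ⟨fun h => eq_inv_of_mul_eq_one_left (by rw [← h]; ring), ?_⟩
  rintro rfl
  field_simp

/-- Splitting off the one factor of (t_0 z;q) that vanishes at the centre turns the integrand into a
holomorphic function over z - a, and Cauchy's formula applies. -/
theorem circleIntegral_kernel {ε : ℝ} (hε : 0 < ε) (hq : ‖q‖ < 1) (hq0 : q ≠ 0)
    (hk : ‖k 3 0‖ < 1) (hb : b ≠ 0) (ht : ∀ r, t r ≠ 0) (n : ℕ)
    (h0 : ∀ z ∈ Metric.closedBall (t 0 * q ^ n)⁻¹ ε, z ≠ 0 ∧ denIn k b t q z ≠ 0 ∧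
      denOut k b t q z ≠ 0 ∧ ∀ m, m ≠ n → z ≠ (t 0 * q ^ m)⁻¹) :
    (∮ z in C((t 0 * q ^ n)⁻¹, ε), kernel k b t q z / z) =
      -(2 * Real.pi * Complex.I * (num k b t q (t 0 * q ^ n)⁻¹ / (denIn k b t q (t 0 * q ^ n)⁻¹ *
        (poleFactor q n * denOut k b t q (t 0 * q ^ n)⁻¹)))) := by
  have ht0 := ht 0
  set a := (t 0 * q ^ n)⁻¹ with ha
  have ha0 : a ≠ 0 := by positivity
  set L : ℂ → ℂ := fun z => (∏ j ∈ Finset.range n, (1 - t 0 * z * q ^ j)) *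
    qPoch (t 0 * z * q ^ (n + 1)) q with hL
  have hfac : ∀ z, qPoch (t 0 * z) q = -(z - a) / a * L z := fun z => by
    rw [qPoch_eq_prod_mul hq _ (n + 1), Finset.prod_range_succ, hL, ha]
    field_simp
    ring
  have hLa : L a = poleFactor q n := by
    simp only [hL, poleFactor, ha]
    congr 1
    · refine Finset.prod_congr rfl fun j _ => ?_
      field_simp
    · congr 1
      field_simp
      ring
  set g : ℂ → ℂ := fun z => -a * num k b t q z / (z * denIn k b t q z * (L z * denOut k b t q z))
    with hg
  have hL0 : ∀ z ∈ Metric.closedBall a ε, L z ≠ 0 := fun z hz h => by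
    rcases eq_or_ne z a with rfl | hza
    · exact poleFactor_ne_zero hq hq0 n (hLa ▸ h)
    · have : qPoch (t 0 * z) q = 0 := by rw [hfac, h, mul_zero]
      obtain ⟨m, hm⟩ := (qPoch_mul_eq_zero_iff hq hq0 ht0).1 this
      rcases eq_or_ne m n with rfl | hmn
      · exact hza hm
      · exact (h0 z hz).2.2.2 m hmn hm
  have hd : ∀ z ∈ Metric.closedBall a ε, DifferentiableAt ℂ g z := fun z hz => by
    obtain ⟨z0, z1, z2, -⟩ := h0 z hz
    have d1 := differentiableAt_num_right hq hk hb ht z0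
    have d2 := differentiableAt_denIn_right hq hk hb ht z0
    have d3 := differentiableAt_denOut_right (z := z) hq hk hb ht
    have d4 : DifferentiableAt ℂ L z := by
      refine DifferentiableAt.mul ?_ (by fun_prop (disch := assumption))
      exact DifferentiableAt.fun_finsetProd fun j _ => by fun_prop
    exact DifferentiableAt.div (d1.const_mul (-a)) ((differentiableAt_id.mul d2).mul (d4.mul d3))
      (mul_ne_zero (mul_ne_zero z0 z1) (mul_ne_zero (hL0 z hz) z2))
  have hc := Complex.circleIntegral_div_sub_of_differentiable_on_off_countable
    (s := ∅) countable_empty (Metric.mem_ball_self hε) (f := g)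
    (fun z hz => (hd z hz).continuousAt.continuousWithinAt)
    (fun z hz => hd z (Metric.ball_subset_closedBall hz.1))
  have he : (∮ z in C(a, ε), kernel k b t q z / z) = ∮ z in C(a, ε), g z / (z - a) := by
    refine circleIntegral.integral_congr hε.le fun z hz => ?_
    have hza : z - a ≠ 0 := sub_ne_zero.2 (Metric.ne_of_mem_sphere hz hε.ne')
    simp only [kernel, hg, hfac]
    generalize denIn k b t q z = A
    generalize denOut k b t q z = B
    generalize num k b t q z = N
    generalize L z = L'
    field_simp
  rw [he, hc]
  simp only [hg, hLa]
  field_simp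

/-- The integral of the symmetry-broken integrand along a separating contour is the integral along
a circle plus the residues of the poles `1 / (t_0 q ^ n)` inside that circle. -/
theorem integral_kernel {ρ : ℝ} (hρ : 0 < ρ) {K : ℕ} (hq : ‖q‖ < 1) (hq0 : q ≠ 0)
    (hk : ‖k 3 0‖ < 1) (hb : b ≠ 0) (ht : ∀ r, t r ≠ 0)
    (hI : ∀ z, ρ ≤ ‖z‖ → denIn k b t q z ≠ 0)
    (hO : ∀ z, ‖z‖ ≤ ρ → denOut k b t q z ≠ 0)
    (hK : ∀ n, if n < K then ‖(t 0 * q ^ n)⁻¹‖ < ρ else ρ < ‖(t 0 * q ^ n)⁻¹‖)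
    {C : Contour} (hC : C.Separates {z | z ≠ 0 ∧ denIn k b t q z = 0}
      {z | z ≠ 0 ∧ (qPoch (t 0 * z) q = 0 ∨ denOut k b t q z = 0)}) :
    (2 * Real.pi * Complex.I)⁻¹ * C.integral (fun z => kernel k b t q z / z) =
      (2 * Real.pi * Complex.I)⁻¹ * (∮ z in C(0, ρ), kernel k b t q z / z) +
      ∑ n ∈ Finset.range K, num k b t q (t 0 * q ^ n)⁻¹ / (denIn k b t q (t 0 * q ^ n)⁻¹ *
        (poleFactor q n * denOut k b t q (t 0 * q ^ n)⁻¹)) := by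
  have ht0 := ht 0
  set I := {z | z ≠ 0 ∧ denIn k b t q z = 0} with hIdef
  set O := {z | z ≠ 0 ∧ (qPoch (t 0 * z) q = 0 ∨ denOut k b t q z = 0)} with hOdef
  set a : Fin K → ℂ := fun n => (t 0 * q ^ (n : ℕ))⁻¹ with ha
  have hpow : ∀ m n : ℕ, (t 0 * q ^ m)⁻¹ = (t 0 * q ^ n)⁻¹ → m = n := fun m n h => by
    have h2 := congrArg norm (mul_left_cancel₀ ht0 (inv_injective h))
    rw [norm_pow, norm_pow] at h2
    exact pow_right_injective₀ (norm_pos_iff.2 hq0) hq.ne h2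
  have haO : ∀ n : ℕ, (t 0 * q ^ n)⁻¹ ∈ O := fun n =>
    ⟨by positivity, .inl ((qPoch_mul_eq_zero_iff hq hq0 ht0).2 ⟨n, rfl⟩)⟩
  -- The existence of a separating contour already forces the inner and outer poles to be disjoint,
  -- as no point has index 1 and 0.
  have hdisj : ∀ z ∈ I, z ∉ O := fun z hz hz' => by
    have h1 := (hC.1 z (Or.inr hz)).2
    rw [(hC.2 z hz').2] at h1
    exact zero_ne_one h1
  have dnum : ∀ z ≠ 0, DifferentiableAt ℂ (num k b t q) z := fun z z0 =>
    differentiableAt_num_right hq hk hb ht z0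
  have dIn : ∀ z ≠ 0, DifferentiableAt ℂ (denIn k b t q) z := fun z z0 =>
    differentiableAt_denIn_right hq hk hb ht z0
  have dOut : ∀ z, DifferentiableAt ℂ (denOut k b t q) z := fun z =>
    differentiableAt_denOut_right hq hk hb ht
  have dQ : ∀ z, DifferentiableAt ℂ (fun z => qPoch (t 0 * z) q) z := fun z => by
    fun_prop (disch := assumption)
  have hρn : ‖(ρ : ℂ)‖ = ρ := by simp [abs_of_pos hρ]
  have hρ0 : (ρ : ℂ) ≠ 0 := by exact_mod_cast hρ.ne'
  have hQρ : qPoch (t 0 * ρ) q ≠ 0 := fun h => by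
    obtain ⟨n, hn⟩ := (qPoch_mul_eq_zero_iff hq hq0 ht0).1 h
    have := hK n
    rw [← hn, hρn] at this
    split_ifs at this <;> exact lt_irrefl _ this
  have hfin : ∀ r R : ℝ, 0 < r → {z ∈ I ∪ O | r ≤ ‖z‖ ∧ ‖z‖ ≤ R}.Finite := fun r R hr => by
    refine (finite_zeros (f := fun z => denIn k b t q z * (qPoch (t 0 * z) q * denOut k b t q z))
      (fun z z0 => (dIn z z0).mul ((dQ z).mul (dOut z))) hρ0
      (mul_ne_zero (hI _ hρn.ge) (mul_ne_zero hQρ (hO _ hρn.le))) r R hr).subset ?_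
    rintro z ⟨(hz | hz), hz'⟩
    · exact ⟨by simp only [hz.2, zero_mul], hz'⟩
    · refine ⟨?_, hz'⟩
      rcases hz.2 with h | h <;> simp only [h, zero_mul, mul_zero]
  have haρ : ∀ i, ‖a i‖ < ρ := fun i => by simpa [ha] using hK i
  have hIρ : ∀ z ∈ I, ‖z‖ < ρ := fun z hz => by
    by_contra! h
    exact hI z h hz.2
  have hgood := Contour.eventually_goodRadii (ρ := ρ) (a := a) (I := I)
    (fun m n h => Fin.ext (hpow _ _ h)) haρ (fun i => (haO i).1)
    (fun i h => hdisj _ h (haO i)) fun r hr => (hfin r ρ hr).subset fun z hz =>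
      ⟨Or.inl hz.1, hz.2, (hIρ z hz.1).le⟩
  obtain ⟨ε, hr, hε⟩ := (hgood.and self_mem_nhdsWithin).exists
  have hε' : (0 : ℝ) < ε := hε
  -- The only outer poles within the circle are the first K poles 1/(t_0 q^n), and these receive
  -- small negative circles. The integral may be moved to this punctured contour.
  have hsep := Contour.separates_punctured hρ hε' hr hIρ (O := O) fun z hz => by
    rcases hz.2 with h | h
    · obtain ⟨n, rfl⟩ := (qPoch_mul_eq_zero_iff hq hq0 ht0).1 h
      have := hK n
      split_ifs at this with hn
      · exact .inr ⟨⟨n, hn⟩, rfl⟩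
      · exact .inl this
    · refine .inl ?_
      by_contra! h'
      exact hO z h' h
  rw [Contour.integral_eq_of_separates hC hsep hfin (g := fun z => kernel k b t q z / z),
    Contour.integral_punctured, mul_sub, sub_eq_add_neg, Finset.sum_range]
  · congr 1
    rw [← mul_neg, ← Finset.sum_neg_distrib, Finset.mul_sum]
    refine Finset.sum_congr rfl fun i _ => ?_
    rw [circleIntegral_kernel hε' hq hq0 hk hb ht i, neg_neg,
      inv_mul_cancel_left₀ Complex.two_pi_I_ne_zero]
    intro z hz
    rw [mem_closedBall_iff_norm] at hz
    obtain ⟨g1, g2, g3, g4⟩ := hr i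
    have hzρ : ‖z‖ < ρ := by
      calc ‖z‖ = ‖(z - a i) + a i‖ := by ring_nf
        _ ≤ ‖z - a i‖ + ‖a i‖ := norm_add_le _ _
        _ < ρ := by linarith [show ‖z - a i‖ ≤ ε from hz]
    have hz0 : z ≠ 0 := by
      rintro rfl
      rw [zero_sub, norm_neg] at hz
      exact absurd hz g2.not_ge
    refine ⟨hz0, fun h => ?_, hO z hzρ.le, fun m hm h => ?_⟩
    · exact absurd hz (g4 z ⟨hz0, h⟩).not_ge
    · have := hK m
      rw [← h] at this
      split_ifs at this with hmK
      · refine absurd hz (not_le.2 ?_)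
        have := g3 ⟨m, hmK⟩ (fun h => hm (congrArg Fin.val h))
        simpa [ha, h] using this
      · exact absurd this hzρ.not_gt
  · intro z z0 hzI hzO
    simp only [hIdef, hOdef, Set.mem_ofPred_eq, not_and, not_or] at hzI hzO
    exact ((dnum z z0).div ((dIn z z0).mul ((dQ z).mul (dOut z))) (mul_ne_zero (hzI z0)
      (mul_ne_zero (hzO z0).1 (hzO z0).2))).div differentiableAt_id z0
  · have an : ∀ f : ℂ → ℂ, (∀ z ≠ 0, DifferentiableAt ℂ f z) → ∀ z ≠ 0, MeromorphicAt f z :=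
      fun f hf z z0 => (DifferentiableOn.analyticAt (s := {0}ᶜ)
        (fun z hz => (hf z hz).differentiableWithinAt)
        (isOpen_compl_singleton.mem_nhds z0)).meromorphicAt
    intro z z0
    exact ((an _ dnum z z0).div ((an _ dIn z z0).mul ((an _ (fun z _ => dQ z) z z0).mul
      (an _ (fun z _ => dOut z) z z0)))).div (MeromorphicAt.id z)

end Residues

end EllipticBeta

namespace EllipticBeta

/-! ## Circle integrals depending on a parameter -/

section Parameters

theorem continuousOn_circleIntegral {X : Type*} [TopologicalSpace X] [FirstCountableTopology X]
    {f : X → ℂ → ℂ} {U : Set X} {c : ℂ} {ρ : ℝ} (hρ : 0 ≤ ρ)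
    (hf : ∀ x ∈ U, ∀ z ∈ Metric.sphere c ρ, ContinuousAt (Function.uncurry f) (x, z)) :
    ContinuousOn (fun x => ∮ z in C(c, ρ), f x z) U := by
  rw [continuousOn_iff_continuous_domRestrict]
  refine intervalIntegral.continuous_parametric_intervalIntegral_of_continuous'
    (f := fun (x : U) θ => deriv (circleMap c ρ) θ • f x (circleMap c ρ θ)) ?_ _ _
  refine Continuous.smul ((continuous_deriv_circleMap c ρ).comp continuous_snd) ?_
  rw [continuous_iff_continuousAt]
  rintro ⟨x, θ⟩
  have hc : Continuous fun y : U × ℝ => ((y.1 : X), circleMap c ρ y.2) :=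
    (continuous_subtype_val.comp continuous_fst).prodMk
      ((continuous_circleMap c ρ).comp continuous_snd)
  exact ContinuousAt.comp (g := Function.uncurry f) (x := (x, θ))
    (f := fun y : U × ℝ => ((y.1 : X), circleMap c ρ y.2))
    (hf x x.2 _ (circleMap_mem_sphere c hρ θ)) hc.continuousAt

theorem integral_single_circle (c : ℂ) (R : ℝ) (f : ℂ → ℂ) :
    (Contour.circles (fun _ : Fin 1 => c) (fun _ => R) fun _ => 1).integral f =
      ∮ z in C(c, R), f z := by
  rw [Contour.integral_circles]; simp

theorem circleIntegral_comm {f : ℂ → ℂ → ℂ} {c : ℂ} {R ρ : ℝ} (hR : 0 ≤ R) (hρ : 0 ≤ ρ)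
    (hf : ContinuousOn (Function.uncurry f) (Metric.sphere 0 ρ ×ˢ Metric.sphere c R)) :
    (∮ x in C(c, R), ∮ z in C(0, ρ), f z x) = ∮ z in C(0, ρ), ∮ x in C(c, R), f z x := by
  simp_rw [← integral_single_circle c R]
  refine Contour.integral_circleIntegral_comm _ hρ (hf.mono (Set.prod_mono subset_rfl fun z hz => ?_))
  obtain ⟨-, h⟩ := Contour.mem_trace_circles (fun _ => hR) hz
  exact mem_sphere_iff_norm.2 h

theorem cauchy_circleIntegral {f : ℂ → ℂ → ℂ} {c w : ℂ} {R ρ : ℝ} (hρ : 0 ≤ ρ)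
    (hw : w ∈ Metric.ball c R)
    (hf : ∀ x ∈ Metric.closedBall c R, ∀ z ∈ Metric.sphere 0 ρ,
      ContinuousAt (Function.uncurry f) (x, z) ∧ DifferentiableAt ℂ (fun x => f x z) x) :
    (∮ x in C(c, R), (∮ z in C(0, ρ), f x z) / (x - w)) =
      2 * Real.pi * Complex.I * ∮ z in C(0, ρ), f w z := by
  have hR : 0 < R := Metric.pos_of_mem_ball hw
  have e : (∮ x in C(c, R), (∮ z in C(0, ρ), f x z) / (x - w)) =
      ∮ x in C(c, R), ∮ z in C(0, ρ), f x z / (x - w) := by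
    refine circleIntegral.integral_congr hR.le fun x _ => ?_
    simp only [div_eq_inv_mul]
    exact (circleIntegral.integral_const_mul _ _ _ _).symm
  rw [e, circleIntegral_comm (f := fun z x => f x z / (x - w)) hR.le hρ,
    ← circleIntegral.integral_const_mul]
  · refine circleIntegral.integral_congr hρ fun z hz => ?_
    exact Complex.circleIntegral_div_sub_of_differentiable_on_off_countable countable_empty hw
      (fun x hx => (hf x hx z hz).2.continuousAt.continuousWithinAt)
      fun x hx => (hf x (Metric.ball_subset_closedBall hx.1) z hz).2
  · rintro ⟨z, x⟩ ⟨hz, hx⟩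
    refine ContinuousAt.continuousWithinAt (ContinuousAt.div ?_ (by fun_prop)
      (sub_ne_zero.2 fun h => ?_))
    · exact ContinuousAt.comp (g := Function.uncurry f) (x := (z, x))
        (f := fun y : ℂ × ℂ => (y.2, y.1))
        (hf x (Metric.sphere_subset_closedBall hx) z hz).1 (by fun_prop)
    · simp only at h
      rw [Metric.mem_sphere, h] at hx
      exact (Metric.mem_ball.1 hw).ne hx

theorem differentiableAt_circleIntegral {f : ℂ → ℂ → ℂ} {w : ℂ} {ρ : ℝ} (hρ : 0 ≤ ρ)
    (hf : ∀ᶠ x in 𝓝 w, ∀ z ∈ Metric.sphere 0 ρ,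
      ContinuousAt (Function.uncurry f) (x, z) ∧ DifferentiableAt ℂ (fun x => f x z) x) :
    DifferentiableAt ℂ (fun x => ∮ z in C(0, ρ), f x z) w := by
  obtain ⟨R, hR, h⟩ := Metric.nhds_basis_closedBall.mem_iff.1 hf
  lift R to NNReal using hR.le
  have hR' : 0 < R := by exact_mod_cast hR
  set F : ℂ → ℂ := fun x => ∮ z in C(0, ρ), f x z with hF
  have hFc : ContinuousOn F (Metric.closedBall w R) :=
    continuousOn_circleIntegral hρ fun x hx z hz => (h hx z hz).1
  have hps := (hasFPowerSeriesOn_cauchy_integral (f := F) (c := w) (R := R)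
    ((hFc.mono Metric.sphere_subset_closedBall).circleIntegrable R.2) hR').analyticAt
  refine (hps.differentiableAt).congr_of_eventuallyEq ?_
  filter_upwards [Metric.ball_mem_nhds w hR] with x hx
  have := cauchy_circleIntegral hρ hx fun x hx z hz => h hx z hz
  simp only [smul_eq_mul, ← div_eq_inv_mul]
  rw [this, div_eq_inv_mul, inv_mul_cancel_left₀ Complex.two_pi_I_ne_zero]

/-- Cauchy's formula in a disc with a removable singularity at the centre. -/
theorem cauchy_of_removable {f : ℂ → ℂ} {c w : ℂ} {R : ℝ} (hw : w ∈ Metric.ball c R) (hwc : w ≠ c)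
    (hd : ∀ z ∈ Metric.closedBall c R, z ≠ c → DifferentiableAt ℂ f z)
    (hlim : Tendsto (fun z => (z - c) * f z) (𝓝[≠] c) (𝓝 0)) :
    (∮ z in C(c, R), f z / (z - w)) = 2 * Real.pi * Complex.I * f w := by
  have hR : 0 < R := Metric.pos_of_mem_ball hw
  set g := Function.update f c (limUnder (𝓝[≠] c) f) with hg
  have hgf : ∀ z ≠ c, g z = f z := fun z hz => Function.update_of_ne hz _ _
  have ho : (fun z => f z - f c) =o[𝓝[≠] c] fun z => (z - c)⁻¹ := by
    refine Asymptotics.isLittleO_of_tendsto' ?_ ?_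
    · filter_upwards [self_mem_nhdsWithin] with z hz h
      exact absurd h (inv_ne_zero (sub_ne_zero.2 hz))
    · have h2 : Tendsto (fun z => (z - c) * f c) (𝓝[≠] c) (𝓝 0) := by
        have : ContinuousAt (fun z => (z - c) * f c) c := by fun_prop
        simpa using this.tendsto.mono_left nhdsWithin_le_nhds
      have := hlim.sub h2
      rw [sub_zero] at this
      refine this.congr fun z => ?_
      rw [div_inv_eq_mul]; ring
  have hgd : DifferentiableOn ℂ g (Metric.ball c R) :=
    Complex.differentiableOn_update_limUnder_of_isLittleO (Metric.ball_mem_nhds c hR)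
      (fun z hz => (hd z (Metric.ball_subset_closedBall hz.1) hz.2).differentiableWithinAt) ho
  have hgd' : ∀ z ∈ Metric.closedBall c R, DifferentiableAt ℂ g z := fun z hz => by
    rcases eq_or_ne z c with rfl | hzc
    · exact hgd.differentiableAt (Metric.ball_mem_nhds _ hR)
    · refine (hd z hz hzc).congr_of_eventuallyEq ?_
      filter_upwards [isOpen_ne.mem_nhds hzc] with y hy using hgf y hy
  rw [← hgf w hwc, ← Complex.circleIntegral_div_sub_of_differentiable_on_off_countable
    countable_empty hw (f := g) (fun z hz => (hgd' z hz).continuousAt.continuousWithinAt)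
    fun z hz => hgd' z (Metric.ball_subset_closedBall hz.1)]
  refine circleIntegral.integral_congr hR.le fun z hz => ?_
  rw [hgf z (Metric.ne_of_mem_sphere hz hR.ne')]

end Parameters

end EllipticBeta

namespace EllipticBeta

/-! ## The symmetry-broken integral as a circle integral plus residues -/

section BrokenIntegral

/-- The residue of the symmetry-broken integrand at `1 / (t_0 q ^ n)` times the prefactor, after
cancellation. -/
noncomputable def residueTerm (k : Fin 4 → Fin 4 → ℂ) (b : ℂ) (t : Fin 4 → ℂ) (q : ℂ) (n : ℕ) : ℂ :=
  prefCore k b t q * numCore k b t q (t 0 * q ^ n)⁻¹ *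
    (shiftProd (b * t 0 ^ 2 * k 1 0 * q ^ n) (k 3 0) q n * shiftProd (q / b) (k 3 0) q n *
    ∏ s : Fin 3, (shiftProd (t 0 * t s.succ * k 1 s.succ) (k 3 0) q n *
      shiftProd (q * t 0 * k 3 s.succ / (b * t s.succ)) (k 3 0) q n)) /
    (pqPoch (t 0 ^ 2 * k 1 0 * q ^ n) (k 3 0) q *
      (poleFactor q n * denOut k b t q (t 0 * q ^ n)⁻¹))

/-- The residue term without the factor that vanishes if `t_0 ^ 2 = q ^ {-N}`. -/
noncomputable def residueCore (k : Fin 4 → Fin 4 → ℂ) (b : ℂ) (t : Fin 4 → ℂ) (q : ℂ) (n : ℕ) : ℂ :=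
  prefCore k b t q * numCore k b t q (t 0 * q ^ n)⁻¹ *
    (shiftProd (b * t 0 ^ 2 * k 1 0 * q ^ n) (k 3 0) q n * shiftProd (q / b) (k 3 0) q n *
    ∏ s : Fin 3, (shiftProd (t 0 * t s.succ * k 1 s.succ) (k 3 0) q n *
      shiftProd (q * t 0 * k 3 s.succ / (b * t s.succ)) (k 3 0) q n)) /
    (poleFactor q n * denOut k b t q (t 0 * q ^ n)⁻¹)

theorem residueTerm_eq_residueCore_div (k : Fin 4 → Fin 4 → ℂ) (b : ℂ) (t : Fin 4 → ℂ) (q : ℂ)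
    (n : ℕ) : residueTerm k b t q n =
      residueCore k b t q n / pqPoch (t 0 ^ 2 * k 1 0 * q ^ n) (k 3 0) q := by
  rw [residueTerm, residueCore, div_div, mul_comm (pqPoch _ _ _)]

/-- The symmetry-broken integral, as an integral along the circle of radius `ρ` and the residues
of the first `K` poles outside it. -/
noncomputable def brokenIntegral (k : Fin 4 → Fin 4 → ℂ) (b : ℂ) (t : Fin 4 → ℂ) (q : ℂ) (ρ : ℝ)
    (K : ℕ) : ℂ :=
  pref k b t q * ((2 * Real.pi * Complex.I)⁻¹ * ∮ z in C(0, ρ), kernel k b t q z / z) +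
    ∑ n ∈ Finset.range K, residueTerm k b t q n

/-- The parameters for which the circle of radius `ρ` separates the poles apart from
`1 / (t_0 q ^ n)`, `n < K`. -/
structure Admissible (ρ : ℝ) (K : ℕ) (q : ℂ) (x : (Fin 4 → Fin 4 → ℂ) × ℂ × (Fin 4 → ℂ)) : Prop where
  b_ne : x.2.1 ≠ 0
  t_ne : ∀ r, x.2.2 r ≠ 0
  norm_p : ‖x.1 3 0‖ < 1
  in1 : ‖q / (x.2.1 * x.2.2 0)‖ < ρ
  in2 : ‖x.2.1 * x.1 1 0‖ < ρ ^ 2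
  in3 : ‖x.2.2 0 * x.1 1 0‖ < ρ
  in4 : ∀ s : Fin 3, ‖x.2.2 s.succ * x.1 1 s.succ‖ < ρ
  in5 : ∀ s : Fin 3, ‖q * x.1 3 s.succ / (x.2.1 * x.2.2 s.succ)‖ < ρ
  out1 : ‖x.1 2 0 * q / (x.2.1 * x.2.2 0)‖ * ρ < 1
  out2 : ‖x.2.1 * x.1 2 0‖ * ρ ^ 2 < 1
  out3 : ‖x.1 3 0 * x.2.2 0‖ * ρ < 1
  out4 : ∀ s : Fin 3, ‖x.2.2 s.succ * x.1 0 s.succ‖ * ρ < 1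
  out5 : ∀ s : Fin 3, ‖q * x.1 2 s.succ / (x.2.1 * x.2.2 s.succ)‖ * ρ < 1
  pole_lt : ∀ n ∈ Finset.range K, 1 < ‖x.2.2 0 * q ^ n‖ * ρ
  lt_pole : ‖x.2.2 0 * q ^ K‖ * ρ < 1

/-- The residues and the prefactor are defined. -/
structure Regular (q : ℂ) (x : (Fin 4 → Fin 4 → ℂ) × ℂ × (Fin 4 → ℂ)) : Prop where
  b_ne : qPoch (q / x.2.1 ^ 2) q ≠ 0
  t_ne : pqPoch (x.2.2 0 ^ 2 * x.1 1 0) (x.1 3 0) q ≠ 0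

theorem qPoch_ne_zero_of_norm_lt_one {q x : ℂ} (hq : ‖q‖ < 1) (hx : ‖x‖ < 1) : qPoch x q ≠ 0 := by
  rw [Ne, qPoch_eq_zero_iff hq]
  rintro ⟨n, h⟩
  have := congrArg norm h
  rw [norm_mul, norm_pow, norm_one] at this
  have h1 : ‖q‖ ^ n ≤ 1 := pow_le_one₀ (norm_nonneg _) hq.le
  nlinarith [norm_nonneg x, norm_nonneg q]

theorem pqPoch_ne_zero_of_norm_lt_one {p q x : ℂ} (hp : ‖p‖ < 1) (hq : ‖q‖ < 1) (hx : ‖x‖ < 1) :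
    pqPoch x p q ≠ 0 := by
  rw [Ne, pqPoch_eq_zero_iff hp hq]
  rintro ⟨m, n, h⟩
  have := congrArg norm h
  rw [norm_mul, norm_mul, norm_pow, norm_pow, norm_one] at this
  have h1 : ‖q‖ ^ n ≤ 1 := pow_le_one₀ (norm_nonneg _) hq.le
  have h2 : ‖p‖ ^ m ≤ 1 := pow_le_one₀ (norm_nonneg _) hp.le
  have h3 : ‖x‖ * ‖p‖ ^ m < 1 := (mul_le_of_le_one_right (norm_nonneg _) h2).trans_lt hx
  exact (((mul_le_of_le_one_right (by positivity) h1).trans_lt h3).ne this)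

variable {ρ : ℝ} {K : ℕ} {q : ℂ} {x : (Fin 4 → Fin 4 → ℂ) × ℂ × (Fin 4 → ℂ)}

theorem isOpen_admissible (ρ : ℝ) (K : ℕ) (q : ℂ) : IsOpen {x | Admissible ρ K q x} := by
  rw [isOpen_iff_mem_nhds]
  intro x hx
  have hb := hx.b_ne
  have ht := hx.t_ne
  have c (r : Fin 4) : ContinuousAt
    (fun x : (Fin 4 → Fin 4 → ℂ) × ℂ × (Fin 4 → ℂ) => x.2.2 r) x := by fun_prop
  have e0 (r : Fin 4) : x.2.1 * x.2.2 r ≠ 0 := mul_ne_zero hb (ht r)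
  have lt {f g : (Fin 4 → Fin 4 → ℂ) × ℂ × (Fin 4 → ℂ) → ℝ} (hf : ContinuousAt f x)
      (hg : ContinuousAt g x) (h : f x < g x) : ∀ᶠ y in 𝓝 x, f y < g y := hf.eventually_lt hg h
  have i1 := lt (f := fun x => ‖x.1 3 0‖) (g := fun _ => 1) (by fun_prop) (by fun_prop) hx.norm_p
  have i2 := lt (f := fun x => ‖q / (x.2.1 * x.2.2 0)‖) (g := fun _ => ρ)
    (by fun_prop (disch := exact e0 _)) (by fun_prop) hx.in1
  have i3 := lt (f := fun x => ‖x.2.1 * x.1 1 0‖) (g := fun _ => ρ ^ 2)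
    (by fun_prop) (by fun_prop) hx.in2
  have i4 := lt (f := fun x => ‖x.2.2 0 * x.1 1 0‖) (g := fun _ => ρ)
    (by fun_prop) (by fun_prop) hx.in3
  have i5 (s : Fin 3) := lt (f := fun x => ‖x.2.2 s.succ * x.1 1 s.succ‖) (g := fun _ => ρ)
    (by fun_prop) (by fun_prop) (hx.in4 s)
  have i6 (s : Fin 3) := lt (f := fun x => ‖q * x.1 3 s.succ / (x.2.1 * x.2.2 s.succ)‖)
    (g := fun _ => ρ) (by fun_prop (disch := exact e0 _)) (by fun_prop) (hx.in5 s)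
  have i7 := lt (f := fun x => ‖x.1 2 0 * q / (x.2.1 * x.2.2 0)‖ * ρ) (g := fun _ => 1)
    (by fun_prop (disch := exact e0 _)) (by fun_prop) hx.out1
  have i8 := lt (f := fun x => ‖x.2.1 * x.1 2 0‖ * ρ ^ 2) (g := fun _ => 1)
    (by fun_prop) (by fun_prop) hx.out2
  have i9 := lt (f := fun x => ‖x.1 3 0 * x.2.2 0‖ * ρ) (g := fun _ => 1)
    (by fun_prop) (by fun_prop) hx.out3
  have i10 (s : Fin 3) := lt (f := fun x => ‖x.2.2 s.succ * x.1 0 s.succ‖ * ρ) (g := fun _ => 1)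
    (by fun_prop) (by fun_prop) (hx.out4 s)
  have i11 (s : Fin 3) := lt (f := fun x => ‖q * x.1 2 s.succ / (x.2.1 * x.2.2 s.succ)‖ * ρ)
    (g := fun _ => 1) (by fun_prop (disch := exact e0 _)) (by fun_prop) (hx.out5 s)
  have i12 : ∀ᶠ y : (Fin 4 → Fin 4 → ℂ) × ℂ × (Fin 4 → ℂ) in 𝓝 x,
      ∀ n ∈ Finset.range K, 1 < ‖y.2.2 0 * q ^ n‖ * ρ :=
    (Filter.eventually_all_finset _).2 fun n hn =>
      lt (f := fun _ => 1) (g := fun x => ‖x.2.2 0 * q ^ n‖ * ρ) (by fun_prop) (by fun_prop)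
        (hx.pole_lt n hn)
  have i13 := lt (f := fun x => ‖x.2.2 0 * q ^ K‖ * ρ) (g := fun _ => 1)
    (by fun_prop) (by fun_prop) hx.lt_pole
  have j1 : ∀ᶠ y : (Fin 4 → Fin 4 → ℂ) × ℂ × (Fin 4 → ℂ) in 𝓝 x, y.2.1 ≠ 0 :=
    ContinuousAt.eventually_ne (by fun_prop) hb
  have j2 (r : Fin 4) : ∀ᶠ y : (Fin 4 → Fin 4 → ℂ) × ℂ × (Fin 4 → ℂ) in 𝓝 x, y.2.2 r ≠ 0 :=
    ContinuousAt.eventually_ne (c r) (ht r)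
  filter_upwards [i1, i2, i3, i4, eventually_all.2 i5, eventually_all.2 i6, i7, i8, i9,
    eventually_all.2 i10, eventually_all.2 i11, i12, i13, j1, eventually_all.2 j2]
    with y h1 h2 h3 h4 h5 h6 h7 h8 h9 h10 h11 h12 h13 h14 h15
  exact ⟨h14, h15, h1, h2, h3, h4, h5, h6, h7, h8, h9, h10, h11, h12, h13⟩

namespace Admissible

theorem denIn_ne_zero (hx : Admissible ρ K q x) (hq : ‖q‖ < 1) (hρ : 0 < ρ) {z : ℂ}
    (hz : ρ ≤ ‖z‖) : denIn x.1 x.2.1 x.2.2 q z ≠ 0 := by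
  have hz0 : 0 < ‖z‖ := hρ.trans_le hz
  have key : ∀ c : ℂ, ‖c‖ < ρ → pqPoch (c / z) (x.1 3 0) q ≠ 0 := fun c hc =>
    pqPoch_ne_zero_of_norm_lt_one hx.norm_p hq (by
      rw [norm_div, div_lt_one hz0]; exact hc.trans_le hz)
  have e : ∀ c d : ℂ, c / (d * z) = c / d / z := fun c d => by rw [div_div]
  have sq : pqPoch (x.2.1 * x.1 1 0 / z ^ 2) (x.1 3 0) q ≠ 0 :=
    pqPoch_ne_zero_of_norm_lt_one hx.norm_p hq (by
      rw [norm_div, norm_pow, div_lt_one (by positivity)]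
      exact hx.in2.trans_le (by gcongr))
  simp only [denIn, denInCore, e]
  refine mul_ne_zero (mul_ne_zero (mul_ne_zero (key _ hx.in1) sq)
    (Finset.prod_ne_zero_iff.2 fun s _ => mul_ne_zero (key _ (hx.in4 s)) (key _ (hx.in5 s))))
    (key _ hx.in3)

theorem denOut_ne_zero (hx : Admissible ρ K q x) (hq : ‖q‖ < 1) {z : ℂ}
    (hz : ‖z‖ ≤ ρ) : denOut x.1 x.2.1 x.2.2 q z ≠ 0 := by
  have key : ∀ c : ℂ, ‖c‖ * ρ < 1 → pqPoch (c * z) (x.1 3 0) q ≠ 0 := fun c hc =>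
    pqPoch_ne_zero_of_norm_lt_one hx.norm_p hq (by
      rw [norm_mul]; exact (by gcongr : ‖c‖ * ‖z‖ ≤ ‖c‖ * ρ).trans_lt hc)
  have e : ∀ c d : ℂ, c * z / d = c / d * z := fun c d => by ring
  have sq : pqPoch (x.2.1 * x.1 2 0 * z ^ 2) (x.1 3 0) q ≠ 0 :=
    pqPoch_ne_zero_of_norm_lt_one hx.norm_p hq (by
      rw [norm_mul, norm_pow]
      exact (by gcongr : _ ≤ ‖x.2.1 * x.1 2 0‖ * ρ ^ 2).trans_lt hx.out2)
  simp only [denOut, denOutCore, e]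
  refine mul_ne_zero (mul_ne_zero (mul_ne_zero (key _ hx.out1) sq)
    (Finset.prod_ne_zero_iff.2 fun s _ => mul_ne_zero (key _ (hx.out4 s)) (key _ (hx.out5 s))))
    (key _ hx.out3)

theorem norm_pole (hx : Admissible ρ K q x) (hq : ‖q‖ < 1) (hq0 : q ≠ 0) (n : ℕ) :
    if n < K then ‖(x.2.2 0 * q ^ n)⁻¹‖ < ρ else ρ < ‖(x.2.2 0 * q ^ n)⁻¹‖ := by
  have h0 : 0 < ‖x.2.2 0 * q ^ n‖ := norm_pos_iff.2 (mul_ne_zero (hx.t_ne 0) (pow_ne_zero _ hq0))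
  rw [norm_inv]
  split_ifs with h
  · rw [inv_lt_iff_one_lt_mul₀ h0]
    rw [mul_comm]
    exact hx.pole_lt n (Finset.mem_range.2 h)
  · rw [lt_inv_comm₀ (lt_of_le_of_lt (norm_nonneg _) hx.in1) h0, lt_inv_comm₀ h0
      (lt_of_le_of_lt (norm_nonneg _) hx.in1), ← one_div, lt_div_iff₀' h0]
    refine lt_of_le_of_lt ?_ hx.lt_pole
    have hρ : 0 ≤ ρ := (norm_nonneg _).trans hx.in1.le
    rw [norm_mul, norm_mul, norm_pow, norm_pow]
    have := pow_le_pow_of_le_one (norm_nonneg q) hq.le (not_lt.1 h)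
    gcongr

theorem qPoch_ne_zero (hx : Admissible ρ K q x) (hq : ‖q‖ < 1) (hq0 : q ≠ 0) {z : ℂ}
    (hz : ‖z‖ = ρ) : qPoch (x.2.2 0 * z) q ≠ 0 := fun h => by
  obtain ⟨n, rfl⟩ := (qPoch_mul_eq_zero_iff hq hq0 (hx.t_ne 0)).1 h
  have := hx.norm_pole hq hq0 n
  split_ifs at this <;> linarith

end Admissible

/-- At the pole each denominator factor has the form (x q^n;p,q). For all but one of them (x;p,q) is
a factor of the prefactor or of the numerator, so only the finite product `shiftProd` remains. The
exception is (t_0² k_{10} q^n;p,q), the one remaining inner factor that can vanish. -/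
theorem residueTerm_eq {k : Fin 4 → Fin 4 → ℂ} {b : ℂ} {t : Fin 4 → ℂ} (hq : ‖q‖ < 1)
    (hq0 : q ≠ 0) (hk : ‖k 3 0‖ < 1) (hb : b ≠ 0) (ht : ∀ r, t r ≠ 0) (n : ℕ)
    (h : denIn k b t q (t 0 * q ^ n)⁻¹ ≠ 0) :
    pref k b t q * (num k b t q (t 0 * q ^ n)⁻¹ / (denIn k b t q (t 0 * q ^ n)⁻¹ *
        (poleFactor q n * denOut k b t q (t 0 * q ^ n)⁻¹))) = residueTerm k b t q n := by
  have ht0 := ht 0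
  have e1 : q / (b * t 0 * (t 0 * q ^ n)⁻¹) = q / b * q ^ n := by field_simp
  have e2 : b * k 1 0 / (t 0 * q ^ n)⁻¹ ^ 2 = b * t 0 ^ 2 * k 1 0 * q ^ n * q ^ n := by
    field_simp
  have e3 : b * t 0 * k 1 0 / (t 0 * q ^ n)⁻¹ = b * t 0 ^ 2 * k 1 0 * q ^ n := by field_simp
  have e4 : t 0 * k 1 0 / (t 0 * q ^ n)⁻¹ = t 0 ^ 2 * k 1 0 * q ^ n := by field_simp
  have e5 : ∀ s : Fin 3, t s.succ * k 1 s.succ / (t 0 * q ^ n)⁻¹ =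
      t 0 * t s.succ * k 1 s.succ * q ^ n := fun s => by field_simp
  have e6 : ∀ s : Fin 3, q * k 3 s.succ / (b * t s.succ * (t 0 * q ^ n)⁻¹) =
      q * t 0 * k 3 s.succ / (b * t s.succ) * q ^ n := fun s => by
    have := ht s.succ
    field_simp
  simp only [denIn, denInCore, e1, e2, e4, e5, e6] at h
  simp only [num, denIn, denInCore, pref, e1, e2, e3, e4, e5, e6]
  rw [← shiftProd_mul hk hq (b * t 0 ^ 2 * k 1 0 * q ^ n) n, ← shiftProd_mul hk hq (q / b) n,
    Finset.prod_congr rfl fun s _ => congrArg₂ (· * ·)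
      (shiftProd_mul hk hq (t 0 * t (Fin.succ s) * k 1 s.succ) n).symm
      (shiftProd_mul hk hq (q * t 0 * k 3 (Fin.succ s) / (b * t s.succ)) n).symm, residueTerm]
  simp only [mul_ne_zero_iff, Finset.prod_ne_zero_iff, Finset.mem_univ, true_implies,
    forall_and] at h
  obtain ⟨⟨⟨h1, h2⟩, h3, h4⟩, h5⟩ := h
  simp only [Finset.prod_mul_distrib]
  have h3' := Finset.prod_ne_zero_iff.2 fun s (_ : s ∈ Finset.univ) => h3 s
  have h4' := Finset.prod_ne_zero_iff.2 fun s (_ : s ∈ Finset.univ) => h4 s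
  generalize ∏ s : Fin 3, pqPoch (t 0 * t (Fin.succ s) * k 1 s.succ * q ^ n) (k 3 0) q = A1 at *
  generalize ∏ s : Fin 3, pqPoch (q * t 0 * k 3 (Fin.succ s) / (b * t s.succ) * q ^ n) (k 3 0) q
    = A2 at *
  generalize pqPoch (q / b * q ^ n) (k 3 0) q = A3 at *
  generalize pqPoch (b * t 0 ^ 2 * k 1 0 * q ^ n * q ^ n) (k 3 0) q = A4 at *
  generalize pqPoch (t 0 ^ 2 * k 1 0 * q ^ n) (k 3 0) q = A5 at *
  generalize denOut k b t q (t 0 * q ^ n)⁻¹ = A6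
  generalize numCore k b t q (t 0 * q ^ n)⁻¹ = A7
  generalize shiftProd (q / b) (k 3 0) q n = A8
  generalize shiftProd (b * t 0 ^ 2 * k 1 0 * q ^ n) (k 3 0) q n = A9
  field_simp

/-- The prefactor times the integral along any separating contour. -/
theorem pref_mul_integral_eq_brokenIntegral (hρ : 0 < ρ) (hq : ‖q‖ < 1) (hq0 : q ≠ 0)
    (hx : Admissible ρ K q x) {C : Contour}
    (hC : C.Separates {z | z ≠ 0 ∧ denIn x.1 x.2.1 x.2.2 q z = 0}
      {z | z ≠ 0 ∧ (qPoch (x.2.2 0 * z) q = 0 ∨ denOut x.1 x.2.1 x.2.2 q z = 0)}) :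
    pref x.1 x.2.1 x.2.2 q *
      ((2 * Real.pi * Complex.I)⁻¹ * C.integral (fun z => kernel x.1 x.2.1 x.2.2 q z / z)) =
      brokenIntegral x.1 x.2.1 x.2.2 q ρ K := by
  rw [integral_kernel hρ hq hq0 hx.norm_p hx.b_ne hx.t_ne (fun z hz => hx.denIn_ne_zero hq hρ hz)
    (fun z hz => hx.denOut_ne_zero hq hz) (hx.norm_pole hq hq0) hC, mul_add, Finset.mul_sum,
    brokenIntegral]
  congr 1
  refine Finset.sum_congr rfl fun n _ => residueTerm_eq hq hq0 hx.norm_p hx.b_ne hx.t_ne n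
    fun h => ?_
  have ht0 := hx.t_ne 0
  have h1 := (hC.1 (x.2.2 0 * q ^ n)⁻¹ (Or.inr ⟨by positivity, h⟩)).2
  rw [(hC.2 (x.2.2 0 * q ^ n)⁻¹ ⟨by positivity,
    .inl ((qPoch_mul_eq_zero_iff hq hq0 ht0).2 ⟨n, rfl⟩)⟩).2] at h1
  exact zero_ne_one h1

namespace Admissible

theorem denOut_pole_ne_zero (hx : Admissible ρ K q x) (hq : ‖q‖ < 1) (hq0 : q ≠ 0) {n : ℕ}
    (hn : n < K) : denOut x.1 x.2.1 x.2.2 q (x.2.2 0 * q ^ n)⁻¹ ≠ 0 := by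
  have := hx.norm_pole hq hq0 n
  rw [if_pos hn] at this
  exact hx.denOut_ne_zero hq this.le

theorem pqPoch_shift_ne_zero (hx : Admissible ρ K q x) (h : Regular q x) (hq : ‖q‖ < 1) (n : ℕ) :
    pqPoch (x.2.2 0 ^ 2 * x.1 1 0 * q ^ n) (x.1 3 0) q ≠ 0 := by
  have := h.t_ne
  rw [← shiftProd_mul hx.norm_p hq _ n] at this
  exact right_ne_zero_of_mul this

theorem continuousAt_residueCore (hx : Admissible ρ K q x) (h : qPoch (q / x.2.1 ^ 2) q ≠ 0)
    (hq : ‖q‖ < 1) (hq0 : q ≠ 0) {n : ℕ} (hn : n < K) :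
    ContinuousAt (fun x : (Fin 4 → Fin 4 → ℂ) × ℂ × (Fin 4 → ℂ) =>
      residueCore x.1 x.2.1 x.2.2 q n) x := by
  have hp := hx.norm_p
  have hb := hx.b_ne
  have h0 := hx.t_ne 0
  have h1 := hx.t_ne 1
  have h2 := hx.t_ne 2
  have h3 := hx.t_ne 3
  have h4 := poleFactor_ne_zero hq hq0 n
  have h5 := hx.denOut_pole_ne_zero hq hq0 hn
  have c0 : ContinuousAt (fun x : (Fin 4 → Fin 4 → ℂ) × ℂ × (Fin 4 → ℂ) =>
      (x.1, x.2.1, x.2.2, (x.2.2 0 * q ^ n)⁻¹)) x := by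
    fun_prop (disch := first | assumption | positivity)
  have c1 : ContinuousAt (fun x : (Fin 4 → Fin 4 → ℂ) × ℂ × (Fin 4 → ℂ) =>
      numCore x.1 x.2.1 x.2.2 q (x.2.2 0 * q ^ n)⁻¹) x :=
    (continuousAt_numCore (x := (x.1, x.2.1, x.2.2, (x.2.2 0 * q ^ n)⁻¹)) hq hp hb hx.t_ne
      (by simp only; positivity)).comp (f := fun x : (Fin 4 → Fin 4 → ℂ) × ℂ × (Fin 4 → ℂ) =>
      (x.1, x.2.1, x.2.2, (x.2.2 0 * q ^ n)⁻¹)) c0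
  have c2 : ContinuousAt (fun x : (Fin 4 → Fin 4 → ℂ) × ℂ × (Fin 4 → ℂ) =>
      denOut x.1 x.2.1 x.2.2 q (x.2.2 0 * q ^ n)⁻¹) x :=
    (continuousAt_denOut (x := (x.1, x.2.1, x.2.2, (x.2.2 0 * q ^ n)⁻¹)) hq hp hb hx.t_ne).comp
      (f := fun x : (Fin 4 → Fin 4 → ℂ) × ℂ × (Fin 4 → ℂ) =>
      (x.1, x.2.1, x.2.2, (x.2.2 0 * q ^ n)⁻¹)) c0
  have c3 := continuousAt_prefCore hq hp hb hx.t_ne h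
  unfold residueCore
  simp only [Fin.prod_univ_three, Fin.succ_zero_eq_one, Fin.succ_one_eq_two,
    show Fin.succ (2 : Fin 3) = 3 from rfl]
  fun_prop (disch := first | assumption | positivity)

theorem continuousAt_residueTerm (hx : Admissible ρ K q x) (h : Regular q x) (hq : ‖q‖ < 1)
    (hq0 : q ≠ 0) {n : ℕ} (hn : n < K) :
    ContinuousAt (fun x : (Fin 4 → Fin 4 → ℂ) × ℂ × (Fin 4 → ℂ) =>
      residueTerm x.1 x.2.1 x.2.2 q n) x := by
  have hp := hx.norm_p
  have h6 := hx.pqPoch_shift_ne_zero h hq n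
  have c1 := hx.continuousAt_residueCore h.b_ne hq hq0 hn
  simp only [residueTerm_eq_residueCore_div]
  fun_prop (disch := assumption)

theorem continuousAt_kernel_div (hx : Admissible ρ K q x) (hρ : 0 < ρ) (hq : ‖q‖ < 1)
    (hq0 : q ≠ 0) {z : ℂ} (hz : z ∈ Metric.sphere (0 : ℂ) ρ) :
    ContinuousAt (Function.uncurry fun (x : (Fin 4 → Fin 4 → ℂ) × ℂ × (Fin 4 → ℂ)) (z : ℂ) =>
      kernel x.1 x.2.1 x.2.2 q z / z) (x, z) := by
  have hz' : ‖z‖ = ρ := mem_sphere_zero_iff_norm.1 hz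
  have hz0 : z ≠ 0 := norm_pos_iff.1 (hz' ▸ hρ)
  refine ContinuousAt.div ?_ continuousAt_snd hz0
  exact (continuousAt_kernel (x := (x.1, x.2.1, x.2.2, z)) hq hx.norm_p hx.b_ne hx.t_ne hz0
    (hx.denIn_ne_zero hq hρ hz'.ge) (hx.qPoch_ne_zero hq hq0 hz')
    (hx.denOut_ne_zero hq hz'.le)).comp (x := (x, z))
    (f := fun y : ((Fin 4 → Fin 4 → ℂ) × ℂ × (Fin 4 → ℂ)) × ℂ => (y.1.1, y.1.2.1, y.1.2.2, y.2))
    (by fun_prop)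

theorem continuousAt_brokenIntegral (hx : Admissible ρ K q x) (h : Regular q x) (hρ : 0 < ρ)
    (hq : ‖q‖ < 1) (hq0 : q ≠ 0) :
    ContinuousAt (fun x : (Fin 4 → Fin 4 → ℂ) × ℂ × (Fin 4 → ℂ) =>
      brokenIntegral x.1 x.2.1 x.2.2 q ρ K) x := by
  have c1 := continuousAt_pref hq hx.norm_p hx.b_ne hx.t_ne h.b_ne
  have c2 : ContinuousAt (fun x : (Fin 4 → Fin 4 → ℂ) × ℂ × (Fin 4 → ℂ) =>
      ∮ z in C(0, ρ), kernel x.1 x.2.1 x.2.2 q z / z) x :=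
    (continuousOn_circleIntegral (f := fun (x : (Fin 4 → Fin 4 → ℂ) × ℂ × (Fin 4 → ℂ)) (z : ℂ) =>
      kernel x.1 x.2.1 x.2.2 q z / z) hρ.le fun y (hy : Admissible ρ K q y) z hz =>
      hy.continuousAt_kernel_div hρ hq hq0 hz).continuousAt
      ((isOpen_admissible ρ K q).mem_nhds hx)
  have c3 : ContinuousAt (fun x : (Fin 4 → Fin 4 → ℂ) × ℂ × (Fin 4 → ℂ) =>
      ∑ n ∈ Finset.range K, residueTerm x.1 x.2.1 x.2.2 q n) x :=
    tendsto_finsetSum _ fun n hn =>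
      hx.continuousAt_residueTerm h hq hq0 (Finset.mem_range.1 hn)
  unfold brokenIntegral
  fun_prop

end Admissible

section Differentiability

variable {k : Fin 4 → Fin 4 → ℂ} {g : ℂ → ℂ × (Fin 4 → ℂ)} {w : ℂ}

/-- Holomorphy is stated along maps g of one complex variable, which is the form used for Cauchy's
formula in a single coordinate. -/
theorem differentiableAt_residueTerm (hg : Differentiable ℂ g) (hx : Admissible ρ K q (k, g w))
    (h : Regular q (k, g w)) (hq : ‖q‖ < 1) (hq0 : q ≠ 0) {n : ℕ} (hn : n < K) :
    DifferentiableAt ℂ (fun z => residueTerm k (g z).1 (g z).2 q n) w := by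
  have hp : ‖k 3 0‖ < 1 := hx.norm_p
  have hb : (g w).1 ≠ 0 := hx.b_ne
  have ht : ∀ r, (g w).2 r ≠ 0 := hx.t_ne
  have h0 := ht 0
  have h1 := ht 1
  have h2 := ht 2
  have h3 := ht 3
  have h4 := poleFactor_ne_zero hq hq0 n
  have h5 := hx.denOut_pole_ne_zero hq hq0 hn
  have h6 := hx.pqPoch_shift_ne_zero h hq n
  have gw := hg w
  have g1 : DifferentiableAt ℂ (fun z => (g z).1) w := gw.fst
  have g2 : DifferentiableAt ℂ (fun z => (g z).2) w := gw.snd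
  have c0 : DifferentiableAt ℂ (fun z => ((g z).1, (g z).2, ((g z).2 0 * q ^ n)⁻¹)) w := by
    fun_prop (disch := first | assumption | positivity)
  have c1 : DifferentiableAt ℂ (fun z => numCore k (g z).1 (g z).2 q ((g z).2 0 * q ^ n)⁻¹) w :=
    (differentiableAt_numCore (x := ((g w).1, (g w).2, ((g w).2 0 * q ^ n)⁻¹)) hq hp hb ht
      (by simp only; positivity)).comp w (f := fun z =>
      ((g z).1, (g z).2, ((g z).2 0 * q ^ n)⁻¹)) c0
  have c2 : DifferentiableAt ℂ (fun z => denOut k (g z).1 (g z).2 q ((g z).2 0 * q ^ n)⁻¹) w :=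
    (differentiableAt_denOut (x := ((g w).1, (g w).2, ((g w).2 0 * q ^ n)⁻¹)) hq hp hb ht).comp w
      (f := fun z => ((g z).1, (g z).2, ((g z).2 0 * q ^ n)⁻¹)) c0
  have c3 : DifferentiableAt ℂ (fun z => prefCore k (g z).1 (g z).2 q) w :=
    (differentiableAt_prefCore hq hp hb ht h.b_ne).comp w gw
  unfold residueTerm
  simp only [Fin.prod_univ_three, Fin.succ_zero_eq_one, Fin.succ_one_eq_two,
    show Fin.succ (2 : Fin 3) = 3 from rfl] at *
  fun_prop (disch := first | assumption | positivity)

theorem differentiableAt_circleIntegral_kernel (hg : Differentiable ℂ g)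
    (hx : Admissible ρ K q (k, g w)) (hρ : 0 < ρ) (hq : ‖q‖ < 1) (hq0 : q ≠ 0) :
    DifferentiableAt ℂ (fun x => ∮ z in C(0, ρ), kernel k (g x).1 (g x).2 q z / z) w := by
  refine differentiableAt_circleIntegral (f := fun x z => kernel k (g x).1 (g x).2 q z / z)
    hρ.le ?_
  have hgc : Continuous fun x => (k, g x) := continuous_const.prodMk hg.continuous
  filter_upwards [hgc.continuousAt.eventually_mem ((isOpen_admissible ρ K q).mem_nhds hx)]
    with x (hx : Admissible ρ K q (k, g x)) z hz
  have hz' : ‖z‖ = ρ := mem_sphere_zero_iff_norm.1 hz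
  have hz0 : z ≠ 0 := norm_pos_iff.1 (hz' ▸ hρ)
  constructor
  · exact (hx.continuousAt_kernel_div hρ hq hq0 hz).comp (x := (x, z))
      (f := fun y : ℂ × ℂ => ((k, g y.1), y.2))
      ((hgc.comp continuous_fst).prodMk continuous_snd).continuousAt
  · refine DifferentiableAt.div ?_ (differentiableAt_const z) hz0
    exact (differentiableAt_kernel (x := ((g x).1, (g x).2, z)) hq hx.norm_p hx.b_ne hx.t_ne hz0
      (hx.denIn_ne_zero hq hρ hz'.ge) (hx.qPoch_ne_zero hq hq0 hz')
      (hx.denOut_ne_zero hq hz'.le)).comp x (f := fun x => ((g x).1, (g x).2, z))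
      ((hg x).fst.prodMk ((hg x).snd.prodMk (differentiableAt_const z)))

theorem differentiableAt_brokenIntegral (hg : Differentiable ℂ g)
    (hx : Admissible ρ K q (k, g w)) (h : Regular q (k, g w)) (hρ : 0 < ρ) (hq : ‖q‖ < 1)
    (hq0 : q ≠ 0) :
    DifferentiableAt ℂ (fun z => brokenIntegral k (g z).1 (g z).2 q ρ K) w := by
  have c1 : DifferentiableAt ℂ (fun z => pref k (g z).1 (g z).2 q) w :=
    (differentiableAt_pref hq hx.norm_p hx.b_ne hx.t_ne h.b_ne).comp w (hg w)
  have c2 := differentiableAt_circleIntegral_kernel hg hx hρ hq hq0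
  have c3 : DifferentiableAt ℂ (fun z => ∑ n ∈ Finset.range K,
      residueTerm k (g z).1 (g z).2 q n) w :=
    DifferentiableAt.fun_sum fun n hn =>
      differentiableAt_residueTerm hg hx h hq hq0 (Finset.mem_range.1 hn)
  unfold brokenIntegral
  fun_prop

end Differentiability

end BrokenIntegral

end EllipticBeta

namespace EllipticBeta

/-! ## Contours separating the zeros of a function from their inverses -/

section Separation

variable {f : ℂ → ℂ} {B : ℝ}

theorem finite_zeros_union (hf : ∀ z ≠ 0, DifferentiableAt ℂ f z) (hB : 0 < B)
    (hfB : ∀ z, B ≤ ‖z‖ → f z ≠ 0) (r R : ℝ) (hr : 0 < r) :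
    {z ∈ {z | z ≠ 0 ∧ f z = 0} ∪ {z | z ≠ 0 ∧ f z⁻¹ = 0} | r ≤ ‖z‖ ∧ ‖z‖ ≤ R}.Finite := by
  have hBn : ‖(B : ℂ)‖ = B := by simp [abs_of_pos hB]
  have hB0 : (B : ℂ) ≠ 0 := by exact_mod_cast hB.ne'
  have h1 := finite_zeros hf hB0 (hfB _ hBn.ge) r R hr
  have h2 := finite_zeros (f := fun z => f z⁻¹) (fun z hz =>
    DifferentiableAt.comp z (hf _ (inv_ne_zero hz)) (differentiableAt_inv hz)) (z₀ := (B : ℂ)⁻¹)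
    (inv_ne_zero hB0) (by simpa using hfB _ hBn.ge) r R hr
  refine (h1.union h2).subset ?_
  rintro z ⟨hz | hz, h⟩
  · exact .inl ⟨hz.2, h⟩
  · exact .inr ⟨hz.2, h⟩

theorem exists_separates_zeros (hf : ∀ z ≠ 0, DifferentiableAt ℂ f z) (hB : 0 < B)
    (hfB : ∀ z, B ≤ ‖z‖ → f z ≠ 0) (hne : ∀ z, z ≠ 0 → f z = 0 → f z⁻¹ ≠ 0) :
    ∃ C : Contour, C.Separates {z | z ≠ 0 ∧ f z = 0} {z | z ≠ 0 ∧ f z⁻¹ = 0} ∧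
      ∀ i s, C.arc i s ≠ 0 := by
  have hfin := finite_zeros_union hf hB hfB
  refine Contour.exists_separates (B := B) (Set.disjoint_left.2 fun z h1 h2 => hne z h1.1 h1.2 h2.2)
    (fun z hz => ?_) (fun r hr => (hfin r B hr).subset fun z hz => ?_)
    (fun R => (hfin B⁻¹ R (by positivity)).subset fun z hz => ?_) (by simp)
  · by_contra! h
    exact hfB z h.le hz.2
  · refine ⟨.inl hz.1, hz.2, ?_⟩
    by_contra! h
    exact hfB z h.le hz.1.2
  · refine ⟨.inr hz.1, ?_, hz.2⟩
    by_contra! h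
    refine hfB z⁻¹ ?_ hz.1.2
    rw [norm_inv, le_inv_comm₀ hB (norm_pos_iff.2 hz.1.1)]
    exact h.le

theorem Contour.isOpen_index_eq (C : Contour) (c : ℂ) : IsOpen {a | a ∉ C.trace ∧ C.index a = c} :=
  isOpen_iff_mem_nhds.2 fun a ha => by
    filter_upwards [C.eventually_index_eq ha.1] with z hz using ⟨hz.1, hz.2.trans ha.2⟩

/-- Points that avoid a compact piece of the plane near a given parameter. -/
theorem eventually_ne_zero_of_compact {X : Type*} [TopologicalSpace X] {f : X → ℂ → ℂ} {x₀ : X}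
    {K : Set ℂ} (hK : IsCompact K) (hf : ∀ z ∈ K, ContinuousAt (Function.uncurry f) (x₀, z))
    (h0 : ∀ z ∈ K, f x₀ z ≠ 0) : ∀ᶠ x in 𝓝 x₀, ∀ z ∈ K, f x z ≠ 0 :=
  hK.eventually_forall_of_forall_eventually fun z hz => (hf z hz).eventually_ne (h0 z hz)

/-- A contour keeps separating when the parameters move slightly. Zeros close to 0 have index 1 and
zeros beyond `B` do not occur. What remains is a compact annulus without the open set of index 1,
where f has no zeros at `x₀` and hence none nearby. Outer points are treated alike. -/
theorem eventually_separates {X : Type*} [TopologicalSpace X] {f : X → ℂ → ℂ} {x₀ : X}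
    (hf : ∀ z ≠ 0, ContinuousAt (Function.uncurry f) (x₀, z)) (hB : 0 < B)
    (hfB : ∀ᶠ x in 𝓝 x₀, ∀ z, B ≤ ‖z‖ → f x z ≠ 0) {C : Contour}
    (hC : C.Separates {z | z ≠ 0 ∧ f x₀ z = 0} {z | z ≠ 0 ∧ f x₀ z⁻¹ = 0}) :
    ∀ᶠ x in 𝓝 x₀, C.Separates {z | z ≠ 0 ∧ f x z = 0} {z | z ≠ 0 ∧ f x z⁻¹ = 0} := by
  have hcpt : ∀ (S : Set ℂ) (r R : ℝ), IsOpen S →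
      IsCompact ({z : ℂ | r ≤ ‖z‖ ∧ ‖z‖ ≤ R} \ S) := fun S r R hS => by
    refine ((isCompact_closedBall (0 : ℂ) R).of_isClosed_subset
      ((isClosed_le continuous_const continuous_norm).inter
        (isClosed_le continuous_norm continuous_const)) fun z hz => by simpa using hz.2).diff hS
  have h0 := hC.1 0 (mem_insert 0 _)
  obtain ⟨ε, hε, hεS⟩ := Metric.isOpen_iff.1 (C.isOpen_index_eq 1) 0 h0
  obtain ⟨R, hR, hRC⟩ := C.exists_norm_lt
  have e1 := eventually_ne_zero_of_compact (f := f) (x₀ := x₀)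
    (hcpt {a | a ∉ C.trace ∧ C.index a = 1} ε B (C.isOpen_index_eq 1))
    (fun z hz => hf z (norm_pos_iff.1 (hε.trans_le hz.1.1))) fun z hz h =>
      hz.2 (hC.1 z (.inr ⟨norm_pos_iff.1 (hε.trans_le hz.1.1), h⟩))
  have hB' : 0 < B⁻¹ := by positivity
  have e2 := eventually_ne_zero_of_compact (f := fun x z => f x z⁻¹) (x₀ := x₀)
    (hcpt {a | a ∉ C.trace ∧ C.index a = 0} B⁻¹ R (C.isOpen_index_eq 0))
    (fun z hz => by
      have hz0 : z ≠ 0 := norm_pos_iff.1 (hB'.trans_le hz.1.1)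
      exact (hf z⁻¹ (inv_ne_zero hz0)).comp (x := (x₀, z)) (f := fun y : X × ℂ => (y.1, y.2⁻¹))
        (continuousAt_fst.prodMk (continuousAt_snd.inv₀ hz0))) fun z hz h =>
      hz.2 (hC.2 z ⟨norm_pos_iff.1 (hB'.trans_le hz.1.1), h⟩)
  filter_upwards [e1, e2, hfB] with x h1 h2 h3
  refine ⟨fun z hz => ?_, fun z hz => ?_⟩
  · rcases hz with rfl | ⟨hz0, hz⟩
    · exact h0
    by_contra hcon
    rcases lt_or_ge ‖z‖ ε with h | h
    · exact hcon (hεS (by simpa using h))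
    rcases le_or_gt B ‖z‖ with h' | h'
    · exact h3 z h' hz
    · exact h1 z ⟨⟨h, h'.le⟩, hcon⟩ hz
  · obtain ⟨hz0, hz⟩ := hz
    by_contra hcon
    have hz' := norm_pos_iff.2 hz0
    rcases lt_or_ge ‖z‖ B⁻¹ with h | h
    · refine h3 z⁻¹ ?_ hz
      rw [norm_inv, le_inv_comm₀ hB hz']
      exact h.le
    rcases le_or_gt R ‖z‖ with h' | h'
    · exact hcon (C.index_eq_zero_of_norm_lt fun y hy => (hRC y hy).trans_le h')
    · exact h2 z ⟨⟨h, h'.le⟩, hcon⟩ hz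

theorem Contour.separates_mono {C : Contour} {I O I' O' : Set ℂ} (h : C.Separates I O)
    (hI : I' ⊆ I) (hO : O' ⊆ O) : C.Separates I' O' :=
  ⟨fun a ha => h.1 a (Set.insert_subset_insert hI ha), fun a ha => h.2 a (hO ha)⟩

theorem Contour.integral_eq_of_separates_zeros {C C' : Contour} {f g : ℂ → ℂ} {B : ℝ}
    (hf : ∀ z ≠ 0, DifferentiableAt ℂ f z) (hB : 0 < B) (hfB : ∀ z, B ≤ ‖z‖ → f z ≠ 0)
    (hC : C.Separates {z | z ≠ 0 ∧ f z = 0} {z | z ≠ 0 ∧ f z⁻¹ = 0})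
    (hC' : C'.Separates {z | z ≠ 0 ∧ f z = 0} {z | z ≠ 0 ∧ f z⁻¹ = 0})
    {m d : ℂ → ℂ} (hm : ∀ z ≠ 0, DifferentiableAt ℂ m z) (hd : ∀ z ≠ 0, DifferentiableAt ℂ d z)
    (hd0 : ∀ z ≠ 0, f z ≠ 0 → f z⁻¹ ≠ 0 → d z ≠ 0) (hg : ∀ z, g z = m z / d z) :
    C.integral g = C'.integral g := by
  have an : ∀ f : ℂ → ℂ, (∀ z ≠ 0, DifferentiableAt ℂ f z) → ∀ z ≠ 0, MeromorphicAt f z :=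
    fun f hf z z0 => (DifferentiableOn.analyticAt (s := {0}ᶜ)
      (fun z hz => (hf z hz).differentiableWithinAt)
      (isOpen_compl_singleton.mem_nhds z0)).meromorphicAt
  have e : g = fun z => m z / d z := funext hg
  subst e
  refine Contour.integral_eq_of_separates hC hC' (finite_zeros_union hf hB hfB)
    (fun z z0 h1 h2 => ?_) fun z z0 => (an m hm z z0).div (an d hd z z0)
  simp only [Set.mem_ofPred_eq, not_and] at h1 h2
  exact (hm z z0).div (hd z z0) (hd0 z z0 (h1 z0) (h2 z0))

theorem Contour.separates_inv_zeros {C : Contour} (h : ∀ i s, C.arc i s ≠ 0)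
    (hC : C.Separates {z | z ≠ 0 ∧ f z = 0} {z | z ≠ 0 ∧ f z⁻¹ = 0}) :
    (C.inv h).Separates {z | z ≠ 0 ∧ f z = 0} {z | z ≠ 0 ∧ f z⁻¹ = 0} :=
  Contour.separates_inv h (fun z hz => ⟨hz.1, inv_ne_zero hz.1, by simpa using hz.2⟩)
    (fun z hz => ⟨hz.1, inv_ne_zero hz.1, hz.2⟩) hC

end Separation

end EllipticBeta

namespace EllipticBeta

/-! ## The quotient that defines `ellE` at generic parameters -/

theorem Contour.continuousOn_integral {X : Type*} [TopologicalSpace X] [FirstCountableTopology X]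
    (C : Contour) {f : X → ℂ → ℂ} {U : Set X}
    (hf : ∀ x ∈ U, ∀ z ∈ C.trace, ContinuousAt (Function.uncurry f) (x, z)) :
    ContinuousOn (fun x => C.integral (f x)) U := by
  rw [continuousOn_iff_continuous_domRestrict]
  have hp : ∀ s : ℝ, (Set.projIcc (0 : ℝ) 1 zero_le_one s : ℝ) ∈ Icc (0 : ℝ) 1 := fun s =>
    (Set.projIcc (0 : ℝ) 1 zero_le_one s).2
  have e : ∀ x, C.integral (f x) = ∑ i, ∫ s in (0 : ℝ)..1,
      f x (C.arc i (Set.projIcc (0 : ℝ) 1 zero_le_one s)) * deriv (C.arc i) s := fun x => by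
    refine Finset.sum_congr rfl fun i _ => intervalIntegral.integral_congr fun s hs => ?_
    rw [uIcc_of_le zero_le_one] at hs
    simp only [Set.projIcc_of_mem zero_le_one hs]
  have : (U.domRestrict fun x => C.integral (f x)) = fun x : U => ∑ i, ∫ s in (0 : ℝ)..1,
      f x (C.arc i (Set.projIcc (0 : ℝ) 1 zero_le_one s)) * deriv (C.arc i) s :=
    funext fun x => e x
  rw [this]
  refine continuous_finsetSum _ fun i _ => ?_
  refine intervalIntegral.continuous_parametric_intervalIntegral_of_continuous'
    (f := fun (x : U) s => f x (C.arc i (Set.projIcc (0 : ℝ) 1 zero_le_one s)) *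
      deriv (C.arc i) s) ?_ _ _
  refine Continuous.mul ?_ ((C.continuous_deriv_arc i).comp continuous_snd)
  rw [continuous_iff_continuousAt]
  rintro ⟨x, s⟩
  have hc : Continuous fun y : U × ℝ =>
      ((y.1 : X), C.arc i (Set.projIcc (0 : ℝ) 1 zero_le_one y.2)) :=
    (continuous_subtype_val.comp continuous_fst).prodMk ((C.continuous_arc i).comp
      (continuous_subtype_val.comp (continuous_projIcc.comp continuous_snd)))
  exact ContinuousAt.comp (g := Function.uncurry f) (x := (x, s))
    (f := fun y : U × ℝ => ((y.1 : X), C.arc i (Set.projIcc (0 : ℝ) 1 zero_le_one y.2)))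
    (hf x x.2 _ (C.arc_mem_trace i (hp s))) hc.continuousAt

section Generic

noncomputable section

/-- The function of `z` that vanishes at the points `u p ^ j q ^ k`, for `u` in `params b t p q`. -/
def polesIn (b : ℂ) (t : Fin 4 → ℂ) (p q z : ℂ) : ℂ :=
  pqPoch (b / z ^ 2) p q * ∏ r, (pqPoch (t r / z) p q * pqPoch (p * q / (b * t r * z)) p q)

/-- The numerator of `symIntegrand`. -/
def symNum (b : ℂ) (t : Fin 4 → ℂ) (p q z : ℂ) : ℂ :=
  theta (z ^ 2) p * theta (z ^ 2)⁻¹ q *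
    (∏ r, (pqPoch (p * q / (t r * z)) p q * pqPoch (p * q * z / t r) p q *
        pqPoch (b * t r * z) p q * pqPoch (b * t r / z) p q)) *
    (pqPoch (p * q / (b * z ^ 2)) p q * pqPoch (p * q * z ^ 2 / b) p q)

/-- The factor in front of the beta integral, divided by `denom`. -/
def pairFactor (b : ℂ) (t : Fin 4 → ℂ) (p q : ℂ) : ℂ :=
  ((∏ s : Fin 3, (pqPoch (q * t s.succ * p / (b * t 0)) p q *
      pqPoch (q ^ 2 * (p * p) / (b ^ 2 * t 0 * t s.succ)) p q)) *
    (crossFactor (unitScale p) b t q 1 2 * crossFactor (unitScale p) b t q 1 3 *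
      crossFactor (unitScale p) b t q 2 3) *
    pqPoch (p * q / b) p q ^ 4 * ∏ s : Fin 3, (pqPoch (t 0 * t s.succ) p q *
      pqPoch (q * t 0 * p / (b * t s.succ)) p q)) *
  (pqPoch (-b) p q * pqPoch (-b * q) p q * pqPoch (-b * p) p q * pqPoch (-b * p * q) p q *
      (pqPoch (b ^ 2 * q) (p ^ 2) (q ^ 2) * pqPoch (b ^ 2 * p) (p ^ 2) (q ^ 2) *
       pqPoch (b ^ 2 * p * q) (p ^ 2) (q ^ 2) ^ 2 * pqPoch (b ^ 2 * p * q ^ 2) (p ^ 2) (q ^ 2) *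
       pqPoch (b ^ 2 * p ^ 2 * q) (p ^ 2) (q ^ 2)) ^ 2) * (qPoch p p * qPoch q q)

/-- The quotient whose continuation is `ellE`. -/
def betaQuotient (p q : ℂ) (x : ℂ × (Fin 4 → ℂ)) : ℂ :=
  beta (params x.1 x.2 p q) p q / denom x.1 x.2 p q

end

variable {b : ℂ} {t : Fin 4 → ℂ} {p q : ℂ}

/-- After this cancellation the quotient defining E at generic parameters is `pairFactor` times an
integral, with no denominator left. -/
theorem pairs_eq_denom_mul (hp : ‖p‖ < 1) (hq : ‖q‖ < 1) (hb : b ≠ 0) (ht : ∀ r, t r ≠ 0) :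
    (∏ r, ∏ s ∈ Finset.Ioi r, pqPoch (params b t p q r * params b t p q s) p q) *
      (qPoch p p * qPoch q q) = denom b t p q * pairFactor b t p q := by
  rw [prod_Ioi_add (m := 8) (n := 8) (fun r s => pqPoch (params b t p q r * params b t p q s) p q),
    prod_left_pairs hb ht, prod_left_mul_roots hp hq hb ht, prod_root_pairs hp hq, pairFactor]
  ring

theorem symIntegrand_eq_div (b : ℂ) (t : Fin 4 → ℂ) (p q z : ℂ) :
    symIntegrand b t p q z = symNum b t p q z / (polesIn b t p q z * polesIn b t p q z⁻¹) := by
  simp only [symIntegrand, symNum, polesIn, inv_pow, div_inv_eq_mul, Finset.prod_div_distrib,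
    Finset.prod_mul_distrib]
  simp only [show ∀ r, p * q / (b * t r * z⁻¹) = p * q * z / (b * t r) from fun r => by
    rw [← div_eq_mul_inv, div_div_eq_mul_div]]
  ring

theorem polesIn_eq_prod (hp : ‖p‖ < 1) (hq : ‖q‖ < 1) (z : ℂ) :
    polesIn b t p q z = ∏ r, pqPoch (params b t p q r / z) p q := by
  have e := Fin.prod_univ_add (a := 8) (b := 8) fun r => pqPoch (params b t p q r / z) p q
  have e2 := prod_mul_roots hp hq b t z⁻¹
  simp only [inv_mul_eq_div, inv_pow, ← div_eq_mul_inv] at e2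
  rw [e2] at e
  refine Eq.trans ?_ e.symm
  rw [polesIn, mul_comm]
  congr 1
  simp only [params, Fin.prod_univ_succ]
  simp
  simp only [div_div]
  ring

theorem params_ne_zero (hp0 : p ≠ 0) (hq0 : q ≠ 0) (hb : b ≠ 0) (ht : ∀ r, t r ≠ 0)
    (r : Fin (2 * 5 + 6)) : params b t p q r ≠ 0 := by
  have h := mul_ne_zero hp0 hq0
  have c : ∀ x : ℂ, x ≠ 0 → x ^ (1 / 2 : ℂ) ≠ 0 := fun x hx => by simp [hx]
  have c1 := c b hb
  have c2 := c (b * q) (mul_ne_zero hb hq0)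
  have c3 := c (b * p) (mul_ne_zero hb hp0)
  have c4 := c (b * p * q) (mul_ne_zero (mul_ne_zero hb hp0) hq0)
  have d : ∀ r, p * q / (b * t r) ≠ 0 := fun r => div_ne_zero h (mul_ne_zero hb (ht r))
  fin_cases r
  exacts [ht 0, d 0, ht 1, d 1, ht 2, d 2, ht 3, d 3, c1, neg_ne_zero.2 c1, c2, neg_ne_zero.2 c2,
    c3, neg_ne_zero.2 c3, c4, neg_ne_zero.2 c4]

theorem polesIn_eq_zero_iff (hp : ‖p‖ < 1) (hq : ‖q‖ < 1) (hp0 : p ≠ 0) (hq0 : q ≠ 0) (hb : b ≠ 0)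
    (ht : ∀ r, t r ≠ 0) (z : ℂ) :
    (∃ r, ∃ j k : ℕ, z = params b t p q r * p ^ j * q ^ k) ↔ z ≠ 0 ∧ polesIn b t p q z = 0 := by
  rw [polesIn_eq_prod hp hq, Finset.prod_eq_zero_iff]
  simp only [Finset.mem_univ, true_and, pqPoch_eq_zero_iff hp hq]
  constructor
  · rintro ⟨r, j, k, rfl⟩
    have h0 : params b t p q r * p ^ j * q ^ k ≠ 0 :=
      mul_ne_zero (mul_ne_zero (params_ne_zero hp0 hq0 hb ht r) (pow_ne_zero _ hp0))
        (pow_ne_zero _ hq0)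
    refine ⟨h0, r, j, k, ?_⟩
    rw [div_mul_eq_mul_div, div_mul_eq_mul_div, div_self h0]
  · rintro ⟨h0, r, j, k, h⟩
    refine ⟨r, j, k, ?_⟩
    rw [div_mul_eq_mul_div, div_mul_eq_mul_div, div_eq_one_iff_eq h0] at h
    exact h.symm

/-- Describing the poles as zeros of one function and of its composition with inversion makes the
general separation lemmas applicable. -/
theorem isBetaContour_iff (hp : ‖p‖ < 1) (hq : ‖q‖ < 1) (hp0 : p ≠ 0) (hq0 : q ≠ 0) (hb : b ≠ 0)
    (ht : ∀ r, t r ≠ 0) (C : Contour) :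
    IsBetaContour (params b t p q) p q C ↔
      C.Separates {z | z ≠ 0 ∧ polesIn b t p q z = 0} {z | z ≠ 0 ∧ polesIn b t p q z⁻¹ = 0} := by
  have h1 : {z | ∃ r, ∃ j k : ℕ, z = params b t p q r * p ^ j * q ^ k} =
      {z | z ≠ 0 ∧ polesIn b t p q z = 0} := by
    ext z
    exact polesIn_eq_zero_iff hp hq hp0 hq0 hb ht z
  have h2 : {z | ∃ r, ∃ j k : ℕ, z = (params b t p q r)⁻¹ * (p ^ j)⁻¹ * (q ^ k)⁻¹} =
      {z | z ≠ 0 ∧ polesIn b t p q z⁻¹ = 0} := by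
    ext z
    have := polesIn_eq_zero_iff hp hq hp0 hq0 hb ht z⁻¹
    simp only [inv_eq_iff_eq_inv (a := z), ne_eq, inv_zero] at this
    simpa [mul_inv, mul_assoc, mul_comm, mul_left_comm] using this
  rw [IsBetaContour, h1, h2]

theorem polesIn_differentiableAt (hp : ‖p‖ < 1) (hq : ‖q‖ < 1) (hb : b ≠ 0) (ht : ∀ r, t r ≠ 0) :
    ∀ z ≠ 0, DifferentiableAt ℂ (polesIn b t p q) z := fun z hz => by
  have h (r : Fin 4) : b * t r * z ≠ 0 := mul_ne_zero (mul_ne_zero hb (ht r)) hz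
  unfold polesIn
  simp only [Fin.prod_univ_four]
  fun_prop (disch := first | assumption | exact h _ | positivity)

theorem symNum_differentiableAt (hp : ‖p‖ < 1) (hq : ‖q‖ < 1) (hb : b ≠ 0) (ht : ∀ r, t r ≠ 0) :
    ∀ z ≠ 0, DifferentiableAt ℂ (symNum b t p q) z := fun z hz => by
  have h (r : Fin 4) : t r * z ≠ 0 := mul_ne_zero (ht r) hz
  have h' (r : Fin 4) : t r ≠ 0 := ht r
  unfold symNum
  simp only [Fin.prod_univ_four]
  fun_prop (disch := first | assumption | exact h _ | exact h' _ | positivity)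

theorem continuousAt_polesIn {x : ℂ × (Fin 4 → ℂ)} {z : ℂ} (hp : ‖p‖ < 1) (hq : ‖q‖ < 1)
    (hb : x.1 ≠ 0) (ht : ∀ r, x.2 r ≠ 0) (hz : z ≠ 0) :
    ContinuousAt (fun y : (ℂ × (Fin 4 → ℂ)) × ℂ => polesIn y.1.1 y.1.2 p q y.2) (x, z) := by
  have h (r : Fin 4) : x.1 * x.2 r * z ≠ 0 := mul_ne_zero (mul_ne_zero hb (ht r)) hz
  unfold polesIn
  simp only [Fin.prod_univ_four]
  fun_prop (disch := first | assumption | exact h _ | (simp only; positivity))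

theorem continuousAt_symNum {x : ℂ × (Fin 4 → ℂ)} {z : ℂ} (hp : ‖p‖ < 1) (hq : ‖q‖ < 1)
    (hb : x.1 ≠ 0) (ht : ∀ r, x.2 r ≠ 0) (hz : z ≠ 0) :
    ContinuousAt (fun y : (ℂ × (Fin 4 → ℂ)) × ℂ => symNum y.1.1 y.1.2 p q y.2) (x, z) := by
  have h (r : Fin 4) : x.2 r * z ≠ 0 := mul_ne_zero (ht r) hz
  have h' (r : Fin 4) : x.2 r ≠ 0 := ht r
  unfold symNum
  simp only [Fin.prod_univ_four]
  fun_prop (disch := first | assumption | exact h _ | exact h' _ | (simp only; positivity))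

theorem continuousAt_pairFactor {x : ℂ × (Fin 4 → ℂ)} (hp : ‖p‖ < 1) (hq : ‖q‖ < 1)
    (hb : x.1 ≠ 0) (ht : ∀ r, x.2 r ≠ 0) :
    ContinuousAt (fun y : ℂ × (Fin 4 → ℂ) => pairFactor y.1 y.2 p q) x := by
  have hp2 := norm_sq_lt_one hp
  have hq2 := norm_sq_lt_one hq
  have h0 := ht 0
  have h1 := ht 1
  have h2 := ht 2
  have h3 := ht 3
  unfold pairFactor crossFactor
  simp only [Fin.prod_univ_three, Fin.succ_zero_eq_one, Fin.succ_one_eq_two,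
    show Fin.succ (2 : Fin 3) = 3 from rfl, show unitScale p 3 0 = p from rfl]
  fun_prop (disch := first | assumption | positivity)

theorem exists_polesIn_ne_zero {x : ℂ × (Fin 4 → ℂ)} (hp : ‖p‖ < 1) (hq : ‖q‖ < 1)
    (hb : x.1 ≠ 0) (ht : ∀ r, x.2 r ≠ 0) :
    ∃ B > 0, ∀ᶠ y in 𝓝 x, ∀ z, B ≤ ‖z‖ → polesIn y.1 y.2 p q z ≠ 0 := by
  let g : ℂ × (Fin 4 → ℂ) → ℝ := fun y => 1 + ‖y.1‖ + ∑ r, (‖y.2 r‖ + ‖p * q / (y.1 * y.2 r)‖)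
  have hg : ContinuousAt g x := by
    have h (r : Fin 4) : x.1 * x.2 r ≠ 0 := mul_ne_zero hb (ht r)
    simp only [g, Fin.sum_univ_four]
    fun_prop (disch := exact h _)
  refine ⟨g x + 1, by positivity, ?_⟩
  filter_upwards [hg.eventually_lt continuousAt_const (lt_add_one (g x))] with y hy z hz
  have hgz : g y < ‖z‖ := hy.trans_le hz
  have hs : ∀ r, ‖y.2 r‖ + ‖p * q / (y.1 * y.2 r)‖ ≤
      ∑ r, (‖y.2 r‖ + ‖p * q / (y.1 * y.2 r)‖) := fun r =>
    Finset.single_le_sum (f := fun r => ‖y.2 r‖ + ‖p * q / (y.1 * y.2 r)‖)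
      (fun _ _ => by positivity) (Finset.mem_univ r)
  have h1 : 1 + ‖y.1‖ < ‖z‖ := by
    have := (add_nonneg (norm_nonneg _) (norm_nonneg _)).trans (hs 0)
    simp only [g] at hgz
    linarith
  have h2 : ∀ r, ‖y.2 r‖ < ‖z‖ ∧ ‖p * q / (y.1 * y.2 r)‖ < ‖z‖ := fun r => by
    have := hs r
    simp only [g] at hgz
    constructor <;> linarith [norm_nonneg y.1, norm_nonneg (y.2 r),
      norm_nonneg (p * q / (y.1 * y.2 r))]
  have hz0 : 0 < ‖z‖ := by linarith [norm_nonneg y.1]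
  have key : ∀ c : ℂ, ‖c‖ < ‖z‖ → pqPoch (c / z) p q ≠ 0 := fun c hc =>
    pqPoch_ne_zero_of_norm_lt_one hp hq (by rwa [norm_div, div_lt_one hz0])
  refine mul_ne_zero (pqPoch_ne_zero_of_norm_lt_one hp hq ?_)
    (Finset.prod_ne_zero_iff.2 fun r _ => mul_ne_zero (key _ (h2 r).1) ?_)
  · rw [norm_div, norm_pow, div_lt_one (by positivity)]
    nlinarith [norm_nonneg y.1]
  · rw [← div_div]
    exact key _ (h2 r).2

theorem symIntegrand_integral_eq (hp : ‖p‖ < 1) (hq : ‖q‖ < 1) (hb : b ≠ 0) (ht : ∀ r, t r ≠ 0)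
    {C C' : Contour}
    (hC : C.Separates {z | z ≠ 0 ∧ polesIn b t p q z = 0} {z | z ≠ 0 ∧ polesIn b t p q z⁻¹ = 0})
    (hC' : C'.Separates {z | z ≠ 0 ∧ polesIn b t p q z = 0} {z | z ≠ 0 ∧ polesIn b t p q z⁻¹ = 0}) :
    C.integral (fun z => symIntegrand b t p q z / z) =
      C'.integral fun z => symIntegrand b t p q z / z := by
  obtain ⟨B, hB, h⟩ := exists_polesIn_ne_zero (x := (b, t)) hp hq hb ht
  have hd := polesIn_differentiableAt hp hq hb ht
  refine Contour.integral_eq_of_separates_zeros (f := polesIn b t p q) (B := B) hd hB h.self_of_nhds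
    hC hC' (m := symNum b t p q) (d := fun z => polesIn b t p q z * polesIn b t p q z⁻¹ * z)
    (symNum_differentiableAt hp hq hb ht) (fun z hz => ?_) (fun z hz h1 h2 => by positivity)
    fun z => by rw [symIntegrand_eq_div, div_div]
  exact ((hd z hz).mul ((hd z⁻¹ (inv_ne_zero hz)).comp z (differentiableAt_inv hz))).mul
    differentiableAt_id

theorem betaAlong_eq (hp : ‖p‖ < 1) (hq : ‖q‖ < 1) (hp0 : p ≠ 0) (hq0 : q ≠ 0) (hb : b ≠ 0)
    (ht : ∀ r, t r ≠ 0) (C : Contour) :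
    betaAlong (m := 5) (params b t p q) p q C = denom b t p q * (pairFactor b t p q / 2 *
      ((2 * Real.pi * Complex.I)⁻¹ * C.integral fun z => symIntegrand b t p q z / z)) := by
  have hZ : {z : ℂ | z ^ 2 ∈ exceptionalSquares b (t 0) p q}.Countable :=
    countable_setOf_sq_mem (countable_exceptionalSquares b (t 0) p q)
  -- The gamma-function form of the integrand agrees with `symIntegrand` except at countably many
  -- points, where division by zero has its conventional value.
  rw [betaAlong, C.integral_congr_off_countable hZ
    (g := fun z => (2 * Real.pi * Complex.I)⁻¹ * (symIntegrand b t p q z / z)) fun z _ hz => ?_,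
    Contour.integral_const_mul, ← mul_div_assoc, pairs_eq_denom_mul hp hq hb ht]
  · ring
  · simp only [exceptionalSquares, Set.mem_ofPred_eq, Set.mem_union, Set.mem_iUnion,
      Set.mem_singleton_iff, Set.mem_insert_iff, not_or, not_exists] at hz
    obtain ⟨⟨h0, -⟩, hj⟩ := hz
    have hz : z ≠ 0 := fun h => h0 (by simp [h])
    rw [prod_ellGamma_eq_symIntegrand hp hq hp0 hq0 hz hb ht]
    · field_simp
    · rw [Ne, pqPoch_eq_zero_iff hp hq]
      rintro ⟨j, k, h⟩
      refine (hj (j + 1) (k + 1)).1 ?_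
      field_simp at h
      rw [← h]; ring
    · rw [Ne, pqPoch_eq_zero_iff hp hq]
      rintro ⟨j, k, h⟩
      refine (hj (j + 1) (k + 1)).2 ?_
      exact eq_inv_of_mul_eq_one_left (by rw [← h]; ring)

theorem betaQuotient_eq {x : ℂ × (Fin 4 → ℂ)} (hp : ‖p‖ < 1) (hq : ‖q‖ < 1) (hp0 : p ≠ 0)
    (hq0 : q ≠ 0) (hx : x ∈ generic p q) {C : Contour}
    (hC : C.Separates {z | z ≠ 0 ∧ polesIn x.1 x.2 p q z = 0}
      {z | z ≠ 0 ∧ polesIn x.1 x.2 p q z⁻¹ = 0}) :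
    betaQuotient p q x = pairFactor x.1 x.2 p q / 2 *
      ((2 * Real.pi * Complex.I)⁻¹ * C.integral fun z => symIntegrand x.1 x.2 p q z / z) := by
  obtain ⟨hb, ht, hex, hd⟩ := hx
  rw [betaQuotient, beta, dif_pos hex, betaAlong_eq hp hq hp0 hq0 hb ht, mul_div_cancel_left₀ _ hd,
    symIntegrand_integral_eq hp hq hb ht
      ((isBetaContour_iff hp hq hp0 hq0 hb ht _).1 hex.choose_spec) hC]

theorem continuousAt_denom {x : ℂ × (Fin 4 → ℂ)} (hp : ‖p‖ < 1) (hq : ‖q‖ < 1)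
    (hb : x.1 ≠ 0) (ht : ∀ r, x.2 r ≠ 0) :
    ContinuousAt (fun y : ℂ × (Fin 4 → ℂ) => denom y.1 y.2 p q) x := by
  have h (r : Fin 4) : x.1 * x.2 r ^ 2 ≠ 0 := mul_ne_zero hb (pow_ne_zero 2 (ht r))
  unfold denom
  simp only [Fin.prod_univ_four]
  fun_prop (disch := first | assumption | exact h _)

theorem eventually_separates_polesIn {x : ℂ × (Fin 4 → ℂ)} (hp : ‖p‖ < 1) (hq : ‖q‖ < 1)
    (hb : x.1 ≠ 0) (ht : ∀ r, x.2 r ≠ 0) {C : Contour}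
    (hC : C.Separates {z | z ≠ 0 ∧ polesIn x.1 x.2 p q z = 0}
      {z | z ≠ 0 ∧ polesIn x.1 x.2 p q z⁻¹ = 0}) :
    ∀ᶠ y in 𝓝 x, C.Separates {z | z ≠ 0 ∧ polesIn y.1 y.2 p q z = 0}
      {z | z ≠ 0 ∧ polesIn y.1 y.2 p q z⁻¹ = 0} := by
  have key := exists_polesIn_ne_zero hp hq hb ht
  let f : ℂ × (Fin 4 → ℂ) → ℂ → ℂ := fun y z => polesIn y.1 y.2 p q z
  have hf : ∀ z ≠ 0, ContinuousAt (Function.uncurry f) (x, z) :=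
    fun z hz => continuousAt_polesIn hp hq hb ht hz
  change ∃ B > 0, ∀ᶠ y in 𝓝 x, ∀ z, B ≤ ‖z‖ → f y z ≠ 0 at key
  change C.Separates {z | z ≠ 0 ∧ f x z = 0} {z | z ≠ 0 ∧ f x z⁻¹ = 0} at hC
  change ∀ᶠ y in 𝓝 x, C.Separates {z | z ≠ 0 ∧ f y z = 0} {z | z ≠ 0 ∧ f y z⁻¹ = 0}
  clear_value f
  obtain ⟨B, hB, h⟩ := key
  exact eventually_separates hf hB h hC

theorem eventually_generic {x : ℂ × (Fin 4 → ℂ)} (hp : ‖p‖ < 1) (hq : ‖q‖ < 1) (hp0 : p ≠ 0)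
    (hq0 : q ≠ 0) (hx : x ∈ generic p q) {C : Contour}
    (hC : C.Separates {z | z ≠ 0 ∧ polesIn x.1 x.2 p q z = 0}
      {z | z ≠ 0 ∧ polesIn x.1 x.2 p q z⁻¹ = 0}) :
    ∀ᶠ y in 𝓝 x, y ∈ generic p q ∧ C.Separates {z | z ≠ 0 ∧ polesIn y.1 y.2 p q z = 0}
      {z | z ≠ 0 ∧ polesIn y.1 y.2 p q z⁻¹ = 0} := by
  obtain ⟨hb, ht, hex, hd⟩ := hx
  have e := eventually_separates_polesIn hp hq hb ht hC
  have c := (continuousAt_denom hp hq hb ht).eventually_ne hd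
  have j1 : ∀ᶠ y : ℂ × (Fin 4 → ℂ) in 𝓝 x, y.1 ≠ 0 := ContinuousAt.eventually_ne (by fun_prop) hb
  have j2 (r : Fin 4) : ∀ᶠ y : ℂ × (Fin 4 → ℂ) in 𝓝 x, y.2 r ≠ 0 :=
    ContinuousAt.eventually_ne (by fun_prop) (ht r)
  filter_upwards [e, c, j1, eventually_all.2 j2] with y h1 h2 h3 h4
  exact ⟨⟨h3, h4, ⟨C, (isBetaContour_iff hp hq hp0 hq0 h3 h4 C).2 h1⟩, h2⟩, h1⟩

theorem exists_separates_of_mem_generic {x : ℂ × (Fin 4 → ℂ)} (hp : ‖p‖ < 1) (hq : ‖q‖ < 1)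
    (hp0 : p ≠ 0) (hq0 : q ≠ 0) (hx : x ∈ generic p q) :
    ∃ C : Contour, C.Separates {z | z ≠ 0 ∧ polesIn x.1 x.2 p q z = 0}
      {z | z ≠ 0 ∧ polesIn x.1 x.2 p q z⁻¹ = 0} := by
  obtain ⟨hb, ht, ⟨C, hC⟩, -⟩ := hx
  exact ⟨C, (isBetaContour_iff hp hq hp0 hq0 hb ht C).1 hC⟩

theorem isOpen_generic (hp : ‖p‖ < 1) (hq : ‖q‖ < 1) (hp0 : p ≠ 0) (hq0 : q ≠ 0) :
    IsOpen (generic p q) := isOpen_iff_mem_nhds.2 fun x hx => by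
  obtain ⟨C, hC⟩ := exists_separates_of_mem_generic hp hq hp0 hq0 hx
  exact (eventually_generic hp hq hp0 hq0 hx hC).mono fun y hy => hy.1

/-- One contour separates the poles for all nearby parameters, so the contour chosen in the
definition can be replaced by a fixed one. -/
theorem continuousAt_betaQuotient {x : ℂ × (Fin 4 → ℂ)} (hp : ‖p‖ < 1) (hq : ‖q‖ < 1)
    (hp0 : p ≠ 0) (hq0 : q ≠ 0) (hx : x ∈ generic p q) :
    ContinuousAt (betaQuotient p q) x := by
  obtain ⟨C, hC⟩ := exists_separates_of_mem_generic hp hq hp0 hq0 hx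
  have hev := eventually_generic hp hq hp0 hq0 hx hC
  have hc := C.continuousOn_integral (f := fun y z => symIntegrand y.1 y.2 p q z / z)
    (U := {y | y ∈ generic p q ∧ C.Separates {z | z ≠ 0 ∧ polesIn y.1 y.2 p q z = 0}
      {z | z ≠ 0 ∧ polesIn y.1 y.2 p q z⁻¹ = 0}}) fun y hy z hz => by
    have hz0 : z ≠ 0 := fun h => (hy.2.1 0 (mem_insert 0 _)).1 (h ▸ hz)
    have h1 : polesIn y.1 y.2 p q z ≠ 0 := fun h => (hy.2.1 z (.inr ⟨hz0, h⟩)).1 hz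
    have h2 : polesIn y.1 y.2 p q z⁻¹ ≠ 0 := fun h => (hy.2.2 z ⟨hz0, h⟩).1 hz
    have c2 := (continuousAt_polesIn hp hq hy.1.1 hy.1.2.1 (inv_ne_zero hz0)).comp (x := (y, z))
      (f := fun v : (ℂ × (Fin 4 → ℂ)) × ℂ => (v.1, v.2⁻¹))
      (continuousAt_fst.prodMk (continuousAt_snd.inv₀ hz0))
    have := ((continuousAt_symNum hp hq hy.1.1 hy.1.2.1 hz0).div
      ((continuousAt_polesIn hp hq hy.1.1 hy.1.2.1 hz0).mul c2) (mul_ne_zero h1 h2)).div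
      (continuousAt_snd (p := (y, z))) hz0
    refine this.congr (Eventually.of_forall fun v => ?_)
    simp only [Function.uncurry, symIntegrand_eq_div]
    rfl
  have hc' := hc.continuousAt hev
  have := ((continuousAt_pairFactor hp hq hx.1 hx.2.1).div_const 2).mul
    (hc'.const_mul (2 * Real.pi * Complex.I)⁻¹)
  refine this.congr (hev.mono fun y hy => ?_)
  exact (betaQuotient_eq hp hq hp0 hq0 hy.1 hy.2).symm

end Generic

end EllipticBeta

namespace EllipticBeta

/-! ## The beta integral as a symmetry-broken integral -/

section SymmetryBreaking

variable {b : ℂ} {t : Fin 4 → ℂ} {p q : ℂ}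

/-- The poles enclosed by the contour of the symmetry-broken integral, and those that cancel
after symmetrization. -/
noncomputable def polesInBroken (b : ℂ) (t : Fin 4 → ℂ) (p q z : ℂ) : ℂ :=
  polesIn b t p q z * pqPoch (q / (b * t 0 * z)) p q

/-- The inner poles of the kernel are among the zeros of `polesInBroken`. A contour separating the
latter therefore serves the symmetric integrand and the kernel at the same time. -/
theorem polesInBroken_eq (hp : ‖p‖ < 1) (hq : ‖q‖ < 1) (b : ℂ) (t : Fin 4 → ℂ) (z : ℂ) :
    polesInBroken b t p q z = denIn (unitScale p) b t q z *
      (qPoch (b / z ^ 2) q * qPoch (t 0 / z) q * pqPoch (p * q / (b * t 0 * z)) p q) := by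
  rw [polesInBroken, polesIn, pqPoch_succ_left hp hq (b / z ^ 2), Fin.prod_univ_succ,
    pqPoch_succ_left hp hq (t 0 / z), denIn, denInCore]
  simp only [show unitScale p 3 0 = p from rfl, show unitScale p 1 0 = p from rfl,
    show ∀ s : Fin 3, unitScale p 1 s.succ = 1 from fun s => by fin_cases s <;> rfl,
    show ∀ s : Fin 3, unitScale p 3 s.succ = p from fun s => rfl, mul_one, mul_comm q p,
    div_mul_eq_mul_div]
  ring

theorem polesInBroken_inv_eq (hp : ‖p‖ < 1) (hq : ‖q‖ < 1) (b : ℂ) (t : Fin 4 → ℂ) (z : ℂ) :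
    polesInBroken b t p q z⁻¹ = (qPoch (t 0 * z) q * denOut (unitScale p) b t q z) *
      pqPoch (p * q * z / (b * t 0)) p q := by
  rw [polesInBroken, polesIn, Fin.prod_univ_succ, div_inv_eq_mul (t 0),
    pqPoch_succ_left hp hq (t 0 * z), denOut, denOutCore]
  simp only [show unitScale p 3 0 = p from rfl, show unitScale p 2 0 = 1 from rfl,
    show ∀ s : Fin 3, unitScale p 2 s.succ = p from fun s => by fin_cases s <;> rfl,
    show ∀ s : Fin 3, unitScale p 0 s.succ = 1 from fun s => rfl, mul_one, one_mul, mul_comm q p,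
    inv_pow, div_inv_eq_mul, show ∀ x y : ℂ, x / (y * z⁻¹) = x * z / y from fun x y => by
      rw [← div_eq_mul_inv, div_div_eq_mul_div], show t 0 * z * p = p * t 0 * z by ring]
  ring

theorem differentiableAt_polesInBroken (hp : ‖p‖ < 1) (hq : ‖q‖ < 1) (hb : b ≠ 0)
    (ht : ∀ r, t r ≠ 0) : ∀ z ≠ 0, DifferentiableAt ℂ (polesInBroken b t p q) z := fun z hz => by
  have h := mul_ne_zero (mul_ne_zero hb (ht 0)) hz
  have h1 := polesIn_differentiableAt hp hq hb ht z hz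
  unfold polesInBroken
  fun_prop (disch := assumption)

theorem exists_polesInBroken_ne_zero (hp : ‖p‖ < 1) (hq : ‖q‖ < 1) (hb : b ≠ 0)
    (ht : ∀ r, t r ≠ 0) : ∃ B > 0, ∀ z, B ≤ ‖z‖ → polesInBroken b t p q z ≠ 0 := by
  obtain ⟨B, hB, h⟩ := exists_polesIn_ne_zero (x := (b, t)) hp hq hb ht
  refine ⟨max B (‖q / (b * t 0)‖ + 1), lt_max_of_lt_left hB, fun z hz => mul_ne_zero
    (h.self_of_nhds z ((le_max_left _ _).trans hz)) (pqPoch_ne_zero_of_norm_lt_one hp hq ?_)⟩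
  have h1 := (le_max_right _ _).trans hz
  rw [← div_div, norm_div, div_lt_one] <;> linarith [norm_nonneg (q / (b * t 0))]

/-- The parameters at which the integrand can be symmetrized and the contour separates all poles. -/
structure StronglyGeneric (p q : ℂ) (x : ℂ × (Fin 4 → ℂ)) : Prop where
  b_ne : x.1 ≠ 0
  t_ne : ∀ r, x.2 r ≠ 0
  denom_ne : denom x.1 x.2 p q ≠ 0
  theta_ne : theta x.1 q ≠ 0
  theta_sq_ne : theta (x.1 ^ 2) q ≠ 0
  poles_ne : ∀ z, z ≠ 0 → polesInBroken x.1 x.2 p q z = 0 → polesInBroken x.1 x.2 p q z⁻¹ ≠ 0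

theorem StronglyGeneric.exists_separates {x : ℂ × (Fin 4 → ℂ)} (hx : StronglyGeneric p q x)
    (hp : ‖p‖ < 1) (hq : ‖q‖ < 1) :
    ∃ C : Contour, C.Separates {z | z ≠ 0 ∧ polesInBroken x.1 x.2 p q z = 0}
      {z | z ≠ 0 ∧ polesInBroken x.1 x.2 p q z⁻¹ = 0} ∧ ∀ i s, C.arc i s ≠ 0 := by
  obtain ⟨B, hB, h⟩ := exists_polesInBroken_ne_zero hp hq hx.b_ne hx.t_ne
  exact exists_separates_zeros (differentiableAt_polesInBroken hp hq hx.b_ne hx.t_ne) hB h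
    hx.poles_ne

theorem separates_polesIn_of_broken {C : Contour}
    (hC : C.Separates {z | z ≠ 0 ∧ polesInBroken b t p q z = 0}
      {z | z ≠ 0 ∧ polesInBroken b t p q z⁻¹ = 0}) :
    C.Separates {z | z ≠ 0 ∧ polesIn b t p q z = 0} {z | z ≠ 0 ∧ polesIn b t p q z⁻¹ = 0} :=
  Contour.separates_mono hC (fun z hz => ⟨hz.1, by simp [polesInBroken, hz.2]⟩)
    fun z hz => ⟨hz.1, by simp [polesInBroken, hz.2]⟩

theorem StronglyGeneric.mem_generic {x : ℂ × (Fin 4 → ℂ)} (hx : StronglyGeneric p q x)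
    (hp : ‖p‖ < 1) (hq : ‖q‖ < 1) (hp0 : p ≠ 0) (hq0 : q ≠ 0) : x ∈ generic p q := by
  obtain ⟨C, hC, -⟩ := hx.exists_separates hp hq
  exact ⟨hx.b_ne, hx.t_ne, ⟨C, (isBetaContour_iff hp hq hp0 hq0 hx.b_ne hx.t_ne C).2
    (separates_polesIn_of_broken hC)⟩, hx.denom_ne⟩

/-- Integrating the symmetrization identity gives the kernel and its inversion. Their integrals
agree, and the resulting factor 2 cancels the 1/2 in the beta integral. -/
theorem StronglyGeneric.betaQuotient_eq {x : ℂ × (Fin 4 → ℂ)} (hx : StronglyGeneric p q x)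
    (hp : ‖p‖ < 1) (hq : ‖q‖ < 1) (hp0 : p ≠ 0) (hq0 : q ≠ 0) {C : Contour}
    (hC : C.Separates {z | z ≠ 0 ∧ polesInBroken x.1 x.2 p q z = 0}
      {z | z ≠ 0 ∧ polesInBroken x.1 x.2 p q z⁻¹ = 0}) (hC0 : ∀ i s, C.arc i s ≠ 0) :
    betaQuotient p q x = pref (unitScale p) x.1 x.2 q * ((2 * Real.pi * Complex.I)⁻¹ *
      C.integral fun z => kernel (unitScale p) x.1 x.2 q z / z) := by
  obtain ⟨b, t⟩ := x
  have hb : b ≠ 0 := hx.b_ne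
  have ht : ∀ r, t r ≠ 0 := hx.t_ne
  have hθ : theta b q ≠ 0 := hx.theta_ne
  have hθ2 : theta (b ^ 2) q ≠ 0 := hx.theta_sq_ne
  simp only at hC ⊢
  have hu : ‖unitScale p 3 0‖ < 1 := hp
  obtain ⟨B, hB, hfB⟩ := exists_polesInBroken_ne_zero hp hq hb ht
  have dm := differentiableAt_polesInBroken hp hq hb ht
  have dn : ∀ z ≠ 0, DifferentiableAt ℂ (num (unitScale p) b t q) z := fun z hz =>
    differentiableAt_num_right hq hu hb ht hz
  have dd : ∀ z ≠ 0, DifferentiableAt ℂ (fun z => denIn (unitScale p) b t q z *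
      (qPoch (t 0 * z) q * denOut (unitScale p) b t q z)) z := fun z hz => by
    have h1 := differentiableAt_denIn_right hq hu hb ht hz
    have h2 := differentiableAt_denOut_right (z := z) hq hu hb ht
    fun_prop (disch := assumption)
  have nz : ∀ z ≠ 0, polesInBroken b t p q z ≠ 0 → polesInBroken b t p q z⁻¹ ≠ 0 →
      denIn (unitScale p) b t q z * (qPoch (t 0 * z) q * denOut (unitScale p) b t q z) ≠ 0 :=
    fun z hz h1 h2 => by
      rw [polesInBroken_eq hp hq] at h1
      rw [polesInBroken_inv_eq hp hq] at h2
      exact mul_ne_zero (left_ne_zero_of_mul h1) (left_ne_zero_of_mul h2)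
  -- The inverted contour separates the same sets, because these are exchanged by inversion.
  have inv_eq : (C.integral fun z => kernel (unitScale p) b t q z⁻¹ / z) =
      C.integral fun z => kernel (unitScale p) b t q z / z := by
    rw [← Contour.integral_eq_of_separates_zeros (g := fun z => kernel (unitScale p) b t q z / z)
      dm hB hfB (Contour.separates_inv_zeros hC0 hC) hC
      (m := num (unitScale p) b t q) (d := fun z => denIn (unitScale p) b t q z *
      (qPoch (t 0 * z) q * denOut (unitScale p) b t q z) * z) dn
      (fun z hz => (dd z hz).mul differentiableAt_id)
      (fun z hz h1 h2 => mul_ne_zero (nz z hz h1 h2) hz)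
      (fun z => by rw [kernel, div_div]), Contour.integral_inv]
    refine Contour.integral_congr _ fun z _ => ?_
    by_cases hz : z = 0
    · simp [hz]
    · field_simp
  have htr : ∀ z ∈ C.trace, z ≠ 0 ∧ polesInBroken b t p q z ≠ 0 ∧ polesInBroken b t p q z⁻¹ ≠ 0 :=
    fun z hz => by
      have hz0 : z ≠ 0 := fun h => (hC.1 0 (mem_insert 0 _)).1 (h ▸ hz)
      exact ⟨hz0, fun h => (hC.1 z (.inr ⟨hz0, h⟩)).1 hz, fun h => (hC.2 z ⟨hz0, h⟩).1 hz⟩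
  have ck : ContinuousOn (fun z => kernel (unitScale p) b t q z / z) C.trace := fun z hz => by
    obtain ⟨hz0, h1, h2⟩ := htr z hz
    exact (((dn z hz0).div (dd z hz0) (nz z hz0 h1 h2)).div differentiableAt_id
      hz0).continuousAt.continuousWithinAt
  have ck' : ContinuousOn (fun z => kernel (unitScale p) b t q z⁻¹ / z) C.trace := fun z hz => by
    obtain ⟨hz0, h1, h2⟩ := htr z hz
    have hi := inv_ne_zero hz0
    have := ((dn _ hi).div (dd _ hi) (nz _ hi h2 (by rwa [inv_inv]))).comp z
      (differentiableAt_inv hz0)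
    exact (this.div differentiableAt_id hz0).continuousAt.continuousWithinAt
  have hsym : theta (b ^ 2) q * (C.integral fun z => symIntegrand b t p q z / z) =
      theta b q * (2 * C.integral fun z => kernel (unitScale p) b t q z / z) := by
    rw [← Contour.integral_const_mul, C.integral_congr_off_countable
      (countable_setOf_sq_mem (countable_exceptionalSquares b (t 0) p q))
      (g := fun z => theta b q * (kernel (unitScale p) b t q z / z +
        kernel (unitScale p) b t q z⁻¹ / z)), Contour.integral_const_mul,
      Contour.integral_add ck ck', inv_eq, two_mul]
    intro z _ hz
    have := (theta_mul_symIntegrand_of_sq_notMem hp hq hq0 hb (ht 0) hθ hz).2.2.2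
    rw [← mul_div_assoc, this]
    ring
  -- The ratio of theta functions left by the symmetrization is exactly the ratio of the two
  -- prefactors.
  have hpre : pairFactor b t p q * theta b q = pref (unitScale p) b t q * theta (b ^ 2) q := by
    apply mul_left_cancel₀ (show denom b t p q ≠ 0 from hx.denom_ne)
    rw [← mul_assoc, ← mul_assoc, ← pairs_eq_denom_mul hp hq hb ht]
    exact pairs_mul_theta hp hq hb ht (right_ne_zero_of_mul hθ2)
  apply mul_left_cancel₀ hθ2
  rw [EllipticBeta.betaQuotient_eq hp hq hp0 hq0 (hx.mem_generic hp hq hp0 hq0)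
    (separates_polesIn_of_broken hC)]
  simp only
  linear_combination pairFactor b t p q / 2 * (2 * Real.pi * Complex.I)⁻¹ * hsym +
    (2 * Real.pi * Complex.I)⁻¹ * (C.integral fun z => kernel (unitScale p) b t q z / z) * hpre

/-- The scales for parameters `t_r s_r` after the substitution `z = ζ / s_0`. -/
noncomputable def scaleOf (p : ℂ) (s : Fin 4 → ℂ) : Fin 4 → Fin 4 → ℂ :=
  ![fun r => s r / s 0, fun r => if r = 0 then p * s 0 ^ 2 else s r * s 0,
    fun r => if r = 0 then (s 0 ^ 2)⁻¹ else p / (s r * s 0), fun r => p * s 0 / s r]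

theorem powScale_eq (τ : Fin 4 → ℝ) (w : ℂ) :
    powScale τ w = scaleOf (Complex.exp w) fun r => Complex.exp (τ r * w) := by
  ext i r
  fin_cases i <;> simp only [powScale, scaleOf]
  · simp [← Complex.exp_sub]; ring_nf
  · by_cases h : r = 0 <;> simp [h, ← Complex.exp_add, ← Complex.exp_nat_mul] <;> ring_nf
  · by_cases h : r = 0 <;> simp [h, ← Complex.exp_add, ← Complex.exp_nat_mul, ← Complex.exp_sub,
      ← Complex.exp_neg] <;> ring_nf
  · simp [← Complex.exp_sub, ← Complex.exp_add]; ring_nf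

/-- With the congruence lemmas below, it reduces an identity of long products to equality of the
arguments factor by factor. -/
theorem mul_congr_aux {a b c d : ℂ} (h : a = b) (h' : c = d) : a * c = b * d := h ▸ h' ▸ rfl

theorem pqPoch_congr {x y p q : ℂ} (h : x - y = 0) : pqPoch x p q = pqPoch y p q := by
  rw [sub_eq_zero.1 h]

theorem qPoch_congr {x y q : ℂ} (h : x - y = 0) : qPoch x q = qPoch y q := by
  rw [sub_eq_zero.1 h]

theorem theta_congr {x y q : ℂ} (h : x - y = 0) : theta x q = theta y q := by
  rw [sub_eq_zero.1 h]

/-! ### Rescaling of the parameters and of the integration variable -/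

section Homogeneity

variable {s : Fin 4 → ℂ} (p b : ℂ) (t : Fin 4 → ℂ) (q : ℂ)

/-- Multiplying t_r by s_r and dividing z by s_0 changes each argument only by the monomial in p and
s recorded in `scaleOf`. -/
theorem num_scaleOf (hs : ∀ r, s r ≠ 0) (z : ℂ) :
    num (unitScale p) b (fun r => t r * s r) q (z / s 0) = num (scaleOf p s) b t q z := by
  have h0 := hs 0
  have h1 := hs 1
  have h2 := hs 2
  have h3 := hs 3
  simp only [num, numCore, unitScale, scaleOf, Fin.prod_univ_three, Fin.succ_zero_eq_one,
    Fin.succ_one_eq_two, show Fin.succ (2 : Fin 3) = 3 from rfl, Matrix.cons_val, mul_one, one_mul,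
    if_pos, one_ne_zero, Fin.reduceEq, if_false, mul_div_cancel_right₀ p h0]
  repeat' first
    | with_reducible rfl
    | with_reducible apply pqPoch_congr
    | with_reducible apply qPoch_congr
    | with_reducible apply theta_congr
    | with_reducible apply mul_congr_aux
    | with_reducible apply congrArg (· ^ 3)
  all_goals (rw [sub_eq_zero]; field_simp)

theorem denIn_scaleOf (hs : ∀ r, s r ≠ 0) (z : ℂ) :
    denIn (unitScale p) b (fun r => t r * s r) q (z / s 0) = denIn (scaleOf p s) b t q z := by
  have h0 := hs 0
  have h1 := hs 1
  have h2 := hs 2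
  have h3 := hs 3
  simp only [denIn, denInCore, unitScale, scaleOf, Fin.prod_univ_three, Fin.succ_zero_eq_one,
    Fin.succ_one_eq_two, show Fin.succ (2 : Fin 3) = 3 from rfl, Matrix.cons_val, mul_one,
    if_pos, one_ne_zero, Fin.reduceEq, if_false, mul_div_cancel_right₀ p h0]
  repeat' first
    | with_reducible rfl
    | with_reducible apply pqPoch_congr
    | with_reducible apply qPoch_congr
    | with_reducible apply theta_congr
    | with_reducible apply mul_congr_aux
    | with_reducible apply congrArg (· ^ 3)
  all_goals (rw [sub_eq_zero]; field_simp)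

theorem denOut_scaleOf (hs : ∀ r, s r ≠ 0) (z : ℂ) :
    denOut (unitScale p) b (fun r => t r * s r) q (z / s 0) = denOut (scaleOf p s) b t q z := by
  have h0 := hs 0
  have h1 := hs 1
  have h2 := hs 2
  have h3 := hs 3
  simp only [denOut, denOutCore, unitScale, scaleOf, Fin.prod_univ_three, Fin.succ_zero_eq_one,
    Fin.succ_one_eq_two, show Fin.succ (2 : Fin 3) = 3 from rfl, Matrix.cons_val, mul_one, one_mul,
    if_pos, one_ne_zero, Fin.reduceEq, if_false, mul_div_cancel_right₀ p h0]
  repeat' first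
    | with_reducible rfl
    | with_reducible apply pqPoch_congr
    | with_reducible apply qPoch_congr
    | with_reducible apply theta_congr
    | with_reducible apply mul_congr_aux
    | with_reducible apply congrArg (· ^ 3)
  all_goals (rw [sub_eq_zero]; field_simp)

theorem pref_scaleOf (hs : ∀ r, s r ≠ 0) :
    pref (unitScale p) b (fun r => t r * s r) q = pref (scaleOf p s) b t q := by
  have h0 := hs 0
  have h1 := hs 1
  have h2 := hs 2
  have h3 := hs 3
  simp only [pref, prefCore, crossFactor, unitScale, scaleOf, Fin.prod_univ_three, Fin.succ_zero_eq_one,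
    Fin.succ_one_eq_two, show Fin.succ (2 : Fin 3) = 3 from rfl, Matrix.cons_val, mul_one, one_mul,
    one_ne_zero, Fin.reduceEq, if_false, mul_div_cancel_right₀ p h0]
  repeat' first
    | with_reducible rfl
    | with_reducible apply pqPoch_congr
    | with_reducible apply qPoch_congr
    | with_reducible apply theta_congr
    | with_reducible apply mul_congr_aux
    | with_reducible apply congrArg (· ^ 3)
  all_goals (rw [sub_eq_zero]; field_simp)

theorem kernel_scaleOf (hs : ∀ r, s r ≠ 0) (z : ℂ) :
    kernel (unitScale p) b (fun r => t r * s r) q (z / s 0) = kernel (scaleOf p s) b t q z := by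
  have h0 := hs 0
  rw [kernel, kernel, num_scaleOf p b t q hs, denIn_scaleOf p b t q hs, denOut_scaleOf p b t q hs,
    show t 0 * s 0 * (z / s 0) = t 0 * z by field_simp]

end Homogeneity

theorem StronglyGeneric.betaQuotient_eq_brokenIntegral {τ : Fin 4 → ℝ} {w : ℂ} {ρ : ℝ} {K : ℕ}
    (hρ : 0 < ρ) (hq : ‖q‖ < 1) (hq0 : q ≠ 0) (hx : Admissible ρ K q (powScale τ w, b, t))
    (hg : StronglyGeneric (Complex.exp w) q (b, fun r => t r * Complex.exp (τ r * w))) :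
    betaQuotient (Complex.exp w) q (b, fun r => t r * Complex.exp (τ r * w)) =
      brokenIntegral (powScale τ w) b t q ρ K := by
  have hs : ∀ r, Complex.exp (τ r * w) ≠ 0 := fun r => Complex.exp_ne_zero _
  have hp : ‖Complex.exp w‖ < 1 := by
    have := hx.norm_p
    simpa [powScale] using this
  obtain ⟨C, hC, hC0⟩ := hg.exists_separates hp hq
  rw [hg.betaQuotient_eq hp hq (Complex.exp_ne_zero w) hq0 hC hC0]
  rw [powScale_eq] at hx ⊢
  set s : Fin 4 → ℂ := fun r => Complex.exp (τ r * w) with hsdef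
  have hs0 := hs 0
  have hmul : ∀ z : ℂ, s 0 * z / s 0 = z := fun z => mul_div_cancel_left₀ z hs0
  -- The contour is scaled along with z. The poles of the scaled kernel form a subset of the scaled
  -- zeros of `polesInBroken`.
  have hsep : (C.scale (s 0)).Separates
      {z | z ≠ 0 ∧ denIn (scaleOf (Complex.exp w) s) b t q z = 0}
      {z | z ≠ 0 ∧ (qPoch (t 0 * z) q = 0 ∨ denOut (scaleOf (Complex.exp w) s) b t q z = 0)} := by
    refine Contour.separates_scale hs0 (Contour.separates_mono hC (fun z hz => ?_) fun z hz => ?_)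
    · have h1 : z ≠ 0 := right_ne_zero_of_mul hz.1
      have h2 := hz.2
      rw [← denIn_scaleOf _ b t q hs, hmul] at h2
      exact ⟨h1, by rw [polesInBroken_eq hp hq]; exact mul_eq_zero_of_left h2 _⟩
    · have h1 : z ≠ 0 := right_ne_zero_of_mul hz.1
      have h2 := hz.2
      rw [← denOut_scaleOf _ b t q hs, hmul] at h2
      refine ⟨h1, ?_⟩
      rw [polesInBroken_inv_eq hp hq]
      refine mul_eq_zero_of_left (mul_eq_zero.2 (h2.imp (fun h => ?_) id)) _
      rw [← h]
      simp only
      ring_nf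
  rw [← pref_mul_integral_eq_brokenIntegral hρ hq hq0 hx hsep, ← pref_scaleOf _ b t q hs,
    Contour.integral_scale]
  congr 2
  refine Contour.integral_congr _ fun z _ => ?_
  have hs0' : s 0 ≠ 0 := hs0
  rw [← kernel_scaleOf _ b t q hs, hmul, ← mul_div_right_comm, mul_comm (s 0) z,
    mul_div_mul_right _ _ hs0']

end SymmetryBreaking

end EllipticBeta

namespace EllipticBeta

/-! ## Density of generic parameters -/

section Density

variable {p q : ℂ}

/-- The squares of the poles up to powers of `p` and `q`. The last entry only concerns the
symmetry-broken integrand. -/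
noncomputable def poleSquares (p q : ℂ) (x : ℂ × (Fin 4 → ℂ)) : Fin 10 → ℂ :=
  ![x.2 0 ^ 2, x.2 1 ^ 2, x.2 2 ^ 2, x.2 3 ^ 2,
    (p * q / (x.1 * x.2 0)) ^ 2, (p * q / (x.1 * x.2 1)) ^ 2,
    (p * q / (x.1 * x.2 2)) ^ 2, (p * q / (x.1 * x.2 3)) ^ 2, x.1, (q / (x.1 * x.2 0)) ^ 2]

theorem exists_poleSquares_of_polesIn_eq_zero (hp : ‖p‖ < 1) (hq : ‖q‖ < 1)
    {x : ℂ × (Fin 4 → ℂ)} {z : ℂ} (hz : z ≠ 0) (h : polesIn x.1 x.2 p q z = 0) :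
    ∃ i, i ≠ 9 ∧ ∃ m n : ℕ, z ^ 2 = poleSquares p q x i * p ^ m * q ^ n := by
  have sq : ∀ c : ℂ, pqPoch (c / z) p q = 0 → ∃ m n : ℕ, z ^ 2 = c ^ 2 * p ^ m * q ^ n := fun c hc => by
    obtain ⟨j, k, hjk⟩ := (pqPoch_eq_zero_iff hp hq).1 hc
    refine ⟨2 * j, 2 * k, ?_⟩
    have : z = c * p ^ j * q ^ k := by
      rw [div_mul_eq_mul_div, div_mul_eq_mul_div, div_eq_one_iff_eq hz] at hjk
      exact hjk.symm
    rw [this]; ring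
  rcases mul_eq_zero.1 h with h | h
  · obtain ⟨j, k, hjk⟩ := (pqPoch_eq_zero_iff hp hq).1 h
    refine ⟨8, by decide, j, k, ?_⟩
    rw [div_mul_eq_mul_div, div_mul_eq_mul_div, div_eq_one_iff_eq (pow_ne_zero 2 hz)] at hjk
    exact hjk.symm
  · obtain ⟨r, -, h⟩ := Finset.prod_eq_zero_iff.1 h
    rcases mul_eq_zero.1 h with h | h
    · have := sq _ h
      fin_cases r
      exacts [⟨0, by decide, this⟩, ⟨1, by decide, this⟩, ⟨2, by decide, this⟩,
        ⟨3, by decide, this⟩]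
    · rw [← div_div] at h
      have := sq _ h
      fin_cases r
      exacts [⟨4, by decide, this⟩, ⟨5, by decide, this⟩, ⟨6, by decide, this⟩,
        ⟨7, by decide, this⟩]

theorem exists_poleSquares_of_polesInBroken_eq_zero (hp : ‖p‖ < 1) (hq : ‖q‖ < 1)
    {x : ℂ × (Fin 4 → ℂ)} {z : ℂ} (hz : z ≠ 0) (h : polesInBroken x.1 x.2 p q z = 0) :
    ∃ i, ∃ m n : ℕ, z ^ 2 = poleSquares p q x i * p ^ m * q ^ n := by
  rcases mul_eq_zero.1 h with h | h
  · obtain ⟨i, -, h⟩ := exists_poleSquares_of_polesIn_eq_zero hp hq hz h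
    exact ⟨i, h⟩
  · obtain ⟨j, k, hjk⟩ := (pqPoch_eq_zero_iff hp hq).1 h
    refine ⟨9, 2 * j, 2 * k, ?_⟩
    rw [← div_div, div_mul_eq_mul_div, div_mul_eq_mul_div, div_eq_one_iff_eq hz] at hjk
    simp only [poleSquares, Matrix.cons_val, ← hjk]
    ring

/-- No two of the first nine squares of poles are inverse to each other up to powers of `p`, `q`. -/
def SquaresAvoid (p q : ℂ) (S : Set (Fin 10)) (x : ℂ × (Fin 4 → ℂ)) : Prop :=
  ∀ i ∈ S, ∀ j ∈ S, ∀ m n : ℕ, poleSquares p q x i * poleSquares p q x j * (p ^ m * q ^ n) ≠ 1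

theorem SquaresAvoid.denom_ne_zero (hp : ‖p‖ < 1) (hq : ‖q‖ < 1) {x : ℂ × (Fin 4 → ℂ)}
    (hb : x.1 ≠ 0) (ht : ∀ r, x.2 r ≠ 0) (h : SquaresAvoid p q {i | i ≠ 9} x) :
    denom x.1 x.2 p q ≠ 0 := by
  have key : ∀ r : Fin 4, (∃ i : Fin 10, i ≠ 9 ∧ poleSquares p q x i = x.2 r ^ 2) ∧
      ∃ i : Fin 10, i ≠ 9 ∧ poleSquares p q x i = (p * q / (x.1 * x.2 r)) ^ 2 := fun r => by
    fin_cases r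
    exacts [⟨⟨0, by decide, rfl⟩, 4, by decide, rfl⟩, ⟨⟨1, by decide, rfl⟩, 5, by decide, rfl⟩,
      ⟨⟨2, by decide, rfl⟩, 6, by decide, rfl⟩, ⟨⟨3, by decide, rfl⟩, 7, by decide, rfl⟩]
  refine Finset.prod_ne_zero_iff.2 fun r _ => ?_
  obtain ⟨⟨i, hi, ei⟩, j, hj, ej⟩ := key r
  have hr := ht r
  refine mul_ne_zero ?_ ?_ <;> rw [Ne, pqPoch_eq_zero_iff hp hq] <;> rintro ⟨m, n, e⟩
  · refine h 8 (by decide : (8 : Fin 10) ≠ 9) i hi m n ?_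
    rw [ei, ← e, show poleSquares p q x 8 = x.1 from rfl]
    ring
  · refine h 8 (by decide : (8 : Fin 10) ≠ 9) j hj m n ?_
    rw [ej, ← e, show poleSquares p q x 8 = x.1 from rfl]
    field_simp

theorem SquaresAvoid.mem_generic (hp : ‖p‖ < 1) (hq : ‖q‖ < 1) (hp0 : p ≠ 0) (hq0 : q ≠ 0)
    {x : ℂ × (Fin 4 → ℂ)} (hb : x.1 ≠ 0) (ht : ∀ r, x.2 r ≠ 0)
    (h : SquaresAvoid p q {i | i ≠ 9} x) : x ∈ generic p q := by
  obtain ⟨B, hB, hfB⟩ := exists_polesIn_ne_zero (x := x) hp hq hb ht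
  obtain ⟨C, hC, -⟩ := exists_separates_zeros (f := polesIn x.1 x.2 p q)
    (polesIn_differentiableAt hp hq hb ht) hB hfB.self_of_nhds fun z hz h1 h2 => by
      obtain ⟨i, hi, m, n, e⟩ := exists_poleSquares_of_polesIn_eq_zero hp hq hz h1
      obtain ⟨j, hj, m', n', e'⟩ := exists_poleSquares_of_polesIn_eq_zero hp hq (inv_ne_zero hz) h2
      refine h i hi j hj (m + m') (n + n') ?_
      have : z ^ 2 * z⁻¹ ^ 2 = 1 := by field_simp
      rw [← this, e, e']
      ring
  exact ⟨hb, ht, ⟨C, (isBetaContour_iff hp hq hp0 hq0 hb ht C).2 hC⟩, h.denom_ne_zero hp hq hb ht⟩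

theorem SquaresAvoid.stronglyGeneric (hp : ‖p‖ < 1) (hq : ‖q‖ < 1) (hq0 : q ≠ 0)
    {x : ℂ × (Fin 4 → ℂ)} (hb : x.1 ≠ 0) (ht : ∀ r, x.2 r ≠ 0)
    (h : SquaresAvoid p q univ x) (hbq : ∀ n : ℤ, x.1 ^ 2 ≠ q ^ n) : StronglyGeneric p q x where
  b_ne := hb
  t_ne := ht
  denom_ne := SquaresAvoid.denom_ne_zero hp hq hb ht fun i _ j _ => h i trivial j trivial
  theta_ne := theta_zpow_ne_zero hq hq0 hb fun n hn => hbq (n * 2) (by rw [hn, zpow_mul]; rfl)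
  theta_sq_ne := theta_zpow_ne_zero hq hq0 (pow_ne_zero 2 hb) hbq
  poles_ne z hz h1 h2 := by
    obtain ⟨i, m, n, e⟩ := exists_poleSquares_of_polesInBroken_eq_zero hp hq hz h1
    obtain ⟨j, m', n', e'⟩ := exists_poleSquares_of_polesInBroken_eq_zero hp hq (inv_ne_zero hz) h2
    refine h i trivial j trivial (m + m') (n + n') ?_
    have : z ^ 2 * z⁻¹ ^ 2 = 1 := by field_simp
    rw [← this, e, e']
    ring

/-- A curve through `x` along which monomials in the parameters are exponential functions. -/
noncomputable def expCurve (x : ℂ × (Fin 4 → ℂ)) (β : ℤ) (l : ℂ) : ℂ × (Fin 4 → ℂ) :=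
  -- The exponents are spread out so that, for β = 1, no two of the ten pole squares have opposite
  -- exponents. For β = 0, among the first nine, this happens only for t_r against pq/(b t_r) with
  -- the same r, and for b against itself.
  (x.1 * Complex.exp (β * l), fun r => x.2 r * Complex.exp ((![10, 20, 40, 80] r : ℤ) * l))

theorem expCurve_zero (x : ℂ × (Fin 4 → ℂ)) (β : ℤ) : expCurve x β 0 = x := by
  simp [expCurve]

theorem continuous_expCurve (x : ℂ × (Fin 4 → ℂ)) (β : ℤ) : Continuous (expCurve x β) := by
  unfold expCurve
  fun_prop

theorem poleSquares_expCurve (x : ℂ × (Fin 4 → ℂ)) (β : ℤ) (l : ℂ) (i : Fin 10) :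
    poleSquares p q (expCurve x β l) i = poleSquares p q x i * Complex.exp
      ((![20, 40, 80, 160, -20 - 2 * β, -40 - 2 * β, -80 - 2 * β, -160 - 2 * β, β, -20 - 2 * β] i : ℤ)
        * l) := by
  have e1 : ∀ (n : ℤ) (c : ℂ), (c * Complex.exp (n * l)) ^ 2 =
      c ^ 2 * Complex.exp ((2 * n : ℤ) * l) := fun n c => by
    rw [mul_pow, ← Complex.exp_nat_mul]; push_cast; ring_nf
  have e2 : ∀ (n : ℤ) (c d e : ℂ), (c / (d * Complex.exp (β * l) * (e * Complex.exp (n * l)))) ^ 2 =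
      (c / (d * e)) ^ 2 * Complex.exp ((-(2 * n) - 2 * β : ℤ) * l) := fun n c d e => by
    rw [show d * Complex.exp (β * l) * (e * Complex.exp (n * l)) = (d * e) *
      Complex.exp ((n + β) * l) by rw [add_mul, Complex.exp_add]; ring, ← div_div, div_eq_mul_inv _ (Complex.exp _),
      ← Complex.exp_neg, mul_pow, ← Complex.exp_nat_mul]
    push_cast; ring_nf
  fin_cases i
  exacts [e1 _ _, e1 _ _, e1 _ _, e1 _ _, e2 _ _ _ _, e2 _ _ _ _, e2 _ _ _ _, e2 _ _ _ _, rfl,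
    e2 _ _ _ _]

theorem countable_setOf_mul_exp_eq (c d : ℂ) (n : ℤ) (hd : d ≠ 0) (h : n ≠ 0 ∨ c ≠ d) :
    {l : ℂ | c * Complex.exp (n * l) = d}.Countable := by
  by_cases hn : n = 0
  · subst hn
    simp only [ne_eq, not_true_eq_false, false_or] at h
    simp [h]
  have hn' : (n : ℂ) ≠ 0 := by exact_mod_cast hn
  refine (Set.countable_range fun k : ℤ =>
    (Complex.log (d / c) + k * (2 * Real.pi * Complex.I)) / n).mono fun l hl => ?_
  have hl' : c * Complex.exp (n * l) = d := hl
  have hc : c ≠ 0 := fun h => hd (by rw [← hl', h, zero_mul])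
  have e : Complex.exp (n * l) = Complex.exp (Complex.log (d / c)) := by
    rw [Complex.exp_log (div_ne_zero hd hc), ← hl', mul_div_cancel_left₀ _ hc]
  obtain ⟨k, hk⟩ := Complex.exp_eq_exp_iff_exists_int.1 e
  exact ⟨k, by simp only; rw [← hk]; field_simp⟩

/-- Along the curve each forbidden coincidence is an equation c exp(n l) = 1. It has countably many
solutions if n ≠ 0, and none if n = 0 and c ≠ 1. -/
theorem countable_not_squaresAvoid (S : Set (Fin 10))
    (x : ℂ × (Fin 4 → ℂ)) (β : ℤ)
    (h : ∀ i ∈ S, ∀ j ∈ S, (![20, 40, 80, 160, -20 - 2 * β, -40 - 2 * β, -80 - 2 * β, -160 - 2 * β, β,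
      -20 - 2 * β] i : ℤ) + ![20, 40, 80, 160, -20 - 2 * β, -40 - 2 * β, -80 - 2 * β, -160 - 2 * β,
      β, -20 - 2 * β] j ≠ 0 ∨
      ∀ m n : ℕ, poleSquares p q x i * poleSquares p q x j * (p ^ m * q ^ n) ≠ 1) :
    {l | ¬ SquaresAvoid p q S (expCurve x β l)}.Countable := by
  have : {l | ¬ SquaresAvoid p q S (expCurve x β l)} ⊆ ⋃ i ∈ S, ⋃ j ∈ S, ⋃ m : ℕ, ⋃ n : ℕ,
      {l | poleSquares p q (expCurve x β l) i * poleSquares p q (expCurve x β l) j *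
        (p ^ m * q ^ n) = 1} := fun l hl => by
    simp only [SquaresAvoid, Set.mem_ofPred_eq, not_forall, not_not] at hl
    simpa only [Set.mem_iUnion, exists_prop, Set.mem_ofPred_eq] using hl
  refine Set.Countable.mono this ?_
  refine (Set.toFinite S).countable.biUnion fun i hi => (Set.toFinite S).countable.biUnion
    fun j hj => Set.countable_iUnion fun m => Set.countable_iUnion fun n => ?_
  simp only [poleSquares_expCurve]
  refine (countable_setOf_mul_exp_eq (poleSquares p q x i * poleSquares p q x j * (p ^ m * q ^ n)) 1
    _ one_ne_zero ((h i hi j hj).imp id fun h => h m n)).mono fun l hl => ?_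
  rw [Set.mem_ofPred_eq] at hl ⊢
  rw [← hl]
  push_cast
  rw [add_mul, Complex.exp_add]
  ring

theorem mem_closure_stronglyGeneric (hp : ‖p‖ < 1) (hq : ‖q‖ < 1) (hq0 : q ≠ 0)
    {x : ℂ × (Fin 4 → ℂ)} (hb : x.1 ≠ 0) (ht : ∀ r, x.2 r ≠ 0) {c d : ℂ} (hc : c ≠ 0)
    (hd : d ≠ 0) : x ∈ closure {y | StronglyGeneric p q y ∧ y.1 ≠ c ∧ y.2 0 ≠ d} := by
  have h1 := countable_not_squaresAvoid (p := p) (q := q) univ x 1 fun i _ j _ => .inl (by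
    revert i j; decide)
  have h2 : (⋃ n : ℤ, {l : ℂ | x.1 ^ 2 * Complex.exp ((2 : ℤ) * l) = q ^ n}).Countable :=
    Set.countable_iUnion fun n => countable_setOf_mul_exp_eq _ _ _ (zpow_ne_zero _ hq0)
      (.inl two_ne_zero)
  have h3 := countable_setOf_mul_exp_eq x.1 c 1 hc (.inl one_ne_zero)
  have h4 := countable_setOf_mul_exp_eq (x.2 0) d 10 hd (.inl (by norm_num))
  have hd := ((h1.union h2).union (h3.union h4)).dense_compl ℂ
  rw [← expCurve_zero x 1]
  refine map_mem_closure (continuous_expCurve x 1) (hd 0) fun l hl => ?_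
  simp only [Set.mem_compl_iff, Set.mem_union, not_or, Set.mem_iUnion, not_exists,
    Set.mem_ofPred_eq, not_not] at hl
  refine ⟨SquaresAvoid.stronglyGeneric hp hq hq0 (mul_ne_zero hb (Complex.exp_ne_zero _))
    (fun r => mul_ne_zero (ht r) (Complex.exp_ne_zero _)) hl.1.1 fun n h => hl.1.2 n ?_, hl.2.1,
    hl.2.2⟩
  rw [← h]
  simp only [expCurve, mul_pow, ← Complex.exp_nat_mul]
  push_cast
  ring_nf

/-- Here b stays fixed and only t moves. The coincidences that cannot be moved away are (pq/b)² p^m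
q^n = 1 and b² p^m q^n = 1, and both are excluded by the bounds on the moduli. -/
theorem mem_closure_generic_of_fst (hp : ‖p‖ < 1) (hq : ‖q‖ < 1) (hp0 : p ≠ 0) (hq0 : q ≠ 0)
    {x : ℂ × (Fin 4 → ℂ)} (hb : x.1 ≠ 0) (ht : ∀ r, x.2 r ≠ 0) (hb1 : ‖x.1‖ < 1)
    (hb2 : ‖p * q / x.1‖ < 1) : x.2 ∈ closure {t | (x.1, t) ∈ generic p q} := by
  have hpq : ∀ c : ℂ, ‖c‖ < 1 → ∀ m n : ℕ, c ^ 2 * (p ^ m * q ^ n) ≠ 1 := fun c hc m n h => by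
    have h1 := congrArg norm h
    rw [norm_mul, norm_mul, norm_pow, norm_pow, norm_pow, norm_one] at h1
    have h2 : ‖q‖ ^ n ≤ 1 := pow_le_one₀ (norm_nonneg _) hq.le
    have h3 : ‖p‖ ^ m ≤ 1 := pow_le_one₀ (norm_nonneg _) hp.le
    have h4 : ‖c‖ ^ 2 < 1 := pow_lt_one₀ (norm_nonneg _) hc two_ne_zero
    have h5 : ‖p‖ ^ m * ‖q‖ ^ n ≤ 1 := mul_le_one₀ h3 (by positivity) h2
    nlinarith [sq_nonneg ‖c‖]
  have h1 := countable_not_squaresAvoid (p := p) (q := q) {i | i ≠ 9} x 0 (by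
    have e : ∀ r, x.2 r ^ 2 * (p * q / (x.1 * x.2 r)) ^ 2 = (p * q / x.1) ^ 2 := fun r => by
      have := ht r
      field_simp
    have e' : ∀ r, (p * q / (x.1 * x.2 r)) ^ 2 * x.2 r ^ 2 = (p * q / x.1) ^ 2 := fun r => by
      rw [mul_comm, e]
    have key : ∀ i j : Fin 10, i ≠ 9 → j ≠ 9 →
        (![20, 40, 80, 160, -20, -40, -80, -160, 0, -20] i : ℤ) +
          ![20, 40, 80, 160, -20, -40, -80, -160, 0, -20] j ≠ 0 ∨
        (j.val = i.val + 4 ∧ i.val < 4) ∨ (i.val = j.val + 4 ∧ j.val < 4) ∨ (i = 8 ∧ j = 8) := by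
      decide
    intro i hi j hj
    rcases key i j hi hj with h | ⟨h, h'⟩ | ⟨h, h'⟩ | ⟨rfl, rfl⟩
    · exact .inl h
    · refine .inr fun m n => ?_
      have : poleSquares p q x i * poleSquares p q x j = (p * q / x.1) ^ 2 := by
        obtain ⟨i, _⟩ := i
        obtain ⟨j, _⟩ := j
        simp only at h h'
        subst h
        interval_cases i
        exacts [e 0, e 1, e 2, e 3]
      rw [this]
      exact hpq _ hb2 m n
    · refine .inr fun m n => ?_
      have : poleSquares p q x i * poleSquares p q x j = (p * q / x.1) ^ 2 := by
        obtain ⟨i, _⟩ := i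
        obtain ⟨j, _⟩ := j
        simp only at h h'
        subst h
        interval_cases j
        exacts [e' 0, e' 1, e' 2, e' 3]
      rw [this]
      exact hpq _ hb2 m n
    · refine .inr fun m n => ?_
      rw [show poleSquares p q x 8 * poleSquares p q x 8 = x.1 ^ 2 from (sq x.1).symm]
      exact hpq _ hb1 m n)
  have hd := h1.dense_compl ℂ
  have hc : Continuous fun l => (expCurve x 0 l).2 := (continuous_expCurve x 0).snd
  have e0 : x.2 = (expCurve x 0 0).2 := by rw [expCurve_zero]
  rw [e0]
  refine map_mem_closure (f := fun l => (expCurve x 0 l).2) hc (hd 0) fun l hl => ?_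
  simp only [Set.mem_compl_iff, Set.mem_ofPred_eq, not_not] at hl
  have := hl.mem_generic hp hq hp0 hq0 (mul_ne_zero hb (Complex.exp_ne_zero _))
    fun r => mul_ne_zero (ht r) (Complex.exp_ne_zero _)
  simpa [expCurve] using this

end Density

end EllipticBeta

namespace EllipticBeta

/-! ## Cauchy integrals over tori -/

section Torus

open MeasureTheory

variable {n : ℕ} {c y : Fin n → ℂ} {R : Fin n → ℝ}

theorem continuous_torusMap (c : Fin n → ℂ) (R : Fin n → ℝ) : Continuous (torusMap c R) := by
  unfold torusMap
  fun_prop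

theorem torusMap_mem_sphere (hR : ∀ i, 0 ≤ R i) (θ : Fin n → ℝ) (i : Fin n) :
    torusMap c R θ i ∈ Metric.sphere (c i) (R i) := circleMap_mem_sphere (c i) (hR i) (θ i)

theorem continuousOn_torusIntegral {X : Type*} [TopologicalSpace X] [FirstCountableTopology X]
    {f : X → (Fin n → ℂ) → ℂ} {U : Set X}
    (hf : ∀ x ∈ U, ∀ θ, ContinuousAt (Function.uncurry f) (x, torusMap c R θ)) :
    ContinuousOn (fun x => ∯ ξ in T(c, R), f x ξ) U := by
  intro x₀ hx₀
  have key : ∀ x ∈ U, ∀ θ, ContinuousAt (fun y : X × (Fin n → ℝ) => f y.1 (torusMap c R y.2)) (x, θ) :=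
    fun x hx θ => ContinuousAt.comp (g := Function.uncurry f) (x := (x, θ))
      (f := fun y : X × (Fin n → ℝ) => (y.1, torusMap c R y.2)) (hf x hx θ)
      (continuous_fst.prodMk ((continuous_torusMap c R).comp continuous_snd)).continuousAt
  have key2 : ∀ x ∈ U, Continuous fun θ => f x (torusMap c R θ) := fun x hx =>
    continuous_iff_continuousAt.2 fun θ => (key x hx θ).comp (x := θ)
      (f := fun θ : Fin n → ℝ => (x, θ)) (continuous_const.prodMk continuous_id).continuousAt
  let w : (Fin n → ℝ) → ℂ := fun θ => ∏ i, R i * Complex.exp (θ i * Complex.I) * Complex.I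
  have hw : Continuous w := by fun_prop
  obtain ⟨M, hM⟩ := (isCompact_Icc (a := (0 : Fin n → ℝ)) (b := fun _ => 2 * Real.pi)).exists_bound_of_continuousOn
    (f := fun θ => w θ * f x₀ (torusMap c R θ)) (hw.mul (key2 x₀ hx₀)).continuousOn
  -- Compactness of the parameter cube gives a constant bound for all nearby parameters, so
  -- dominated convergence applies.
  have hbound : ∀ᶠ x in 𝓝 x₀, ∀ θ ∈ Icc (0 : Fin n → ℝ) fun _ => 2 * Real.pi,
      ‖w θ * f x (torusMap c R θ)‖ < M + 1 :=
    isCompact_Icc.eventually_forall_of_forall_eventually fun θ hθ =>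
      ((((hw.comp continuous_snd).continuousAt (x := (x₀, θ))).mul (key x₀ hx₀ θ)).norm).eventually_lt
        continuousAt_const ((hM θ hθ).trans_lt (lt_add_one M))
  refine continuousWithinAt_of_dominated (bound := fun _ => M + 1) ?_ ?_ ?_ ?_
  · filter_upwards [self_mem_nhdsWithin] with x hx
    exact (hw.mul (key2 x hx)).aestronglyMeasurable
  · filter_upwards [nhdsWithin_le_nhds hbound] with x hx
    filter_upwards [ae_restrict_mem measurableSet_Icc] with θ hθ using (hx θ hθ).le
  · exact integrableOn_const isCompact_Icc.measure_lt_top.ne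
  · refine Eventually.of_forall fun θ => ContinuousAt.continuousWithinAt ?_
    exact (continuousAt_const (y := w θ)).mul ((key x₀ hx₀ θ).comp (x := x₀) (f := fun x : X => (x, θ))
      (continuousAt_id.prodMk continuousAt_const))

/-- Integration of continuous functions against a continuous density on a compact set. -/
theorem exists_clm_setIntegral {K : Set (Fin n → ℝ)} (hK : IsCompact K) [CompactSpace K]
    {w : (Fin n → ℝ) → ℂ} (hw : Continuous w) :
    ∃ L : C(K, ℂ) →L[ℂ] ℂ, ∀ (g : C(K, ℂ)) (h : (Fin n → ℝ) → ℂ), (∀ θ : K, g θ = h θ) →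
      L g = ∫ θ in K, w θ * h θ := by
  let μ : Measure K := Measure.comap Subtype.val volume
  have hm := hK.measurableSet
  have : IsFiniteMeasure μ := ⟨by
    rw [comap_subtype_coe_apply hm]
    exact (measure_mono (Subtype.coe_image_subset K univ)).trans_lt hK.measure_lt_top⟩
  let W : C(K, ℂ) := ⟨fun θ => w θ, hw.comp continuous_subtype_val⟩
  have hi : ∀ g : C(K, ℂ), Integrable (fun θ => W θ * g θ) μ := fun g =>
    Integrable.of_bound (W * g).continuous.aestronglyMeasurable ‖W * g‖
      (Eventually.of_forall fun θ => (W * g).norm_coe_le_norm θ)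
  let L : C(K, ℂ) →ₗ[ℂ] ℂ :=
    { toFun := fun g => ∫ θ, W θ * g θ ∂μ
      map_add' := fun g h => by
        rw [← integral_add (hi g) (hi h)]
        simp only [ContinuousMap.add_apply, mul_add]
      map_smul' := fun a g => by
        simp only [ContinuousMap.smul_apply, smul_eq_mul, RingHom.id_apply]
        rw [← integral_const_mul]
        congr 1
        ext θ
        ring }
  refine ⟨L.mkContinuous (‖W‖ * μ.real univ) fun g => ?_, fun g h hg => ?_⟩
  · refine (norm_integral_le_of_norm_le_const (C := ‖W‖ * ‖g‖)
      (Eventually.of_forall fun θ => ?_)).trans (by rw [mul_right_comm])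
    rw [norm_mul]
    exact mul_le_mul (W.norm_coe_le_norm θ) (g.norm_coe_le_norm θ) (norm_nonneg _) (norm_nonneg _)
  · rw [← integral_subtype_comap hm]
    refine integral_congr_ae (Eventually.of_forall fun θ => ?_)
    change W θ * g θ = _
    rw [hg]
    rfl

/-- The Cauchy kernel is regarded as a function of y with values in the Banach algebra of continuous
functions on the cube. There it is a product of inverses and hence jointly analytic in y.
Integration against F is a continuous linear functional. -/
theorem analyticAt_torusIntegral (hR : ∀ i, 0 ≤ R i) {F : (Fin n → ℂ) → ℂ}
    (hF : ∀ θ, ContinuousAt F (torusMap c R θ)) (hy : ∀ i, y i ∈ Metric.ball (c i) (R i)) :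
    AnalyticAt ℂ (fun y => ∯ ξ in T(c, R), F ξ * ∏ i, (ξ i - y i)⁻¹) y := by
  let K : Set (Fin n → ℝ) := Icc 0 fun _ => 2 * Real.pi
  have hK : IsCompact K := isCompact_Icc
  have : CompactSpace K := isCompact_iff_compactSpace.1 hK
  let w : (Fin n → ℝ) → ℂ := fun θ =>
    (∏ i, R i * Complex.exp (θ i * Complex.I) * Complex.I : ℂ) * F (torusMap c R θ)
  have hw : Continuous w := by
    refine Continuous.mul (by fun_prop) (continuous_iff_continuousAt.2 fun θ => ?_)
    exact ContinuousAt.comp (g := F) (hF θ) (continuous_torusMap c R).continuousAt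
  obtain ⟨L, hL⟩ := exists_clm_setIntegral hK hw
  let e : Fin n → C(K, ℂ) := fun i => ⟨fun θ => torusMap c R θ i,
    (continuous_apply i).comp ((continuous_torusMap c R).comp continuous_subtype_val)⟩
  let A : Fin n → (Fin n → ℂ) → C(K, ℂ) := fun i y => e i - y i • (1 : C(K, ℂ))
  have hA : ∀ i, ∀ y : Fin n → ℂ, y i ∈ Metric.ball (c i) (R i) → IsUnit (A i y) := fun i y hy => by
    rw [ContinuousMap.isUnit_iff_forall_ne_zero]
    intro θ h
    have h1 := mem_sphere_iff_norm.1 (torusMap_mem_sphere (c := c) hR θ i)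
    have h2 := mem_ball_iff_norm.1 hy
    have h3 : torusMap c R θ i = y i := by
      have : torusMap c R θ i - y i • (1 : ℂ) = 0 := h
      simpa [sub_eq_zero] using this
    rw [h3] at h1
    exact h2.ne h1
  have hinv : ∀ i, ∀ y : Fin n → ℂ, y i ∈ Metric.ball (c i) (R i) → ∀ θ : K,
      Ring.inverse (A i y) θ = (torusMap c R θ i - y i)⁻¹ := fun i y hy θ => by
    have h := congrArg (fun g : C(K, ℂ) => g θ) (Ring.mul_inverse_cancel _ (hA i y hy))
    refine eq_inv_of_mul_eq_one_right ?_
    rw [← show (1 : C(K, ℂ)) θ = 1 from rfl, ← show _ = (1 : C(K, ℂ)) θ from h]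
    simp [A, e]
  have hana : AnalyticAt ℂ (fun y => L (∏ i, Ring.inverse (A i y))) y := by
    refine L.analyticAt _ |>.comp ?_
    refine Finset.analyticAt_fun_prod _ fun i _ => ?_
    have h1 : AnalyticAt ℂ (A i) y := by
      refine analyticAt_const.sub ?_
      exact AnalyticAt.smul ((ContinuousLinearMap.proj (R := ℂ) (φ := fun _ : Fin n => ℂ)
        i).analyticAt y) analyticAt_const
    obtain ⟨u, hu⟩ := hA i y (hy i)
    have h2 := analyticAt_inverse (𝕜 := ℂ) u
    rw [hu] at h2
    exact h2.comp h1
  refine hana.congr ?_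
  have hopen : ∀ᶠ z in 𝓝 y, ∀ i, z i ∈ Metric.ball (c i) (R i) := eventually_all.2 fun i =>
    (continuous_apply i).continuousAt.eventually_mem (Metric.isOpen_ball.mem_nhds (hy i))
  filter_upwards [hopen] with z hz
  rw [hL _ (fun θ => ∏ i, (torusMap c R θ i - z i)⁻¹) fun θ => ?_]
  · simp only [torusIntegral, w, smul_eq_mul, mul_assoc, K]
  · rw [ContinuousMap.prod_apply]
    exact Finset.prod_congr rfl fun i _ => hinv i z (hz i) θ

/-- Cauchy's formula over a torus for a function that satisfies Cauchy's formula in each variable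
away from some hyperplanes through the center. -/
theorem torusIntegral_cauchy (B : ℕ → Prop) {r : ℝ} (hr : 0 < r) : ∀ {n : ℕ} {c : Fin n → ℂ}
    (o : ℕ) {F : (Fin n → ℂ) → ℂ},
    (∀ y : Fin n → ℂ, (∀ i, y i ∈ Metric.closedBall (c i) r ∧ (B (i + o) → y i ≠ c i)) →
      ContinuousAt F y) →
    (∀ y : Fin n → ℂ, (∀ i, y i ∈ Metric.closedBall (c i) r ∧ (B (i + o) → y i ≠ c i)) →
      ∀ i, y i ∈ Metric.ball (c i) r →
      (∮ z in C(c i, r), F (Function.update y i z) / (z - y i)) =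
        2 * Real.pi * Complex.I * F y) →
    ∀ y : Fin n → ℂ, (∀ i, y i ∈ Metric.ball (c i) r ∧ (B (i + o) → y i ≠ c i)) →
      (∯ ξ in T(c, fun _ => r), F ξ * ∏ i, (ξ i - y i)⁻¹) = (2 * Real.pi * Complex.I) ^ n * F y := by
  intro n
  induction n with
  | zero =>
    intro c o F _ _ y _
    simp [Subsingleton.elim c y]
  | succ n ih =>
    intro c o F hF hC y hy
    -- On the torus every coordinate differs from its centre, so the exceptional hyperplanes are
    -- never met.
    have hsph : ∀ z ∈ Metric.sphere (c 0) r, z ≠ y 0 ∧ z ≠ c 0 := fun z hz => by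
      have h1 := mem_sphere_iff_norm.1 hz
      have h2 := mem_ball_iff_norm.1 (hy 0).1
      exact ⟨fun h => (h ▸ h2).ne h1, fun h => by rw [h, sub_self, norm_zero] at h1; exact hr.ne h1⟩
    have hint : TorusIntegrable (fun ξ => F ξ * ∏ i, (ξ i - y i)⁻¹) c fun _ => r := by
      refine ContinuousOn.integrableOn_compact isCompact_Icc (continuousOn_of_forall_continuousAt
        fun θ _ => ?_)
      have hs := fun i => torusMap_mem_sphere (c := c) (R := fun _ => r) (fun _ => hr.le) θ i
      have hne : ∀ i, torusMap c (fun _ => r) θ i - y i ≠ 0 := fun i => by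
        have h1 := mem_sphere_iff_norm.1 (hs i)
        have h2 := mem_ball_iff_norm.1 (hy i).1
        exact fun h => (sub_eq_zero.1 h ▸ h2).ne h1
      have hcθ : ∀ i, torusMap c (fun _ => r) θ i ≠ c i := fun i h => by
        have h1 := mem_sphere_iff_norm.1 (hs i)
        rw [h, sub_self, norm_zero] at h1; exact hr.ne h1
      have c1 := hF (torusMap c (fun _ => r) θ) fun i =>
        ⟨Metric.sphere_subset_closedBall (hs i), fun _ => hcθ i⟩
      have c2 : ContinuousAt (fun ξ : Fin (n + 1) → ℂ => ∏ i, (ξ i - y i)⁻¹)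
          (torusMap c (fun _ => r) θ) :=
        tendsto_finsetProd _ fun i _ => ContinuousAt.inv₀
          ((continuous_apply i).continuousAt.sub continuousAt_const) (hne i)
      exact (c1.mul c2).comp (f := torusMap c fun _ => r) (continuous_torusMap c _).continuousAt
    rw [torusIntegral_succ hint]
    have inner : ∀ z ∈ Metric.sphere (c 0) r,
        (∯ η in T(c ∘ Fin.succ, (fun _ => r) ∘ Fin.succ),
          F (Fin.cons z η) * ∏ i, ((Fin.cons z η : Fin (n + 1) → ℂ) i - y i)⁻¹) =
        (2 * Real.pi * Complex.I) ^ n * (F (Function.update y 0 z) / (z - y 0)) := fun z hz => by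
      obtain ⟨hz1, hz2⟩ := hsph z hz
      have good : ∀ η : Fin n → ℂ, (∀ i, η i ∈ Metric.closedBall ((c ∘ Fin.succ) i) r ∧
          (B (i + (o + 1)) → η i ≠ (c ∘ Fin.succ) i)) → ∀ i : Fin (n + 1),
          (Fin.cons z η : Fin (n + 1) → ℂ) i ∈ Metric.closedBall (c i) r ∧
          (B (i + o) → (Fin.cons z η : Fin (n + 1) → ℂ) i ≠ c i) := fun η hη i => by
        refine Fin.cases ?_ (fun j => ?_) i
        · exact ⟨Metric.sphere_subset_closedBall hz, fun _ => hz2⟩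
        · have := hη j
          simp only [Fin.cons_succ, Fin.val_succ]
          rw [show (j : ℕ) + 1 + o = j + (o + 1) by ring]
          exact this
      -- The offset o grows by one because the remaining coordinates are renumbered, so that B still
      -- refers to their original positions.
      have := ih (c := c ∘ Fin.succ) (o + 1) (F := fun η => F (Fin.cons z η)) (fun η hη => by
          have hcons : Continuous fun η : Fin n → ℂ => (Fin.cons z η : Fin (n + 1) → ℂ) :=
            continuous_pi fun i => Fin.cases (by simpa using continuous_const)
              (fun j => by simpa using continuous_apply j) i
          exact ContinuousAt.comp (g := F) (f := fun η : Fin n → ℂ => (Fin.cons z η : Fin (n + 1) → ℂ))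
            (hF _ (good η hη)) hcons.continuousAt) (fun η hη i hi => by
          have := hC _ (good η hη) i.succ (by simpa using hi)
          simp only [Fin.cons_succ, ← Fin.cons_update] at this
          exact this) (Fin.tail y) (fun i => by
          have := hy i.succ
          rw [Fin.val_succ, show (i : ℕ) + 1 + o = i + (o + 1) by ring] at this
          exact this)
      have e : (Fin.cons z (Fin.tail y) : Fin (n + 1) → ℂ) = Function.update y 0 z := by
        rw [← Fin.cons_self_tail y, Fin.update_cons_zero, Fin.tail_cons]
      rw [e] at this
      rw [mul_div_assoc', ← this, div_eq_inv_mul, ← torusIntegral_const_mul]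
      refine congrArg (fun f => torusIntegral f _ _) (funext fun η => ?_)
      rw [Fin.prod_univ_succ]
      simp only [Fin.cons_zero, Fin.cons_succ, Fin.tail]
      ring
    rw [circleIntegral.integral_congr hr.le inner, circleIntegral.integral_const_mul,
      hC y (fun i => ⟨Metric.ball_subset_closedBall (hy i).1, (hy i).2⟩) 0 (hy 0).1]
    ring

end Torus

end EllipticBeta

namespace EllipticBeta

/-! ## Removable singularities in `b` -/

section Removable

variable {τ : Fin 4 → ℝ} {w q : ℂ} {ρ : ℝ} {K : ℕ}

theorem eq_of_frequently_eq {X Y : Type*} [TopologicalSpace X] [TopologicalSpace Y] [T2Space Y]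
    {f g : X → Y} {x : X} (hf : ContinuousAt f x) (hg : ContinuousAt g x)
    (h : ∃ᶠ y in 𝓝 x, f y = g y) : f x = g x := by
  by_contra hne
  exact h ((hf.ne_iff_eventually_ne hg).1 hne)

/-- The parameters `t_r p ^ {τ_r}` with `p = exp w`. -/
noncomputable def scaleParams (τ : Fin 4 → ℝ) (w : ℂ) (x : ℂ × (Fin 4 → ℂ)) : ℂ × (Fin 4 → ℂ) :=
  (x.1, fun r => x.2 r * Complex.exp (τ r * w))

theorem continuous_scaleParams (τ : Fin 4 → ℝ) (w : ℂ) : Continuous (scaleParams τ w) := by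
  unfold scaleParams
  fun_prop

theorem powScale_three (τ : Fin 4 → ℝ) (w : ℂ) : powScale τ w 3 0 = Complex.exp w := by
  simp [powScale]

theorem mem_closure_stronglyGeneric_scaleParams (hp : ‖Complex.exp w‖ < 1) (hq : ‖q‖ < 1)
    (hq0 : q ≠ 0) {x : ℂ × (Fin 4 → ℂ)} (hb : x.1 ≠ 0) (ht : ∀ r, x.2 r ≠ 0) {c d : ℂ}
    (hc : c ≠ 0) (hd : d ≠ 0) :
    x ∈ closure {y | StronglyGeneric (Complex.exp w) q (scaleParams τ w y) ∧ y.1 ≠ c ∧ y.2 0 ≠ d} := by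
  have he : ∀ r, Complex.exp (τ r * w) ≠ 0 := fun r => Complex.exp_ne_zero _
  have h := mem_closure_stronglyGeneric hp hq hq0 (x := scaleParams τ w x) hb
    (fun r => mul_ne_zero (ht r) (he r)) hc (mul_ne_zero hd (he 0))
  let ψ : ℂ × (Fin 4 → ℂ) → ℂ × (Fin 4 → ℂ) := fun y =>
    (y.1, fun r => y.2 r * (Complex.exp (τ r * w))⁻¹)
  have hψ : Continuous ψ := by fun_prop
  have e1 : ∀ y, ψ (scaleParams τ w y) = y := fun y => by
    simp only [ψ, scaleParams]
    congr 1
    ext r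
    exact mul_inv_cancel_right₀ (he r) _
  have e2 : ∀ y, scaleParams τ w (ψ y) = y := fun y => by
    simp only [ψ, scaleParams]
    congr 1
    ext r
    exact inv_mul_cancel_right₀ (he r) _
  rw [← e1 x]
  refine map_mem_closure hψ h fun y hy => ⟨by rw [e2]; exact hy.1, hy.2.1, fun hyd => hy.2.2 ?_⟩
  rw [← hyd]
  exact (inv_mul_cancel_right₀ (he 0) _).symm

/-- Both sides are continuous at generic regular parameters and agree at the strongly generic ones,
which are dense. -/
theorem betaQuotient_eq_brokenIntegral (hρ : 0 < ρ) (hq : ‖q‖ < 1) (hq0 : q ≠ 0)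
    {x : ℂ × (Fin 4 → ℂ)} (hx : Admissible ρ K q (powScale τ w, x))
    (hreg : Regular q (powScale τ w, x)) (hgen : scaleParams τ w x ∈ generic (Complex.exp w) q) :
    betaQuotient (Complex.exp w) q (scaleParams τ w x) =
      brokenIntegral (powScale τ w) x.1 x.2 q ρ K := by
  have hp : ‖Complex.exp w‖ < 1 := powScale_three τ w ▸ hx.norm_p
  have c1 : ContinuousAt (fun x => betaQuotient (Complex.exp w) q (scaleParams τ w x)) x :=
    (continuousAt_betaQuotient hp hq (Complex.exp_ne_zero w) hq0 hgen).comp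
      (continuous_scaleParams τ w).continuousAt
  have hc : Continuous fun x : ℂ × (Fin 4 → ℂ) => (powScale τ w, x) := by fun_prop
  have c2 : ContinuousAt (fun x : ℂ × (Fin 4 → ℂ) => brokenIntegral (powScale τ w) x.1 x.2 q ρ K) x :=
    (hx.continuousAt_brokenIntegral hreg hρ hq hq0).comp (x := x)
      (f := fun x : ℂ × (Fin 4 → ℂ) => (powScale τ w, x)) hc.continuousAt
  refine eq_of_frequently_eq c1 c2 ?_
  have hev : ∀ᶠ y in 𝓝 x, Admissible ρ K q (powScale τ w, y) :=
    hc.continuousAt.eventually ((isOpen_admissible ρ K q).mem_nhds hx)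
  refine ((mem_closure_iff_frequently.1 (mem_closure_stronglyGeneric_scaleParams (τ := τ) hp hq hq0
    hx.b_ne hx.t_ne one_ne_zero one_ne_zero)).and_eventually hev).mono fun y hy => ?_
  exact hy.1.1.betaQuotient_eq_brokenIntegral (b := y.1) (t := y.2) hρ hq hq0 hy.2

theorem tendsto_sub_mul_zero {f : ℂ → ℂ} {c : ℂ} (hf : ContinuousAt f c) :
    Tendsto (fun z => (z - c) * f z) (𝓝[≠] c) (𝓝 0) := by
  have : ContinuousAt (fun z => (z - c) * f z) c := by fun_prop
  have h := this.tendsto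
  rw [sub_self, zero_mul] at h
  exact h.mono_left nhdsWithin_le_nhds

/-- The zeros satisfy c² = q^{k+1}. That they lie in the unit disc is what allows b to be kept fixed
in the density argument. -/
theorem norm_lt_one_of_qPoch_eq_zero (hq : ‖q‖ < 1) {c : ℂ} (hc : c ≠ 0)
    (h : qPoch (q / c ^ 2) q = 0) : ‖c‖ < 1 := by
  obtain ⟨k, hk⟩ := (qPoch_eq_zero_iff hq).1 h
  have e : c ^ 2 = q ^ (k + 1) := by
    field_simp at hk
    rw [← hk, pow_succ']
  have := congrArg norm e
  rw [norm_pow, norm_pow] at this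
  have h1 : ‖q‖ ^ (k + 1) < 1 := pow_lt_one₀ (norm_nonneg _) hq (by omega)
  by_contra! hcon
  nlinarith

/-- For generic t the broken integral coincides near the singular b with the original integral,
which is continuous there, so the singularity is removable and Cauchy's formula holds. Both sides of
the formula are continuous in t and such t are dense. -/
theorem brokenIntegral_cauchy_fst (hρ : 0 < ρ) (hq : ‖q‖ < 1) (hq0 : q ≠ 0) {c v : ℂ} {r : ℝ}
    (hr : 0 ≤ r) {t : Fin 4 → ℂ} (hadm : ∀ z ∈ Metric.closedBall c r, Admissible ρ K q (powScale τ w, z, t))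
    (hb : ∀ z ∈ Metric.closedBall c r, z ≠ c → qPoch (q / z ^ 2) q ≠ 0)
    (ht : pqPoch (t 0 ^ 2 * powScale τ w 1 0) (powScale τ w 3 0) q ≠ 0)
    (hpc : ‖Complex.exp w * q / c‖ < 1) (hv : v ∈ Metric.ball c r) (hvc : v ≠ c) :
    (∮ z in C(c, r), brokenIntegral (powScale τ w) z t q ρ K / (z - v)) =
      2 * Real.pi * Complex.I * brokenIntegral (powScale τ w) v t q ρ K := by
  have hcc : c ∈ Metric.closedBall c r := Metric.mem_closedBall_self hr
  have hc0 : c ≠ 0 := (hadm c hcc).b_ne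
  have hp : ‖Complex.exp w‖ < 1 := powScale_three τ w ▸ (hadm c hcc).norm_p
  have diff : ∀ t : Fin 4 → ℂ, ∀ z, Admissible ρ K q (powScale τ w, z, t) →
      Regular q (powScale τ w, z, t) →
      DifferentiableAt ℂ (fun z => brokenIntegral (powScale τ w) z t q ρ K) z := fun t z h1 h2 =>
    differentiableAt_brokenIntegral (g := fun z => (z, t)) (by fun_prop) h1 h2 hρ hq hq0
  -- If (q/c²;q) does not vanish at the centre, the function is holomorphic in the whole disc and
  -- nothing has to be removed.
  by_cases hbad : qPoch (q / c ^ 2) q = 0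
  swap
  · refine cauchy_of_removable hv hvc (fun z hz hzc => diff t z (hadm z hz) ⟨hb z hz hzc, ht⟩) ?_
    exact tendsto_sub_mul_zero (diff t c (hadm c hcc) ⟨hbad, ht⟩).continuousAt
  have hc1 := norm_lt_one_of_qPoch_eq_zero hq hc0 hbad
  have cm : Continuous fun y : (Fin 4 → ℂ) × ℂ => (powScale τ w, y.2, y.1) := by fun_prop
  have ev1 : ∀ᶠ t' in 𝓝 t, ∀ z ∈ Metric.closedBall c r, Admissible ρ K q (powScale τ w, z, t') :=
    (isCompact_closedBall c r).eventually_forall_of_forall_eventually fun z hz =>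
      cm.continuousAt.eventually ((isOpen_admissible ρ K q).mem_nhds (hadm z hz))
  have ct : ContinuousAt (fun t : Fin 4 → ℂ =>
      pqPoch (t 0 ^ 2 * powScale τ w 1 0) (powScale τ w 3 0) q) t := by
    exact ContinuousAt.pqPoch (((continuous_apply 0).pow 2).mul continuous_const).continuousAt
      continuousAt_const continuousAt_const (hadm c hcc).norm_p hq
  have ev2 := ct.eventually_ne ht
  have cont : ∀ (t' : Fin 4 → ℂ) (z : ℂ), Admissible ρ K q (powScale τ w, z, t') →
      Regular q (powScale τ w, z, t') → ContinuousAt (fun y : (Fin 4 → ℂ) × ℂ =>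
        brokenIntegral (powScale τ w) y.2 y.1 q ρ K) (t', z) := fun t' z h1 h2 =>
    (h1.continuousAt_brokenIntegral h2 hρ hq hq0).comp (x := (t', z))
      (f := fun y : (Fin 4 → ℂ) × ℂ => (powScale τ w, y.2, y.1)) cm.continuousAt
  have hsph : ∀ z ∈ Metric.sphere c r, z ≠ c ∧ z ≠ v := fun z hz => by
    have h1 := mem_sphere_iff_norm.1 hz
    have h2 := mem_ball_iff_norm.1 hv
    refine ⟨fun h => ?_, fun h => (h ▸ h2).ne h1⟩
    rw [h, sub_self, norm_zero] at h1
    exact absurd h2 (by rw [← h1]; exact not_lt.2 (norm_nonneg _))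
  have c1 := (continuousOn_circleIntegral (f := fun (t' : Fin 4 → ℂ) z =>
      brokenIntegral (powScale τ w) z t' q ρ K / (z - v)) hr (U := {t' | (∀ z ∈ Metric.closedBall c r,
      Admissible ρ K q (powScale τ w, z, t')) ∧
      pqPoch (t' 0 ^ 2 * powScale τ w 1 0) (powScale τ w 3 0) q ≠ 0}) fun t' ht' z hz => by
    obtain ⟨hz1, hz2⟩ := hsph z hz
    have hz' := Metric.sphere_subset_closedBall hz
    exact (cont t' z (ht'.1 z hz') ⟨hb z hz' hz1, ht'.2⟩).div (by fun_prop)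
      (sub_ne_zero.2 hz2)).continuousAt (ev1.and ev2)
  have hvb := Metric.ball_subset_closedBall hv
  have c2 : ContinuousAt (fun t' => 2 * Real.pi * Complex.I *
      brokenIntegral (powScale τ w) v t' q ρ K) t :=
    continuousAt_const.mul ((cont t v (hadm v hvb) ⟨hb v hvb hvc, ht⟩).comp (x := t)
      (f := fun t' : Fin 4 → ℂ => (t', v)) (by fun_prop))
  refine eq_of_frequently_eq c1 c2 ?_
  have he : ∀ r, Complex.exp (τ r * w) ≠ 0 := fun r => Complex.exp_ne_zero _
  have hfreq : t ∈ closure {t' | scaleParams τ w (c, t') ∈ generic (Complex.exp w) q} := by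
    have h := mem_closure_generic_of_fst (x := scaleParams τ w (c, t)) hp hq (Complex.exp_ne_zero w) hq0
      hc0 (fun r => mul_ne_zero ((hadm c hcc).t_ne r) (he r)) hc1 hpc
    have e1 : ∀ u : Fin 4 → ℂ, (fun r => u r * Complex.exp (τ r * w) * (Complex.exp (τ r * w))⁻¹) = u :=
      fun u => funext fun r => mul_inv_cancel_right₀ (he r) _
    have e2 : ∀ u : Fin 4 → ℂ, (fun r => u r * (Complex.exp (τ r * w))⁻¹ * Complex.exp (τ r * w)) = u :=
      fun u => funext fun r => inv_mul_cancel_right₀ (he r) _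
    rw [← e1 t]
    refine map_mem_closure (f := fun (u : Fin 4 → ℂ) r => u r * (Complex.exp (τ r * w))⁻¹)
      (by fun_prop) h fun u hu => ?_
    simp only [Set.mem_ofPred_eq, scaleParams, e2]
    exact hu
  refine ((mem_closure_iff_frequently.1 hfreq).and_eventually (ev1.and ev2)).mono ?_
  rintro t' ⟨hg, h1, h2⟩
  refine cauchy_of_removable hv hvc (fun z hz hzc => diff t' z (h1 z hz) ⟨hb z hz hzc, h2⟩) ?_
  have cN : ContinuousAt (fun z => betaQuotient (Complex.exp w) q (scaleParams τ w (z, t'))) c :=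
    (continuousAt_betaQuotient hp hq (Complex.exp_ne_zero w) hq0 hg).comp (x := c)
      (f := fun z => scaleParams τ w (z, t'))
      ((continuous_scaleParams τ w).comp (Continuous.prodMk_left t')).continuousAt
  -- Near c, but off c, the broken integral equals the continuous function `betaQuotient`, so (z -
  -- c) times it tends to zero.
  refine (tendsto_sub_mul_zero cN).congr' ?_
  have hev : ∀ᶠ z in 𝓝 c, scaleParams τ w (z, t') ∈ generic (Complex.exp w) q :=
    ((continuous_scaleParams τ w).comp (Continuous.prodMk_left t')).continuousAt.eventually
      ((isOpen_generic hp hq (Complex.exp_ne_zero w) hq0).mem_nhds hg)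
  have hball : ∀ᶠ z in 𝓝 c, z ∈ Metric.closedBall c r :=
    Metric.closedBall_mem_nhds c ((norm_nonneg _).trans_lt (mem_ball_iff_norm.1 hv))
  filter_upwards [nhdsWithin_le_nhds hev, nhdsWithin_le_nhds hball, self_mem_nhdsWithin]
    with z hz1 hz2 hz3
  rw [betaQuotient_eq_brokenIntegral hρ hq hq0 (h1 z hz2) ⟨hb z hz2 hz3, h2⟩ hz1]

end Removable

end EllipticBeta

namespace EllipticBeta

/-! ## The sum of the residues on the hyperplanes `t_0 ^ 2 = q ^ {-N}` -/

section Antisymmetry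

/-- The scales for `τ = (-1/2, 1/2, 1/2, 1/2)`. -/
def halfScale (p : ℂ) : Fin 4 → Fin 4 → ℂ :=
  ![![1, p, p, p], fun _ => 1, fun _ => p, ![p, 1, 1, 1]]

variable {b : ℂ} {t : Fin 4 → ℂ} {p q : ℂ}

/-- Half of the factors of `num k b t q ζ * denHalf b t p q ζ⁻¹` that are invariant under
inversion of `ζ`. -/
noncomputable def halfFactor (b : ℂ) (t : Fin 4 → ℂ) (p q ζ : ℂ) : ℂ :=
  pqPoch (p * (b * t 0 * ζ)) p q * pqPoch (p * (q * ζ / t 0)) p q * pqPoch (p * (q * ζ ^ 2 / b)) p q *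
    pqPoch (p * (q * ζ / (b * t 0))) p q * pqPoch (p * (b * ζ ^ 2)) p q * pqPoch (p * (t 0 * ζ)) p q *
    ∏ s : Fin 3, (pqPoch (p * (q * ζ / t s.succ)) p q * pqPoch (p * (b * t s.succ * ζ)) p q *
      pqPoch (p * (t s.succ * ζ)) p q * pqPoch (p * (q * ζ / (b * t s.succ))) p q)

/-- The theta functions in `num k b t q ζ * denHalf b t p q ζ⁻¹`. -/
noncomputable def thetaHalf (b : ℂ) (t : Fin 4 → ℂ) (p q ζ η : ℂ) : ℂ :=
  theta (b ^ 2 * t 0 * ζ) q * theta (b * t 0 * η) q * theta (b * ζ ^ 2) q * theta (η ^ 2) p *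
    ∏ s : Fin 3, (theta (t s.succ * ζ) q * theta (b * t s.succ * η) q)

/-- The denominator of the integrand without the zeros at `t_0 q ^ n` and `1 / (t_0 q ^ n)`. -/
noncomputable def denHalf (b : ℂ) (t : Fin 4 → ℂ) (p q ζ : ℂ) : ℂ :=
  denInCore (halfScale p) b t q ζ * denOutCore (halfScale p) b t q ζ *
    (pqPoch (p * t 0 * ζ) p q * pqPoch (p * t 0 / ζ) p q)

theorem num_halfScale {ζ η : ℂ} (hη : ζ * η = 1) : num (halfScale p) b t q ζ =
    theta (b ^ 2 * t 0 * ζ) q * pqPoch (p * (b * t 0 * ζ)) p q * pqPoch (p * (q * η / t 0)) p q *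
    pqPoch (p * (q * ζ / t 0)) p q * pqPoch (p * (q * ζ ^ 2 / b)) p q * pqPoch (q * η ^ 2 / b) p q *
    qPoch (η ^ 2) p * qPoch (p * ζ ^ 2) p *
    (∏ s : Fin 3, (pqPoch (q * η / t s.succ) p q * pqPoch (p * (q * ζ / t s.succ)) p q *
      pqPoch (b * t s.succ * η) p q * pqPoch (p * (b * t s.succ * ζ)) p q)) *
    pqPoch (b * t 0 * η) p q := by
  have hη' : η = ζ⁻¹ := eq_inv_of_mul_eq_one_right hη
  subst hη'
  simp only [num, numCore, halfScale, Fin.prod_univ_three, Fin.succ_zero_eq_one,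
    Fin.succ_one_eq_two, show Fin.succ (2 : Fin 3) = 3 from rfl, Matrix.cons_val, mul_one]
  repeat' first
    | with_reducible rfl
    | with_reducible apply pqPoch_congr
    | with_reducible apply qPoch_congr
    | with_reducible apply theta_congr
    | with_reducible apply mul_congr_aux
  all_goals (try simp only [div_eq_mul_inv, mul_inv, inv_pow]); ring

theorem denHalf_inv {ζ η : ℂ} (hη : ζ * η = 1) : denHalf b t p q η =
    (pqPoch (q * ζ / (b * t 0)) p q * pqPoch (b * ζ ^ 2) p q *
      ∏ s : Fin 3, (pqPoch (t s.succ * ζ) p q * pqPoch (q * ζ / (b * t s.succ)) p q)) *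
    (pqPoch (p * (q * η / (b * t 0))) p q * pqPoch (p * (b * η ^ 2)) p q *
      ∏ s : Fin 3, (pqPoch (p * (t s.succ * η)) p q * pqPoch (p * (q * η / (b * t s.succ))) p q)) *
    (pqPoch (p * (t 0 * η)) p q * pqPoch (p * (t 0 * ζ)) p q) := by
  have hη' : η = ζ⁻¹ := eq_inv_of_mul_eq_one_right hη
  subst hη'
  simp only [denHalf, denInCore, denOutCore, halfScale, Fin.prod_univ_three, Fin.succ_zero_eq_one,
    Fin.succ_one_eq_two, show Fin.succ (2 : Fin 3) = 3 from rfl, Matrix.cons_val, mul_one]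
  repeat' first
    | with_reducible rfl
    | with_reducible apply pqPoch_congr
    | with_reducible apply mul_congr_aux
  all_goals (try simp only [div_eq_mul_inv, mul_inv, inv_pow, inv_inv]); ring

/-- The factors carrying an additional p combine to an expression that is symmetric in ζ and η. The
factors without it pair up to theta functions: all of nome q, except one of nome p. -/
theorem num_mul_denHalf_inv (hp : ‖p‖ < 1) (hq : ‖q‖ < 1) {ζ η : ℂ} (hη : ζ * η = 1) :
    num (halfScale p) b t q ζ * denHalf b t p q η =
      halfFactor b t p q ζ * halfFactor b t p q η * thetaHalf b t p q ζ η := by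
  have s : ∀ x, pqPoch x p q = qPoch x q * pqPoch (p * x) p q := fun x => by
    rw [pqPoch_succ_left hp hq, mul_comm p]
  have hζ : η = ζ⁻¹ := eq_inv_of_mul_eq_one_right hη
  have e1 : ∀ x : ℂ, q / (x * η) = q * ζ / x := fun x => by
    subst hζ; simp only [div_eq_mul_inv, mul_inv, inv_inv]; ring
  have e2 : ∀ x : ℂ, q / (x * ζ) = q * η / x := fun x => by
    subst hζ; simp only [div_eq_mul_inv, mul_inv]; ring
  have e3 : q / (b * ζ ^ 2) = q * η ^ 2 / b := by
    subst hζ; simp only [div_eq_mul_inv, mul_inv, inv_pow]; ring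
  have e4 : p / η ^ 2 = p * ζ ^ 2 := by
    subst hζ; simp only [div_eq_mul_inv, inv_pow, inv_inv]
  rw [num_halfScale hη, denHalf_inv hη, halfFactor, halfFactor, thetaHalf,
    s (q * η ^ 2 / b), s (b * t 0 * η), s (q * ζ / (b * t 0)), s (b * ζ ^ 2)]
  simp only [fun i : Fin 3 => s (q * η / t i.succ), fun i : Fin 3 => s (b * t i.succ * η),
    fun i : Fin 3 => s (t i.succ * ζ), fun i : Fin 3 => s (q * ζ / (b * t i.succ))]
  simp only [theta.eq_def (b * t 0 * η), theta.eq_def (b * ζ ^ 2), theta.eq_def (η ^ 2),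
    fun i : Fin 3 => theta.eq_def (t i.succ * ζ), fun i : Fin 3 => theta.eq_def (b * t i.succ * η),
    e1, e2, e3, e4, Finset.prod_mul_distrib]
  ring

/-- Iterating the quasi-periodicity gives d explicitly, but only its square enters later, so signs
need not be tracked. -/
theorem exists_theta_mul_pow (hq : ‖q‖ < 1) (hq0 : q ≠ 0) (M : ℕ) :
    ∃ d : ℂ, d ^ 2 * q ^ (M * M) = q ^ M ∧ ∀ x ≠ 0, theta (x * q ^ M) q * x ^ M = d * theta x q := by
  induction M with
  | zero => exact ⟨1, by simp, fun x _ => by simp⟩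
  | succ M ih =>
    obtain ⟨d, hd, h⟩ := ih
    refine ⟨-(q ^ M)⁻¹ * d, ?_, fun x hx => ?_⟩
    · have e : q ^ ((M + 1) * (M + 1)) = q ^ (M * M) * (q ^ M) ^ 2 * q := by ring
      have hi : (q ^ M)⁻¹ * q ^ M = 1 := inv_mul_cancel₀ (pow_ne_zero _ hq0)
      rw [e, pow_succ]
      linear_combination hd * q + d ^ 2 * q ^ (M * M) * q * ((q ^ M)⁻¹ * q ^ M + 1) * hi
    · have hM : q ^ M ≠ 0 := pow_ne_zero _ hq0
      have h1 := theta_mul hq hq0 (mul_ne_zero hx hM)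
      rw [pow_succ, ← mul_assoc x, h1]
      have h2 := h x hx
      field_simp
      linear_combination -h2 * x

/-- Since ζ² = q^M and ζη = 1, exchanging ζ and η shifts the arguments by powers of q. The
multipliers arising from the theta functions of nome q are b^{-M}, ζ² b^{-2M} and b^{3M}. The theta
function of nome p contributes -ζ^{-2}, so the total is -1. -/
theorem thetaHalf_inv (hp : ‖p‖ < 1) (hq : ‖q‖ < 1) (hq0 : q ≠ 0) (hb : b ≠ 0)
    (ht : ∀ r, t r ≠ 0) {ζ η : ℂ} (hη : ζ * η = 1) {M : ℕ} (hM : ζ ^ 2 = q ^ M) :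
    thetaHalf b t p q η ζ = -thetaHalf b t p q ζ η := by
  obtain ⟨d, hd, h⟩ := exists_theta_mul_pow hq hq0 M
  have hζ0 : ζ ≠ 0 := left_ne_zero_of_mul_eq_one hη
  have hη' : η = ζ⁻¹ := eq_inv_of_mul_eq_one_right hη
  have hη0 : η ≠ 0 := right_ne_zero_of_mul_eq_one hη
  -- The quasi-periodicity is symmetrized about the midpoint: θ(xζ) x^M = e θ(xη) with e² = ζ².
  set e : ℂ := d * ζ ^ M with he
  have he2 : e ^ 2 = ζ ^ 2 := by
    rw [he, mul_pow, ← pow_mul, mul_comm M 2, pow_mul, hM, ← pow_mul, hd, ← hM]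
  have hs : ∀ x ≠ 0, theta (x * ζ) q * x ^ M = e * theta (x * η) q := fun x hx => by
    have := h (x * η) (mul_ne_zero hx hη0)
    rw [← hM, show x * η * ζ ^ 2 = x * ζ * (ζ * η) by ring, hη, mul_one, mul_pow] at this
    have h1 : η ^ M * ζ ^ M = 1 := by rw [← mul_pow, mul_comm, hη, one_pow]
    linear_combination this * ζ ^ M - theta (x * ζ) q * x ^ M * h1
  have hb2 : theta (b * ζ ^ 2) q * (b ^ M) ^ 2 = ζ ^ 2 * theta (b * η ^ 2) q := by
    have a1 := hs (b * ζ) (mul_ne_zero hb hζ0)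
    have a2 := hs (b * η) (mul_ne_zero hb hη0)
    rw [show b * ζ * ζ = b * ζ ^ 2 by ring, show b * ζ * η = b * (ζ * η) by ring, hη, mul_one,
      mul_pow] at a1
    rw [show b * η * ζ = b * (ζ * η) by ring, hη, mul_one, show b * η * η = b * η ^ 2 by ring,
      mul_pow] at a2
    have h1 : η ^ M * ζ ^ M = 1 := by rw [← mul_pow, mul_comm, hη, one_pow]
    linear_combination b ^ M * η ^ M * a1 + e * a2 + theta (b * η ^ 2) q * he2 - theta (b * ζ ^ 2) q * (b ^ M) ^ 2 * h1
  have h0 := ht 0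
  have hpb : theta (η ^ 2) p * ζ ^ 2 = -theta (ζ ^ 2) p := by
    rw [hη', inv_pow, theta_inv hp (pow_ne_zero 2 hζ0)]
    field_simp
  have k1 := hs (b ^ 2 * t 0) (mul_ne_zero (pow_ne_zero 2 hb) h0)
  have k2 := hs (b * t 0) (mul_ne_zero hb h0)
  have k3 : ∀ s : Fin 3, theta (t s.succ * ζ) q * t s.succ ^ M * (e * theta (b * t s.succ * η) q) =
      theta (b * t s.succ * ζ) q * (b * t s.succ) ^ M * (e * theta (t s.succ * η) q) := fun s => by
    rw [hs _ (ht s.succ), hs _ (mul_ne_zero hb (ht s.succ))]; ring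
  have k4 : (∏ s : Fin 3, (theta (t s.succ * ζ) q * theta (b * t s.succ * η) q)) =
      (b ^ M) ^ 3 * ∏ s : Fin 3, (theta (t s.succ * η) q * theta (b * t s.succ * ζ) q) := by
    rw [show (b ^ M) ^ 3 = ∏ s : Fin 3, b ^ M by simp, ← Finset.prod_mul_distrib]
    refine Finset.prod_congr rfl fun s _ => ?_
    have he0 : e ≠ 0 := fun h => by
      rw [h, zero_pow two_ne_zero] at he2
      exact pow_ne_zero 2 hζ0 he2.symm
    apply mul_left_cancel₀ (mul_ne_zero (pow_ne_zero M (ht s.succ)) he0)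
    linear_combination k3 s
  have he0 : e ≠ 0 := fun h => by
    rw [h, zero_pow two_ne_zero] at he2
    exact pow_ne_zero 2 hζ0 he2.symm
  have htM : t 0 ^ M ≠ 0 := pow_ne_zero _ h0
  have k5 : theta (b ^ 2 * t 0 * ζ) q * theta (b * t 0 * η) q * b ^ M =
      theta (b ^ 2 * t 0 * η) q * theta (b * t 0 * ζ) q := by
    apply mul_left_cancel₀ (mul_ne_zero (mul_ne_zero htM he0) (pow_ne_zero M hb))
    have p1 : (b ^ 2 * t 0) ^ M = (b ^ M) ^ 2 * t 0 ^ M := by ring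
    have p2 : (b * t 0) ^ M = b ^ M * t 0 ^ M := by ring
    rw [p1] at k1
    rw [p2] at k2
    linear_combination e * theta (b * t 0 * η) q * k1 - e * theta (b ^ 2 * t 0 * η) q * k2
  rw [thetaHalf, thetaHalf, k4]
  apply mul_right_cancel₀ (pow_ne_zero 2 hζ0)
  set P := ∏ s : Fin 3, (theta (t s.succ * η) q * theta (b * t s.succ * ζ) q)
  linear_combination P * ζ ^ 2 * theta (η ^ 2) p * (theta (b * ζ ^ 2) q * (b ^ M) ^ 2 * k5 +
    theta (b ^ 2 * t 0 * η) q * theta (b * t 0 * ζ) q * hb2) +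
    P * ζ ^ 2 * theta (b ^ 2 * t 0 * η) q * theta (b * t 0 * ζ) q * theta (b * η ^ 2) q * hpb

end Antisymmetry

end EllipticBeta

namespace EllipticBeta

/-! ### Cancellation of the residues in pairs -/

section ResidueSum

variable {b : ℂ} {t : Fin 4 → ℂ} {p q : ℂ} {ρ : ℝ} {K : ℕ}

/-- This undoes the cancellation that led to `residueCore`, so that the antisymmetry of the
numerators can be used. The relation between t_0 and q identifies one factor of `denHalf` as
(p/q^m;p,q). -/
theorem residueCore_mul_denHalf (hp : ‖p‖ < 1) (hq : ‖q‖ < 1) (hq0 : q ≠ 0) (hb : b ≠ 0)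
    (ht : ∀ r, t r ≠ 0) {n m : ℕ} (hc : t 0 ^ 2 * q ^ (n + m) = 1)
    (hP : pqPoch (p / q ^ m) p q ≠ 0) (hD : denOut (halfScale p) b t q (t 0 * q ^ n)⁻¹ ≠ 0) :
    residueCore (halfScale p) b t q n / pqPoch (p / q ^ m) p q * poleFactor q n *
      denHalf b t p q (t 0 * q ^ n)⁻¹ =
    pref (halfScale p) b t q * num (halfScale p) b t q (t 0 * q ^ n)⁻¹ := by
  have ht0 := ht 0
  have hpf := poleFactor_ne_zero hq hq0 n
  have e1 : q / (b * t 0 * (t 0 * q ^ n)⁻¹) = q / b * q ^ n := by field_simp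
  have e2 : b * halfScale p 1 0 / (t 0 * q ^ n)⁻¹ ^ 2 =
      b * t 0 ^ 2 * halfScale p 1 0 * q ^ n * q ^ n := by
    field_simp
  have e3 : b * t 0 * halfScale p 1 0 / (t 0 * q ^ n)⁻¹ = b * t 0 ^ 2 * halfScale p 1 0 * q ^ n := by
    field_simp
  have e5 : ∀ s : Fin 3, t s.succ * halfScale p 1 s.succ / (t 0 * q ^ n)⁻¹ =
      t 0 * t s.succ * halfScale p 1 s.succ * q ^ n := fun s => by field_simp
  have e6 : ∀ s : Fin 3, q * halfScale p 3 s.succ / (b * t s.succ * (t 0 * q ^ n)⁻¹) =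
      q * t 0 * halfScale p 3 s.succ / (b * t s.succ) * q ^ n := fun s => by
    have := ht s.succ
    field_simp
  have e7 : p * t 0 / (t 0 * q ^ n)⁻¹ = p / q ^ m := by
    rw [div_inv_eq_mul, eq_div_iff (pow_ne_zero _ hq0)]
    linear_combination p * hc
  have hh : halfScale p 3 0 = p := rfl
  have hk : ‖halfScale p 3 0‖ < 1 := hp
  rw [denHalf, e7]
  simp only [num, denInCore, pref, e1, e2, e3, e5, e6]
  rw [← shiftProd_mul hk hq (b * t 0 ^ 2 * halfScale p 1 0 * q ^ n) n,
    ← shiftProd_mul hk hq (q / b) n,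
    Finset.prod_congr rfl fun s _ => congrArg₂ (· * ·)
      (shiftProd_mul hk hq (t 0 * t (Fin.succ s) * halfScale p 1 s.succ) n).symm
      (shiftProd_mul hk hq (q * t 0 * halfScale p 3 (Fin.succ s) / (b * t s.succ)) n).symm,
    residueCore]
  simp only [Finset.prod_mul_distrib]
  rw [denOut] at hD
  rw [denOut]
  simp only [hh] at hD ⊢
  generalize ∏ s : Fin 3, pqPoch (t 0 * t (Fin.succ s) * halfScale p 1 s.succ * q ^ n) p q = A1
  generalize ∏ s : Fin 3, pqPoch (q * t 0 * halfScale p 3 (Fin.succ s) / (b * t s.succ) * q ^ n) p q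
    = A2
  generalize pqPoch (q / b * q ^ n) p q = A3
  generalize pqPoch (b * t 0 ^ 2 * halfScale p 1 0 * q ^ n * q ^ n) p q = A4
  generalize pqPoch (p / q ^ m) p q = A5 at *
  generalize pqPoch (p * t 0 * (t 0 * q ^ n)⁻¹) p q = A6 at *
  generalize denOutCore (halfScale p) b t q (t 0 * q ^ n)⁻¹ = A7 at *
  generalize numCore (halfScale p) b t q (t 0 * q ^ n)⁻¹ = A8
  generalize shiftProd (q / b) p q n = A9
  generalize shiftProd (b * t 0 ^ 2 * halfScale p 1 0 * q ^ n) p q n = A10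
  have h7 := left_ne_zero_of_mul hD
  have h6 := right_ne_zero_of_mul hD
  field_simp

theorem countable_setOf_pqPoch_mul_exp_eq_zero (hp : ‖p‖ < 1) (hq : ‖q‖ < 1) (x : ℂ) {n : ℤ}
    (hn : n ≠ 0) : {l | pqPoch (x * Complex.exp (n * l)) p q = 0}.Countable := by
  have : {l | pqPoch (x * Complex.exp (n * l)) p q = 0} ⊆ ⋃ i : ℕ, ⋃ j : ℕ,
      {l | x * p ^ i * q ^ j * Complex.exp (n * l) = 1} := fun l hl => by
    obtain ⟨i, j, h⟩ := (pqPoch_eq_zero_iff hp hq).1 hl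
    simp only [Set.mem_iUnion]
    exact ⟨i, j, by rw [Set.mem_ofPred_eq]; linear_combination h⟩
  exact (countable_iUnion fun i => countable_iUnion fun j =>
    countable_setOf_mul_exp_eq _ 1 n one_ne_zero (.inl hn)).mono this

/-- The curve fixes t_0, and along it the arguments of all factors vary with exponents -1, 1, 2 or
-3, none of which is zero. -/
theorem countable_setOf_denInCore_eq_zero {k : Fin 4 → Fin 4 → ℂ} (hk : ‖k 3 0‖ < 1)
    (hq : ‖q‖ < 1) (ζ : ℂ) : {l | denInCore k (b * Complex.exp l)
      ![t 0, t 1 * Complex.exp (2 * l), t 2 * Complex.exp (2 * l), t 3 * Complex.exp (2 * l)] q ζ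
      = 0}.Countable := by
  have h : ∀ (x : ℂ) (n : ℤ), n ≠ 0 → {l | pqPoch (x * Complex.exp (n * l)) (k 3 0) q = 0}.Countable :=
    fun x n hn => countable_setOf_pqPoch_mul_exp_eq_zero hk hq x hn
  refine (((h (q / (b * t 0 * ζ)) (-1) (by simp)).union (h (b * k 1 0 / ζ ^ 2) 1 one_ne_zero)).union
    (countable_iUnion fun s : Fin 3 => (h (t s.succ * k 1 s.succ / ζ) 2 two_ne_zero).union
      (h (q * k 3 s.succ / (b * t s.succ * ζ)) (-3) (by norm_num)))).mono fun l hl => ?_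
  have e1 : Complex.exp (-l) = (Complex.exp l)⁻¹ := Complex.exp_neg l
  have e2 : Complex.exp (2 * l) = Complex.exp l ^ 2 := by rw [← Complex.exp_nat_mul]; simp
  have e3 : Complex.exp (-3 * l) = (Complex.exp l ^ 3)⁻¹ := by
    rw [← Complex.exp_nat_mul, neg_mul, Complex.exp_neg]; simp
  have hs : ∀ s : Fin 3, (![t 0, t 1 * Complex.exp (2 * l), t 2 * Complex.exp (2 * l),
      t 3 * Complex.exp (2 * l)] : Fin 4 → ℂ) s.succ = t s.succ * Complex.exp l ^ 2 := fun s => by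
    rw [← e2]; fin_cases s <;> rfl
  simp only [Set.mem_ofPred_eq, denInCore, mul_eq_zero, Finset.prod_eq_zero_iff, hs,
    Finset.mem_univ, true_and, Matrix.cons_val_zero] at hl
  simp only [Set.mem_union, Set.mem_iUnion, Set.mem_ofPred_eq, Int.cast_neg, Int.cast_one,
    Int.cast_ofNat, one_mul, neg_mul, e1, e2]
  rw [show -(3 * l) = -3 * l by ring, e3]
  rcases hl with (hl | hl) | ⟨s, hl | hl⟩
  · exact .inl (.inl (by rw [← hl]; congr 1; simp only [div_eq_mul_inv, mul_inv]; ring))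
  · exact .inl (.inr (by rw [← hl]; congr 1; ring))
  · exact .inr ⟨s, .inl (by rw [← hl]; congr 1; ring)⟩
  · refine .inr ⟨s, .inr (by rw [← hl]; congr 1; simp only [div_eq_mul_inv, mul_inv]; ring)⟩

/-- The poles ζ and η with indices n and m satisfy ζη = 1. The products of a numerator at one pole
and a denominator at the other are therefore opposite by `thetaHalf_inv`. -/
theorem residueCore_antisymm_of_denInCore_ne_zero (hq : ‖q‖ < 1) (hq0 : q ≠ 0)
    (hx : Admissible ρ K q (halfScale p, b, t)) {n m : ℕ} (hn : n < K) (hm : m < K)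
    (hc : t 0 ^ 2 * q ^ (n + m) = 1) (hnm : n ≤ m)
    (h1 : denInCore (halfScale p) b t q (t 0 * q ^ n)⁻¹ ≠ 0)
    (h2 : denInCore (halfScale p) b t q (t 0 * q ^ m)⁻¹ ≠ 0) :
    residueCore (halfScale p) b t q n / pqPoch (p / q ^ m) p q * poleFactor q n =
      -(residueCore (halfScale p) b t q m / pqPoch (p / q ^ n) p q * poleFactor q m) := by
  have hp : ‖p‖ < 1 := hx.norm_p
  have hb : b ≠ 0 := hx.b_ne
  have ht : ∀ r, t r ≠ 0 := hx.t_ne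
  have ht0 := ht 0
  have hc' : t 0 ^ 2 * q ^ (m + n) = 1 := by rw [add_comm, hc]
  have d1 : denOut (halfScale p) b t q (t 0 * q ^ n)⁻¹ ≠ 0 := hx.denOut_pole_ne_zero hq hq0 hn
  have d2 : denOut (halfScale p) b t q (t 0 * q ^ m)⁻¹ ≠ 0 := hx.denOut_pole_ne_zero hq hq0 hm
  have e : ∀ {n m : ℕ}, t 0 ^ 2 * q ^ (n + m) = 1 → p * t 0 * (t 0 * q ^ m)⁻¹ = p / q ^ m ∧
      p * t 0 / (t 0 * q ^ n)⁻¹ = p / q ^ m := fun {n m} hc => by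
    constructor
    · field_simp
    · rw [div_inv_eq_mul, eq_div_iff (pow_ne_zero _ hq0)]
      linear_combination p * hc
  have P1 : pqPoch (p / q ^ n) p q ≠ 0 := by
    rw [← (e hc').1]; exact right_ne_zero_of_mul d1
  have P2 : pqPoch (p / q ^ m) p q ≠ 0 := by
    rw [← (e hc).1]; exact right_ne_zero_of_mul d2
  have H1 : denHalf b t p q (t 0 * q ^ n)⁻¹ ≠ 0 := by
    rw [denHalf, (e hc).2]
    exact mul_ne_zero (mul_ne_zero h1 (left_ne_zero_of_mul d1))
      (mul_ne_zero (right_ne_zero_of_mul d1) P2)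
  have H2 : denHalf b t p q (t 0 * q ^ m)⁻¹ ≠ 0 := by
    rw [denHalf, (e hc').2]
    exact mul_ne_zero (mul_ne_zero h2 (left_ne_zero_of_mul d2))
      (mul_ne_zero (right_ne_zero_of_mul d2) P1)
  have r1 := residueCore_mul_denHalf hp hq hq0 hb ht hc P2 d1
  have r2 := residueCore_mul_denHalf hp hq hq0 hb ht hc' P1 d2
  have hz : (t 0 * q ^ n)⁻¹ * (t 0 * q ^ m)⁻¹ = 1 := by
    rw [← mul_inv, inv_eq_one]
    linear_combination hc
  have hz' : (t 0 * q ^ m)⁻¹ * (t 0 * q ^ n)⁻¹ = 1 := by rw [mul_comm, hz]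
  have n1 := num_mul_denHalf_inv (b := b) (t := t) hp hq hz
  have n2 := num_mul_denHalf_inv (b := b) (t := t) hp hq hz'
  have hM : (t 0 * q ^ n)⁻¹ ^ 2 = q ^ (m - n) := by
    rw [inv_pow]
    refine inv_eq_of_mul_eq_one_right ?_
    rw [← hc, mul_pow, mul_assoc, ← pow_mul, ← pow_add]
    congr 2
    omega
  have th := thetaHalf_inv (b := b) (t := t) hp hq hq0 hb ht hz hM
  rw [th] at n2
  apply mul_right_cancel₀ (mul_ne_zero H1 H2)
  linear_combination denHalf b t p q (t 0 * q ^ m)⁻¹ * r1 + denHalf b t p q (t 0 * q ^ n)⁻¹ * r2 +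
    pref (halfScale p) b t q * (n1 + n2)

theorem residueCore_antisymm (hq : ‖q‖ < 1) (hq0 : q ≠ 0)
    (hx : Admissible ρ K q (halfScale p, b, t)) (hb2 : qPoch (q / b ^ 2) q ≠ 0) {n m : ℕ}
    (hn : n < K) (hm : m < K) (hc : t 0 ^ 2 * q ^ (n + m) = 1) (hnm : n ≤ m) :
    residueCore (halfScale p) b t q n / pqPoch (p / q ^ m) p q * poleFactor q n =
      -(residueCore (halfScale p) b t q m / pqPoch (p / q ^ n) p q * poleFactor q m) := by
  have hp : ‖p‖ < 1 := hx.norm_p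
  -- The non-vanishing of `denInCore` is obtained by perturbing b and the other t_r while t_0 stays
  -- fixed, and then removed by continuity.
  let γ : ℂ → ℂ × (Fin 4 → ℂ) := fun l => (b * Complex.exp l,
    ![t 0, t 1 * Complex.exp (2 * l), t 2 * Complex.exp (2 * l), t 3 * Complex.exp (2 * l)])
  have γ0 : γ 0 = (b, t) := by
    simp only [γ, mul_zero, Complex.exp_zero, mul_one]
    congr 1
    ext r
    fin_cases r <;> rfl
  have hγ : Continuous γ := by
    refine (by fun_prop : Continuous fun l => b * Complex.exp l).prodMk (continuous_pi fun r => ?_)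
    fin_cases r <;> simp <;> fun_prop
  have hd := ((countable_setOf_denInCore_eq_zero (b := b) (t := t) (k := halfScale p) hp hq
    (t 0 * q ^ n)⁻¹).union (countable_setOf_denInCore_eq_zero (b := b) (t := t)
    (k := halfScale p) hp hq (t 0 * q ^ m)⁻¹)).dense_compl ℂ
  have hd' : ∃ᶠ l in 𝓝 0, (γ l).2 0 = t 0 ∧
      denInCore (halfScale p) (γ l).1 (γ l).2 q (t 0 * q ^ n)⁻¹ ≠ 0 ∧
      denInCore (halfScale p) (γ l).1 (γ l).2 q (t 0 * q ^ m)⁻¹ ≠ 0 :=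
    (mem_closure_iff_frequently.1 (hd 0)).mono fun l hl => ⟨rfl, not_or.1 hl⟩
  clear hd
  clear_value γ
  have hx0 : Admissible ρ K q (halfScale p, γ 0) := by rw [γ0]; exact hx
  have hb0 : qPoch (q / (γ 0).1 ^ 2) q ≠ 0 := by rw [γ0]; exact hb2
  have hγ' : ContinuousAt (fun l => (halfScale p, γ l)) 0 :=
    (continuous_const.prodMk hγ).continuousAt
  have c : ∀ n < K, ContinuousAt (fun l => residueCore (halfScale p) (γ l).1 (γ l).2 q n) 0 :=
    fun n hn => (hx0.continuousAt_residueCore hb0 hq hq0 hn).comp (x := (0 : ℂ))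
      (f := fun l => (halfScale p, γ l)) hγ'
  have key : residueCore (halfScale p) (γ 0).1 (γ 0).2 q n / pqPoch (p / q ^ m) p q * poleFactor q n =
      -(residueCore (halfScale p) (γ 0).1 (γ 0).2 q m / pqPoch (p / q ^ n) p q * poleFactor q m) := by
    refine eq_of_frequently_eq
      (f := fun l => residueCore (halfScale p) (γ l).1 (γ l).2 q n / pqPoch (p / q ^ m) p q *
        poleFactor q n)
      (g := fun l => -(residueCore (halfScale p) (γ l).1 (γ l).2 q m / pqPoch (p / q ^ n) p q *
        poleFactor q m)) (((c n hn).div_const _).mul_const _)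
        (((c m hm).div_const _).mul_const _).neg ?_
    have hev : ∀ᶠ l in 𝓝 0, Admissible ρ K q (halfScale p, γ l) :=
      hγ'.eventually ((isOpen_admissible ρ K q).mem_nhds hx0)
    refine (hd'.and_eventually hev).mono fun l hl => ?_
    obtain ⟨⟨h0, h1, h2⟩, h3⟩ := hl
    rw [← h0] at h1 h2 hc
    exact residueCore_antisymm_of_denInCore_ne_zero hq hq0 h3 hn hm hc hnm h1 h2
  rw [γ0] at key
  exact key

end ResidueSum

end EllipticBeta

namespace EllipticBeta

/-! ## Removable singularities in `t_0` -/

section RemovableSnd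

variable {b : ℂ} {t : Fin 4 → ℂ} {p q : ℂ} {ρ : ℝ} {K : ℕ} {k : Fin 4 → Fin 4 → ℂ}

theorem update_apply_zero (t : Fin 4 → ℂ) (z : ℂ) : Function.update t 0 z 0 = z :=
  Function.update_self 0 z t

theorem continuous_prodMk_update (k : Fin 4 → Fin 4 → ℂ) (b : ℂ) (t : Fin 4 → ℂ) :
    Continuous fun z => (k, b, Function.update t 0 z) :=
  continuous_const.prodMk (continuous_const.prodMk (continuous_const.update 0 continuous_id))

theorem differentiable_prodMk_update (b : ℂ) (t : Fin 4 → ℂ) :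
    Differentiable ℂ fun z => (b, Function.update t 0 z) :=
  (differentiable_const b).prodMk (differentiable_pi.2 fun r => by
    by_cases hr : r = 0
    · subst hr; simp
    · simp [Function.update_of_ne hr])

theorem continuousAt_residueCore_update (hq : ‖q‖ < 1) (hq0 : q ≠ 0)
    (hx : Admissible ρ K q (k, b, t)) (hb2 : qPoch (q / b ^ 2) q ≠ 0) {n : ℕ} (hn : n < K) :
    ContinuousAt (fun z => residueCore k b (Function.update t 0 z) q n) (t 0) := by
  have hx' : Admissible ρ K q (k, b, Function.update t 0 (t 0)) := by
    rwa [Function.update_eq_self]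
  exact (hx'.continuousAt_residueCore hb2 hq hq0 hn).comp (x := t 0)
    (f := fun z => (k, b, Function.update t 0 z)) (continuous_prodMk_update k b t).continuousAt

/-- Among the factors of (z² q^n;p,q) the one with exponents (0, m) of p and q vanishes at z = c. It
is split off, and the rest is the cofactor. -/
theorem pqPoch_eq_sub_mul (hp : ‖p‖ < 1) (hq : ‖q‖ < 1) {c : ℂ} (hc0 : c ≠ 0) {n m : ℕ}
    (hc : c ^ 2 * q ^ (n + m) = 1) (z : ℂ) :
    pqPoch (z ^ 2 * q ^ n) p q = (z - c) * (-(z + c) / c ^ 2 *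
      ((∏ j ∈ Finset.range m, (1 - z ^ 2 * q ^ n * q ^ j)) * qPoch (z ^ 2 * q ^ n * q ^ (m + 1)) q *
        pqPoch (z ^ 2 * q ^ n * p) p q)) := by
  rw [pqPoch_succ_left hp hq, qPoch_eq_prod_mul hq _ (m + 1), Finset.prod_range_succ]
  have e : 1 - z ^ 2 * q ^ n * q ^ m = (z - c) * (-(z + c) / c ^ 2) := by
    rw [mul_assoc, ← pow_add, eq_inv_of_mul_eq_one_right hc]
    field_simp
    ring
  rw [e]
  ring

/-- This computes the coefficient of the simple pole in t_0. The derivative of the vanishing factor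
supplies the -t_0/2 and the `poleFactor` of the partner index m. -/
theorem tendsto_sub_mul_residueTerm (hq : ‖q‖ < 1) (hq0 : q ≠ 0)
    (hx : Admissible ρ K q (halfScale p, b, t)) (hb2 : qPoch (q / b ^ 2) q ≠ 0) {n m : ℕ}
    (hn : n < K) (hm : m < K) (hc : t 0 ^ 2 * q ^ (n + m) = 1) :
    Tendsto (fun z => (z - t 0) * residueTerm (halfScale p) b (Function.update t 0 z) q n)
      (𝓝[≠] (t 0)) (𝓝 (-(t 0) / 2 *
        (residueCore (halfScale p) b t q n / pqPoch (p / q ^ m) p q / poleFactor q m))) := by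
  have hp : ‖p‖ < 1 := hx.norm_p
  have ht0 : t 0 ≠ 0 := hx.t_ne 0
  have hP : pqPoch (p / q ^ m) p q ≠ 0 := by
    have d2 : denOut (halfScale p) b t q (t 0 * q ^ m)⁻¹ ≠ 0 := hx.denOut_pole_ne_zero hq hq0 hm
    rw [show p / q ^ m = halfScale p 3 0 * t 0 * (t 0 * q ^ m)⁻¹ by
      rw [show halfScale p 3 0 = p from rfl]; field_simp]
    exact right_ne_zero_of_mul d2
  have hpf := poleFactor_ne_zero hq hq0 m
  have e1 : t 0 ^ 2 * q ^ n = (q ^ m)⁻¹ := by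
    rw [pow_add, ← mul_assoc] at hc
    exact eq_inv_of_mul_eq_one_left hc
  have cA := continuousAt_residueCore_update hq hq0 hx hb2 hn
  set W : ℂ → ℂ := fun z => -(z + t 0) / t 0 ^ 2 *
      ((∏ j ∈ Finset.range m, (1 - z ^ 2 * q ^ n * q ^ j)) * qPoch (z ^ 2 * q ^ n * q ^ (m + 1)) q *
        pqPoch (z ^ 2 * q ^ n * p) p q) with hW
  have cW : ContinuousAt W (t 0) := by
    rw [hW]
    fun_prop (disch := first | assumption | positivity)
  have W0 : W (t 0) = -2 / t 0 * (poleFactor q m * pqPoch (p / q ^ m) p q) := by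
    have e2 : (q ^ m)⁻¹ * q ^ (m + 1) = q := by
      rw [pow_succ]; field_simp
    simp only [hW, e1, poleFactor, e2]
    rw [show (q ^ m)⁻¹ * p = p / q ^ m by ring]
    simp only [show ∀ j, (q ^ m)⁻¹ * q ^ j = q ^ j / q ^ m from fun j => by ring]
    field_simp
    ring
  have W0' : W (t 0) ≠ 0 := by
    rw [W0]
    exact mul_ne_zero (div_ne_zero (by norm_num) ht0) (mul_ne_zero hpf hP)
  have h : Tendsto (fun z => residueCore (halfScale p) b (Function.update t 0 z) q n / W z) (𝓝 (t 0))
      (𝓝 (residueCore (halfScale p) b (Function.update t 0 (t 0)) q n / W (t 0))) :=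
    (cA.div cW W0').tendsto
  rw [Function.update_eq_self, W0] at h
  rw [show -(t 0) / 2 * (residueCore (halfScale p) b t q n / pqPoch (p / q ^ m) p q / poleFactor q m)
    = residueCore (halfScale p) b t q n / (-2 / t 0 * (poleFactor q m * pqPoch (p / q ^ m) p q)) by
      field_simp]
  refine (h.mono_left nhdsWithin_le_nhds).congr' ?_
  filter_upwards [self_mem_nhdsWithin] with z hz
  have hz' : z - t 0 ≠ 0 := sub_ne_zero.2 hz
  rw [residueTerm_eq_residueCore_div, update_apply_zero, show halfScale p 1 0 = 1 from rfl, mul_one,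
    show halfScale p 3 0 = p from rfl, pqPoch_eq_sub_mul hp hq ht0 hc, mul_div_mul_left _ _ hz' |>.symm,
    mul_div_assoc]

theorem tendsto_sub_mul_residueTerm_zero (hq : ‖q‖ < 1) (hq0 : q ≠ 0)
    (hx : Admissible ρ K q (k, b, t)) (hb2 : qPoch (q / b ^ 2) q ≠ 0) {n : ℕ}
    (hn : n < K) (h : pqPoch (t 0 ^ 2 * k 1 0 * q ^ n) (k 3 0) q ≠ 0) :
    Tendsto (fun z => (z - t 0) * residueTerm k b (Function.update t 0 z) q n)
      (𝓝[≠] (t 0)) (𝓝 0) := by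
  have hp : ‖k 3 0‖ < 1 := hx.norm_p
  refine tendsto_sub_mul_zero ?_
  have cA := continuousAt_residueCore_update hq hq0 hx hb2 hn
  simp only [residueTerm_eq_residueCore_div, update_apply_zero]
  refine cA.div ?_ h
  fun_prop (disch := assumption)

/-- Reversing the order of summation, n → N - n, changes the sign of every term, so the sum equals
its own negative. -/
theorem sum_residueCore_eq_zero (hq : ‖q‖ < 1) (hq0 : q ≠ 0)
    (hx : Admissible ρ K q (halfScale p, b, t)) (hb2 : qPoch (q / b ^ 2) q ≠ 0) {N : ℕ}
    (hN : N < K) (hc : t 0 ^ 2 * q ^ N = 1) :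
    ∑ n ∈ Finset.range (N + 1), residueCore (halfScale p) b t q n / pqPoch (p / q ^ (N - n)) p q /
      poleFactor q (N - n) = 0 := by
  set f : ℕ → ℂ := fun n => residueCore (halfScale p) b t q n / pqPoch (p / q ^ (N - n)) p q /
      poleFactor q (N - n) with hf
  have key : ∀ n m, n + m = N → n ≤ m → f n = -f m := fun n m hnm h => by
    have := residueCore_antisymm hq hq0 hx hb2 (n := n) (m := m) (by omega) (by omega)
      (by rw [hnm, hc]) h
    have h1 := poleFactor_ne_zero hq hq0 n
    have h2 := poleFactor_ne_zero hq hq0 m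
    simp only [hf, show N - n = m by omega, show N - m = n by omega]
    generalize residueCore (halfScale p) b t q n / pqPoch (p / q ^ m) p q = A at *
    generalize residueCore (halfScale p) b t q m / pqPoch (p / q ^ n) p q = B at *
    field_simp
    linear_combination this
  have key' : ∀ n ∈ Finset.range (N + 1), f (N + 1 - 1 - n) = -f n := fun n hn => by
    have := Finset.mem_range.1 hn
    rw [Nat.add_sub_cancel]
    rcases le_total (N - n) n with h | h
    · exact key _ _ (by omega) h
    · rw [key n (N - n) (by omega) h, neg_neg]
  have h := Finset.sum_range_reflect f (N + 1)
  rw [Finset.sum_congr rfl key', Finset.sum_neg_distrib] at h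
  linear_combination -(1 / 2 : ℂ) * h

/-- Only the residue terms with n ≤ N are singular on t_0² q^N = 1, and the coefficients of their
poles add up to zero. -/
theorem tendsto_sub_mul_brokenIntegral (hρ : 0 < ρ) (hq : ‖q‖ < 1) (hq0 : q ≠ 0)
    (hx : Admissible ρ K q (halfScale p, b, t)) (hb2 : qPoch (q / b ^ 2) q ≠ 0)
    (ht : qPoch (t 0 ^ 2) q = 0) :
    Tendsto (fun z => (z - t 0) * brokenIntegral (halfScale p) b (Function.update t 0 z) q ρ K)
      (𝓝[≠] (t 0)) (𝓝 0) := by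
  obtain ⟨N, hN⟩ := (qPoch_eq_zero_iff hq).1 ht
  have hp : ‖p‖ < 1 := hx.norm_p
  have ht0 : t 0 ≠ 0 := hx.t_ne 0
  -- The pole with index N is t_0 itself, which condition `in3` places inside the circle. Hence all
  -- partners n ≤ N are present in the sum.
  have hNK : N < K := by
    by_contra hcon
    have h1 := hx.norm_pole hq hq0 N
    rw [if_neg hcon] at h1
    have h2 : ‖t 0 * 1‖ < ρ := hx.in3
    rw [mul_one] at h2
    have : (t 0 * q ^ N)⁻¹ = t 0 := inv_eq_of_mul_eq_one_right (by rw [← hN]; ring)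
    simp only [this] at h1
    exact absurd h1 h2.le.not_gt
  have hx' : Admissible ρ K q (halfScale p, b, Function.update t 0 (t 0)) := by
    rwa [Function.update_eq_self]
  have hg := differentiable_prodMk_update b t
  have c1 : DifferentiableAt ℂ (fun z => pref (halfScale p) b (Function.update t 0 z) q) (t 0) :=
    (differentiableAt_pref (x := (b, Function.update t 0 (t 0))) hq hp hx.b_ne hx'.t_ne hb2).comp
      (t 0) (f := fun z => (b, Function.update t 0 z)) (hg _)
  have c2 := differentiableAt_circleIntegral_kernel (w := t 0)
    (g := fun z => (b, Function.update t 0 z)) hg hx' hρ hq hq0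
  have l1 := tendsto_sub_mul_zero (c1.continuousAt.mul (continuousAt_const (y := (2 * Real.pi *
    Complex.I)⁻¹) |>.mul c2.continuousAt))
  have l2 : Tendsto (fun z => ∑ n ∈ Finset.range K,
      (z - t 0) * residueTerm (halfScale p) b (Function.update t 0 z) q n) (𝓝[≠] (t 0))
      (𝓝 (∑ n ∈ Finset.range K, if n ∈ Finset.range (N + 1) then -(t 0) / 2 *
        (residueCore (halfScale p) b t q n / pqPoch (p / q ^ (N - n)) p q / poleFactor q (N - n))
        else 0)) := by
    refine tendsto_finsetSum _ fun n hn => ?_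
    have hn' := Finset.mem_range.1 hn
    split_ifs with h
    · have := Finset.mem_range.1 h
      exact tendsto_sub_mul_residueTerm hq hq0 hx hb2 hn' (by omega)
        (by rw [show n + (N - n) = N by omega, hN])
    · have h' : N < n := by simpa using h
      refine tendsto_sub_mul_residueTerm_zero hq hq0 hx hb2 hn'
        (pqPoch_ne_zero_of_norm_lt_one hp hq ?_)
      rw [show n = N + (n - N) by omega, pow_add, ← mul_assoc, show halfScale p 1 0 = 1 from rfl,
        mul_one, hN, one_mul, norm_pow]
      exact pow_lt_one₀ (norm_nonneg _) hq (by omega)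
  rw [Finset.sum_ite_mem, Finset.inter_eq_right.2 (Finset.range_subset_range.2 (by omega)),
    ← Finset.mul_sum, sum_residueCore_eq_zero hq hq0 hx hb2 hNK hN, mul_zero] at l2
  have h := l1.add l2
  rw [add_zero] at h
  refine h.congr fun z => ?_
  simp only [brokenIntegral, mul_add, Finset.mul_sum, Pi.mul_apply]

theorem brokenIntegral_cauchy_snd (hρ : 0 < ρ) (hq : ‖q‖ < 1) (hq0 : q ≠ 0) {v : ℂ} {r : ℝ}
    (hadm : ∀ z ∈ Metric.closedBall (t 0) r, Admissible ρ K q (k, b, Function.update t 0 z))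
    (hb : qPoch (q / b ^ 2) q ≠ 0)
    (ht : ∀ z ∈ Metric.closedBall (t 0) r, z ≠ t 0 → pqPoch (z ^ 2 * k 1 0) (k 3 0) q ≠ 0)
    (hbad : pqPoch (t 0 ^ 2 * k 1 0) (k 3 0) q = 0 →
      k = halfScale (k 3 0) ∧ qPoch (t 0 ^ 2) q = 0)
    (hv : v ∈ Metric.ball (t 0) r) (hvc : v ≠ t 0) :
    (∮ z in C(t 0, r), brokenIntegral k b (Function.update t 0 z) q ρ K / (z - v)) =
      2 * Real.pi * Complex.I * brokenIntegral k b (Function.update t 0 v) q ρ K := by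
  have hg := differentiable_prodMk_update b t
  have diff : ∀ z, Admissible ρ K q (k, b, Function.update t 0 z) →
      pqPoch (z ^ 2 * k 1 0) (k 3 0) q ≠ 0 →
      DifferentiableAt ℂ (fun z => brokenIntegral k b (Function.update t 0 z) q ρ K) z :=
    fun z h1 h2 => differentiableAt_brokenIntegral (g := fun z => (b, Function.update t 0 z)) hg h1
      ⟨hb, by simpa only [update_apply_zero] using h2⟩ hρ hq hq0
  have hc := hadm (t 0) (Metric.mem_closedBall_self
    ((norm_nonneg _).trans (mem_ball_iff_norm.1 hv).le))
  refine cauchy_of_removable hv hvc (fun z hz hzc => diff z (hadm z hz) (ht z hz hzc)) ?_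
  by_cases h : pqPoch (t 0 ^ 2 * k 1 0) (k 3 0) q = 0
  · obtain ⟨h1, h2⟩ := hbad h
    rw [Function.update_eq_self, h1] at hc
    rw [h1]
    exact tendsto_sub_mul_brokenIntegral hρ hq hq0 hc hb h2
  · exact tendsto_sub_mul_zero (diff _ hc h).continuousAt

end RemovableSnd

end EllipticBeta

namespace EllipticBeta

/-! ## Cauchy's formula on a polydisc -/

section Polydisc

/-- The parameters `(b, t)` as a function of five coordinates. -/
def paramsOf (y : Fin 5 → ℂ) : ℂ × (Fin 4 → ℂ) := (y 0, fun r => y r.succ)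

/-- The five coordinates of `(b, t)`. -/
def coordsOf (x : ℂ × (Fin 4 → ℂ)) : Fin 5 → ℂ := Fin.cons x.1 x.2

theorem continuous_paramsOf : Continuous paramsOf := by
  unfold paramsOf
  fun_prop

theorem differentiable_coordsOf : Differentiable ℂ coordsOf :=
  differentiable_pi.2 fun i => by
    refine Fin.cases ?_ (fun r => ?_) i
    · exact differentiable_fst
    · show Differentiable ℂ fun x : ℂ × (Fin 4 → ℂ) => x.2 r
      fun_prop

theorem differentiable_paramsOf : Differentiable ℂ paramsOf :=
  (differentiable_apply 0).prodMk (differentiable_pi.2 fun r => differentiable_apply r.succ)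

/-- The conditions for `brokenIntegral` to be analytic on a closed polydisc, except possibly for
removable singularities where the first or second coordinate is central. -/
structure GoodPolydisc (c : Fin 5 → ℂ) (r ρ : ℝ) (K : ℕ) (q : ℂ) (k : Fin 4 → Fin 4 → ℂ) : Prop where
  admissible : ∀ y : Fin 5 → ℂ, (∀ i, y i ∈ Metric.closedBall (c i) r) →
    Admissible ρ K q (k, paramsOf y)
  b_ne : ∀ z ∈ Metric.closedBall (c 0) r, z ≠ c 0 → qPoch (q / z ^ 2) q ≠ 0
  t_ne : ∀ z ∈ Metric.closedBall (c 1) r, z ≠ c 1 → pqPoch (z ^ 2 * k 1 0) (k 3 0) q ≠ 0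

/-- The coordinates `b` and `t_0`. -/
def Singular (n : ℕ) : Prop := n = 0 ∨ n = 1

/-- The points of a polydisc at which `brokenIntegral` is regular. -/
def OffCenter (c : Fin 5 → ℂ) (r : ℝ) (y : Fin 5 → ℂ) : Prop :=
  ∀ i : Fin 5, y i ∈ Metric.closedBall (c i) r ∧ (Singular (i + 0) → y i ≠ c i)

variable {c : Fin 5 → ℂ} {r ρ : ℝ} {K : ℕ} {q : ℂ} {k : Fin 4 → Fin 4 → ℂ} {y : Fin 5 → ℂ}

theorem OffCenter.ne_zero (h : OffCenter c r y) : y 0 ≠ c 0 := (h 0).2 (.inl rfl)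

theorem OffCenter.ne_one (h : OffCenter c r y) : y 1 ≠ c 1 := (h 1).2 (.inr rfl)

/-- The symmetry-broken integral as a function of five coordinates. -/
noncomputable def brokenAt (ρ : ℝ) (K : ℕ) (q : ℂ) (k : Fin 4 → Fin 4 → ℂ) (y : Fin 5 → ℂ) : ℂ :=
  brokenIntegral k (paramsOf y).1 (paramsOf y).2 q ρ K

/-- The analytic continuation of `brokenAt` to a polydisc. -/
noncomputable def cauchyIntegral (c : Fin 5 → ℂ) (r ρ : ℝ) (K : ℕ) (q : ℂ) (k : Fin 4 → Fin 4 → ℂ)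
    (y : Fin 5 → ℂ) : ℂ :=
  ((2 * Real.pi * Complex.I) ^ 5)⁻¹ *
    ∯ ξ in T(c, fun _ => r), brokenAt ρ K q k ξ * ∏ i, (ξ i - y i)⁻¹

theorem GoodPolydisc.regular (h : GoodPolydisc c r ρ K q k) (hy : OffCenter c r y) :
    Admissible ρ K q (k, paramsOf y) ∧ Regular q (k, paramsOf y) :=
  ⟨h.admissible y fun i => (hy i).1, h.b_ne _ (hy 0).1 hy.ne_zero, h.t_ne _ (hy 1).1 hy.ne_one⟩

theorem continuousAt_brokenAt (hρ : 0 < ρ) (hq : ‖q‖ < 1) (hq0 : q ≠ 0)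
    (hx : Admissible ρ K q (k, paramsOf y)) (hr : Regular q (k, paramsOf y)) :
    ContinuousAt (Function.uncurry (brokenAt ρ K q)) (k, y) :=
  (hx.continuousAt_brokenIntegral hr hρ hq hq0).comp (x := (k, y))
    (f := fun x : (Fin 4 → Fin 4 → ℂ) × (Fin 5 → ℂ) => (x.1, paramsOf x.2))
    (continuous_fst.prodMk (continuous_paramsOf.comp continuous_snd)).continuousAt

theorem offCenter_torusMap (hr : 0 < r) (θ : Fin 5 → ℝ) :
    OffCenter c r (torusMap c (fun _ => r) θ) := fun i => by
  have h := torusMap_mem_sphere (c := c) (R := fun _ => r) (fun _ => hr.le) θ i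
  refine ⟨Metric.sphere_subset_closedBall h, fun _ hc => ?_⟩
  rw [hc, mem_sphere_iff_norm, sub_self, norm_zero] at h
  exact hr.ne h

theorem continuousOn_cauchyIntegral (hr : 0 < r) (hρ : 0 < ρ) (hq : ‖q‖ < 1) (hq0 : q ≠ 0)
    (hy : ∀ i, y i ∈ Metric.ball (c i) r) :
    ContinuousOn (fun k => cauchyIntegral c r ρ K q k y) {k | GoodPolydisc c r ρ K q k} := by
  refine continuousOn_const.mul (continuousOn_torusIntegral (c := c) (R := fun _ => r)
    (f := fun k ξ => brokenAt ρ K q k ξ * ∏ i, (ξ i - y i)⁻¹) fun k hk θ => ?_)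
  obtain ⟨h1, h2⟩ := hk.regular (offCenter_torusMap hr θ)
  refine (continuousAt_brokenAt hρ hq hq0 h1 h2).mul ?_
  refine ContinuousAt.comp (x := (k, torusMap c (fun _ => r) θ)) (g := fun ξ : Fin 5 → ℂ => ∏ i, (ξ i - y i)⁻¹) (f := Prod.snd) ?_
    continuousAt_snd
  change ContinuousAt _ (torusMap c (fun _ => r) θ)
  refine tendsto_finsetProd _ fun i _ => ContinuousAt.inv₀
    ((continuous_apply i).sub continuous_const).continuousAt ?_
  have h := torusMap_mem_sphere (c := c) (R := fun _ => r) (fun _ => hr.le) θ i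
  intro h0
  rw [sub_eq_zero.1 h0] at h
  exact (Metric.mem_ball.1 (hy i)).ne (Metric.mem_sphere.1 h)

theorem analyticAt_cauchyIntegral (hr : 0 < r) (hρ : 0 < ρ) (hq : ‖q‖ < 1) (hq0 : q ≠ 0)
    (hk : GoodPolydisc c r ρ K q k) (hy : ∀ i, y i ∈ Metric.ball (c i) r) :
    AnalyticAt ℂ (cauchyIntegral c r ρ K q k) y := by
  refine analyticAt_const.mul (analyticAt_torusIntegral (fun _ => hr.le) (fun θ => ?_) hy)
  obtain ⟨h1, h2⟩ := hk.regular (offCenter_torusMap hr θ)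
  exact (continuousAt_brokenAt hρ hq hq0 h1 h2).comp (x := torusMap c (fun _ => r) θ)
    (f := fun ξ => (k, ξ)) (by fun_prop)

theorem paramsOf_update_zero (y : Fin 5 → ℂ) (z : ℂ) :
    paramsOf (Function.update y 0 z) = (z, (paramsOf y).2) := by
  simp only [paramsOf, Function.update_self]
  congr 1

theorem paramsOf_update_one (y : Fin 5 → ℂ) (z : ℂ) :
    paramsOf (Function.update y 1 z) = (y 0, Function.update (paramsOf y).2 0 z) := by
  simp only [paramsOf]
  congr 1
  ext r
  fin_cases r <;> rfl

theorem differentiable_update (y : Fin 5 → ℂ) (i : Fin 5) :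
    Differentiable ℂ fun z => Function.update y i z :=
  differentiable_pi.2 fun j => by
    by_cases hj : j = i
    · subst hj; simp
    · simp [Function.update_of_ne hj]

/-- Cauchy's formula is checked coordinate by coordinate. The coordinates b and t_0 may have a
removable singularity at the centre, and in the others the function is holomorphic. -/
theorem cauchyIntegral_eq {τ : Fin 4 → ℝ} {w : ℂ} (hr : 0 < r) (hρ : 0 < ρ) (hq : ‖q‖ < 1)
    (hq0 : q ≠ 0) (hk : GoodPolydisc c r ρ K q (powScale τ w)) (hpc : ‖Complex.exp w * q / c 0‖ < 1)
    (hbad : pqPoch (c 1 ^ 2 * powScale τ w 1 0) (powScale τ w 3 0) q = 0 →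
      powScale τ w = halfScale (powScale τ w 3 0) ∧ qPoch (c 1 ^ 2) q = 0)
    (hy : OffCenter c r y) (hyb : ∀ i, y i ∈ Metric.ball (c i) r) :
    cauchyIntegral c r ρ K q (powScale τ w) y = brokenAt ρ K q (powScale τ w) y := by
  have hpi : (2 * Real.pi * Complex.I) ^ 5 ≠ 0 := pow_ne_zero _ Complex.two_pi_I_ne_zero
  rw [cauchyIntegral, inv_mul_eq_iff_eq_mul₀ hpi]
  refine torusIntegral_cauchy Singular hr 0 (fun y hy => ?_) (fun y hy i hyi => ?_) y
    fun i => ⟨hyb i, (hy i).2⟩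
  · obtain ⟨h1, h2⟩ := hk.regular hy
    exact (continuousAt_brokenAt hρ hq hq0 h1 h2).comp (x := y)
      (f := fun ξ => (powScale τ w, ξ)) (by fun_prop)
  replace hy : OffCenter c r y := hy
  have hup : ∀ i, ∀ z ∈ Metric.closedBall (c i) r, ∀ j,
      Function.update y i z j ∈ Metric.closedBall (c j) r := fun i z hz j => by
    by_cases hj : j = i
    · subst hj; rwa [Function.update_self]
    · rw [Function.update_of_ne hj]; exact (hy j).1
  obtain ⟨h1, h2⟩ := hk.regular hy
  by_cases hi0 : i = 0
  · subst hi0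
    simp only [brokenAt, paramsOf_update_zero]
    refine brokenIntegral_cauchy_fst hρ hq hq0 hr.le (fun z hz => ?_) hk.b_ne h2.t_ne hpc hyi
      hy.ne_zero
    rw [← paramsOf_update_zero]
    exact hk.admissible _ (hup 0 z hz)
  by_cases hi1 : i = 1
  · subst hi1
    simp only [brokenAt, paramsOf_update_one]
    -- The base point is moved to the centre in the t_0 coordinate, since
    -- `brokenIntegral_cauchy_snd` is stated for discs around t_0.
    have hu : ∀ z, Function.update (paramsOf y).2 0 z =
        Function.update (Function.update (paramsOf y).2 0 (c 1)) 0 z := fun z => by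
      rw [Function.update_idem]
    have e := Function.update_self 0 (c 1) (paramsOf y).2
    have key := brokenIntegral_cauchy_snd (b := y 0) (t := Function.update (paramsOf y).2 0 (c 1))
      (k := powScale τ w) (K := K) (v := y 1) (r := r) hρ hq hq0 (fun z hz => ?_) h2.b_ne ?_ ?_ ?_ ?_
    · simp only [← hu, e] at key
      rw [key]
      have : Function.update (paramsOf y).2 0 (y 1) = (paramsOf y).2 := Function.update_eq_self 0 _
      rw [this]
      rfl
    · rw [← hu, ← paramsOf_update_one]
      exact hk.admissible _ (hup 1 z (by rwa [e] at hz))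
    · rw [e]; exact hk.t_ne
    · rw [e]; exact hbad
    · rw [e]; exact hyi
    · rw [e]; exact hy.ne_one
  · have hd : DifferentiableOn ℂ (fun z => brokenAt ρ K q (powScale τ w) (Function.update y i z))
        (Metric.closedBall (c i) r) := fun z hz => by
      have hoff : OffCenter c r (Function.update y i z) := fun j => by
        refine ⟨hup i z hz j, fun hj => ?_⟩
        have : j ≠ i := fun h => by
          subst h
          rcases hj with hj | hj
          · exact hi0 (Fin.ext hj)
          · exact hi1 (Fin.ext hj)
        rw [Function.update_of_ne this]
        exact (hy j).2 hj
      obtain ⟨h1, h2⟩ := hk.regular hoff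
      exact (differentiableAt_brokenIntegral (g := fun z => paramsOf (Function.update y i z))
        (differentiable_paramsOf.comp (differentiable_update y i)) h1 h2 hρ hq
        hq0).differentiableWithinAt
    have := (hd.diffContOnCl_ball subset_rfl).circleIntegral_sub_inv_smul hyi
    simp only [smul_eq_mul, Function.update_eq_self] at this
    rw [← this]
    exact circleIntegral.integral_congr hr.le fun z _ => by rw [div_eq_inv_mul]

end Polydisc

end EllipticBeta

namespace EllipticBeta

/-! ### Identification of E with the Cauchy integral -/

section Continuation

variable {c : Fin 5 → ℂ} {r ρ : ℝ} {K : ℕ} {q w : ℂ} {τ : Fin 4 → ℝ}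

theorem scaleParams_neg_scaleParams (τ : Fin 4 → ℝ) (w : ℂ) (x : ℂ × (Fin 4 → ℂ)) :
    scaleParams τ (-w) (scaleParams τ w x) = x := by
  simp only [scaleParams, mul_assoc, ← Complex.exp_add]
  simp

theorem offCenter_coordsOf {x : ℂ × (Fin 4 → ℂ)}
    (h : ∀ i, coordsOf x i ∈ Metric.closedBall (c i) r) (h0 : x.1 ≠ c 0) (h1 : x.2 0 ≠ c 1) :
    OffCenter c r (coordsOf x) := fun i => by
  refine ⟨h i, ?_⟩
  rintro (hi | hi)
  · rw [show i = 0 from Fin.ext hi]; exact h0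
  · rw [show i = 1 from Fin.ext hi]; exact h1

/-- The conditions under which `cauchyIntegral` is the continuation of `betaQuotient` for
`p = exp w`. -/
structure GoodScale (c : Fin 5 → ℂ) (r ρ : ℝ) (K : ℕ) (q : ℂ) (τ : Fin 4 → ℝ) (w : ℂ) : Prop where
  good : GoodPolydisc c r ρ K q (powScale τ w)
  norm_lt : ‖Complex.exp w * q / c 0‖ < 1
  bad : pqPoch (c 1 ^ 2 * powScale τ w 1 0) (powScale τ w 3 0) q = 0 →
    powScale τ w = halfScale (powScale τ w 3 0) ∧ qPoch (c 1 ^ 2) q = 0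

/-- Equality is clear at strongly generic parameters off the central hyperplanes. These are dense,
and both sides are continuous. -/
theorem betaQuotient_eq_cauchyIntegral (hr : 0 < r) (hρ : 0 < ρ) (hq : ‖q‖ < 1) (hq0 : q ≠ 0)
    (hk : GoodScale c r ρ K q τ w) {x : ℂ × (Fin 4 → ℂ)}
    (hx : ∀ i, coordsOf x i ∈ Metric.ball (c i) r)
    (hg : scaleParams τ w x ∈ generic (Complex.exp w) q) :
    betaQuotient (Complex.exp w) q (scaleParams τ w x) =
      cauchyIntegral c r ρ K q (powScale τ w) (coordsOf x) := by
  have hc := hk.good.admissible c fun i => Metric.mem_closedBall_self hr.le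
  have hxa := hk.good.admissible (coordsOf x) fun i => Metric.ball_subset_closedBall (hx i)
  have hp : ‖Complex.exp w‖ < 1 := powScale_three τ w ▸ hc.norm_p
  have c1 : ContinuousAt (fun x => betaQuotient (Complex.exp w) q (scaleParams τ w x)) x :=
    (continuousAt_betaQuotient hp hq (Complex.exp_ne_zero w) hq0 hg).comp
      (continuous_scaleParams τ w).continuousAt
  have c2 : ContinuousAt (fun x => cauchyIntegral c r ρ K q (powScale τ w) (coordsOf x)) x :=
    (analyticAt_cauchyIntegral hr hρ hq hq0 hk.good hx).continuousAt.comp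
      differentiable_coordsOf.continuous.continuousAt
  refine eq_of_frequently_eq c1 c2 ?_
  have hev : ∀ᶠ y in 𝓝 x, ∀ i, coordsOf y i ∈ Metric.ball (c i) r := by
    refine eventually_all.2 fun i => ?_
    exact ((continuous_apply i).comp differentiable_coordsOf.continuous).continuousAt.eventually
      (Metric.isOpen_ball.mem_nhds (hx i))
  refine ((mem_closure_iff_frequently.1 (mem_closure_stronglyGeneric_scaleParams (τ := τ) hp hq hq0
    hxa.b_ne hxa.t_ne hc.b_ne (hc.t_ne 0))).and_eventually hev).mono fun y hy => ?_
  have hoff : OffCenter c r (coordsOf y) := offCenter_coordsOf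
    (fun i => Metric.ball_subset_closedBall (hy.2 i)) hy.1.2.1 hy.1.2.2
  rw [cauchyIntegral_eq hr hρ hq hq0 hk.good hk.norm_lt hk.bad hoff hy.2]
  obtain ⟨h1, h2⟩ := hk.good.regular hoff
  exact hy.1.1.betaQuotient_eq_brokenIntegral (b := y.1) (t := y.2) hρ hq hq0 h1

/-- The generic parameters are dense and the Cauchy integral is continuous, so its value is the
limit that defines `ellE`. -/
theorem ellE_eq_cauchyIntegral (hr : 0 < r) (hρ : 0 < ρ) (hq : ‖q‖ < 1) (hq0 : q ≠ 0)
    (hk : GoodScale c r ρ K q τ w) {x : ℂ × (Fin 4 → ℂ)}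
    (hx : ∀ i, coordsOf x i ∈ Metric.ball (c i) r) :
    ellE x.1 (fun r => x.2 r * Complex.exp (τ r * w)) (Complex.exp w) q =
      cauchyIntegral c r ρ K q (powScale τ w) (coordsOf x) := by
  have hxa := hk.good.admissible (coordsOf x) fun i => Metric.ball_subset_closedBall (hx i)
  have hp : ‖Complex.exp w‖ < 1 := powScale_three τ w ▸ hxa.norm_p
  refine extendFrom_eq (A := generic (Complex.exp w) q) (x := scaleParams τ w x)
    (f := betaQuotient (Complex.exp w) q) ?_ ?_
  · exact map_mem_closure (continuous_scaleParams τ w)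
      (mem_closure_stronglyGeneric_scaleParams (τ := τ) hp hq hq0 hxa.b_ne hxa.t_ne one_ne_zero
        one_ne_zero) fun y hy => hy.1.mem_generic hp hq (Complex.exp_ne_zero w) hq0
  have hψ : ContinuousAt (scaleParams τ (-w)) (scaleParams τ w x) :=
    (continuous_scaleParams τ (-w)).continuousAt
  have hback : ∀ y, scaleParams τ w (scaleParams τ (-w) y) = y := fun y => by
    simpa using scaleParams_neg_scaleParams τ (-w) y
  have c2 : ContinuousAt (fun x => cauchyIntegral c r ρ K q (powScale τ w) (coordsOf x)) x :=
    (analyticAt_cauchyIntegral hr hρ hq hq0 hk.good hx).continuousAt.comp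
      differentiable_coordsOf.continuous.continuousAt
  have h := c2.tendsto
  rw [← scaleParams_neg_scaleParams τ w x] at h
  have h' := (h.comp hψ.tendsto).mono_left (nhdsWithin_le_nhds (s := generic (Complex.exp w) q))
  rw [scaleParams_neg_scaleParams] at h'
  refine h'.congr' ?_
  have hev : ∀ᶠ y in 𝓝 (scaleParams τ w x),
      ∀ i, coordsOf (scaleParams τ (-w) y) i ∈ Metric.ball (c i) r := by
    refine eventually_all.2 fun i => ?_
    refine (((continuous_apply i).comp differentiable_coordsOf.continuous).comp
      (continuous_scaleParams τ (-w))).continuousAt.eventually (Metric.isOpen_ball.mem_nhds ?_)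
    simp only [Function.comp, scaleParams_neg_scaleParams]
    exact hx i
  filter_upwards [nhdsWithin_le_nhds hev, self_mem_nhdsWithin] with y hy hyg
  rw [Function.comp, ← betaQuotient_eq_cauchyIntegral hr hρ hq hq0 hk hy (by rwa [hback]), hback]

end Continuation

end EllipticBeta

namespace EllipticBeta

/-! ## The limit `p → 0` -/

section Limit

variable {q : ℂ} {τ : Fin 4 → ℝ}

/-- The limit of `powScale τ w` as `exp w → 0`. -/
noncomputable def limitScale (τ : Fin 4 → ℝ) : Fin 4 → Fin 4 → ℂ :=
  ![fun r => if r = 0 then 1 else 0,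
    fun r => if r = 0 then (if τ 0 = -1 / 2 then 1 else 0) else if τ r = -τ 0 then 1 else 0,
    fun _ => 0,
    fun r => if r = 0 then 0 else if τ r = 1 + τ 0 then 1 else 0]

theorem tendsto_exp_comap : Tendsto Complex.exp (comap Complex.exp (𝓝[≠] 0)) (𝓝 0) :=
  tendsto_comap.mono_right nhdsWithin_le_nhds

-- Non-triviality of this filter is needed for the uniqueness of limits.
instance : (comap Complex.exp (𝓝[≠] (0 : ℂ))).NeBot := by
  refine NeBot.comap_of_range_mem inferInstance ?_
  rw [Complex.range_exp]
  exact self_mem_nhdsWithin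

theorem tendsto_exp_mul_comap {a : ℝ} (ha : 0 ≤ a) :
    Tendsto (fun w => Complex.exp (a * w)) (comap Complex.exp (𝓝[≠] 0))
      (𝓝 (if a = 0 then 1 else 0)) := by
  split_ifs with h
  · simp [h]
  rw [tendsto_zero_iff_norm_tendsto_zero]
  have e : ∀ w : ℂ, ‖Complex.exp (a * w)‖ = ‖Complex.exp w‖ ^ a := fun w => by
    rw [Complex.norm_exp, Complex.norm_exp, ← Real.exp_mul, Complex.re_ofReal_mul, mul_comm]
  simp only [e]
  have h1 : Tendsto (fun w => ‖Complex.exp w‖) (comap Complex.exp (𝓝[≠] 0)) (𝓝 0) := by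
    simpa using tendsto_exp_comap.norm
  have h2 := h1.rpow_const (p := a) (.inr ha)
  rwa [Real.zero_rpow h] at h2

/-- The hypotheses on τ make every exponent of p non-negative. Positive exponents tend to 0, and
vanishing ones are constantly 1. In particular 2τ_0 ≥ -1, since -τ_0 ≤ 1 + τ_0. -/
theorem tendsto_powScale (hτ0 : τ 0 < 0) (hτ : ∀ r, r ≠ 0 → -τ 0 ≤ τ r ∧ τ r ≤ 1 + τ 0) :
    Tendsto (powScale τ) (comap Complex.exp (𝓝[≠] 0)) (𝓝 (limitScale τ)) := by
  have h10 := hτ 1 (by decide)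
  have key : ∀ {a : ℂ} (c : ℝ) {l : ℂ}, 0 ≤ c → a = c → l = (if c = 0 then 1 else 0) →
      Tendsto (fun w => Complex.exp (a * w)) (comap Complex.exp (𝓝[≠] 0)) (𝓝 l) := by
    rintro a c l hc rfl rfl
    exact tendsto_exp_mul_comap hc
  rw [tendsto_pi_nhds]
  intro i
  rw [tendsto_pi_nhds]
  intro r
  by_cases hr : r = 0
  · subst hr
    fin_cases i
    · simp [powScale, limitScale]
    · refine key (1 + 2 * τ 0) (by linarith) (by push_cast; rfl) ?_
      simp only [limitScale]
      refine if_congr ⟨fun h => by linarith, fun h => by linarith⟩ rfl rfl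
    · refine key (-(2 * τ 0)) (by linarith) (by push_cast; rfl) ?_
      rw [if_neg (by linarith)]; rfl
    · refine key (1 - τ 0 + τ 0) (by linarith) (by push_cast; rfl) ?_
      rw [if_neg (by linarith)]; rfl
  · have h := hτ r hr
    fin_cases i
    · refine key (τ r - τ 0) (by linarith) (by push_cast; rfl) ?_
      rw [if_neg (by linarith)]; simp [limitScale, hr]
    · simp only [powScale, limitScale, Fin.mk_one, Matrix.cons_val_one, Matrix.cons_val_zero, if_neg hr]
      refine key (τ r + τ 0) (by linarith) (by push_cast; rfl) ?_
      exact if_congr ⟨fun h => by linarith, fun h => by linarith⟩ rfl rfl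
    · simp only [powScale, limitScale, Fin.reduceFinMk, Matrix.cons_val, if_neg hr]
      refine key (1 - τ r - τ 0) (by linarith) (by push_cast; rfl) ?_
      rw [if_neg (by linarith)]
    · simp only [powScale, limitScale, Fin.reduceFinMk, Matrix.cons_val, if_neg hr]
      refine key (1 - τ r + τ 0) (by linarith) (by push_cast; rfl) ?_
      exact if_congr ⟨fun h => by linarith, fun h => by linarith⟩ rfl rfl

/-- For τ_0 = -1/2 the interval allowed for the other τ_r shrinks to the point 1/2. Hence the
antisymmetry argument is needed for a single family of scales only. -/
theorem powScale_eq_halfScale (h0 : τ 0 = -1 / 2) (hτ : ∀ r, r ≠ 0 → -τ 0 ≤ τ r ∧ τ r ≤ 1 + τ 0)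
    (w : ℂ) : powScale τ w = halfScale (Complex.exp w) := by
  have h : ∀ r, r ≠ 0 → τ r = 1 / 2 := fun r hr => by
    have := hτ r hr
    rw [h0] at this
    linarith
  have h1 := h 1 (by decide)
  have h2 := h 2 (by decide)
  have h3 := h 3 (by decide)
  ext i r
  fin_cases i <;> fin_cases r <;> simp [powScale, halfScale, h0, h1, h2, h3] <;> norm_num

/-- At the limiting scales all conditions at infinity are void except those on the poles 1/(t_0
q^n), so a large radius works. It is taken as the geometric mean of the moduli of two consecutive
poles, which is why √|q| occurs. -/
theorem exists_admissible (hq : ‖q‖ < 1) (hq0 : q ≠ 0) {x : ℂ × (Fin 4 → ℂ)} (hb : x.1 ≠ 0)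
    (ht : ∀ r, x.2 r ≠ 0) : ∃ ρ K, 0 < ρ ∧ Admissible ρ K q (limitScale τ, x) := by
  have hσ0 : 0 < √‖q‖ := Real.sqrt_pos.2 (norm_pos_iff.2 hq0)
  have hσ1 : √‖q‖ < 1 := by rwa [Real.sqrt_lt' one_pos, one_pow]
  have hσ2 : √‖q‖ ^ 2 = ‖q‖ := Real.sq_sqrt (norm_nonneg q)
  have ht0 : 0 < ‖x.2 0‖ := norm_pos_iff.2 (ht 0)
  set σ := √‖q‖
  have l0 : Tendsto (fun k : ℕ => ‖x.2 0‖ * σ ^ (2 * k + 1)) atTop (𝓝 0) := by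
    have h := (tendsto_pow_atTop_nhds_zero_of_lt_one hσ0.le hσ1).comp
      (tendsto_atTop_mono (fun k : ℕ => (by omega : k ≤ 2 * k + 1)) tendsto_id)
    simpa using h.const_mul ‖x.2 0‖
  have l1 : Tendsto (fun k : ℕ => (‖x.2 0‖ * σ ^ (2 * k + 1))⁻¹) atTop atTop :=
    (tendsto_nhdsWithin_iff.2 ⟨l0, Eventually.of_forall fun k => by
      rw [Set.mem_Ioi]; positivity⟩).inv_tendsto_nhdsGT_zero
  have ev : ∀ᶠ ρ : ℝ in atTop, 1 < ρ ∧ ‖q / (x.1 * x.2 0)‖ < ρ ∧ ‖x.1 * limitScale τ 1 0‖ < ρ ∧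
      ‖x.2 0 * limitScale τ 1 0‖ < ρ ∧ (∀ s : Fin 3, ‖x.2 s.succ * limitScale τ 1 s.succ‖ < ρ) ∧
      ∀ s : Fin 3, ‖q * limitScale τ 3 s.succ / (x.1 * x.2 s.succ)‖ < ρ := by
    filter_upwards [eventually_gt_atTop 1, eventually_gt_atTop ‖q / (x.1 * x.2 0)‖,
      eventually_gt_atTop ‖x.1 * limitScale τ 1 0‖, eventually_gt_atTop ‖x.2 0 * limitScale τ 1 0‖,
      eventually_all.2 fun s : Fin 3 => eventually_gt_atTop ‖x.2 s.succ * limitScale τ 1 s.succ‖,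
      eventually_all.2 fun s : Fin 3 =>
        eventually_gt_atTop ‖q * limitScale τ 3 s.succ / (x.1 * x.2 s.succ)‖]
      with ρ h1 h2 h3 h4 h5 h6 using ⟨h1, h2, h3, h4, h5, h6⟩
  obtain ⟨k, h1, h2, h3, h4, h5, h6⟩ := (l1.eventually ev).exists
  have z2 : ∀ r, limitScale τ 2 r = 0 := fun r => rfl
  have z0 : ∀ s : Fin 3, limitScale τ 0 s.succ = 0 := fun s => by simp [limitScale]
  have z3 : limitScale τ 3 0 = 0 := rfl
  have hn : ∀ n : ℕ, ‖x.2 0 * q ^ n‖ * (‖x.2 0‖ * σ ^ (2 * k + 1))⁻¹ = σ ^ (2 * n) / σ ^ (2 * k + 1) := by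
    intro n
    rw [norm_mul, norm_pow, pow_mul, hσ2]
    field_simp
  refine ⟨(‖x.2 0‖ * σ ^ (2 * k + 1))⁻¹, k + 1, by positivity, hb, ht, ?_, h2, ?_, h4, h5, h6, ?_,
    ?_, ?_, fun s => ?_, fun s => ?_, fun n hn' => ?_, ?_⟩
  · simp [z3]
  · exact h3.trans (lt_self_pow₀ h1 (by norm_num))
  · simp [z2]
  · simp [z2]
  · simp [z3]
  · simp [z0]
  · simp [z2]
  · rw [hn, one_lt_div (by positivity)]
    exact pow_lt_pow_right_of_lt_one₀ hσ0 hσ1 (by have := Finset.mem_range.1 hn'; omega)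
  · rw [hn, div_lt_one (by positivity)]
    exact pow_lt_pow_right_of_lt_one₀ hσ0 hσ1 (by omega)

theorem eventually_ne_zero_of_ne {f : ℂ → ℂ} (hf : ∀ z ≠ 0, DifferentiableAt ℂ f z) {z₀ : ℂ}
    (hz₀ : z₀ ≠ 0) (hf₀ : f z₀ ≠ 0) {c : ℂ} (hc : c ≠ 0) : ∀ᶠ z in 𝓝[≠] c, f z ≠ 0 := by
  have hc' : 0 < ‖c‖ := norm_pos_iff.2 hc
  have hS := (finite_zeros hf hz₀ hf₀ (‖c‖ / 2) (2 * ‖c‖) (by positivity)).subset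
    (Set.sdiff_subset (t := {c}))
  have h1 : ∀ᶠ z in 𝓝 c, z ∉ _ := hS.isClosed.isOpen_compl.mem_nhds fun h => h.2 rfl
  have h2 : ∀ᶠ z in 𝓝 c, ‖c‖ / 2 < ‖z‖ := continuous_norm.continuousAt.eventually_const_lt (by linarith)
  have h3 : ∀ᶠ z in 𝓝 c, ‖z‖ < 2 * ‖c‖ := continuous_norm.continuousAt.eventually_lt_const (by linarith)
  filter_upwards [nhdsWithin_le_nhds h1, nhdsWithin_le_nhds h2, nhdsWithin_le_nhds h3,
    self_mem_nhdsWithin] with z z1 z2 z3 z4 hz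
  exact z1 ⟨⟨hz, z2.le, z3.le⟩, z4⟩

/-- If `k 1 0` is small, the argument has modulus below one and no zero occurs. If it equals 1,
every factor with a positive power of p is non-zero for small p, so the zero comes from (z²;q). -/
theorem eventually_pqPoch_eq_zero (hq : ‖q‖ < 1) (B : ℝ) : ∀ᶠ k in 𝓝 (limitScale τ),
    (τ 0 = -1 / 2 → k 1 0 = 1) → ∀ z : ℂ, ‖z‖ ≤ B → pqPoch (z ^ 2 * k 1 0) (k 3 0) q = 0 →
      τ 0 = -1 / 2 ∧ qPoch (z ^ 2) q = 0 := by
  have c : ∀ i j, ContinuousAt (fun k : Fin 4 → Fin 4 → ℂ => k i j) (limitScale τ) := fun i j =>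
    ((continuous_apply j).comp (continuous_apply i)).continuousAt
  have z3 : limitScale τ 3 0 = 0 := rfl
  have hB : ∀ (x z : ℂ), ‖z‖ ≤ B → B ^ 2 * ‖x‖ < 1 → ‖z ^ 2 * x‖ < 1 := fun x z hz hx => by
    rw [norm_mul, norm_pow]
    exact lt_of_le_of_lt (by gcongr) hx
  have e1 : ∀ᶠ k in 𝓝 (limitScale τ), ‖k 3 0‖ < 1 :=
    (c 3 0).norm.eventually_lt_const (by simp [z3])
  have e2 : ∀ᶠ k in 𝓝 (limitScale τ), B ^ 2 * ‖k 3 0‖ < 1 :=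
    (continuousAt_const.mul (c 3 0).norm).eventually_lt_const (by simp [z3])
  by_cases h : τ 0 = -1 / 2
  · filter_upwards [e1, e2] with k k1 k2 hk z hz h0
    rw [hk h, mul_one, pqPoch_succ_left k1 hq, mul_eq_zero] at h0
    exact ⟨h, h0.resolve_right (pqPoch_ne_zero_of_norm_lt_one k1 hq (hB _ _ hz k2))⟩
  · have z1 : limitScale τ 1 0 = 0 := by simp [limitScale, h]
    have e3 : ∀ᶠ k in 𝓝 (limitScale τ), B ^ 2 * ‖k 1 0‖ < 1 :=
      (continuousAt_const.mul (c 1 0).norm).eventually_lt_const (by simp [z1])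
    filter_upwards [e1, e3] with k k1 k2 _ z hz h0
    exact absurd h0 (pqPoch_ne_zero_of_norm_lt_one k1 hq (hB _ _ hz k2))

/-- The radius has to meet three demands: admissibility near the limit, and isolation of the zeros
of (q/z²;q) and of (z²;q). It must not depend on the scales. -/
theorem exists_goodPolydisc (hq : ‖q‖ < 1) (hq0 : q ≠ 0) {x : ℂ × (Fin 4 → ℂ)} (hb : x.1 ≠ 0)
    (ht : ∀ r, x.2 r ≠ 0) : ∃ r ρ K, 0 < r ∧ 0 < ρ ∧ Admissible ρ K q (limitScale τ, x) ∧
      ∀ᶠ k in 𝓝 (limitScale τ), (τ 0 = -1 / 2 → k 1 0 = 1) →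
        GoodPolydisc (coordsOf x) r ρ K q k := by
  obtain ⟨ρ, K, hρ, hx⟩ := exists_admissible (τ := τ) hq hq0 hb ht
  have hc : ContinuousAt (fun y : (Fin 4 → Fin 4 → ℂ) × (Fin 5 → ℂ) => (y.1, paramsOf y.2))
      (limitScale τ, coordsOf x) :=
    (continuous_fst.prodMk (continuous_paramsOf.comp continuous_snd)).continuousAt
  have ev : ∀ᶠ y : (Fin 4 → Fin 4 → ℂ) × (Fin 5 → ℂ) in 𝓝 (limitScale τ) ×ˢ 𝓝 (coordsOf x),
      Admissible ρ K q (y.1, paramsOf y.2) := by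
    rw [← nhds_prod_eq]
    exact hc.eventually ((isOpen_admissible ρ K q).mem_nhds hx)
  obtain ⟨P, hP, Q, hQ, hPQ⟩ := eventually_prod_iff.1 ev
  obtain ⟨ε₁, hε₁, h1⟩ := Metric.nhds_basis_closedBall.eventually_iff.1 hQ
  have b0 : ∀ᶠ z in 𝓝[≠] (coordsOf x 0), qPoch (q / z ^ 2) q ≠ 0 :=
    eventually_ne_zero_of_ne (f := fun z => qPoch (q / z ^ 2) q)
      (fun z hz => by fun_prop (disch := first | assumption | positivity)) one_ne_zero
      (qPoch_ne_zero_of_norm_lt_one hq (by simpa using hq)) hb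
  have t0 : ∀ᶠ z in 𝓝[≠] (coordsOf x 1), qPoch (z ^ 2) q ≠ 0 :=
    eventually_ne_zero_of_ne (f := fun z => qPoch (z ^ 2) q)
      (fun z hz => by fun_prop (disch := assumption)) hq0
      (qPoch_ne_zero_of_norm_lt_one hq (by
        rw [norm_pow]; exact pow_lt_one₀ (norm_nonneg _) hq two_ne_zero)) (ht 0)
  obtain ⟨ε₂, hε₂, h2⟩ := Metric.nhds_basis_closedBall.eventually_iff.1 (eventually_nhdsWithin_iff.1 b0)
  obtain ⟨ε₃, hε₃, h3⟩ := Metric.nhds_basis_closedBall.eventually_iff.1 (eventually_nhdsWithin_iff.1 t0)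
  refine ⟨min ε₁ (min ε₂ ε₃), ρ, K, by positivity, hρ, hx, ?_⟩
  filter_upwards [hP, eventually_pqPoch_eq_zero hq (‖coordsOf x 1‖ + ε₃)] with k hk1 hk2 hk
  refine ⟨fun y hy => hPQ hk1 (h1 ?_), fun z hz => h2 ?_, fun z hz hzc h0 => ?_⟩
  · rw [closedBall_pi _ hε₁.le]
    exact fun i _ => Metric.closedBall_subset_closedBall (min_le_left _ _) (hy i)
  · exact Metric.closedBall_subset_closedBall ((min_le_right _ _).trans (min_le_left _ _)) hz
  · have hz' := Metric.closedBall_subset_closedBall ((min_le_right _ _).trans (min_le_right _ _)) hz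
    have := norm_le_norm_add_norm_sub' z (coordsOf x 1)
    exact h3 hz' hzc (hk2 hk z (this.trans (by gcongr; exact mem_closedBall_iff_norm.1 hz')) h0).2

end Limit

end EllipticBeta

namespace EllipticBeta

/-! ### Existence and analyticity of the limit -/

section Limit

variable {q : ℂ} {τ : Fin 4 → ℝ}

theorem analyticAt_coordsOf (x : ℂ × (Fin 4 → ℂ)) : AnalyticAt ℂ coordsOf x :=
  analyticAt_pi_iff.2 fun i => by
    refine Fin.cases ?_ (fun r => ?_) i
    · exact analyticAt_fst
    · exact ((ContinuousLinearMap.proj (R := ℂ) (φ := fun _ : Fin 4 => ℂ) r).comp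
        (ContinuousLinearMap.snd ℂ ℂ (Fin 4 → ℂ))).analyticAt x

theorem powScale_one_zero (h : τ 0 = -1 / 2) (w : ℂ) : powScale τ w 1 0 = 1 := by
  simp only [powScale, Matrix.cons_val_one, Matrix.cons_val_zero, if_true, h]
  norm_num

theorem eventually_goodScale (hq : ‖q‖ < 1) (hτ0 : τ 0 < 0)
    (hτ : ∀ r, r ≠ 0 → -τ 0 ≤ τ r ∧ τ r ≤ 1 + τ 0) {c : Fin 5 → ℂ} {r ρ : ℝ} {K : ℕ}
    (h : ∀ᶠ k in 𝓝 (limitScale τ), (τ 0 = -1 / 2 → k 1 0 = 1) → GoodPolydisc c r ρ K q k) :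
    ∀ᶠ w in comap Complex.exp (𝓝[≠] 0), GoodScale c r ρ K q τ w := by
  have l1 : ∀ᶠ w in comap Complex.exp (𝓝[≠] 0), ‖Complex.exp w * q / c 0‖ < 1 :=
    ((tendsto_exp_comap.mul_const q).div_const (c 0)).norm.eventually_lt_const (by simp)
  filter_upwards [l1, (tendsto_powScale hτ0 hτ).eventually h,
    (tendsto_powScale hτ0 hτ).eventually (eventually_pqPoch_eq_zero hq ‖c 1‖)] with w w1 w2 w3
  refine ⟨w2 fun h => powScale_one_zero h w, w1, fun h0 => ?_⟩
  obtain ⟨h1, h2⟩ := w3 (fun h => powScale_one_zero h w) (c 1) le_rfl h0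
  exact ⟨by rw [powScale_three]; exact powScale_eq_halfScale h1 hτ w, h2⟩

/-- The limit is the Cauchy integral at `limitScale`. It is asserted for all y near x with one and
the same M, so that analyticity of M passes to the limit function. -/
theorem exists_analytic_limit (hq : ‖q‖ < 1) (hq0 : q ≠ 0) (hτ0 : τ 0 < 0)
    (hτ : ∀ r, r ≠ 0 → -τ 0 ≤ τ r ∧ τ r ≤ 1 + τ 0) {x : ℂ × (Fin 4 → ℂ)} (hb : x.1 ≠ 0)
    (ht : ∀ r, x.2 r ≠ 0) : ∃ (M : ℂ × (Fin 4 → ℂ) → ℂ) (ρ : ℝ) (K : ℕ), AnalyticAt ℂ M x ∧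
      (∀ᶠ y in 𝓝 x, Tendsto (fun w : ℂ => ellE y.1 (fun r => y.2 r * Complex.exp (τ r * w))
        (Complex.exp w) q) (comap Complex.exp (𝓝[≠] 0)) (𝓝 (M y))) ∧
      0 < ρ ∧ Admissible ρ K q (limitScale τ, x) ∧ (Regular q (limitScale τ, x) →
        M x = brokenIntegral (limitScale τ) x.1 x.2 q ρ K) := by
  obtain ⟨r, ρ, K, hr, hρ, hadm, h⟩ := exists_goodPolydisc (τ := τ) hq hq0 hb ht
  set c := coordsOf x with hc
  have hcb : ∀ i, c i ∈ Metric.ball (c i) r := fun i => Metric.mem_ball_self hr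
  have hlim : GoodPolydisc c r ρ K q (limitScale τ) := h.self_of_nhds fun h => by
    simp [limitScale, h]
  have hgood := eventually_goodScale hq hτ0 hτ h
  have hts := tendsto_powScale hτ0 hτ
  have hT : ∀ y : Fin 5 → ℂ, (∀ i, y i ∈ Metric.ball (c i) r) →
      Tendsto (fun w => cauchyIntegral c r ρ K q (powScale τ w) y) (comap Complex.exp (𝓝[≠] 0))
        (𝓝 (cauchyIntegral c r ρ K q (limitScale τ) y)) := fun y hy =>
    (continuousOn_cauchyIntegral hr hρ hq hq0 hy _ hlim).tendsto.comp
      (tendsto_nhdsWithin_iff.2 ⟨hts, hgood.mono fun w hw => hw.good⟩)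
  have han : ∀ y : Fin 5 → ℂ, (∀ i, y i ∈ Metric.ball (c i) r) →
      AnalyticAt ℂ (cauchyIntegral c r ρ K q (limitScale τ)) y := fun y hy =>
    analyticAt_cauchyIntegral hr hρ hq hq0 hlim hy
  refine ⟨fun y => cauchyIntegral c r ρ K q (limitScale τ) (coordsOf y), ρ, K,
    AnalyticAt.comp (g := cauchyIntegral c r ρ K q (limitScale τ)) (han c hcb)
      (analyticAt_coordsOf x), ?_, hρ, hadm, fun hreg => ?_⟩
  · have hev : ∀ᶠ y in 𝓝 x, ∀ i, coordsOf y i ∈ Metric.ball (c i) r := by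
      refine eventually_all.2 fun i => ?_
      exact ((continuous_apply i).comp differentiable_coordsOf.continuous).continuousAt.eventually
        (Metric.isOpen_ball.mem_nhds (hcb i))
    filter_upwards [hev] with y hy
    refine (hT _ hy).congr' ?_
    filter_upwards [hgood] with w hw
    exact (ellE_eq_cauchyIntegral hr hρ hq hq0 hw hy).symm
  -- `cauchyIntegral_eq` is available only for p ≠ 0. At the limiting scales the identity follows
  -- because both sides are continuous in the scales.
  have hoff : ∀ y : Fin 5 → ℂ, OffCenter c r y → (∀ i, y i ∈ Metric.ball (c i) r) →
      cauchyIntegral c r ρ K q (limitScale τ) y = brokenAt ρ K q (limitScale τ) y := by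
    intro y hy hyb
    obtain ⟨h1, h2⟩ := hlim.regular hy
    have l : Tendsto (fun w => brokenAt ρ K q (powScale τ w) y) (comap Complex.exp (𝓝[≠] 0))
        (𝓝 (brokenAt ρ K q (limitScale τ) y)) :=
      (continuousAt_brokenAt hρ hq hq0 h1 h2).tendsto.comp
        (f := fun w => (powScale τ w, y)) (hts.prodMk_nhds tendsto_const_nhds)
    refine tendsto_nhds_unique (hT y hyb) (l.congr' ?_)
    filter_upwards [hgood] with w hw
    exact (cauchyIntegral_eq hr hρ hq hq0 hw.good hw.norm_lt hw.bad hy hyb).symm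
  -- The diagonal line through the centre leaves both exceptional hyperplanes immediately, so the
  -- identity extends to the centre by continuity.
  let γ : ℂ → Fin 5 → ℂ := fun l i => c i + l
  have γ0 : γ 0 = c := by simp [γ]
  have hγ : ContinuousAt γ 0 := by fun_prop
  have c1 : ContinuousAt (fun l => cauchyIntegral c r ρ K q (limitScale τ) (γ l)) 0 := by
    refine ContinuousAt.comp (g := cauchyIntegral c r ρ K q (limitScale τ)) ?_ hγ
    rw [γ0]; exact (han c hcb).continuousAt
  have c2 : ContinuousAt (fun l => brokenAt ρ K q (limitScale τ) (γ l)) 0 :=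
    ContinuousAt.comp (x := (0 : ℂ)) (g := Function.uncurry (brokenAt ρ K q))
      (f := fun l => (limitScale τ, γ l))
      (by simp only [γ0]; exact continuousAt_brokenAt hρ hq hq0 hadm hreg)
      (continuousAt_const.prodMk hγ)
  have key := eq_of_frequently_eq c1 c2 ?_
  · simp only [γ0] at key
    exact key
  have hne : ∃ᶠ l : ℂ in 𝓝 0, l ≠ 0 := by
    exact mem_closure_iff_frequently.1 ((dense_compl_singleton (0 : ℂ)) 0)
  have hev : ∀ᶠ l : ℂ in 𝓝 0, ∀ i, γ l i ∈ Metric.ball (c i) r := by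
    refine eventually_all.2 fun i => ?_
    refine (((continuous_apply i).continuousAt.comp hγ)).eventually
      (Metric.isOpen_ball.mem_nhds ?_)
    rw [Function.comp, γ0]; exact hcb i
  refine (hne.and_eventually hev).mono fun l hl => hoff _ (fun i => ?_) hl.2
  exact ⟨Metric.ball_subset_closedBall (hl.2 i), fun _ hi => hl.1 (by simpa [γ] using hi)⟩

end Limit

/-! ## The limiting integral -/

section LimitIntegral

variable {q b : ℂ} {t : Fin 4 → ℂ} {τ : Fin 4 → ℝ}

theorem prod_lowerFace (τ : Fin 4 → ℝ) (f : Fin 4 → ℂ) :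
    ∏ r ∈ lowerFace τ, f r = ∏ s : Fin 3, if τ s.succ = -τ 0 then f s.succ else 1 := by
  rw [lowerFace, Finset.prod_filter, Fin.prod_univ_succ]
  simp

theorem prod_upperFace (τ : Fin 4 → ℝ) (f : Fin 4 → ℂ) :
    ∏ r ∈ upperFace τ, f r = ∏ s : Fin 3, if τ s.succ = 1 + τ 0 then f s.succ else 1 := by
  rw [upperFace, Finset.prod_filter, Fin.prod_univ_succ]
  simp

theorem limitScale_one_succ (τ : Fin 4 → ℝ) (s : Fin 3) :
    limitScale τ 1 s.succ = if τ s.succ = -τ 0 then 1 else 0 := by simp [limitScale]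

theorem limitScale_three_succ (τ : Fin 4 → ℝ) (s : Fin 3) :
    limitScale τ 3 s.succ = if τ s.succ = 1 + τ 0 then 1 else 0 := by simp [limitScale]

theorem limitScale_zero_succ (τ : Fin 4 → ℝ) (s : Fin 3) : limitScale τ 0 s.succ = 0 := by
  simp [limitScale]

theorem limitScale_two (τ : Fin 4 → ℝ) (r : Fin 4) : limitScale τ 2 r = 0 := rfl

theorem limitScale_three_zero (τ : Fin 4 → ℝ) : limitScale τ 3 0 = 0 := rfl

/-- All poles that do not come from (t_0 z;q) escape to infinity as p → 0. -/
theorem denOut_limitScale (z : ℂ) : denOut (limitScale τ) b t q z = 1 := by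
  simp [denOut, denOutCore, limitScale_three_zero, limitScale_zero_succ, limitScale_two]

theorem denIn_limitScale (hq : ‖q‖ < 1) (z : ℂ) : denIn (limitScale τ) b t q z =
    (if τ 0 = -1 / 2 then qPoch (b / z ^ 2) q * qPoch (t 0 / z) q else 1) *
      qPoch (q / (b * t 0 * z)) q * (∏ r ∈ lowerFace τ, qPoch (t r / z) q) *
      ∏ r ∈ upperFace τ, qPoch (q / (b * t r * z)) q := by
  rw [denIn, denInCore, limitScale_three_zero, Finset.prod_mul_distrib, prod_lowerFace,
    prod_upperFace]
  simp only [pqPoch_zero_mid hq, limitScale_one_succ, limitScale_three_succ]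
  have e1 : ∀ s : Fin 3, qPoch (t s.succ * (if τ s.succ = -τ 0 then 1 else 0) / z) q =
      if τ s.succ = -τ 0 then qPoch (t s.succ / z) q else 1 := fun s => by split_ifs <;> simp
  have e2 : ∀ s : Fin 3, qPoch (q * (if τ s.succ = 1 + τ 0 then 1 else 0) / (b * t s.succ * z)) q =
      if τ s.succ = 1 + τ 0 then qPoch (q / (b * t s.succ * z)) q else 1 := fun s => by
    split_ifs <;> simp
  simp only [e1, e2]
  by_cases h : τ 0 = -1 / 2
  · simp [limitScale, h]; ring
  · simp [limitScale, h, mul_assoc]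

theorem num_limitScale (hq : ‖q‖ < 1) (z : ℂ) : num (limitScale τ) b t q z =
    (if τ 0 = -1 / 2 then (1 - (z ^ 2)⁻¹) * (qPoch (q / (b * z ^ 2)) q * qPoch (b * t 0 / z) q)
      else 1) *
      theta (b ^ 2 * t 0 * z) q * (∏ r ∈ lowerFace τ, qPoch (b * t r / z) q) *
      ∏ r ∈ upperFace τ, qPoch (q / (t r * z)) q := by
  rw [num, numCore, limitScale_three_zero, prod_lowerFace, prod_upperFace]
  simp only [pqPoch_zero_mid hq, limitScale_one_succ, limitScale_three_succ, limitScale_zero_succ,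
    limitScale_two, mul_zero, zero_mul, zero_div, qPoch_zero_left, mul_one, Finset.prod_mul_distrib]
  have e1 : ∀ s : Fin 3, qPoch (b * t s.succ * (if τ s.succ = -τ 0 then 1 else 0) / z) q =
      if τ s.succ = -τ 0 then qPoch (b * t s.succ / z) q else 1 := fun s => by split_ifs <;> simp
  have e2 : ∀ s : Fin 3, qPoch (q * (if τ s.succ = 1 + τ 0 then 1 else 0) / (t s.succ * z)) q =
      if τ s.succ = 1 + τ 0 then qPoch (q / (t s.succ * z)) q else 1 := fun s => by
    split_ifs <;> simp
  simp only [e1, e2]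
  by_cases h : τ 0 = -1 / 2
  · simp [limitScale, h]; ring
  · simp [limitScale, h]; ring

theorem limitIntegrand_eq (hq : ‖q‖ < 1) (z : ℂ) : limitIntegrand τ b t q z =
    (2 * Real.pi * Complex.I)⁻¹ * (kernel (limitScale τ) b t q z / z) := by
  rw [limitIntegrand, kernel, num_limitScale hq, denIn_limitScale hq, denOut_limitScale,
    Finset.prod_div_distrib, Finset.prod_div_distrib]
  split_ifs <;> simp only [div_eq_mul_inv, mul_inv, mul_one, one_mul] <;> ring

/-- The factor (qb²;q) splits as (qb²;q²)(qb;q)(-qb;q). The hypothesis allows (qb;q) to be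
cancelled. -/
theorem pref_limitScale (hq : ‖q‖ < 1) (hb : qPoch (q * b) q ≠ 0) :
    pref (limitScale τ) b t q = limitPrefactor τ b t q := by
  have h2 : qPoch (q * b ^ 2) q = qPoch (q * b ^ 2) (q ^ 2) * (qPoch (q * b) q * qPoch (-q * b) q) := by
    rw [qPoch_even_odd hq, neg_mul, qPoch_mul_neg hq]
    congr 2; ring
  have e1 : ∀ s : Fin 3, qPoch (t 0 * t s.succ * (if τ s.succ = -τ 0 then 1 else 0)) q =
      if τ s.succ = -τ 0 then qPoch (t s.succ * t 0) q else 1 := fun s => by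
    split_ifs <;> simp [mul_comm]
  have e2 : ∀ s : Fin 3, qPoch (q * t 0 * (if τ s.succ = 1 + τ 0 then 1 else 0) / (b * t s.succ)) q =
      if τ s.succ = 1 + τ 0 then qPoch (q * t 0 / (b * t s.succ)) q else 1 := fun s => by
    split_ifs <;> simp
  have z1 : limitScale τ 0 1 = 0 := limitScale_zero_succ τ 0
  have z2 : limitScale τ 0 2 = 0 := limitScale_zero_succ τ 1
  have z3 : limitScale τ 0 3 = 0 := limitScale_zero_succ τ 2
  rw [limitPrefactor, h2, prod_lowerFace, prod_upperFace]
  simp only [pref, prefCore, crossFactor, rootFactor, limitScale_three_zero, pqPoch_zero_mid hq,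
    limitScale_one_succ, limitScale_three_succ, limitScale_zero_succ, limitScale_two, z1, z2, z3,
    mul_zero, zero_mul, zero_div, qPoch_zero_left, pqPoch_zero_left, mul_one, one_mul, one_pow,
    e1, e2, Finset.prod_mul_distrib, Finset.prod_const_one, zero_pow two_ne_zero]
  generalize (∏ s : Fin 3, if τ s.succ = -τ 0 then qPoch (t s.succ * t 0) q else 1) = A
  generalize (∏ s : Fin 3, if τ s.succ = 1 + τ 0 then qPoch (q * t 0 / (b * t s.succ)) q else 1) = B
  field_simp

/-- If (t_0²;q) vanished for τ_0 = -1/2, then the point t_0 would be an inner and an outer point of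
the contour at the same time. -/
theorem IsLimitContour.regular (hq : ‖q‖ < 1) (hb : qPoch (q / b ^ 2) q ≠ 0) (ht : t 0 ≠ 0)
    {C : Contour} (hC : IsLimitContour τ b t q C) : Regular q (limitScale τ, b, t) := by
  refine ⟨hb, ?_⟩
  show pqPoch (t 0 ^ 2 * limitScale τ 1 0) (limitScale τ 3 0) q ≠ 0
  rw [limitScale_three_zero, pqPoch_zero_mid hq]
  by_cases h : τ 0 = -1 / 2
  · intro h0
    have h1 : limitScale τ 1 0 = 1 := by simp [limitScale, h]
    rw [h1, mul_one, sq] at h0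
    have hin := (hC.1 (t 0) (.inr ⟨ht, .inr (.inl ⟨h, .inr (by
      rw [div_self ht, qPoch_succ hq, sub_self, zero_mul])⟩)⟩)).2
    rw [(hC.2 (t 0) ⟨ht, h0⟩).2] at hin
    exact zero_ne_one hin
  · simp [limitScale, h]

/-- The contour of the statement separates exactly the poles of the limiting kernel, so it can be
exchanged for the circle with residues. -/
theorem IsLimitContour.brokenIntegral_eq (hq : ‖q‖ < 1) (hq0 : q ≠ 0) {ρ : ℝ} {K : ℕ} (hρ : 0 < ρ)
    (hadm : Admissible ρ K q (limitScale τ, b, t)) (hb : qPoch (q * b) q ≠ 0)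
    {C : Contour} (hC : IsLimitContour τ b t q C) :
    brokenIntegral (limitScale τ) b t q ρ K =
      limitPrefactor τ b t q * C.integral (limitIntegrand τ b t q) := by
  have hS : C.Separates {z | z ≠ 0 ∧ denIn (limitScale τ) b t q z = 0}
      {z | z ≠ 0 ∧ (qPoch (t 0 * z) q = 0 ∨ denOut (limitScale τ) b t q z = 0)} := by
    refine Contour.separates_mono hC (fun z hz => ⟨hz.1, ?_⟩) fun z hz => ⟨hz.1, ?_⟩
    · have h := hz.2
      rw [denIn_limitScale hq] at h
      simp only [mul_eq_zero, Finset.prod_eq_zero_iff, ite_eq_iff, one_ne_zero, and_false,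
        or_false] at h
      rcases h with ((h | h) | h) | h
      · exact .inr (.inl h)
      · exact .inl h
      · exact .inr (.inr (.inl h))
      · exact .inr (.inr (.inr h))
    · refine hz.2.resolve_right ?_
      rw [denOut_limitScale]
      exact one_ne_zero
  rw [← pref_mul_integral_eq_brokenIntegral hρ hq hq0 hadm hS, pref_limitScale hq hb,
    ← Contour.integral_const_mul]
  congr 1
  exact Contour.integral_congr _ fun z _ => (limitIntegrand_eq hq z).symm

end LimitIntegral

end EllipticBeta

/-! ### Conclusion -/

theorem mainTheorem6 (q : ℂ) (hq0 : q ≠ 0) (hq : ‖q‖ < 1) (τ : Fin 4 → ℝ)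
    (hτ0 : τ 0 < 0) (hτ : ∀ r, r ≠ 0 → -τ 0 ≤ τ r ∧ τ r ≤ 1 + τ 0) :
    ∃ R : ℂ × (Fin 4 → ℂ) → ℂ,
      -- `R` is the analytic continuation of the right-hand side to all non-zero `b`, `t_r`
      AnalyticOnNhd ℂ R {x | x.1 ≠ 0 ∧ ∀ r, x.2 r ≠ 0} ∧
      (∀ (b : ℂ) (t : Fin 4 → ℂ), b ≠ 0 → (∀ r, t r ≠ 0) →
        EllipticBeta.qPoch (q / b ^ 2) q ≠ 0 → EllipticBeta.qPoch (q * b) q ≠ 0 →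
        ∀ C : EllipticBeta.Contour, EllipticBeta.IsLimitContour τ b t q C →
          R (b, t) = EllipticBeta.limitPrefactor τ b t q *
            C.integral (EllipticBeta.limitIntegrand τ b t q)) ∧
      -- the limit `p = exp w → 0`, where `p ^ τ_r = exp (τ_r w)`
      ∀ (b : ℂ) (t : Fin 4 → ℂ), b ≠ 0 → (∀ r, t r ≠ 0) →
        Filter.Tendsto
          (fun w : ℂ => EllipticBeta.ellE b (fun r => t r * Complex.exp (τ r * w))
            (Complex.exp w) q)
          (Filter.comap Complex.exp (nhdsWithin 0 {0}ᶜ))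
          (nhds (R (b, t))) := by
  let E : ℂ × (Fin 4 → ℂ) → ℂ → ℂ := fun x w =>
    EllipticBeta.ellE x.1 (fun r => x.2 r * Complex.exp (τ r * w)) (Complex.exp w) q
  have key : ∀ x : ℂ × (Fin 4 → ℂ), x.1 ≠ 0 → (∀ r, x.2 r ≠ 0) → _ := fun x hb ht =>
    EllipticBeta.exists_analytic_limit hq hq0 hτ0 hτ hb ht
  -- R is defined pointwise as the limit. Near each point it agrees with a local analytic function,
  -- so no gluing is required.
  refine ⟨fun x => limUnder (Filter.comap Complex.exp (nhdsWithin 0 {0}ᶜ)) (E x), ?_, ?_, ?_⟩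
  · rintro x ⟨hb, ht⟩
    obtain ⟨M, ρ, K, hM, hlim, -⟩ := key x hb ht
    exact hM.congr (hlim.mono fun y hy => hy.limUnder_eq.symm)
  · intro b t hb ht hb2 hqb C hC
    obtain ⟨M, ρ, K, -, hlim, hρ, hadm, hreg⟩ := key (b, t) hb ht
    rw [← hC.brokenIntegral_eq hq hq0 hρ hadm hqb, ← hreg (hC.regular hq hb2 (ht 0))]
    exact hlim.self_of_nhds.limUnder_eq
  · intro b t hb ht
    obtain ⟨M, ρ, K, -, hlim, -⟩ := key (b, t) hb ht
    have h := hlim.self_of_nhds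
    have e : Filter.limUnder (Filter.comap Complex.exp (nhdsWithin 0 {0}ᶜ)) (E (b, t)) = M (b, t) :=
      h.limUnder_eq
    show Filter.Tendsto (E (b, t)) _ (nhds (Filter.limUnder _ (E (b, t))))
    rwa [e]
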